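/- **Setting.** Let $S$ be a closed connected oriented surface and $Z\subset S$ a finite non-empty set of marked points. A *half-translation surface* $(S,q)$ is given by an atlas of charts on $S-Z$ with values in $\mathbb{C}$ whose changes of charts are locally of the form $w\mapsto \pm w+c$, and such that every $z\in Z$ is a cone point of angle $k\pi$ for some integer $k\ge 1$ (equivalently, $q$ is a meromorphic quadratic differential with at most simple poles, all of whose zeros and poles lie in $Z$; regular points are allowed in $Z$). A *saddle connection* is a straight segment with endpoints in $Z$ whose interior is embedded in $S-Z$; it has a holonomy $v\in\mathbb{C}$, well defined up to sign, *width* $|\operatorname{Re} v|$, *height* $|\operatorname{Im} v|$ and *slope* $\operatorname{Im} v/\operatorname{Re} v$, and it is vertical if $\operatorname{Re} v=0$. The surface is *vertically Keane* if it has no vertical saddle connection. A *straight triangulation* of $(S,q)$ is a triangulation of $S$ with vertex set $Z$ whose edges are saddle connections (edges may be loops and several edges may have the same endpoints). It is *staggered* if no edge is vertical. It is *veering* if every edge is neither horizontal nor vertical and, when edges of positive slope are coloured red and edges of negative slope blue, there is no triangle whose three sides have the same colour and no vertex all of whose incident edges have the same colour. Let $e$ be an edge such that the union $Q$ of $e$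 with the two adjacent open triangles is, laid out in the plane, the interior of a strictly convex quadrilateral, and such that $e$ is at least as wide as each of the four sides of $Q$. A *forward flip* at $e$ replaces $e$ by the other diagonal of $Q$. An *infinite forward flip sequence* is a sequence $(\tau^{(n)})_{n\ge 0}$ of straight triangulations in which each $\tau^{(n+1)}$ is obtained from $\tau^{(n)}$ by one forward flip. **Theorem.** Let $(S,q)$ be a half-translation surface, and let $(\tau^{(n)})_{n\ge 0}$ be an infinite forward flip sequence of staggered triangulations of $(S,q)$. Then 1. the maximal width among the edges of $\tau^{(n)}$ tends to $0$ as $n\to\infty$; 2. the minimal height among the edges of $\tau^{(n)}$ tends to $\infty$ as $n\to\infty$; 3. $\tau^{(n)}$ is veering for all sufficiently large $n$; 4. $(S,q)$ is vertically Keane. Conversely, if $(S,q)$ is vertically Keane, then it admits an infinite forward flip sequence of staggered triangulations. -/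

import Mathlib

open Set Filter Topology

/-- Near `a`, the function `h` is obtained from `g` by a half-translation `w ↦ ± w + c`. -/
def HalfTranslationAt {α : Type*} [TopologicalSpace α] (g h : α → ℂ) (a : α) : Prop :=
  ∃ ε c : ℂ, (ε = 1 ∨ ε = -1) ∧ ∀ᶠ x in 𝓝 a, h x = ε * g x + c

/-- A half-translation structure on a space `S` (which the theorem takes to be compact, connected and
Hausdorff): a finite non-empty set `Z` of marked points, an atlas on `S - Z` whose changes of charts
are locally `w ↦ ± w + c`, and at each marked point a cone angle `k * π` with `k ≥ 1`.

The flat charts are the local primitives of a square root of the quadratic differential `q`. The cone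
condition says that around `z ∈ Z` there is a complex coordinate `φ` in which the flat charts are
`c ± φ ^ (k / 2)`, so that `q = (k / 2) ^ 2 * φ ^ (k - 2) * dφ ^ 2`: a simple pole for `k = 1`, a
regular marked point for `k = 2`, a zero of order `k - 2` for `k ≥ 3`. -/
structure HalfTranslationSurface (S : Type*) [TopologicalSpace S] where
  Z : Set S
  finite_Z : Z.Finite
  nonempty_Z : Z.Nonempty
  charts : Set (OpenPartialHomeomorph S ℂ)
  source_subset : ∀ ψ ∈ charts, ψ.source ⊆ Zᶜ
  covers : ∀ x ∉ Z, ∃ ψ ∈ charts, x ∈ ψ.source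
  compatible : ∀ ψ ∈ charts, ∀ ψ' ∈ charts, ∀ x ∈ ψ.source ∩ ψ'.source, HalfTranslationAt ψ ψ' x
  cone : ∀ z ∈ Z, ∃ k : ℕ, 1 ≤ k ∧ ∃ φ : OpenPartialHomeomorph S ℂ,
    φ.source ∩ Z = {z} ∧ φ z = 0 ∧
      ∀ ψ ∈ charts, ∀ x ∈ φ.source ∩ ψ.source,
        ∃ c : ℂ, ∀ᶠ y in 𝓝 x, (ψ y - c) ^ 2 = φ y ^ k

namespace HalfTranslationSurface

variable {S : Type*} [TopologicalSpace S] (X : HalfTranslationSurface S)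

/-- At `a` the map `f` takes its value in `S - Z`, and there, read in the flat charts, it agrees with
`g` up to a half-translation. -/
def FlatAt {α : Type*} [TopologicalSpace α] (g : α → ℂ) (f : α → S) (a : α) : Prop :=
  f a ∉ X.Z ∧ ∀ ψ ∈ X.charts, f a ∈ ψ.source → HalfTranslationAt g (fun x => ψ (f x)) a

/-- `e` is the interior of a saddle connection with holonomy `v` (defined up to sign): `e` is the
image of `(0, 1)` under a path of constant velocity `v`, injective on `(0, 1)` with values in `S - Z`
there, and with endpoints in `Z`. A saddle connection is recorded by its interior `e`. -/
def IsSaddle (e : Set S) (v : ℂ) : Prop :=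
  ∃ γ : ℝ → S, ContinuousOn γ (Icc 0 1) ∧ InjOn γ (Ioo 0 1) ∧ γ 0 ∈ X.Z ∧ γ 1 ∈ X.Z ∧
    (∀ t ∈ Ioo (0 : ℝ) 1, X.FlatAt (fun s : ℝ => (s : ℂ) * v) γ t) ∧ e = γ '' Ioo 0 1

/-- There is no vertical saddle connection. -/
def VerticallyKeane : Prop :=
  ∀ (e : Set S) (v : ℂ), X.IsSaddle e v → v.re ≠ 0

/-- `f`, restricted to the convex hull of `p`, is a flat polygon in the surface: the points `p i` are
the corners, in anti-clockwise order, of a strictly convex polygon; `f` is continuous on the closed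
polygon, embeds its interior in `S - Z` by a local half-translation, and sends the corners to `Z`. -/
structure IsPolygon {n : ℕ} (p : Fin n → ℂ) (f : ℂ → S) : Prop where
  convex : ∀ i j k : Fin n, i < j → j < k →
    0 < ((starRingEnd ℂ) (p j - p i) * (p k - p i)).im
  continuousOn : ContinuousOn f (convexHull ℝ (range p))
  injOn : InjOn f (interior (convexHull ℝ (range p)))
  flat : ∀ w ∈ interior (convexHull ℝ (range p)), X.FlatAt id f w
  corner : ∀ i, f (p i) ∈ X.Z

/-- `f` restricted to the hull of `p` is a triangle of the collection `E` of edges: its open sides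
are edges, and its interior meets no edge. -/
def IsTriangle (E : Set (Set S)) (p : Fin 3 → ℂ) (f : ℂ → S) : Prop :=
  X.IsPolygon p f ∧ (∀ i, f '' openSegment ℝ (p i) (p (i + 1)) ∈ E) ∧
    Disjoint (f '' interior (convexHull ℝ (range p))) (⋃₀ E)

/-- A straight triangulation, given by its set `E` of (open) edges: finitely many saddle connections
with pairwise disjoint interiors that cut `S` into triangles. -/
structure IsStraightTriangulation (E : Set (Set S)) : Prop where
  finite : E.Finite
  saddle : ∀ e ∈ E, ∃ v, X.IsSaddle e v
  disjoint : E.PairwiseDisjoint id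
  triangles : ∀ x ∉ X.Z ∪ ⋃₀ E, ∃ p f, X.IsTriangle E p f ∧ x ∈ f '' interior (convexHull ℝ (range p))

/-- A straight triangulation without vertical edges. -/
def IsStaggered (E : Set (Set S)) : Prop :=
  X.IsStraightTriangulation E ∧ ∀ e ∈ E, ∀ v, X.IsSaddle e v → v.re ≠ 0

/-- The largest width of an edge in `E`. -/
noncomputable def maxWidth (E : Set (Set S)) : ℝ :=
  sSup {x | ∃ e ∈ E, ∃ v, X.IsSaddle e v ∧ x = |v.re|}

/-- The smallest height of an edge in `E`. -/
noncomputable def minHeight (E : Set (Set S)) : ℝ :=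
  sInf {y | ∃ e ∈ E, ∃ v, X.IsSaddle e v ∧ y = |v.im|}

/-- `f` lays out in the plane, as a strictly convex quadrilateral with corners `p 0`, `p 1`, `p 2`,
`p 3`, the union `Q` of two triangles of `E` and of their common edge, the diagonal from `p 0` to
`p 2`. -/
def IsQuad (E : Set (Set S)) (p : Fin 4 → ℂ) (f : ℂ → S) : Prop :=
  X.IsPolygon p f ∧ (∀ i, f '' openSegment ℝ (p i) (p (i + 1)) ∈ E) ∧
    f '' openSegment ℝ (p 0) (p 2) ∈ E ∧
    Disjoint (f '' (interior (convexHull ℝ (range p)) \ openSegment ℝ (p 0) (p 2))) (⋃₀ E)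

/-- `E'` is obtained from `E` by a forward flip: an edge at least as wide as the four sides of the
quadrilateral around it is replaced by the other diagonal. -/
def IsForwardFlip (E E' : Set (Set S)) : Prop :=
  ∃ (p : Fin 4 → ℂ) (f : ℂ → S), X.IsQuad E p f ∧
    (∀ i, |(p (i + 1) - p i).re| ≤ |(p 2 - p 0).re|) ∧
    E' = insert (f '' openSegment ℝ (p 1) (p 3)) (E \ {f '' openSegment ℝ (p 0) (p 2)})

/-- An infinite forward flip sequence of staggered triangulations. -/
def IsStaggeredFlipSequence (τ : ℕ → Set (Set S)) : Prop :=
  (∀ n, X.IsStaggered (τ n)) ∧ ∀ n, X.IsForwardFlip (τ n) (τ (n + 1))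

end HalfTranslationSurface

/-- The two colours of edges. -/
inductive EdgeColour
  | red
  | blue

namespace HalfTranslationSurface

variable {S : Type*} [TopologicalSpace S] (X : HalfTranslationSurface S)

/-- A veering triangulation of the half-translation surface: it is straight, and for a colouring in
which red edges have positive slope and blue edges have negative slope, there is no monochromatic
triangle and no monochromatic vertex. The closure of an open edge adds its endpoints. -/
def IsVeering (E : Set (Set S)) : Prop :=
  X.IsStraightTriangulation E ∧ ∃ colour : Set S → EdgeColour,
    (∀ e ∈ E, ∀ v, X.IsSaddle e v →
      (colour e = .red → 0 < v.im / v.re) ∧ (colour e = .blue → v.im / v.re < 0)) ∧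
    (∀ p f, X.IsTriangle E p f →
      ¬ ∃ c, ∀ i, colour (f '' openSegment ℝ (p i) (p (i + 1))) = c) ∧
    (∀ z ∈ X.Z, ¬ ∃ c, ∀ e ∈ E, z ∈ closure e → colour e = c)

end HalfTranslationSurface

namespace HalfTranslationSurface

open Metric (ball mem_ball_self sphere mem_ball closedBall ball_mem_nhds ball_subset_closedBall sphere_subset_closedBall isOpen_ball ball_subset_ball)
open AffineMap (lineMap lineMap_apply lineMap_apply_one lineMap_apply_zero lineMap_injective)
open Complex (sub_re sub_im add_re add_im neg_re neg_im norm_real re_ofReal_mul im_ofReal_mul real_smul ofReal_zero)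

local notation "seg" => openSegment ℝ
local notation "hull" p:max => convexHull ℝ (range p)

variable {S : Type*} [TopologicalSpace S] {X : HalfTranslationSurface S}
  {E E' : Set (Set S)} {e : Set S} {b v w x c ε a₀ a₁ : ℂ} {f f' g F : ℂ → S} {γ : ℝ → S} {r : ℝ}
  {p p' : Fin 3 → ℂ} {τ : ℕ → Set (Set S)}

theorem sq_eq_one_of_sign (h : ε = 1 ∨ ε = -1) : ε * ε = 1 := by
  rcases h with rfl | rfl <;> norm_num

theorem ne_zero_of_sign (h : ε = 1 ∨ ε = -1) : ε ≠ 0 := by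
  rcases h with rfl | rfl <;> norm_num

theorem norm_of_sign (h : ε = 1 ∨ ε = -1) : ‖ε‖ = 1 := by
  rcases h with rfl | rfl <;> norm_num

theorem mul_of_sign {ε ε' : ℂ} (h : ε = 1 ∨ ε = -1) (h' : ε' = 1 ∨ ε' = -1) :
    ε * ε' = 1 ∨ ε * ε' = -1 := by
  rcases h with rfl | rfl <;> rcases h' with rfl | rfl <;> norm_num

variable (X)

/-- `FlatAt` together with continuity at the point. -/
def IsFlatAt {α : Type*} [TopologicalSpace α] (g : α → ℂ) (f : α → S) (a : α) : Prop :=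
  ContinuousAt f a ∧ X.FlatAt g f a

variable {X}

section Local

variable {α β : Type*} [TopologicalSpace α] [TopologicalSpace β]

theorem IsFlatAt.notMem {g : α → ℂ} {f : α → S} {a : α} (h : X.IsFlatAt g f a) : f a ∉ X.Z := h.2.1

theorem IsFlatAt.chart {g : α → ℂ} {f : α → S} {a : α} (h : X.IsFlatAt g f a)
    {ψ : OpenPartialHomeomorph S ℂ} (hψ : ψ ∈ X.charts) (ha : f a ∈ ψ.source) :
    ∃ ε c : ℂ, (ε = 1 ∨ ε = -1) ∧ ∀ᶠ x in 𝓝 a, f x ∈ ψ.source ∧ ψ (f x) = ε * g x + c := by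
  obtain ⟨ε, c, hε, h1⟩ := h.2.2 ψ hψ ha
  exact ⟨ε, c, hε, (h.1.eventually (ψ.open_source.mem_nhds ha)).and h1⟩

theorem IsFlatAt.of_chart {g : α → ℂ} {f : α → S} {a : α} (hc : ContinuousAt f a)
    {ψ : OpenPartialHomeomorph S ℂ} (hψ : ψ ∈ X.charts) (ha : f a ∈ ψ.source) {ε c : ℂ}
    (hε : ε = 1 ∨ ε = -1) (h : ∀ᶠ x in 𝓝 a, ψ (f x) = ε * g x + c) : X.IsFlatAt g f a := by
  refine ⟨hc, X.source_subset ψ hψ ha, fun ψ' hψ' ha' => ?_⟩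
  obtain ⟨ε', c', hε', h'⟩ := X.compatible ψ hψ ψ' hψ' (f a) ⟨ha, ha'⟩
  refine ⟨ε' * ε, ε' * c + c', mul_of_sign hε' hε, ?_⟩
  filter_upwards [h, hc.eventually h'] with x h1 h2
  rw [h2, h1]; ring

theorem IsFlatAt.exists_chart {g : α → ℂ} {f : α → S} {a : α} (h : X.IsFlatAt g f a) :
    ∃ ψ ∈ X.charts, f a ∈ ψ.source ∧ ∃ ε c : ℂ, (ε = 1 ∨ ε = -1) ∧
      ∀ᶠ x in 𝓝 a, f x ∈ ψ.source ∧ ψ (f x) = ε * g x + c := by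
  obtain ⟨ψ, hψ, ha⟩ := X.covers _ h.notMem
  exact ⟨ψ, hψ, ha, h.chart hψ ha⟩

theorem IsFlatAt.comp {g : α → ℂ} {f : α → S} {k : β → α} {g' : β → ℂ} {b : β}
    (h : X.IsFlatAt g f (k b)) (hk : ContinuousAt k b) {ε c : ℂ} (hε : ε = 1 ∨ ε = -1)
    (hg : ∀ᶠ y in 𝓝 b, g (k y) = ε * g' y + c) : X.IsFlatAt g' (fun y => f (k y)) b := by
  obtain ⟨ψ, hψ, ha, ε', c', hε', h'⟩ := h.exists_chart
  refine IsFlatAt.of_chart (ContinuousAt.comp h.1 hk) hψ ha (mul_of_sign hε' hε)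
    (c := ε' * c + c') ?_
  filter_upwards [hk.eventually h', hg] with y h1 h2
  rw [h1.2, h2]; ring

theorem IsFlatAt.congr {g : α → ℂ} {f f' : α → S} {a : α} (h : X.IsFlatAt g f a)
    (hf : f' =ᶠ[𝓝 a] f) : X.IsFlatAt g f' a := by
  obtain ⟨ψ, hψ, ha, ε', c', hε', h'⟩ := h.exists_chart
  refine IsFlatAt.of_chart (h.1.congr hf.symm) hψ (by rwa [hf.eq_of_nhds]) hε' (c := c') ?_
  filter_upwards [h', hf] with x h1 h2
  rw [h2, h1.2]

/-- Two flat maps with the same value at a point differ by a half-translation near that point. -/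
theorem IsFlatAt.germ_eq (hF : X.IsFlatAt id F w) {g : α → ℂ} {γ : α → S}
    {a : α} (hγ : X.IsFlatAt g γ a) (hg : ContinuousAt g a) (h : γ a = F w) :
    ∃ ε : ℂ, (ε = 1 ∨ ε = -1) ∧ ∀ᶠ x in 𝓝 a, γ x = F (w + ε * (g x - g a)) := by
  obtain ⟨ψ, hψ, hw, ε₁, c₁, hε₁, h₁⟩ := hF.exists_chart
  obtain ⟨ε₂, c₂, hε₂, h₂⟩ := hγ.chart hψ (by rwa [h])
  refine ⟨ε₁ * ε₂, mul_of_sign hε₁ hε₂, ?_⟩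
  have hc : Tendsto (fun x => w + ε₁ * ε₂ * (g x - g a)) (𝓝 a) (𝓝 w) := by
    have : ContinuousAt (fun x => w + ε₁ * ε₂ * (g x - g a)) a := by fun_prop
    simpa [ContinuousAt] using this
  have e1 := h₁.self_of_nhds.2
  have e2 := h₂.self_of_nhds.2
  filter_upwards [h₂, hc.eventually h₁] with x h3 h4
  refine ψ.injOn h3.1 h4.1 ?_
  rw [h3.2, h4.2]
  rw [h, e1] at e2
  simp only [id] at *
  linear_combination -e2 - (ε₂ * g x - ε₂ * g a) * sq_eq_one_of_sign hε₁

theorem IsFlatAt.injOn_nhds (h : X.IsFlatAt id f w) : ∃ δ > 0, InjOn f (ball w δ) := by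
  obtain ⟨ψ, hψ, hw, ε, c, hε, h₁⟩ := h.exists_chart
  obtain ⟨δ, hδ, hb⟩ := Metric.eventually_nhds_iff_ball.1 h₁
  refine ⟨δ, hδ, fun x hx y hy hxy => ?_⟩
  have h3 := (hb x hx).2
  have h4 := (hb y hy).2
  rw [hxy, h4] at h3
  simp only [id] at h3
  exact (mul_left_cancel₀ (ne_zero_of_sign hε) (add_right_cancel h3)).symm

theorem IsFlatAt.map_nhds (h : X.IsFlatAt id f w) : map f (𝓝 w) = 𝓝 (f w) := by
  obtain ⟨ψ, hψ, hw, ε, c, hε, h₁⟩ := h.exists_chart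
  have e1 : f =ᶠ[𝓝 w] (ψ.symm ∘ fun x => ε * x + c) := by
    filter_upwards [h₁] with x hx
    simp only [Function.comp]
    have := hx.2
    simp only [id] at this
    rw [← this, ψ.left_inv hx.1]
  have e2 : ε * w + c = ψ (f w) := h₁.self_of_nhds.2.symm
  have e3 : map (fun x => ε * x + c) (𝓝 w) = 𝓝 (ε * w + c) := by
    have := ((Homeomorph.mulLeft₀ ε (ne_zero_of_sign hε)).trans (Homeomorph.addRight c)).map_nhds_eq w
    exact this
  rw [map_congr e1, ← map_map, e3, e2, ψ.symm.map_nhds_eq (ψ.map_source hw), ψ.left_inv hw]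

/-- There is a flat map with any given regular value. -/
theorem exists_germ {y : S} (hy : y ∉ X.Z) (b : ℂ) :
    ∃ δ > 0, ∃ f : ℂ → S, f b = y ∧ ∀ w ∈ ball b δ, X.IsFlatAt id f w := by
  obtain ⟨ψ, hψ, hyψ⟩ := X.covers y hy
  have hm : ContinuousAt (fun w : ℂ => w - b + ψ y) b := by fun_prop
  have ht : ∀ᶠ w in 𝓝 b, w - b + ψ y ∈ ψ.target := by
    refine hm.eventually (ψ.open_target.mem_nhds ?_)
    simpa using ψ.map_source hyψ
  obtain ⟨δ, hδ, hb⟩ := Metric.eventually_nhds_iff_ball.1 ht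
  refine ⟨δ, hδ, fun w => ψ.symm (w - b + ψ y), by simp [ψ.left_inv hyψ], fun w hw => ?_⟩
  have hc : ContinuousAt (fun w => ψ.symm (w - b + ψ y)) w := by
    have h1 := ψ.symm.continuousAt (x := w - b + ψ y) (hb w hw)
    have h2 : ContinuousAt (fun w : ℂ => w - b + ψ y) w := by fun_prop
    exact ContinuousAt.comp (f := fun w : ℂ => w - b + ψ y) h1 h2
  refine IsFlatAt.of_chart hc hψ (ψ.map_target (hb w hw)) (Or.inl rfl) (c := -b + ψ y) ?_
  filter_upwards [isOpen_ball.mem_nhds hw] with x hx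
  rw [ψ.right_inv (hb x hx)]
  simp only [id]; ring

/-- Unique continuation of flat maps. -/
theorem eqOn_of_isFlatAt [T2Space S] {g : α → ℂ} {γ₁ γ₂ : α → S} {J : Set α}
    (hJ : IsPreconnected J) (hnd : ∀ a, ∃ᶠ x in 𝓝 a, g x ≠ g a)
    (h₁ : ∀ a ∈ J, X.IsFlatAt g γ₁ a) (h₂ : ∀ a ∈ J, X.IsFlatAt g γ₂ a) {a₀ : α} (ha₀ : a₀ ∈ J)
    (h : γ₁ =ᶠ[𝓝 a₀] γ₂) :
    ∀ a ∈ J, γ₁ =ᶠ[𝓝 a] γ₂ := by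
  refine hJ.subset_of_closure_inter_subset (u := {a | γ₁ =ᶠ[𝓝 a] γ₂}) isOpen_setOfPred_eventually_nhds
    ⟨a₀, ha₀, h⟩ ?_
  rintro a ⟨hac, haJ⟩
  have hfr : ∃ᶠ x in 𝓝 a, γ₁ =ᶠ[𝓝 x] γ₂ := mem_closure_iff_frequently.1 hac
  have heq : γ₁ a = γ₂ a := by
    by_contra hne
    obtain ⟨U, V, hU, hV, hau, hav, hd⟩ := t2_separation hne
    have e1 := (h₁ a haJ).1.eventually (hU.mem_nhds hau)
    have e2 := (h₂ a haJ).1.eventually (hV.mem_nhds hav)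
    obtain ⟨x, hx, hx1, hx2⟩ := (hfr.and_eventually (e1.and e2)).exists
    rw [hx.eq_of_nhds] at hx1
    exact hd.le_bot ⟨hx1, hx2⟩
  obtain ⟨ψ, hψ, ha, ε₁, c₁, hε₁, e₁⟩ := (h₁ a haJ).exists_chart
  obtain ⟨ε₂, c₂, hε₂, e₂⟩ := (h₂ a haJ).chart hψ (by rwa [← heq])
  obtain ⟨x, hx, hx1, hx2⟩ :=
    (hfr.and_eventually (e₁.eventually_nhds.and e₂.eventually_nhds)).exists
  obtain ⟨y, hy, hy1, hy2, hy3⟩ := ((hnd x).and_eventually (hx1.and (hx2.and hx))).exists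
  have a1 := hx1.self_of_nhds.2
  have a2 := hx2.self_of_nhds.2
  have a3 := hx.self_of_nhds
  have b1 := hy1.2
  have b2 := hy2.2
  rw [a3, a2] at a1
  rw [hy3, b2] at b1
  have hεε : ε₂ = ε₁ := by
    have : (ε₂ - ε₁) * (g y - g x) = 0 := by linear_combination b1 - a1
    rcases mul_eq_zero.1 this with h' | h'
    · exact sub_eq_zero.1 h'
    · exact absurd (sub_eq_zero.1 h') hy
  have hcc : c₂ = c₁ := by rw [hεε] at a1; exact add_left_cancel a1
  show γ₁ =ᶠ[𝓝 a] γ₂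
  filter_upwards [e₁, e₂] with z hz1 hz2
  refine ψ.injOn hz1.1 hz2.1 ?_
  rw [hz1.2, hz2.2, hεε, hcc]

end Local

theorem frequently_id_ne (a : ℂ) : ∃ᶠ x in 𝓝 a, id x ≠ id a := by
  have : (𝓝[≠] a).NeBot := inferInstance
  exact (frequently_mem_iff_neBot.2 this : ∃ᶠ x in 𝓝 a, x ∈ ({a}ᶜ : Set ℂ))

theorem frequently_mul_ne (hv : v ≠ 0) (a : ℝ) : ∃ᶠ x : ℝ in 𝓝 a, (x : ℂ) * v ≠ (a : ℂ) * v := by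
  have : (𝓝[≠] a).NeBot := inferInstance
  refine (frequently_mem_iff_neBot.2 this : ∃ᶠ x in 𝓝 a, x ∈ ({a}ᶜ : Set ℝ)).mono fun x hx h => hx ?_
  exact_mod_cast mul_right_cancel₀ hv h

theorem mem_segment_or_of_mem_segment {b w x y : ℂ} (hx : x ∈ segment ℝ b w)
    (hy : y ∈ segment ℝ b w) : y ∈ segment ℝ b x ∨ y ∈ segment ℝ x w := by
  rw [segment_eq_image_lineMap] at hx hy
  obtain ⟨s, hs, rfl⟩ := hx
  obtain ⟨t, ht, rfl⟩ := hy
  rcases le_total t s with h | h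
  · left
    have h0 : t ∈ segment ℝ (0 : ℝ) s := by rw [segment_eq_Icc hs.1]; exact ⟨ht.1, h⟩
    have := mem_image_of_mem (lineMap b w : ℝ →ᵃ[ℝ] ℂ) h0
    rwa [image_segment, lineMap_apply_zero] at this
  · right
    have h0 : t ∈ segment ℝ s (1 : ℝ) := by rw [segment_eq_Icc hs.2]; exact ⟨h, ht.2⟩
    have := mem_image_of_mem (lineMap b w : ℝ →ᵃ[ℝ] ℂ) h0
    rwa [image_segment, lineMap_apply_one] at this

variable (X)

/-- The domain of the developing map with base point `b` and germ `g`. -/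
def dom (b : ℂ) (g : ℂ → S) : Set ℂ :=
  {w | ∃ (U : Set ℂ) (f : ℂ → S), IsOpen U ∧ Convex ℝ U ∧ b ∈ U ∧ w ∈ U ∧
    (∀ x ∈ U, X.IsFlatAt id f x) ∧ f =ᶠ[𝓝 b] g}

open Classical in
/-- The flat continuation of the germ of `g` at `b` along straight segments. -/
noncomputable def dev (b : ℂ) (g : ℂ → S) (w : ℂ) : S :=
  if h : w ∈ X.dom b g then h.choose_spec.choose w else g w

variable {X}

theorem eqOn_flat [T2Space S] {f₁ f₂ : ℂ → S} {U : Set ℂ} (hU : IsPreconnected U)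
    (h₁ : ∀ x ∈ U, X.IsFlatAt id f₁ x) (h₂ : ∀ x ∈ U, X.IsFlatAt id f₂ x) {a : ℂ} (ha : a ∈ U)
    (h : f₁ =ᶠ[𝓝 a] f₂) : ∀ x ∈ U, f₁ =ᶠ[𝓝 x] f₂ :=
  eqOn_of_isFlatAt hU frequently_id_ne h₁ h₂ ha h

theorem dev_eq [T2Space S] {U : Set ℂ} (hU : IsOpen U)
    (hc : Convex ℝ U) (hb : b ∈ U) (hf : ∀ x ∈ U, X.IsFlatAt id f x) (hg : f =ᶠ[𝓝 b] g)
    (hw : w ∈ U) : w ∈ X.dom b g ∧ X.dev b g w = f w := by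
  have h : w ∈ X.dom b g := ⟨U, f, hU, hc, hb, hw, hf, hg⟩
  refine ⟨h, ?_⟩
  rw [dev, dif_pos h]
  obtain ⟨hU', hc', hb', hw', hf', hg'⟩ := h.choose_spec.choose_spec
  exact (eqOn_flat (hc'.inter hc).isPreconnected (fun x hx => hf' x hx.1) (fun x hx => hf x hx.2)
    (a := b) ⟨hb', hb⟩ (hg'.trans hg.symm) w ⟨hw', hw⟩).eq_of_nhds

theorem isOpen_dom : IsOpen (X.dom b g) := by
  rw [isOpen_iff_mem_nhds]
  rintro w ⟨U, f, hU, hc, hb, hw, hf, hg⟩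
  filter_upwards [hU.mem_nhds hw] with x hx
  exact ⟨U, f, hU, hc, hb, hx, hf, hg⟩

theorem flat_dev [T2Space S] (h : w ∈ X.dom b g) : X.IsFlatAt id (X.dev b g) w := by
  obtain ⟨U, f, hU, hc, hb, hw, hf, hg⟩ := h
  refine (hf w hw).congr ?_
  filter_upwards [hU.mem_nhds hw] with x hx
  exact (dev_eq hU hc hb hf hg hx).2

theorem segment_subset_dom (h : w ∈ X.dom b g) : segment ℝ b w ⊆ X.dom b g := by
  obtain ⟨U, f, hU, hc, hb, hw, hf, hg⟩ := h
  exact fun x hx => ⟨U, f, hU, hc, hb, hc.segment_subset hb hw hx, hf, hg⟩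

theorem base_mem_dom {δ : ℝ} (hδ : 0 < δ)
    (h : ∀ w ∈ ball b δ, X.IsFlatAt id g w) : ball b δ ⊆ X.dom b g := fun _ hw =>
  ⟨_, g, isOpen_ball, convex_ball b δ, mem_ball_self hδ, hw, h, EventuallyEq.rfl⟩

theorem dev_base [T2Space S] (h : b ∈ X.dom b g) : X.dev b g =ᶠ[𝓝 b] g := by
  obtain ⟨U, f, hU, hc, hb, hw, hf, hg⟩ := h
  filter_upwards [hU.mem_nhds hw, hg] with x hx hx'
  rw [(dev_eq hU hc hb hf hg hx).2, hx']

theorem dev_of_segment [T2Space S] {O : Set ℂ} (hO : IsOpen O)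
    (hF : ∀ x ∈ O, X.IsFlatAt id F x) (hw : segment ℝ b w ⊆ O) (hg : F =ᶠ[𝓝 b] g) :
    w ∈ X.dom b g ∧ X.dev b g w = F w := by
  have hcomp : IsCompact (segment ℝ b w) := by
    rw [← convexHull_pair]; exact (Set.toFinite _).isCompact_convexHull ℝ
  obtain ⟨δ, hδ, hsub⟩ := hcomp.exists_thickening_subset_open hO hw
  have hss := Metric.self_subset_thickening hδ (segment ℝ b w)
  exact dev_eq Metric.isOpen_thickening ((convex_segment b w).thickening δ)
    (hss (left_mem_segment ℝ b w)) (fun x hx => hF x (hsub hx)) hg (hss (right_mem_segment ℝ b w))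

/-- Two flat maps that agree on a connected intersection of their domains can be glued. -/
theorem exists_glue [T2Space S] {U V : Set ℂ} {f₁ f₂ : ℂ → S} (hU : IsOpen U) (hV : IsOpen V)
    (h₁ : ∀ x ∈ U, X.IsFlatAt id f₁ x) (h₂ : ∀ x ∈ V, X.IsFlatAt id f₂ x)
    (hUV : IsPreconnected (U ∩ V)) {a : ℂ} (ha : a ∈ U ∩ V) (h : f₁ =ᶠ[𝓝 a] f₂) :
    ∃ f : ℂ → S, (∀ x ∈ U ∪ V, X.IsFlatAt id f x) ∧ EqOn f f₁ U ∧ EqOn f f₂ V := by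
  classical
  have e := eqOn_flat hUV (fun x hx => h₁ x hx.1) (fun x hx => h₂ x hx.2) ha h
  have e1 : EqOn (U.piecewise f₁ f₂) f₁ U := fun x hx => piecewise_eq_of_mem _ _ _ hx
  have e2 : EqOn (U.piecewise f₁ f₂) f₂ V := fun x hx => by
    by_cases hxU : x ∈ U
    · rw [piecewise_eq_of_mem _ _ _ hxU]; exact (e x ⟨hxU, hx⟩).eq_of_nhds
    · exact piecewise_eq_of_notMem _ _ _ hxU
  refine ⟨U.piecewise f₁ f₂, ?_, e1, e2⟩
  rintro x (hx | hx)
  · exact (h₁ x hx).congr (e1.eventuallyEq_of_mem (hU.mem_nhds hx))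
  · exact (h₂ x hx).congr (e2.eventuallyEq_of_mem (hV.mem_nhds hx))

/-- A flat map on a convex set converges at a point of the closure to a marked point, or can be
continued to a ball about that point. -/
theorem tendsto_or_continues [CompactSpace S] [T2Space S] {A : Set ℂ}
    (hA : Convex ℝ A) (hf : ∀ x ∈ A, X.IsFlatAt id f x) (hw : w ∈ closure A) :
    (∃ z ∈ X.Z, Tendsto f (𝓝[A] w) (𝓝 z)) ∨
      ∃ δ > 0, ∃ f' : ℂ → S, (∀ x ∈ ball w δ, X.IsFlatAt id f' x) ∧
        ∃ a ∈ A ∩ ball w δ, f' =ᶠ[𝓝 a] f := by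
  have hne : (𝓝[A] w).NeBot := mem_closure_iff_nhdsWithin_neBot.1 hw
  by_cases hx : ∃ x ∉ X.Z, ClusterPt x (map f (𝓝[A] w))
  · right
    obtain ⟨x, hxZ, hx⟩ := hx
    obtain ⟨δ, hδ, f₀, hf₀, hfl⟩ := exists_germ hxZ 0
    have hN : f₀ '' ball 0 (δ / 2) ∈ 𝓝 x := by
      rw [← hf₀, ← (hfl 0 (mem_ball_self hδ)).map_nhds]
      exact image_mem_map (ball_mem_nhds 0 (by positivity))
    have hfr : ∃ᶠ a in 𝓝[A] w, f a ∈ f₀ '' ball 0 (δ / 2) := (clusterPt_iff_frequently.1 hx _ hN)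
    have hball : ∀ᶠ a in 𝓝[A] w, a ∈ A ∩ ball w (δ / 4) := (eventually_mem_nhdsWithin).and
        (nhdsWithin_le_nhds (ball_mem_nhds w (by positivity)))
    obtain ⟨a, ⟨u, hu, hua⟩, haA, haw⟩ := (hfr.and_eventually hball).exists
    rw [mem_ball, dist_zero_right] at hu
    have hfu := hfl u (by rw [mem_ball, dist_zero_right]; linarith)
    obtain ⟨ε, hε, he⟩ := hfu.germ_eq (hf a haA) continuousAt_id hua.symm
    have hin : ∀ y ∈ ball w (δ / 4), u + ε * (y - a) ∈ ball (0 : ℂ) δ := by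
      intro y hy
      rw [mem_ball, dist_zero_right]
      have h1 : ‖y - a‖ ≤ ‖y - w‖ + ‖a - w‖ := by
        have := norm_sub_le (y - w) (a - w); simpa using this
      have h2 : ‖u + ε * (y - a)‖ ≤ ‖u‖ + ‖y - a‖ := by
        have := norm_add_le u (ε * (y - a)); rwa [norm_mul, norm_of_sign hε, one_mul] at this
      rw [mem_ball, dist_eq_norm] at hy haw
      linarith
    refine ⟨δ / 4, by positivity, fun y => f₀ (u + ε * (y - a)), fun y hy => ?_, a, ⟨haA, haw⟩, ?_⟩
    · exact (hfl _ (hin y hy)).comp (k := fun y => u + ε * (y - a)) (g' := id) (by fun_prop) hε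
        (c := u - ε * a) (Eventually.of_forall fun x => by simp only [id]; ring)
    · filter_upwards [he] with y hy
      exact hy.symm
  · left
    push Not at hx
    have hZ : ∀ x, ClusterPt x (map f (𝓝[A] w)) → x ∈ X.Z := fun x h => by
      by_contra hxZ; exact hx x hxZ h
    obtain ⟨z, -, hz⟩ := isCompact_univ.exists_clusterPt (f := map f (𝓝[A] w))
      (by simp)
    refine ⟨z, hZ z hz, ?_⟩
    refine le_nhds_of_unique_clusterPt fun z' hz' => ?_
    by_contra hzz
    obtain ⟨O₁, O₂, hO₁, hO₂, hs₁, hs₂, hd⟩ :=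
      (SeparatedNhds.of_isCompact_isCompact (s := {z'}) (t := X.Z \ {z'})
      isCompact_singleton (X.finite_Z.subset sdiff_subset).isCompact (by simp))
    have hev : ∀ᶠ x in 𝓝[A] w, f x ∈ O₁ ∪ O₂ := by
      by_contra hcon
      have hfr : ∃ᶠ y in map f (𝓝[A] w), y ∈ (O₁ ∪ O₂)ᶜ := by
        rw [frequently_map]; exact not_eventually.1 hcon
      obtain ⟨y, hy, hcy⟩ := (hO₁.union hO₂).isClosed_compl.isCompact.exists_clusterPt_of_frequently hfr
      exact hy (by
        by_cases h : y = z'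
        · left; rw [h]; exact hs₁ rfl
        · right; exact hs₂ ⟨hZ y hcy, h⟩)
    obtain ⟨η, hη, hsub⟩ := Metric.mem_nhdsWithin_iff.1 hev
    have hpre : IsPreconnected (f '' (ball w η ∩ A)) :=
      ((convex_ball w η).inter hA).isPreconnected.image f
        fun x hx => (hf x hx.2).1.continuousWithinAt
    have hmem : ball w η ∩ A ∈ 𝓝[A] w := by
      rw [inter_comm]; exact inter_mem_nhdsWithin A (ball_mem_nhds w hη)
    have m1 : (f '' (ball w η ∩ A) ∩ O₁).Nonempty := by
      have := clusterPt_iff_nonempty.1 hz' (hO₁.mem_nhds (hs₁ rfl)) (image_mem_map hmem)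
      rwa [inter_comm]
    have m2 : (f '' (ball w η ∩ A) ∩ O₂).Nonempty := by
      have := clusterPt_iff_nonempty.1 hz (hO₂.mem_nhds (hs₂ ⟨hZ z hz, fun h => hzz h.symm⟩))
        (image_mem_map hmem)
      rwa [inter_comm]
    obtain ⟨y, -, hy1, hy2⟩ := hpre O₁ O₂ hO₁ hO₂ (image_subset_iff.2 hsub) m1 m2
    exact hd.le_bot ⟨hy1, hy2⟩

/-- The half-open segment from `b` to `w`. -/
def halfOpen (b w : ℂ) : Set ℂ := lineMap b w '' Ico (0 : ℝ) 1

theorem convex_halfOpen (b w : ℂ) : Convex ℝ (halfOpen b w) :=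
  (convex_Ico (0 : ℝ) 1).affine_image (lineMap b w)

theorem mem_closure_halfOpen (b w : ℂ) : w ∈ closure (halfOpen b w) := by
  have h : (1 : ℝ) ∈ closure (Ico (0 : ℝ) 1) := by rw [closure_Ico (by norm_num)]; simp
  have := image_closure_subset_closure_image (f := fun t : ℝ => lineMap b w t)
    (by fun_prop) (s := Ico (0 : ℝ) 1) (mem_image_of_mem _ h)
  rw [lineMap_apply_one] at this
  exact this

theorem halfOpen_subset_segment (b w : ℂ) : halfOpen b w ⊆ segment ℝ b w := by
  rw [segment_eq_image_lineMap]; exact image_mono Ico_subset_Icc_self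

/-- The developing map tends to a marked point along a segment that leaves its domain. -/
theorem tendsto_of_visible [CompactSpace S] [T2Space S]
    (hw : w ∉ X.dom b g) {A : Set ℂ} (hA : Convex ℝ A) (h : halfOpen b w ⊆ A)
    (hAd : A ⊆ X.dom b g) : ∃ z ∈ X.Z, Tendsto (X.dev b g) (𝓝[A] w) (𝓝 z) := by
  have hwA : w ∈ closure A := closure_mono h (mem_closure_halfOpen b w)
  rcases tendsto_or_continues hA (fun x hx => flat_dev (hAd hx)) hwA with h' | h'
  · exact h'
  exfalso
  obtain ⟨δ, hδ, f', hf', a, haA, he⟩ := h'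
  obtain ⟨w₁, hw₁, hd⟩ := Metric.mem_closure_iff.1 (mem_closure_halfOpen b w) δ hδ
  have hw₁b : w₁ ∈ ball w δ := by rwa [mem_ball, dist_comm]
  have he₁ : f' =ᶠ[𝓝 w₁] X.dev b g :=
    eqOn_flat (hA.inter (convex_ball w δ)).isPreconnected (fun x hx => hf' x hx.2)
      (fun x hx => flat_dev (hAd hx.1)) haA he w₁ ⟨h hw₁, hw₁b⟩
  have hcomp : IsCompact (segment ℝ b w₁) := by
    rw [← convexHull_pair]; exact (Set.toFinite _).isCompact_convexHull ℝ
  obtain ⟨η, hη, hsub⟩ := hcomp.exists_thickening_subset_open isOpen_dom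
    (segment_subset_dom (hAd (h hw₁)))
  have hss := Metric.self_subset_thickening hη (segment ℝ b w₁)
  obtain ⟨F, hF, hF1, -⟩ := exists_glue Metric.isOpen_thickening isOpen_ball
    (fun x hx => flat_dev (hsub hx)) hf'
    (((convex_segment b w₁).thickening η).inter (convex_ball w δ)).isPreconnected
    ⟨hss (right_mem_segment ℝ b w₁), hw₁b⟩ he₁.symm
  refine hw (dev_of_segment (Metric.isOpen_thickening.union isOpen_ball) hF
    (fun x hx => ?_) ?_).1
  · have hw₁s := halfOpen_subset_segment b w hw₁
    rcases mem_segment_or_of_mem_segment hw₁s hx with h1 | h1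
    · exact Or.inl (hss h1)
    · exact Or.inr ((convex_ball w δ).segment_subset hw₁b (mem_ball_self hδ) h1)
  · have hb := hss (left_mem_segment ℝ b w₁)
    exact (hF1.eventuallyEq_of_mem (Metric.isOpen_thickening.mem_nhds hb)).trans
      (dev_base (segment_subset_dom (hAd (h hw₁)) (left_mem_segment ℝ b w₁)))

/-- The first point at which a segment leaves the domain of the developing map. -/
theorem exists_first_exit (hb : b ∈ X.dom b g)
    (hw : w ∉ X.dom b g) : ∃ t : ℝ, 0 < t ∧ t ≤ 1 ∧ lineMap b w t ∉ X.dom b g ∧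
      ∀ s : ℝ, 0 ≤ s → s < t → lineMap b w s ∈ X.dom b g := by
  have hcont : Continuous fun t : ℝ => lineMap b w t := by fun_prop
  have hK : IsCompact (Icc (0 : ℝ) 1 ∩ (fun t : ℝ => lineMap b w t) ⁻¹' (X.dom b g)ᶜ) :=
    isCompact_Icc.inter_right (isOpen_dom.isClosed_compl.preimage hcont)
  obtain ⟨t, ⟨⟨ht0, ht1⟩, ht⟩, hmin⟩ := hK.exists_isLeast ⟨1, by simp, by simpa using hw⟩
  refine ⟨t, lt_of_le_of_ne ht0 ?_, ht1, ht, fun s hs hst => ?_⟩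
  · rintro rfl; simp at ht; exact ht hb
  · by_contra hcon
    exact absurd (hmin ⟨⟨hs, hst.le.trans ht1⟩, hcon⟩) (not_le.2 hst)

variable (X)

/-- `φ` is a coordinate around the marked point `z` in which the flat charts are `c ± φ ^ (k / 2)`. -/
structure IsCone (z : S) (k : ℕ) (φ : OpenPartialHomeomorph S ℂ) : Prop where
  one_le : 1 ≤ k
  source_inter : φ.source ∩ X.Z = {z}
  map_zero : φ z = 0
  chart : ∀ ψ ∈ X.charts, ∀ x ∈ φ.source ∩ ψ.source, ∃ c : ℂ, ∀ᶠ y in 𝓝 x, (ψ y - c) ^ 2 = φ y ^ k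

variable {X}

theorem exists_isCone {z : S} (hz : z ∈ X.Z) : ∃ k φ, X.IsCone z k φ := by
  obtain ⟨k, hk, φ, h1, h2, h3⟩ := X.cone z hz
  exact ⟨k, φ, hk, h1, h2, h3⟩

namespace IsCone

variable {z : S} {k : ℕ} {φ : OpenPartialHomeomorph S ℂ} (hφ : X.IsCone z k φ)
include hφ

theorem mem_source : z ∈ φ.source := (hφ.source_inter.symm.subset rfl).1

theorem mem_Z : z ∈ X.Z := (hφ.source_inter.symm.subset rfl).2

theorem eq_of_mem {x : S} (hx : x ∈ φ.source) (hxZ : x ∈ X.Z) : x = z :=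
  hφ.source_inter.subset ⟨hx, hxZ⟩

theorem eq_of_map_eq_zero {x : S} (hx : x ∈ φ.source) (h : φ x ^ k = 0) : x = z := by
  refine φ.injOn hx hφ.mem_source ?_
  rw [hφ.map_zero]
  exact (pow_eq_zero_iff (by have := hφ.one_le; omega)).1 h

theorem exists_radius : ∃ ρ > 0, closedBall 0 ρ ⊆ φ.target := by
  have : φ.target ∈ 𝓝 (0 : ℂ) := by
    rw [← hφ.map_zero]; exact φ.open_target.mem_nhds (φ.map_source hφ.mem_source)
  exact Metric.nhds_basis_closedBall.mem_iff.1 this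

theorem eventually_square {α : Type*} [TopologicalSpace α] {g : α → ℂ} {f : α → S} {a : α}
    (h : X.IsFlatAt g f a) (ha : f a ∈ φ.source) :
    ∃ b : ℂ, ∀ᶠ x in 𝓝 a, f x ∈ φ.source ∧ φ (f x) ^ k = (g x - b) ^ 2 := by
  obtain ⟨ψ, hψ, haψ, ε, c, hε, h1⟩ := h.exists_chart
  obtain ⟨c', hc'⟩ := hφ.chart ψ hψ _ ⟨ha, haψ⟩
  refine ⟨ε * (c' - c), ?_⟩
  filter_upwards [h1, h.1.eventually hc', h.1.eventually (φ.open_source.mem_nhds ha)] with x h2 h3 h4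
  refine ⟨h4, ?_⟩
  rw [← h3, h2.2]
  rcases hε with rfl | rfl <;> ring

variable {α : Type*} [TopologicalSpace α] {g : α → ℂ} {f : α → S}

theorem square_of_mem_closure (hnd : ∀ a, ∃ᶠ x in 𝓝 a, g x ≠ g a) {a : α}
    (h : X.IsFlatAt g f a) (ha : f a ∈ φ.source)
    (hc : a ∈ closure {a | ∀ᶠ x in 𝓝 a, f x ∈ φ.source ∧ φ (f x) ^ k = (g x - b) ^ 2}) :
    ∀ᶠ x in 𝓝 a, f x ∈ φ.source ∧ φ (f x) ^ k = (g x - b) ^ 2 := by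
  obtain ⟨b', hb'⟩ := hφ.eventually_square h ha
  obtain ⟨y, hy, hy'⟩ := ((mem_closure_iff_frequently.1 hc).and_eventually hb'.eventually_nhds).exists
  have key : b' = b := by
    by_contra hne
    have h1 : ∀ᶠ x in 𝓝 y, g x = (b + b') / 2 := by
      filter_upwards [hy, hy'] with x h1 h2
      have h3 : (b' - b) * (2 * g x - (b + b')) = 0 := by linear_combination h2.2 - h1.2
      rcases mul_eq_zero.1 h3 with h4 | h4
      · exact absurd (sub_eq_zero.1 h4) hne
      · linear_combination h4 / 2
    obtain ⟨x, hx, hx'⟩ := ((hnd y).and_eventually h1).exists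
    exact hx (hx'.trans h1.self_of_nhds.symm)
  rwa [key] at hb'

/-- Continuation of the cone coordinate inside its domain. -/
theorem square_on (hnd : ∀ a, ∃ᶠ x in 𝓝 a, g x ≠ g a) {J : Set α} (hJ : IsPreconnected J)
    (h : ∀ a ∈ J, X.IsFlatAt g f a) (hs : ∀ a ∈ J, f a ∈ φ.source) {a₀ : α} (ha₀ : a₀ ∈ J)
    (hb : ∀ᶠ x in 𝓝 a₀, f x ∈ φ.source ∧ φ (f x) ^ k = (g x - b) ^ 2) :
    ∀ a ∈ J, ∀ᶠ x in 𝓝 a, f x ∈ φ.source ∧ φ (f x) ^ k = (g x - b) ^ 2 :=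
  hJ.subset_of_closure_inter_subset isOpen_setOfPred_eventually_nhds ⟨a₀, ha₀, hb⟩
    fun a ha => hφ.square_of_mem_closure hnd (h a ha.2) (hs a ha.2) ha.1

omit hφ in
theorem mem_source_of_mem_closure [T2Space S] {ρ : ℝ} (hρ : closedBall 0 ρ ⊆ φ.target)
    {s : Set S} (hs : ∀ x ∈ s, x ∈ φ.source ∧ ‖φ x‖ ≤ ρ) {y : S} (hy : y ∈ closure s) :
    y ∈ φ.source := by
  have hK : IsCompact (φ.symm '' closedBall 0 ρ) :=
    (isCompact_closedBall 0 ρ).image_of_continuousOn (φ.symm.continuousOn.mono hρ)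
  have hsub : s ⊆ φ.symm '' closedBall 0 ρ := fun x hx =>
    ⟨φ x, by simpa using (hs x hx).2, φ.left_inv (hs x hx).1⟩
  obtain ⟨u, hu, rfl⟩ := closure_minimal hsub hK.isClosed hy
  exact φ.map_target (hρ hu)

omit [TopologicalSpace S] hφ in
theorem norm_le_of_square {ρ : ℝ} (hρ : 0 < ρ) {u b c : ℂ} (h : u ^ k = (c - b) ^ 2)
    (hb : ‖c - b‖ ^ 2 < ρ ^ k) : ‖u‖ ≤ ρ := by
  have : ‖u‖ ^ k < ρ ^ k := by rwa [← norm_pow, h, norm_pow]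
  exact (lt_of_pow_lt_pow_left₀ k hρ.le this).le

/-- Continuation of the cone coordinate along a flat map that stays close to the marked point. -/
theorem square_of_norm_lt [T2Space S] {ρ : ℝ} (hρ0 : 0 < ρ) (hρ : closedBall 0 ρ ⊆ φ.target)
    (hnd : ∀ a, ∃ᶠ x in 𝓝 a, g x ≠ g a) (hg : Continuous g) {J : Set α} (hJ : IsPreconnected J)
    (h : ∀ a ∈ J, X.IsFlatAt g f a) {a₀ : α} (ha₀ : a₀ ∈ J)
    (hb : ∀ᶠ x in 𝓝 a₀, f x ∈ φ.source ∧ φ (f x) ^ k = (g x - b) ^ 2)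
    (hn : ∀ a ∈ J, ‖g a - b‖ ^ 2 < ρ ^ k) :
    ∀ a ∈ J, ∀ᶠ x in 𝓝 a, f x ∈ φ.source ∧ φ (f x) ^ k = (g x - b) ^ 2 := by
  refine hJ.subset_of_closure_inter_subset isOpen_setOfPred_eventually_nhds ⟨a₀, ha₀, hb⟩ ?_
  rintro a ⟨hac, haJ⟩
  refine hφ.square_of_mem_closure hnd (h a haJ) ?_ hac
  refine mem_source_of_mem_closure hρ (s := {x | x ∈ φ.source ∧ ‖φ x‖ ≤ ρ}) (fun x hx => hx) ?_
  have hfr := mem_closure_iff_frequently.1 hac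
  have hev : ∀ᶠ x in 𝓝 a, ‖g x - b‖ ^ 2 < ρ ^ k := by
    have : ContinuousAt (fun x => ‖g x - b‖ ^ 2) a := by fun_prop
    exact this.eventually (gt_mem_nhds (hn a haJ))
  rw [mem_closure_iff_frequently]
  refine (h a haJ).1.tendsto.frequently ((hfr.and_eventually hev).mono fun x hx => ?_)
  have : f x ∈ φ.source ∧ φ (f x) ^ k = (g x - b) ^ 2 :=
    (show ∀ᶠ x in 𝓝 x, f x ∈ φ.source ∧ φ (f x) ^ k = (g x - b) ^ 2 from hx.1).self_of_nhds
  exact ⟨this.1, norm_le_of_square hρ0 this.2 hx.2⟩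

theorem square_of_tendsto [T2Space S] {ρ : ℝ} (hρ0 : 0 < ρ)
    (hρ : closedBall 0 ρ ⊆ φ.target) (hg : Continuous g) {J : Set α}
    (hJ : ∀ a ∈ J, ∀ᶠ x in 𝓝 a, f x ∈ φ.source ∧ φ (f x) ^ k = (g x - b) ^ 2)
    (hn : ∀ a ∈ J, ‖g a - b‖ ^ 2 < ρ ^ k) {w : α} (hw : w ∈ closure J) {y : S}
    (hy : Tendsto f (𝓝[J] w) (𝓝 y)) : y ∈ φ.source ∧ φ y ^ k = (g w - b) ^ 2 := by
  have : (𝓝[J] w).NeBot := mem_closure_iff_nhdsWithin_neBot.1 hw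
  have hys : y ∈ φ.source := by
    refine mem_source_of_mem_closure hρ (s := {x | x ∈ φ.source ∧ ‖φ x‖ ≤ ρ}) (fun x hx => hx) ?_
    refine mem_closure_of_tendsto hy ?_
    filter_upwards [self_mem_nhdsWithin] with x hx
    have := (hJ x hx).self_of_nhds
    exact ⟨this.1, norm_le_of_square hρ0 this.2 (hn x hx)⟩
  refine ⟨hys, ?_⟩
  have h1 : Tendsto (fun x => φ (f x) ^ k) (𝓝[J] w) (𝓝 (φ y ^ k)) :=
    ((φ.continuousAt hys).tendsto.comp hy).pow k
  have h2 : Tendsto (fun x => (g x - b) ^ 2) (𝓝[J] w) (𝓝 ((g w - b) ^ 2)) := by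
    have : Continuous fun x => (g x - b) ^ 2 := by fun_prop
    exact this.continuousWithinAt
  refine tendsto_nhds_unique (h1.congr' ?_) h2
  filter_upwards [self_mem_nhdsWithin] with x hx
  exact (hJ x hx).self_of_nhds.2

/-- Near an end at the marked point a flat map has the standard form. -/
theorem square_near_end {β : Type*} [PseudoMetricSpace β] {g : β → ℂ} {f : β → S} (hnd : ∀ a, ∃ᶠ x in 𝓝 a, g x ≠ g a)
    (hg : Continuous g) {A : Set β} {w : β} (hA : ∀ η > 0, IsPreconnected (A ∩ ball w η))
    (hw : w ∈ closure A) (h : ∀ a ∈ A, X.IsFlatAt g f a) (ht : Tendsto f (𝓝[A] w) (𝓝 z)) :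
    ∃ η > 0, ∀ a ∈ A ∩ ball w η, ∀ᶠ x in 𝓝 a, f x ∈ φ.source ∧ φ (f x) ^ k = (g x - g w) ^ 2 := by
  have hne : (𝓝[A] w).NeBot := mem_closure_iff_nhdsWithin_neBot.1 hw
  obtain ⟨η, hη, hsub⟩ := Metric.mem_nhdsWithin_iff.1 (ht (φ.open_source.mem_nhds hφ.mem_source))
  rw [inter_comm] at hsub
  obtain ⟨a₀, ha₀b, ha₀⟩ := Metric.mem_closure_iff.1 hw η hη
  have ha₀J : a₀ ∈ A ∩ ball w η := ⟨ha₀b, by rwa [mem_ball, dist_comm]⟩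
  obtain ⟨b, hb⟩ := hφ.eventually_square (h a₀ ha₀b) (hsub ha₀J)
  have hall := hφ.square_on hnd (hA η hη) (fun a ha => h a ha.1) (fun a ha => hsub ha) ha₀J hb
  have hev : ∀ᶠ x in 𝓝[A] w, φ (f x) ^ k = (g x - b) ^ 2 := by
    filter_upwards [self_mem_nhdsWithin, nhdsWithin_le_nhds (ball_mem_nhds w hη)] with x h1 h2
    exact (hall x ⟨h1, h2⟩).self_of_nhds.2
  have h1 : Tendsto (fun x => φ (f x) ^ k) (𝓝[A] w) (𝓝 (φ z ^ k)) :=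
    ((φ.continuousAt hφ.mem_source).tendsto.comp ht).pow k
  have h2 : Tendsto (fun x => (g x - b) ^ 2) (𝓝[A] w) (𝓝 ((g w - b) ^ 2)) := by
    have : Continuous fun x => (g x - b) ^ 2 := by fun_prop
    exact this.continuousWithinAt
  have h3 := tendsto_nhds_unique (h1.congr' hev) h2
  rw [hφ.map_zero, zero_pow (by have := hφ.one_le; omega)] at h3
  have h4 : g w = b := sub_eq_zero.1 (pow_eq_zero_iff two_ne_zero |>.1 h3.symm)
  exact ⟨η, hη, fun a ha => by rw [h4]; exact hall a ha⟩

end IsCone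

/-- Visible ends of the developing map are isolated. -/
theorem eventually_eq_of_visible [CompactSpace S] [T2Space S]
    (hw : w ∉ X.dom b g) (h : halfOpen b w ⊆ X.dom b g) :
    ∀ᶠ w' in 𝓝 w, w' ∉ X.dom b g → halfOpen b w' ⊆ X.dom b g → w' = w := by
  obtain ⟨z, hz, ht⟩ := tendsto_of_visible hw (convex_halfOpen b w) Subset.rfl h
  obtain ⟨k, φ, hφ⟩ := exists_isCone hz
  obtain ⟨ρ, hρ0, hρ⟩ := hφ.exists_radius
  obtain ⟨η, hη, hsq⟩ := hφ.square_near_end frequently_id_ne continuous_id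
    (fun η _ => ((convex_halfOpen b w).inter (convex_ball w η)).isPreconnected)
    (mem_closure_halfOpen b w) (fun a ha => flat_dev (h ha)) ht
  obtain ⟨η', hη', hle, hsm⟩ : ∃ η' > 0, η' ≤ η ∧ η' ^ 2 < ρ ^ k := by
    have h1 : Tendsto (fun t : ℝ => t ^ 2) (𝓝[>] 0) (𝓝 0) := by
      have : Continuous fun t : ℝ => t ^ 2 := by fun_prop
      simpa using (this.tendsto 0).mono_left nhdsWithin_le_nhds
    have h2 : ∀ᶠ t : ℝ in 𝓝[>] 0, t ≤ η := by
      filter_upwards [nhdsWithin_le_nhds (gt_mem_nhds hη)] with t ht using le_of_lt ht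
    obtain ⟨t, ht, h3, h4⟩ := ((eventually_mem_nhdsWithin).and
      (h2.and (h1.eventually (gt_mem_nhds (pow_pos hρ0 k))))).exists
    exact ⟨t, ht, h3, h4⟩
  obtain ⟨a₀, ha₀, hd⟩ := Metric.mem_closure_iff.1 (mem_closure_halfOpen b w) η' hη'
  have ha₀b : a₀ ∈ ball w η' := by rwa [mem_ball, dist_comm]
  have hsq₀ := hsq a₀ ⟨ha₀, ball_subset_ball hle ha₀b⟩
  obtain ⟨t₀, ht₀, rfl⟩ := ha₀
  have hcont : Continuous fun w' : ℂ => lineMap b w' t₀ := by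
    simp only [lineMap_apply, vsub_eq_sub, vadd_eq_add]; fun_prop
  filter_upwards [hcont.continuousAt.eventually hsq₀.eventually_nhds,
    hcont.continuousAt.eventually (isOpen_ball.mem_nhds ha₀b),
    ball_mem_nhds w hη'] with w' h1 h2 h3 hw' hh'
  obtain ⟨z', hz', ht'⟩ := tendsto_of_visible hw' (convex_halfOpen b w') Subset.rfl hh'
  set J : Set ℂ := lineMap b w' '' Ico t₀ 1 with hJ
  have hJc : Convex ℝ J := (convex_Ico t₀ 1).affine_image (lineMap b w')
  have hJs : J ⊆ halfOpen b w' := image_mono (Ico_subset_Ico_left ht₀.1)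
  have hJb : J ⊆ ball w η' := by
    rintro _ ⟨s, hs, rfl⟩
    have hcv : Convex ℝ ((lineMap b w' : ℝ →ᵃ[ℝ] ℂ) ⁻¹' ball w η') :=
      (convex_ball w η').affine_preimage _
    exact hcv.ordConnected.out h2 (by simpa using h3) ⟨hs.1, hs.2.le⟩
  have hn : ∀ a ∈ J, ‖id a - w‖ ^ 2 < ρ ^ k := fun a ha => by
    have : ‖a - w‖ < η' := by have := hJb ha; rwa [mem_ball, dist_eq_norm] at this
    exact (pow_lt_pow_left₀ this (norm_nonneg _) two_ne_zero).trans hsm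
  have hall := hφ.square_of_norm_lt hρ0 hρ frequently_id_ne continuous_id hJc.isPreconnected
    (fun a ha => flat_dev (hh' (hJs ha))) (a₀ := lineMap b w' t₀)
    ⟨t₀, ⟨le_rfl, ht₀.2⟩, rfl⟩ h1 hn
  have hcl : w' ∈ closure J := by
    have h : (1 : ℝ) ∈ closure (Ico t₀ 1) := by
      rw [closure_Ico ht₀.2.ne]; exact ⟨ht₀.2.le, le_rfl⟩
    have := image_closure_subset_closure_image (f := fun t : ℝ => lineMap b w' t)
      (by fun_prop) (mem_image_of_mem _ h)
    rw [lineMap_apply_one] at this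
    exact this
  obtain ⟨e1, e2⟩ := hφ.square_of_tendsto hρ0 hρ continuous_id hall hn hcl
    (ht'.mono_left (nhdsWithin_mono _ hJs))
  rw [hφ.eq_of_mem e1 hz', hφ.map_zero, zero_pow (by have := hφ.one_le; omega)] at e2
  exact sub_eq_zero.1 (pow_eq_zero_iff two_ne_zero |>.1 e2.symm)

/-- Near a visible end, the complement of the domain of the developing map lies in its shadow. -/
theorem eventually_mem_segment_of_visible [CompactSpace S] [T2Space S]
    (hb : b ∈ X.dom b g) (hw : w ∉ X.dom b g) (h : halfOpen b w ⊆ X.dom b g) :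
    ∀ᶠ w' in 𝓝 w, w' ∉ X.dom b g → w ∈ segment ℝ b w' := by
  by_contra hcon
  have hfr : ∃ᶠ w' in 𝓝 w, w' ∉ X.dom b g ∧ w ∉ segment ℝ b w' := by
    refine (not_eventually.1 hcon).mono fun w' hw' => by push Not at hw'; exact hw'
  obtain ⟨u, hu, hu'⟩ := exists_seq_forall_of_frequently hfr
  choose t ht0 ht1 htd htm using fun n => exists_first_exit hb (hu' n).1
  obtain ⟨t', ht', σ, hσ, hlim⟩ := isCompact_Icc.tendsto_subseq (s := Icc (0 : ℝ) 1)
    (x := t) (fun n => ⟨(ht0 n).le, ht1 n⟩)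
  set y : ℕ → ℂ := fun n => lineMap b (u (σ n)) (t (σ n)) with hy
  have hylim : Tendsto y atTop (𝓝 (lineMap b w t')) := by
    simp only [hy, lineMap_apply, vsub_eq_sub, vadd_eq_add]
    have h1 := hu.comp hσ.tendsto_atTop
    exact ((hlim.smul (h1.sub_const b)).add_const b)
  have hyd : lineMap b w t' ∉ X.dom b g :=
    isOpen_dom.isClosed_compl.mem_of_tendsto hylim (Eventually.of_forall fun n => htd (σ n))
  have ht'1 : t' = 1 := by
    by_contra hne
    exact hyd (h ⟨t', ⟨ht'.1, lt_of_le_of_ne ht'.2 hne⟩, rfl⟩)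
  rw [ht'1, lineMap_apply_one] at hylim
  obtain ⟨n, hn⟩ := (hylim.eventually (eventually_eq_of_visible hw h)).exists
  have hyw : y n = w := by
    refine hn (htd (σ n)) ?_
    rintro _ ⟨s, hs, rfl⟩
    have : lineMap b (y n) s = lineMap b (u (σ n)) (s * t (σ n)) := by
      simp only [hy, lineMap_apply, vsub_eq_sub, vadd_eq_add, add_sub_cancel_right, smul_smul]
    rw [this]
    refine htm (σ n) _ (mul_nonneg hs.1 (ht0 _).le) ?_
    have := ht0 (σ n); nlinarith [hs.2]
  apply (hu' (σ n)).2
  rw [← hyw, segment_eq_image_lineMap]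
  exact ⟨t (σ n), ⟨(ht0 _).le, ht1 _⟩, rfl⟩

/-- From a regular point near a marked point there is a short segment to that point. -/
theorem eventually_exists_notMem_dom [T2Space S] {z : S} (hz : z ∈ X.Z) (hr : 0 < r) :
    ∀ᶠ x in 𝓝 z, ∀ (b : ℂ) (g : ℂ → S), g b = x → b ∈ X.dom b g →
      ∃ w ∈ ball b r, w ∉ X.dom b g := by
  obtain ⟨k, φ, hφ⟩ := exists_isCone hz
  obtain ⟨ρ, hρ0, hρ⟩ := hφ.exists_radius
  have hlim : Tendsto (fun x => ‖φ x‖ ^ k) (𝓝 z) (𝓝 0) := by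
    have := ((φ.continuousAt hφ.mem_source).norm.tendsto.pow k)
    rwa [hφ.map_zero, norm_zero, zero_pow (by have := hφ.one_le; omega)] at this
  filter_upwards [φ.open_source.mem_nhds hφ.mem_source,
    hlim.eventually (gt_mem_nhds (pow_pos hρ0 k)),
    hlim.eventually (gt_mem_nhds (pow_pos hr 2))] with x hx h1 h2 b g hgb hb
  have hd : X.dev b g b = x := by rw [(dev_base hb).eq_of_nhds, hgb]
  obtain ⟨c, hc⟩ := hφ.eventually_square (flat_dev hb) (by rwa [hd])
  have hbc : ‖b - c‖ ^ 2 = ‖φ x‖ ^ k := by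
    have := hc.self_of_nhds.2
    rw [hd] at this
    simp only [id] at this
    rw [← norm_pow, ← norm_pow, this]
  by_contra hcon
  push Not at hcon
  have hseg : segment ℝ b c ⊆ X.dom b g := by
    refine ((convex_ball b r).segment_subset (mem_ball_self hr) ?_).trans hcon
    rw [mem_ball, dist_comm, dist_eq_norm]
    rw [← hbc] at h2
    exact lt_of_pow_lt_pow_left₀ 2 hr.le h2
  have hall := hφ.square_of_norm_lt hρ0 hρ frequently_id_ne continuous_id
    (convex_segment b c).isPreconnected (fun a ha => flat_dev (hseg ha))
    (left_mem_segment ℝ b c) hc (fun a ha => by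
      have : ‖a - c‖ ≤ ‖b - c‖ := by
        have := (convex_closedBall c ‖b - c‖).segment_subset (x := b) (y := c) (by simp [dist_eq_norm])
          (by simp) ha
        rwa [Metric.mem_closedBall, dist_eq_norm] at this
      exact (pow_le_pow_left₀ (norm_nonneg _) this 2).trans_lt (hbc.trans_lt h1))
  have hcd := (hall c (right_mem_segment ℝ b c)).self_of_nhds
  simp only [id, sub_self, ne_eq, OfNat.ofNat_ne_zero, not_false_eq_true, zero_pow] at hcd
  exact (flat_dev (hseg (right_mem_segment ℝ b c))).notMem
    (hφ.eq_of_map_eq_zero hcd.1 hcd.2 ▸ hφ.mem_Z)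

theorem continuous_mul_right_ofReal (v : ℂ) : Continuous fun s : ℝ => (s : ℂ) * v := by fun_prop

theorem isOpen_setOf_eventually_punctured {S : Type*} [TopologicalSpace S] [T1Space S]
    (p : S → Prop) : IsOpen {x | ∀ᶠ y in 𝓝[≠] x, p y} := by
  rw [isOpen_iff_mem_nhds]
  intro x hx
  rw [mem_ofPred_eq, eventually_nhdsWithin_iff] at hx
  obtain ⟨U, hU, hUo, hxU⟩ := eventually_nhds_iff.1 hx
  filter_upwards [hUo.mem_nhds hxU] with y hy
  by_cases hyx : y = x
  · rw [hyx]; exact eventually_nhdsWithin_iff.2 hx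
  · refine eventually_nhdsWithin_of_eventually_nhds ?_
    filter_upwards [hUo.mem_nhds hy, isOpen_ne.mem_nhds hyx] with u hu hu'
    exact hU u hu hu'

theorem isPreconnected_punctured_ball (ρ : ℝ) : IsPreconnected (ball (0 : ℂ) ρ \ {0}) := by
  have : ball (0 : ℂ) ρ \ {0} =
      (fun p : ℝ × ℝ => (p.1 : ℂ) * Complex.exp (p.2 * Complex.I)) '' (Ioo 0 ρ ×ˢ univ) := by
    ext x
    constructor
    · rintro ⟨hx, hx0⟩
      rw [mem_ball, dist_zero_right] at hx
      exact ⟨(‖x‖, x.arg), ⟨⟨norm_pos_iff.2 hx0, hx⟩, trivial⟩, Complex.norm_mul_exp_arg_mul_I x⟩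
    · rintro ⟨⟨r, θ⟩, ⟨⟨h1, h2⟩, -⟩, rfl⟩
      refine ⟨?_, ?_⟩
      · simp only [mem_ball, dist_zero_right, norm_mul, Complex.norm_exp_ofReal_mul_I,
          norm_real, mul_one, Real.norm_eq_abs]
        simp only at h1 h2
        rwa [abs_of_pos h1]
      · simp only [mem_singleton_iff, mul_eq_zero, Complex.exp_ne_zero, or_false,
          Complex.ofReal_eq_zero]
        exact h1.ne'
  rw [this]
  exact (isPreconnected_Ioo.prod isPreconnected_univ).image _ (by fun_prop)

theorem neBot_punctured (X : HalfTranslationSurface S) (x : S) : (𝓝[≠] x).NeBot := by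
  by_cases hx : x ∈ X.Z
  · obtain ⟨k, φ, hφ⟩ := exists_isCone hx
    have : (𝓝[≠] (φ x)).NeBot := inferInstance
    have h2 := φ.symm.continuousAt (x := φ x) (φ.map_source hφ.mem_source)
    rw [ContinuousAt, φ.left_inv hφ.mem_source] at h2
    refine (tendsto_nhdsWithin_of_tendsto_nhds_of_eventually_within _
      (h2.mono_left nhdsWithin_le_nhds) ?_ : Tendsto φ.symm (𝓝[≠] (φ x)) (𝓝[≠] x)).neBot
    filter_upwards [self_mem_nhdsWithin, nhdsWithin_le_nhds
      (φ.open_target.mem_nhds (φ.map_source hφ.mem_source))] with y hy hyt hyx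
    exact hy (by rw [mem_singleton_iff.1 (show φ.symm y ∈ ({x} : Set S) from hyx).symm, φ.right_inv hyt]; rfl)
  · obtain ⟨ψ, hψ, hxψ⟩ := X.covers x hx
    have : (𝓝[≠] (ψ x)).NeBot := inferInstance
    have h2 := ψ.symm.continuousAt (x := ψ x) (ψ.map_source hxψ)
    rw [ContinuousAt, ψ.left_inv hxψ] at h2
    refine (tendsto_nhdsWithin_of_tendsto_nhds_of_eventually_within _
      (h2.mono_left nhdsWithin_le_nhds) ?_ : Tendsto ψ.symm (𝓝[≠] (ψ x)) (𝓝[≠] x)).neBot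
    filter_upwards [self_mem_nhdsWithin, nhdsWithin_le_nhds
      (ψ.open_target.mem_nhds (ψ.map_source hxψ))] with y hy hyt hyx
    exact hy (by rw [mem_singleton_iff.1 (show ψ.symm y ∈ ({x} : Set S) from hyx).symm, ψ.right_inv hyt]; rfl)

theorem exists_notMem_Z [T2Space S] (X : HalfTranslationSurface S) : ∃ y, y ∉ X.Z := by
  obtain ⟨z, -⟩ := X.nonempty_Z
  have := X.neBot_punctured z
  have h : ∀ᶠ y in 𝓝[≠] z, y ∉ X.Z \ {z} := mem_nhdsWithin_of_mem_nhds
    ((X.finite_Z.subset sdiff_subset).isClosed.isOpen_compl.mem_nhds fun h => h.2 rfl)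
  obtain ⟨y, h1, h2⟩ := (h.and self_mem_nhdsWithin).exists
  exact ⟨y, fun hyZ => h1 ⟨hyZ, h2⟩⟩

theorem isOpen_compl_Z [T2Space S] : IsOpen X.Zᶜ := X.finite_Z.isClosed.isOpen_compl

/-- The complement of the marked points is connected. -/
theorem isPreconnected_compl_Z [T2Space S] [ConnectedSpace S] : IsPreconnected X.Zᶜ := by
  rw [isPreconnected_iff_subset_of_disjoint]
  intro U V hU hV hUV hd
  set U' := U ∩ X.Zᶜ
  set V' := V ∩ X.Zᶜ
  have hU' : IsOpen U' := hU.inter isOpen_compl_Z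
  have hV' : IsOpen V' := hV.inter isOpen_compl_Z
  have hdis : ∀ x ∈ U', x ∉ V' := fun x h1 h2 => by
    have : x ∈ X.Zᶜ ∩ (U ∩ V) := ⟨h1.2, h1.1, h2.1⟩
    rw [hd] at this; exact this
  have hcov : ∀ x : S, (∀ᶠ y in 𝓝[≠] x, y ∈ U') ∨ ∀ᶠ y in 𝓝[≠] x, y ∈ V' := by
    intro x
    by_cases hx : x ∈ X.Z
    · obtain ⟨k, φ, hφ⟩ := exists_isCone hx
      obtain ⟨ρ, hρ0, hρ⟩ := hφ.exists_radius
      set P := φ.symm '' (ball 0 ρ \ {0}) with hP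
      have hbt : ball 0 ρ ⊆ φ.target := ball_subset_closedBall.trans hρ
      have hPc : IsPreconnected P := (isPreconnected_punctured_ball ρ).image _
        (φ.symm.continuousOn.mono (sdiff_subset.trans hbt))
      have hPZ : P ⊆ X.Zᶜ := by
        rintro _ ⟨y, hy, rfl⟩ hyZ
        have := hφ.eq_of_mem (φ.map_target (hbt hy.1)) hyZ
        apply hy.2
        rw [mem_singleton_iff, ← φ.right_inv (hbt hy.1), this, hφ.map_zero]
      have hPn : ∀ᶠ y in 𝓝[≠] x, y ∈ P := by
        rw [eventually_nhdsWithin_iff]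
        have h1 := φ.continuousAt hφ.mem_source
        rw [ContinuousAt, hφ.map_zero] at h1
        filter_upwards [h1 (ball_mem_nhds 0 hρ0), φ.open_source.mem_nhds hφ.mem_source]
          with y hy hys hyx
        refine ⟨φ y, ⟨hy, fun h0 => hyx ?_⟩, φ.left_inv hys⟩
        exact φ.injOn hys hφ.mem_source (by rw [hφ.map_zero]; exact h0)
      have := (isPreconnected_iff_subset_of_disjoint.1 hPc) U' V' hU' hV'
        (fun y hy => (hUV (hPZ hy)).imp (fun h => ⟨h, hPZ hy⟩) (fun h => ⟨h, hPZ hy⟩)) (by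
          rw [eq_empty_iff_forall_notMem]; exact fun y hy => hdis y hy.2.1 hy.2.2)
      rcases this with h | h
      · exact Or.inl (hPn.mono fun y hy => h hy)
      · exact Or.inr (hPn.mono fun y hy => h hy)
    · rcases hUV hx with h | h
      · exact Or.inl (nhdsWithin_le_nhds (hU'.mem_nhds ⟨h, hx⟩))
      · exact Or.inr (nhdsWithin_le_nhds (hV'.mem_nhds ⟨h, hx⟩))
  have := (isPreconnected_iff_subset_of_disjoint.1 (isPreconnected_univ (α := S)))
    {x | ∀ᶠ y in 𝓝[≠] x, y ∈ U'} {x | ∀ᶠ y in 𝓝[≠] x, y ∈ V'}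
    (isOpen_setOf_eventually_punctured _) (isOpen_setOf_eventually_punctured _)
    (fun x _ => hcov x) (by
      rw [eq_empty_iff_forall_notMem]
      rintro x ⟨-, h1, h2⟩
      have := neBot_punctured X x
      have h1' : ∀ᶠ y in 𝓝[≠] x, y ∈ U' := h1
      have h2' : ∀ᶠ y in 𝓝[≠] x, y ∈ V' := h2
      obtain ⟨y, hy1, hy2⟩ := (h1'.and h2').exists
      exact hdis y hy1 hy2)
  rcases this with h | h
  · left
    intro x hx
    rcases hUV hx with h' | h'
    · exact h'
    · exfalso
      have h1 : ∀ᶠ y in 𝓝[≠] x, y ∈ U' := h (mem_univ x)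
      have h2 : ∀ᶠ y in 𝓝[≠] x, y ∈ V' := nhdsWithin_le_nhds (hV'.mem_nhds ⟨h', hx⟩)
      have := neBot_punctured X x
      obtain ⟨y, hy1, hy2⟩ := (h1.and h2).exists
      exact hdis y hy1 hy2
  · right
    intro x hx
    rcases hUV hx with h' | h'
    · exfalso
      have h1 : ∀ᶠ y in 𝓝[≠] x, y ∈ V' := h (mem_univ x)
      have h2 : ∀ᶠ y in 𝓝[≠] x, y ∈ U' := nhdsWithin_le_nhds (hU'.mem_nhds ⟨h', hx⟩)
      have := neBot_punctured X x
      obtain ⟨y, hy1, hy2⟩ := (h1.and h2).exists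
      exact hdis y hy2 hy1
    · exact h'

/-- A flat map restricted to a line is a flat path. -/
theorem IsFlatAt.line {w v ε : ℂ} {t₀ t : ℝ} (hε : ε = 1 ∨ ε = -1)
    (h : X.IsFlatAt id F (w + ε * ((t : ℂ) - t₀) * v)) :
    X.IsFlatAt (fun s : ℝ => (s : ℂ) * v) (fun s : ℝ => F (w + ε * ((s : ℂ) - t₀) * v)) t :=
  h.comp (k := fun s : ℝ => w + ε * ((s : ℂ) - t₀) * v) (by fun_prop) hε (c := w - ε * t₀ * v)
    (Eventually.of_forall fun s => by simp only [id]; ring)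

theorem lineMap_line (b v ε : ℂ) (t₀ t s : ℝ) : lineMap b (b + ε * ((t : ℂ) - t₀) * v) s =
      b + ε * (((t₀ + s * (t - t₀) : ℝ) : ℂ) - t₀) * v := by
  simp only [lineMap_apply, vsub_eq_sub, vadd_eq_add, real_smul]
  push_cast; ring

/-- A flat path that starts like a straight line in the developing map follows that line. -/
theorem path_mem_dom [CompactSpace S] [T2Space S] (hb : b ∈ X.dom b g)
    (hv : v ≠ 0) {I : Set ℝ} (hI : I.OrdConnected)
    (hγ : ∀ t ∈ I, X.IsFlatAt (fun s : ℝ => (s : ℂ) * v) γ t) {t₀ : ℝ} (ht₀ : t₀ ∈ I)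
    (hε : ε = 1 ∨ ε = -1)
    (h : ∀ᶠ t : ℝ in 𝓝 t₀, γ t = X.dev b g (b + ε * ((t : ℂ) - t₀) * v)) {t : ℝ} (ht : t ∈ I) :
    b + ε * ((t : ℂ) - t₀) * v ∈ X.dom b g ∧ γ t = X.dev b g (b + ε * ((t : ℂ) - t₀) * v) := by
  have key : ∀ J : Set ℝ, J ⊆ I → IsPreconnected J → t₀ ∈ J →
      (∀ s ∈ J, b + ε * ((s : ℂ) - t₀) * v ∈ X.dom b g) →
      ∀ s ∈ J, γ s = X.dev b g (b + ε * ((s : ℂ) - t₀) * v) := fun J hJI hJ h0 hd s hs =>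
    (eqOn_of_isFlatAt hJ (frequently_mul_ne hv) (fun a ha => hγ a (hJI ha))
      (fun a ha => (flat_dev (hd a ha)).line hε) h0 h s hs).self_of_nhds
  have hd : b + ε * ((t : ℂ) - t₀) * v ∈ X.dom b g := by
    by_contra hcon
    obtain ⟨s, hs0, hs1, hsd, hsm⟩ := exists_first_exit hb hcon
    rw [lineMap_line] at hsd
    have hne : t ≠ t₀ := by rintro rfl; simp at hcon; exact hcon hb
    set t₁ := t₀ + s * (t - t₀) with ht₁
    set w := b + ε * ((t₁ : ℂ) - t₀) * v with hw
    have ht₁I : t₁ ∈ I := by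
      have : t₁ ∈ segment ℝ t₀ t := ⟨1 - s, s, by linarith, hs0.le, by ring, by
        simp only [smul_eq_mul, ht₁]; ring⟩
      exact hI.convex.segment_subset ht₀ ht this
    have hcoef : ∀ r : ℝ, t₀ + r * (t₁ - t₀) = t₀ + (r * s) * (t - t₀) := fun r => by
      rw [ht₁]; ring
    have hho : halfOpen b w ⊆ X.dom b g := by
      rintro _ ⟨r, hr, rfl⟩
      have := hsm (r * s) (mul_nonneg hr.1 hs0.le) (by nlinarith [hr.2])
      rw [lineMap_line, ← hcoef] at this
      rw [hw, lineMap_line]; exact this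
    obtain ⟨z, hz, hlim⟩ := tendsto_of_visible hsd (convex_halfOpen b w) Subset.rfl hho
    set ℓ : ℝ → ℝ := fun r => t₀ + r * (t₁ - t₀) with hℓ
    have hℓc : Continuous ℓ := by fun_prop
    have h1 : Tendsto (fun r : ℝ => lineMap b w r) (𝓝[<] 1) (𝓝[halfOpen b w] w) := by
      refine tendsto_nhdsWithin_of_tendsto_nhds_of_eventually_within _ ?_ ?_
      · have : Continuous fun r : ℝ => lineMap b w r := by fun_prop
        simpa using (this.tendsto 1).mono_left nhdsWithin_le_nhds
      · filter_upwards [Ico_mem_nhdsLT (zero_lt_one (α := ℝ))] with r hr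
        exact ⟨r, hr, rfl⟩
    have h2 : Tendsto (fun r => γ (ℓ r)) (𝓝[<] 1) (𝓝 (γ t₁)) := by
      have e1 : Tendsto ℓ (𝓝[<] 1) (𝓝 t₁) := by
        have := (hℓc.tendsto 1).mono_left (nhdsWithin_le_nhds (s := Iio (1 : ℝ)))
        simpa [hℓ] using this
      exact (hγ t₁ ht₁I).1.tendsto.comp e1
    have h3 := key (ℓ '' Ico 0 1) ?_ (isPreconnected_Ico.image _ hℓc.continuousOn)
      ⟨0, by simp, by simp [hℓ]⟩ ?_
    · have h4 : Tendsto (fun r => γ (ℓ r)) (𝓝[<] 1) (𝓝 z) := by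
        refine (hlim.comp h1).congr' ?_
        filter_upwards [Ico_mem_nhdsLT (zero_lt_one (α := ℝ))] with r hr
        rw [h3 (ℓ r) ⟨r, hr, rfl⟩, Function.comp, hw, lineMap_line]
      exact (hγ t₁ ht₁I).notMem (tendsto_nhds_unique h2 h4 ▸ hz)
    · rintro _ ⟨r, hr, rfl⟩
      have : ℓ r ∈ segment ℝ t₀ t₁ := ⟨1 - r, r, by linarith [hr.2], hr.1, by ring, by
        simp only [smul_eq_mul, hℓ]; ring⟩
      exact hI.convex.segment_subset ht₀ ht₁I this
    · rintro _ ⟨r, hr, rfl⟩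
      apply hho
      exact ⟨r, hr, by rw [hw, lineMap_line]⟩
  refine ⟨hd, key (uIcc t₀ t) (hI.uIcc_subset ht₀ ht) isPreconnected_uIcc left_mem_uIcc ?_ t
    right_mem_uIcc⟩
  intro s hs
  rw [← segment_eq_uIcc, segment_eq_image_lineMap] at hs
  obtain ⟨r, hr, rfl⟩ := hs
  refine segment_subset_dom hd ?_
  rw [segment_eq_image_lineMap]
  refine ⟨r, hr, ?_⟩
  rw [lineMap_line]
  simp only [lineMap_apply, vsub_eq_sub, vadd_eq_add, smul_eq_mul]
  push_cast; ring

/-- If moreover the path tends to a marked point, the developing map is undefined there. -/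
theorem notMem_dom_of_tendsto [T2Space S] {t₀ t₁ : ℝ} {l : Filter ℝ} [l.NeBot] (hl : l ≤ 𝓝 t₁)
    (h : ∀ᶠ t : ℝ in l, γ t = X.dev b g (b + ε * ((t : ℂ) - t₀) * v)) {z : S} (hz : z ∈ X.Z)
    (hlim : Tendsto γ l (𝓝 z)) : b + ε * ((t₁ : ℂ) - t₀) * v ∉ X.dom b g := by
  intro hd
  have h1 := (flat_dev hd).1.tendsto
  have h2 : Tendsto (fun t : ℝ => b + ε * ((t : ℂ) - t₀) * v) l
      (𝓝 (b + ε * ((t₁ : ℂ) - t₀) * v)) := by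
    have : Continuous fun t : ℝ => b + ε * ((t : ℂ) - t₀) * v := by fun_prop
    exact (this.tendsto t₁).mono_left hl
  have h3 := tendsto_nhds_unique hlim ((h1.comp h2).congr' (h.mono fun t ht => ht.symm))
  exact (flat_dev hd).notMem (h3 ▸ hz)

variable (X) in
/-- A path of constant velocity `v` between marked points, flat in between. -/
structure IsArc (γ : ℝ → S) (v : ℂ) : Prop where
  ne_zero : v ≠ 0
  continuousOn : ContinuousOn γ (Icc 0 1)
  left : γ 0 ∈ X.Z
  right : γ 1 ∈ X.Z
  flat : ∀ t ∈ Ioo (0 : ℝ) 1, X.IsFlatAt (fun s : ℝ => (s : ℂ) * v) γ t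

theorem IsSaddle.exists_arc (h : X.IsSaddle e v) :
    ∃ γ : ℝ → S, X.IsArc γ v ∧ InjOn γ (Ioo 0 1) ∧ e = γ '' Ioo 0 1 := by
  obtain ⟨γ, hc, hinj, h0, h1, hf, rfl⟩ := h
  have hfl : ∀ t ∈ Ioo (0 : ℝ) 1, X.IsFlatAt (fun s : ℝ => (s : ℂ) * v) γ t := fun t ht =>
    ⟨(hc.mono Ioo_subset_Icc_self).continuousAt (isOpen_Ioo.mem_nhds ht), hf t ht⟩
  refine ⟨γ, ⟨?_, hc, h0, h1, hfl⟩, hinj, rfl⟩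
  rintro rfl
  have hh : (1 / 2 : ℝ) ∈ Ioo (0 : ℝ) 1 := by norm_num
  obtain ⟨ψ, hψ, hs, ε, c, hε, h2⟩ := (hfl _ hh).exists_chart
  have h3 : ∀ᶠ t : ℝ in 𝓝[≠] (1 / 2 : ℝ), False := by
    rw [eventually_nhdsWithin_iff]
    filter_upwards [h2, isOpen_Ioo.mem_nhds hh] with t ht htI hne
    apply hne
    refine hinj htI hh (ψ.injOn ht.1 hs ?_)
    have := h2.self_of_nhds.2
    simp only [mul_zero, zero_add] at this ht
    rw [ht.2, this]
  simp only [eventually_false_iff_eq_bot] at h3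
  exact (inferInstance : (𝓝[≠] (1 / 2 : ℝ)).NeBot).ne h3

theorem IsSaddle.subset_compl (h : X.IsSaddle e v) : e ⊆ X.Zᶜ := by
  obtain ⟨γ, hγ, -, rfl⟩ := h.exists_arc
  rintro _ ⟨t, ht, rfl⟩
  exact (hγ.flat t ht).notMem

theorem IsSaddle.nonempty (h : X.IsSaddle e v) : e.Nonempty := by
  obtain ⟨γ, hγ, -, rfl⟩ := h.exists_arc
  exact ⟨_, 1 / 2, by norm_num, rfl⟩

theorem IsArc.subset_of_Icc (h : X.IsArc γ v) : γ '' Icc 0 1 ⊆ X.Z ∪ γ '' Ioo 0 1 := by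
  rintro _ ⟨t, ht, rfl⟩
  rcases eq_or_lt_of_le ht.1 with h0 | h0
  · exact Or.inl (h0 ▸ h.left)
  rcases eq_or_lt_of_le ht.2 with h1 | h1
  · exact Or.inl (h1 ▸ h.right)
  · exact Or.inr ⟨t, ⟨h0, h1⟩, rfl⟩

theorem IsSaddle.isClosed_union [T2Space S] (h : X.IsSaddle e v) : IsClosed (X.Z ∪ e) := by
  obtain ⟨γ, hγ, -, rfl⟩ := h.exists_arc
  have : X.Z ∪ γ '' Ioo 0 1 = X.Z ∪ γ '' Icc 0 1 :=
    Subset.antisymm (union_subset_union_right _ (image_mono Ioo_subset_Icc_self))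
      (union_subset subset_union_left hγ.subset_of_Icc)
  rw [this]
  exact X.finite_Z.isClosed.union (isCompact_Icc.image_of_continuousOn hγ.continuousOn).isClosed

/-- The reversed path. -/
theorem IsArc.reverse (h : X.IsArc γ v) : X.IsArc (fun t => γ (1 - t)) v where
  ne_zero := h.ne_zero
  continuousOn := h.continuousOn.comp (by fun_prop) fun t ht => ⟨by linarith [ht.2], by linarith [ht.1]⟩
  left := by simpa using h.right
  right := by simpa using h.left
  flat t ht := (h.flat (1 - t) ⟨by linarith [ht.2], by linarith [ht.1]⟩).comp (k := fun t : ℝ => 1 - t)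
    (by fun_prop) (Or.inr rfl) (c := v) (Eventually.of_forall fun s => by push_cast; ring)

theorem IsArc.neg (h : X.IsArc γ v) : X.IsArc γ (-v) where
  ne_zero := neg_ne_zero.2 h.ne_zero
  continuousOn := h.continuousOn
  left := h.left
  right := h.right
  flat t ht := (h.flat t ht).comp (k := fun t : ℝ => t) continuousAt_id (Or.inr rfl) (c := 0)
    (Eventually.of_forall fun s => by ring)

/-- A flat path between marked points is laid out as a segment by the developing map. -/
theorem IsArc.exists_dev [CompactSpace S] [T2Space S] (h : X.IsArc γ v) {t₀ : ℝ}
    (ht₀ : t₀ ∈ Ioo (0 : ℝ) 1) (hb : b ∈ X.dom b g) (hg : g b = γ t₀) :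
    ∃ ε : ℂ, (ε = 1 ∨ ε = -1) ∧ (∀ t ∈ Ioo (0 : ℝ) 1, b + ε * ((t : ℂ) - t₀) * v ∈ X.dom b g ∧
      γ t = X.dev b g (b + ε * ((t : ℂ) - t₀) * v)) ∧
      b + ε * ((0 : ℂ) - t₀) * v ∉ X.dom b g ∧ b + ε * ((1 : ℂ) - t₀) * v ∉ X.dom b g := by
  have hgd : γ t₀ = X.dev b g b := by rw [(dev_base hb).eq_of_nhds, hg]
  obtain ⟨ε, hε, he⟩ := (flat_dev hb).germ_eq (h.flat t₀ ht₀)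
    (continuous_mul_right_ofReal v).continuousAt hgd
  have he' : ∀ᶠ t : ℝ in 𝓝 t₀, γ t = X.dev b g (b + ε * ((t : ℂ) - t₀) * v) := by
    filter_upwards [he] with t ht
    rw [ht]; congr 1; ring
  have hall := fun t ht => path_mem_dom (t := t) hb h.ne_zero ordConnected_Ioo h.flat ht₀ hε he' ht
  refine ⟨ε, hε, hall, ?_, ?_⟩
  · have hl : Tendsto γ (𝓝[>] 0) (𝓝 (γ 0)) := by
      have := h.continuousOn 0 (left_mem_Icc.2 zero_le_one)
      rw [← nhdsWithin_Ioo_eq_nhdsGT (zero_lt_one (α := ℝ))]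
      exact this.mono_left (nhdsWithin_mono _ Ioo_subset_Icc_self)
    have := notMem_dom_of_tendsto (l := 𝓝[>] (0 : ℝ)) (t₀ := t₀) (ε := ε) (v := v) (b := b) (g := g)
      nhdsWithin_le_nhds (by
        filter_upwards [Ioo_mem_nhdsGT (zero_lt_one (α := ℝ))] with t ht using (hall t ht).2)
      h.left hl
    simpa using this
  · have hl : Tendsto γ (𝓝[<] 1) (𝓝 (γ 1)) := by
      have := h.continuousOn 1 (right_mem_Icc.2 zero_le_one)
      rw [← nhdsWithin_Ioo_eq_nhdsLT (zero_lt_one (α := ℝ))]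
      exact this.mono_left (nhdsWithin_mono _ Ioo_subset_Icc_self)
    have := notMem_dom_of_tendsto (l := 𝓝[<] (1 : ℝ)) (t₀ := t₀) (ε := ε) (v := v) (b := b) (g := g)
      nhdsWithin_le_nhds (by
        filter_upwards [Ioo_mem_nhdsLT (zero_lt_one (α := ℝ))] with t ht using (hall t ht).2)
      h.right hl
    simpa using this

/-- A flat path between marked points is injective in between. -/
theorem IsArc.injOn [CompactSpace S] [T2Space S] (h : X.IsArc γ v) : InjOn γ (Ioo 0 1) := by
  have key : ∀ t ∈ Ioo (0 : ℝ) 1, ∀ t' ∈ Ioo (0 : ℝ) 1, t < t' → γ t ≠ γ t' := by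
    intro t ht t' ht' htt heq
    obtain ⟨δ, hδ, f, hf0, hf⟩ := exists_germ (h.flat t ht).notMem 0
    have hb := base_mem_dom hδ hf (mem_ball_self hδ)
    obtain ⟨ε, hε, ha, hb1, -⟩ := h.exists_dev ht hb hf0
    obtain ⟨ε', hε', ha', -, -⟩ := h.exists_dev ht' hb (by rw [hf0, heq])
    by_cases hs : ε = ε'
    · subst hs
      have h1 := (ha' (t' - t) ⟨by linarith, by linarith [ht.1, ht'.2]⟩).1
      exact hb1 (by convert h1 using 1; push_cast; ring)
    · have hs' : ε' = -ε := by
        rcases hε with rfl | rfl <;> rcases hε' with rfl | rfl <;> simp_all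
      subst hs'
      have hm : (t + t') / 2 ∈ Ioo (0 : ℝ) 1 := ⟨by linarith [ht.1, ht'.1], by linarith [ht.2, ht'.2]⟩
      obtain ⟨η, hη, hinj⟩ := (flat_dev (ha _ hm).1).injOn_nhds
      have hc1 : Continuous fun s : ℝ => (0 : ℂ) + ε * ((s : ℂ) - t) * v := by fun_prop
      have hc2 : Continuous fun s : ℝ => (0 : ℂ) + ε * (((t + t' - s : ℝ) : ℂ) - t) * v := by fun_prop
      have hmm : t + t' - (t + t') / 2 = (t + t') / 2 := by ring
      have e1 := (hc1.tendsto ((t + t') / 2)).eventually (ball_mem_nhds _ hη)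
      have e2 := (hc2.tendsto ((t + t') / 2)).eventually (ball_mem_nhds _ hη)
      rw [hmm] at e2
      have e3 : ∀ᶠ s : ℝ in 𝓝[≠] ((t + t') / 2), False := by
        rw [eventually_nhdsWithin_iff]
        filter_upwards [e1, e2, isOpen_Ioo.mem_nhds hm,
          (continuous_sub_left (t + t')).continuousAt.eventually
            (isOpen_Ioo.mem_nhds (by
              show t + t' - (t + t') / 2 ∈ Ioo (0 : ℝ) 1; rw [hmm]; exact hm))] with s h1 h2 h3 h4 hne
        apply hne
        have h5 : X.dev 0 f (0 + ε * ((s : ℂ) - t) * v) =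
            X.dev 0 f (0 + ε * (((t + t' - s : ℝ) : ℂ) - t) * v) := by
          rw [← (ha _ h4).2, (ha' _ h4).2]
          congr 1; push_cast; ring
        have h6 := hinj h1 h2 h5
        have h7 : ε * v * (2 * (s - (t + t') / 2)) = 0 := by
          push_cast at h6; linear_combination h6
        have h8 : (2 * ((s : ℂ) - (t + t') / 2)) = 0 :=
          (mul_eq_zero.1 h7).resolve_left (mul_ne_zero (ne_zero_of_sign hε) h.ne_zero)
        have h9 : (2 * (s - (t + t') / 2) : ℝ) = 0 := by exact_mod_cast h8
        show s = _
        linarith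
      simp only [eventually_false_iff_eq_bot] at e3
      exact (inferInstance : (𝓝[≠] ((t + t') / 2)).NeBot).ne e3
  intro t ht t' ht' heq
  rcases lt_trichotomy t t' with h1 | h1 | h1
  · exact absurd heq (key t ht t' ht' h1)
  · exact h1
  · exact absurd heq.symm (key t' ht' t ht h1)

theorem IsArc.isSaddle [CompactSpace S] [T2Space S] (h : X.IsArc γ v) :
    X.IsSaddle (γ '' Ioo 0 1) v :=
  ⟨γ, h.continuousOn, h.injOn, h.left, h.right, fun t ht => (h.flat t ht).2, rfl⟩

/-- Near one of its points a saddle connection is a straight segment in the developing map. -/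
theorem IsSaddle.eventually_mem_iff [CompactSpace S] [T2Space S]
    (h : X.IsSaddle e v) (hb : b ∈ X.dom b g) (hg : g b ∈ e) :
    ∀ᶠ x in 𝓝 b, X.dev b g x ∈ e ↔ ∃ r : ℝ, x = b + r * v := by
  obtain ⟨γ, hγ, hinj, rfl⟩ := h.exists_arc
  obtain ⟨t₀, ht₀, hgt⟩ := hg
  obtain ⟨ε, hε, ha, -, -⟩ := hγ.exists_dev ht₀ hb hgt.symm
  have hv := norm_pos_iff.2 hγ.ne_zero
  obtain ⟨δ, hδ, hdinj⟩ := (flat_dev hb).injOn_nhds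
  obtain ⟨η, hη, hηδ, hη0, hη1⟩ : ∃ η > 0, η * ‖v‖ < δ ∧ η < t₀ ∧ η < 1 - t₀ := by
    refine ⟨min (δ / ‖v‖) (min t₀ (1 - t₀)) / 2, ?_, ?_, ?_, ?_⟩
    · have := ht₀.1; have := ht₀.2
      have : 0 < δ / ‖v‖ := by positivity
      have : 0 < min (δ / ‖v‖) (min t₀ (1 - t₀)) :=
        lt_min this (lt_min (by assumption) (by linarith))
      linarith
    · have h1 : min (δ / ‖v‖) (min t₀ (1 - t₀)) ≤ δ / ‖v‖ := min_le_left _ _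
      have h2 : δ / ‖v‖ * ‖v‖ = δ := by field_simp
      nlinarith
    · have h1 : min (δ / ‖v‖) (min t₀ (1 - t₀)) ≤ t₀ := (min_le_right _ _).trans (min_le_left _ _)
      linarith [ht₀.1]
    · have h1 : min (δ / ‖v‖) (min t₀ (1 - t₀)) ≤ 1 - t₀ :=
        (min_le_right _ _).trans (min_le_right _ _)
      linarith [ht₀.2]
  set K := γ '' (Icc 0 1 \ Ioo (t₀ - η) (t₀ + η)) with hK
  have hKc : IsClosed K := ((isCompact_Icc.diff isOpen_Ioo).image_of_continuousOn
    (hγ.continuousOn.mono sdiff_subset)).isClosed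
  have hKn : X.dev b g b ∉ K := by
    rw [(dev_base hb).eq_of_nhds, ← hgt]
    rintro ⟨t, ⟨ht, htn⟩, hteq⟩
    have htI : t ∈ Ioo (0 : ℝ) 1 := by
      refine ⟨lt_of_le_of_ne ht.1 ?_, lt_of_le_of_ne ht.2 ?_⟩
      · rintro rfl; exact (hγ.flat t₀ ht₀).notMem (hteq ▸ hγ.left)
      · rintro rfl; exact (hγ.flat t₀ ht₀).notMem (hteq ▸ hγ.right)
    have := hinj htI ht₀ hteq
    subst this
    exact htn ⟨by linarith, by linarith⟩
  have hnb : ∀ t : ℝ, |t - t₀| < η → t ∈ Ioo (0 : ℝ) 1 ∧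
      b + ε * ((t : ℂ) - t₀) * v ∈ ball b δ := by
    intro t ht
    have ht' := abs_lt.1 ht
    refine ⟨⟨by linarith, by linarith⟩, ?_⟩
    rw [mem_ball, dist_eq_norm, add_sub_cancel_left, norm_mul, norm_mul, norm_of_sign hε,
      one_mul, ← Complex.ofReal_sub, norm_real, Real.norm_eq_abs]
    nlinarith
  filter_upwards [ball_mem_nhds b hδ, ball_mem_nhds b (mul_pos hη hv),
    (flat_dev hb).1.eventually (hKc.isOpen_compl.mem_nhds hKn)] with x hx hx' hxK
  constructor
  · rintro ⟨t, ht, hte⟩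
    have htη : |t - t₀| < η := by
      by_contra hcon
      refine hxK ⟨t, ⟨Ioo_subset_Icc_self ht, fun hm => hcon ?_⟩, hte⟩
      rw [abs_lt]; exact ⟨by linarith [hm.1], by linarith [hm.2]⟩
    rw [(ha t ht).2] at hte
    have := hdinj (hnb t htη).2 hx hte
    rcases hε with rfl | rfl
    · exact ⟨t - t₀, by rw [← this]; push_cast; ring⟩
    · exact ⟨t₀ - t, by rw [← this]; push_cast; ring⟩
  · rintro ⟨r, rfl⟩
    rw [mem_ball, dist_eq_norm, add_sub_cancel_left, norm_mul, norm_real, Real.norm_eq_abs] at hx'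
    have hr : |r| < η := lt_of_mul_lt_mul_right hx' hv.le
    rcases hε with rfl | rfl
    · have h1 := (hnb (t₀ + r) (by simpa using hr)).1
      refine ⟨t₀ + r, h1, ?_⟩
      rw [(ha _ h1).2]; congr 1; push_cast; ring
    · have h1 := (hnb (t₀ - r) (by simpa using hr)).1
      refine ⟨t₀ - r, h1, ?_⟩
      rw [(ha _ h1).2]; congr 1; push_cast; ring

theorem Ioo_eq_of_ends {D : Set ℝ} {a b a' b' x : ℝ} (hx : x ∈ Ioo a b) (hx' : x ∈ Ioo a' b')
    (h : Ioo a b ⊆ D) (h' : Ioo a' b' ⊆ D) (ha : a ∉ D) (hb : b ∉ D) (ha' : a' ∉ D) (hb' : b' ∉ D) :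
    a = a' ∧ b = b' := by
  constructor
  · rcases lt_trichotomy a a' with h1 | h1 | h1
    · exact absurd (h ⟨h1, hx'.1.trans hx.2⟩) ha'
    · exact h1
    · exact absurd (h' ⟨h1, hx.1.trans hx'.2⟩) ha
  · rcases lt_trichotomy b b' with h1 | h1 | h1
    · exact absurd (h' ⟨hx'.1.trans hx.2, h1⟩) hb
    · exact h1
    · exact absurd (h ⟨hx.1.trans hx'.2, h1⟩) hb'

/-- The holonomy of a saddle connection is well defined up to sign. -/
theorem IsSaddle.holonomy_eq [CompactSpace S] [T2Space S] {v v' : ℂ}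
    (h : X.IsSaddle e v) (h' : X.IsSaddle e v') : v' = v ∨ v' = -v := by
  obtain ⟨γ, hγ, -, he⟩ := h.exists_arc
  obtain ⟨γ', hγ', -, he'⟩ := h'.exists_arc
  obtain ⟨y, hy⟩ := h.nonempty
  obtain ⟨t, ht, hty⟩ := he ▸ hy
  obtain ⟨t', ht', hty'⟩ := he' ▸ hy
  obtain ⟨δ, hδ, g, hg0, hg⟩ := exists_germ (h.subset_compl hy) 0
  have hb := base_mem_dom hδ hg (mem_ball_self hδ)
  obtain ⟨ε, hε, ha, ha0, ha1⟩ := hγ.exists_dev ht hb (by rw [hg0, hty])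
  obtain ⟨ε', hε', hc, hc0, hc1⟩ := hγ'.exists_dev ht' hb (by rw [hg0, hty'])
  have hv := hγ.ne_zero
  obtain ⟨r, hr⟩ : ∃ r : ℝ, v' = r * v := by
    have h1 := h.eventually_mem_iff hb (by rwa [hg0])
    have hcont : Continuous fun s : ℝ => (0 : ℂ) + ε' * ((s : ℂ) - t') * v' := by fun_prop
    have h2 : ∀ᶠ s : ℝ in 𝓝 t', X.dev 0 g (0 + ε' * ((s : ℂ) - t') * v') ∈ e ↔
        ∃ r : ℝ, (0 : ℂ) + ε' * ((s : ℂ) - t') * v' = 0 + r * v := by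
      refine hcont.continuousAt.eventually (p := fun x => X.dev 0 g x ∈ e ↔ ∃ r : ℝ, x = 0 + r * v) ?_
      simpa using h1
    obtain ⟨s, ⟨h3, hsI⟩, hs⟩ := (((h2.and (isOpen_Ioo.mem_nhds ht')).filter_mono
      (nhdsWithin_le_nhds (s := {t'}ᶜ))).and self_mem_nhdsWithin).exists
    obtain ⟨r, hr⟩ := h3.1 (by rw [← (hc s hsI).2, he']; exact ⟨s, hsI, rfl⟩)
    have hs' : (s : ℂ) - t' ≠ 0 := sub_ne_zero.2 fun h => hs (by exact_mod_cast h)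
    rcases hε' with rfl | rfl
    · refine ⟨r / (s - t'), ?_⟩
      push_cast; field_simp; linear_combination hr
    · refine ⟨-r / (s - t'), ?_⟩
      push_cast; field_simp; linear_combination -hr
  subst hr
  have hr0 : r ≠ 0 := by rintro rfl; exact hγ'.ne_zero (by simp)
  set D : Set ℝ := {s : ℝ | (s : ℂ) * v ∈ X.dom 0 g} with hD
  have mem : ∀ s : ℝ, s ∈ D ↔ (s : ℂ) * v ∈ X.dom 0 g := fun s => Iff.rfl
  have hav : ∀ s : ℝ, (0 : ℂ) + 1 * ((s : ℂ) - t) * v = ((s - t : ℝ) : ℂ) * v := fun s => by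
    push_cast; ring
  have a1 : ∃ p q : ℝ, q - p = 1 ∧ (0 : ℝ) ∈ Ioo p q ∧ Ioo p q ⊆ D ∧ p ∉ D ∧ q ∉ D := by
    rcases hε with rfl | rfl
    · refine ⟨-t, 1 - t, by ring, ⟨by linarith [ht.1], by linarith [ht.2]⟩, fun s hs => ?_, ?_, ?_⟩
      · rw [mem]
        convert (ha (s + t) ⟨by linarith [hs.1], by linarith [hs.2]⟩).1 using 1
        push_cast; ring
      · rw [mem]; convert ha0 using 2; push_cast; ring
      · rw [mem]; convert ha1 using 2; push_cast; ring
    · refine ⟨t - 1, t, by ring, ⟨by linarith [ht.2], by linarith [ht.1]⟩, fun s hs => ?_, ?_, ?_⟩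
      · rw [mem]
        convert (ha (t - s) ⟨by linarith [hs.2], by linarith [hs.1]⟩).1 using 1
        push_cast; ring
      · rw [mem]; convert ha1 using 2; push_cast; ring
      · rw [mem]; convert ha0 using 2; push_cast; ring
  have a2 : ∃ p q : ℝ, q - p = |r| ∧ (0 : ℝ) ∈ Ioo p q ∧ Ioo p q ⊆ D ∧ p ∉ D ∧ q ∉ D := by
    have key : ∃ ρ : ℝ, ρ ≠ 0 ∧ |ρ| = |r| ∧ (∀ s ∈ Ioo (0 : ℝ) 1, (s - t') * ρ ∈ D) ∧
        (0 - t') * ρ ∉ D ∧ (1 - t') * ρ ∉ D := by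
      rcases hε' with rfl | rfl
      · refine ⟨r, hr0, rfl, fun s hs => ?_, ?_, ?_⟩
        · rw [mem]; convert (hc s hs).1 using 1; push_cast; ring
        · rw [mem]; convert hc0 using 2; push_cast; ring
        · rw [mem]; convert hc1 using 2; push_cast; ring
      · refine ⟨-r, neg_ne_zero.2 hr0, abs_neg r, fun s hs => ?_, ?_, ?_⟩
        · rw [mem]; convert (hc s hs).1 using 1; push_cast; ring
        · rw [mem]; convert hc0 using 2; push_cast; ring
        · rw [mem]; convert hc1 using 2; push_cast; ring
    obtain ⟨ρ, hρ0, hρr, k1, k2, k3⟩ := key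
    rcases lt_or_gt_of_ne hρ0 with hρ | hρ
    · refine ⟨(1 - t') * ρ, (0 - t') * ρ, by rw [← hρr, abs_of_neg hρ]; ring,
        ⟨by nlinarith [ht'.2], by nlinarith [ht'.1]⟩, fun s hs => ?_, k3, k2⟩
      have := k1 (s / ρ + t') ⟨?_, ?_⟩
      · convert this using 1; field_simp; ring
      · have : -t' < s / ρ := by rw [lt_div_iff_of_neg hρ]; linarith [hs.2]
        linarith
      · have : s / ρ < 1 - t' := by rw [div_lt_iff_of_neg hρ]; linarith [hs.1]
        linarith
    · refine ⟨(0 - t') * ρ, (1 - t') * ρ, by rw [← hρr, abs_of_pos hρ]; ring,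
        ⟨by nlinarith [ht'.1], by nlinarith [ht'.2]⟩, fun s hs => ?_, k2, k3⟩
      have := k1 (s / ρ + t') ⟨?_, ?_⟩
      · convert this using 1; field_simp; ring
      · have : -t' < s / ρ := by rw [lt_div_iff₀ hρ]; linarith [hs.1]
        linarith
      · have : s / ρ < 1 - t' := by rw [div_lt_iff₀ hρ]; linarith [hs.2]
        linarith
  obtain ⟨p, q, hpq, h0, hs, hp, hq⟩ := a1
  obtain ⟨p', q', hpq', h0', hs', hp', hq'⟩ := a2
  obtain ⟨rfl, rfl⟩ := Ioo_eq_of_ends h0 h0' hs hs' hp hq hp' hq'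
  rw [hpq] at hpq'
  rcases eq_or_eq_neg_of_abs_eq hpq'.symm with h1 | h1
  · left; rw [h1]; simp
  · right; rw [h1]; simp

/-- Twice the signed area of the triangle `a`, `b`, `w`. -/
noncomputable def cr (a b w : ℂ) : ℝ := ((starRingEnd ℂ) (b - a) * (w - a)).im

theorem cr_eq (a b w : ℂ) :
    cr a b w = (b.re - a.re) * (w.im - a.im) - (b.im - a.im) * (w.re - a.re) := by
  simp [cr]; ring

theorem cr_rotate (a b c : ℂ) : cr b c a = cr a b c := by simp only [cr_eq]; ring

theorem cr_swap (a b c : ℂ) : cr b a c = -cr a b c := by simp only [cr_eq]; ring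

@[simp] theorem cr_left (a b : ℂ) : cr a b a = 0 := by simp only [cr_eq]; ring

@[simp] theorem cr_right (a b : ℂ) : cr a b b = 0 := by simp only [cr_eq]; ring

theorem cr_add_add (a b c w : ℂ) : cr a b w + cr b c w + cr c a w = cr a b c := by
  simp only [cr_eq]; ring

theorem continuous_cr (a b : ℂ) : Continuous (cr a b) := by
  unfold cr; fun_prop

theorem cr_combo (a b x y : ℂ) {s t : ℝ} (h : s + t = 1) :
    cr a b (s • x + t • y) = s * cr a b x + t * cr a b y := by
  obtain rfl : s = 1 - t := by linarith
  simp [cr_eq]; ring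

theorem cr_lineMap (a b x y : ℂ) (t : ℝ) :
    cr a b (lineMap x y t) = (1 - t) * cr a b x + t * cr a b y := by
  rw [AffineMap.lineMap_apply_module]; exact cr_combo a b x y (by ring)

theorem convex_cr_nonneg (a b : ℂ) : Convex ℝ {w | 0 ≤ cr a b w} := by
  intro x hx y hy s t hs ht hst
  simp only [mem_ofPred_eq] at hx hy ⊢
  rw [cr_combo _ _ _ _ hst]
  positivity

theorem convex_cr_pos (a b : ℂ) : Convex ℝ {w | 0 < cr a b w} := by
  intro x hx y hy s t hs ht hst
  simp only [mem_ofPred_eq] at hx hy ⊢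
  rw [cr_combo _ _ _ _ hst]
  rcases hs.eq_or_lt with rfl | hs'
  · obtain rfl : t = 1 := by linarith
    simpa using hy
  · have := mul_pos hs' hx; have := mul_nonneg ht hy.le; linarith

theorem cr_pos_of_mem_interior {a b w : ℂ} (hab : a ≠ b) {s : Set ℂ} (hs : ∀ x ∈ s, 0 ≤ cr a b x)
    (hw : w ∈ interior s) : 0 < cr a b w := by
  have hc : Continuous fun t : ℝ => w - t * (Complex.I * (b - a)) := by fun_prop
  have h1 := hc.tendsto 0
  simp only [ofReal_zero, zero_mul, sub_zero] at h1
  have h2 : ∀ᶠ t : ℝ in 𝓝[>] 0, w - t * (Complex.I * (b - a)) ∈ s :=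
    (h1.eventually (mem_interior_iff_mem_nhds.1 hw)).filter_mono nhdsWithin_le_nhds
  obtain ⟨t, ht, ht0⟩ := (h2.and self_mem_nhdsWithin).exists
  have h3 := hs _ ht
  have h4 : cr a b (w - t * (Complex.I * (b - a))) =
      cr a b w - t * ((b.re - a.re) ^ 2 + (b.im - a.im) ^ 2) := by
    simp [cr_eq]; ring
  have h5 : 0 < (b.re - a.re) ^ 2 + (b.im - a.im) ^ 2 := by
    by_contra hcon
    apply hab
    apply Complex.ext <;> nlinarith [sq_nonneg (b.re - a.re), sq_nonneg (b.im - a.im)]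
  have h6 : 0 < t * ((b.re - a.re) ^ 2 + (b.im - a.im) ^ 2) := mul_pos ht0 h5
  linarith

theorem ne_of_cr_pos {a b w : ℂ} (h : 0 < cr a b w) : a ≠ b := by
  rintro rfl; simp [cr_eq] at h

theorem bary (a b c w : ℂ) : (cr a b c : ℂ) * w = cr b c w * a + cr c a w * b + cr a b w * c := by
  apply Complex.ext <;> simp [cr_eq] <;> ring

theorem openSegment_lineMap {a b w : ℂ} (h : w ∈ seg a b) :
    ∃ t ∈ Ioo (0 : ℝ) 1, w = lineMap a b t := by
  rw [openSegment_eq_image_lineMap] at h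
  obtain ⟨t, ht, rfl⟩ := h
  exact ⟨t, ht, rfl⟩

section Triangle

theorem tri_pos (hp : 0 < cr (p 0) (p 1) (p 2)) (i : Fin 3) : 0 < cr (p i) (p (i + 1)) (p (i + 2)) := by
  fin_cases i
  · exact hp
  · show 0 < cr (p 1) (p 2) (p 0)
    rwa [cr_rotate]
  · show 0 < cr (p 2) (p 0) (p 1)
    rwa [← cr_rotate]

theorem mem_tri (hp : 0 < cr (p 0) (p 1) (p 2)) : w ∈ hull p ↔ ∀ i, 0 ≤ cr (p i) (p (i + 1)) w := by
  constructor
  · intro hw i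
    refine convexHull_min ?_ (convex_cr_nonneg (p i) (p (i + 1))) hw
    rintro _ ⟨j, rfl⟩
    have := (tri_pos hp i).le
    fin_cases i <;> fin_cases j <;> simp_all [cr_left, cr_right]
  · intro h
    have h0 := h 0
    have h1 := h 1
    have h2 : 0 ≤ cr (p 2) (p 0) w := h 2
    have hs := cr_add_add (p 0) (p 1) (p 2) w
    have hb := bary (p 0) (p 1) (p 2) w
    set D := cr (p 0) (p 1) (p 2)
    have hw : w = (cr (p 1) (p 2) w / D) • p 0 + (cr (p 2) (p 0) w / D) • p 1
        + (cr (p 0) (p 1) w / D) • p 2 := by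
      have hD : (D : ℂ) ≠ 0 := by exact_mod_cast hp.ne'
      simp only [real_smul, Complex.ofReal_div]
      field_simp
      linear_combination hb
    have := (convex_convexHull ℝ (range p)).sum_mem (t := Finset.univ)
      (w := ![cr (p 1) (p 2) w / D, cr (p 2) (p 0) w / D, cr (p 0) (p 1) w / D]) (z := p)
      (by intro i _; fin_cases i
          · exact div_nonneg h1 hp.le
          · exact div_nonneg h2 hp.le
          · exact div_nonneg h0 hp.le)
      (by simp [Fin.sum_univ_three]; field_simp; linarith)
      (fun i _ => subset_convexHull ℝ _ ⟨i, rfl⟩)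
    rw [hw]
    simpa [Fin.sum_univ_three] using this

theorem mem_interior_tri (hp : 0 < cr (p 0) (p 1) (p 2)) :
    w ∈ interior (hull p) ↔ ∀ i, 0 < cr (p i) (p (i + 1)) w := by
  constructor
  · intro hw i
    exact cr_pos_of_mem_interior (ne_of_cr_pos (tri_pos hp i)) (fun x hx => (mem_tri hp).1 hx i) hw
  · intro h
    have ho : IsOpen {w | ∀ i, 0 < cr (p i) (p (i + 1)) w} := by
      simp only [ofPred_forall]
      exact isOpen_iInter_of_finite fun i => isOpen_lt continuous_const (continuous_cr _ _)
    exact mem_interior.2 ⟨_, fun x hx => (mem_tri hp).2 fun i => (hx i).le, ho, h⟩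

theorem tri_corner (hp : 0 < cr (p 0) (p 1) (p 2)) (i : Fin 3)
    (h1 : cr (p i) (p (i + 1)) w = 0) (h2 : cr (p (i + 2)) (p i) w = 0) : w = p i := by
  have hb := bary (p i) (p (i + 1)) (p (i + 2)) w
  have hs := cr_add_add (p i) (p (i + 1)) (p (i + 2)) w
  rw [h1, h2] at hs hb
  have h3 : cr (p (i + 1)) (p (i + 2)) w = cr (p i) (p (i + 1)) (p (i + 2)) := by linarith
  rw [h3] at hb
  have hD : (cr (p i) (p (i + 1)) (p (i + 2)) : ℂ) ≠ 0 := by exact_mod_cast (tri_pos hp i).ne'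
  refine mul_left_cancel₀ hD ?_
  rw [hb]; simp

theorem mem_side_tri (hp : 0 < cr (p 0) (p 1) (p 2)) (i : Fin 3) :
    w ∈ seg (p i) (p (i + 1)) ↔ cr (p i) (p (i + 1)) w = 0 ∧
      0 < cr (p (i + 1)) (p (i + 2)) w ∧ 0 < cr (p (i + 2)) (p i) w := by
  have hi := tri_pos hp i
  constructor
  · intro hw
    obtain ⟨t, ht, rfl⟩ := openSegment_lineMap hw
    simp only [cr_lineMap, cr_left, cr_right, mul_zero, add_zero, zero_add, true_and]
    have e1 : cr (p (i + 1)) (p (i + 2)) (p i) = cr (p i) (p (i + 1)) (p (i + 2)) := cr_rotate _ _ _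
    have e2 : cr (p (i + 2)) (p i) (p (i + 1)) = cr (p i) (p (i + 1)) (p (i + 2)) := by
      rw [← cr_rotate]
    rw [e1, e2]
    exact ⟨mul_pos (by linarith [ht.2]) hi, mul_pos ht.1 hi⟩
  · rintro ⟨h0, h1, h2⟩
    have hb := bary (p i) (p (i + 1)) (p (i + 2)) w
    have hs := cr_add_add (p i) (p (i + 1)) (p (i + 2)) w
    set D := cr (p i) (p (i + 1)) (p (i + 2))
    refine ⟨cr (p (i + 1)) (p (i + 2)) w / D, cr (p (i + 2)) (p i) w / D, div_pos h1 hi,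
      div_pos h2 hi, by field_simp; linarith, ?_⟩
    have hD : (D : ℂ) ≠ 0 := by exact_mod_cast hi.ne'
    simp only [real_smul, Complex.ofReal_div]
    field_simp
    rw [h0, ofReal_zero] at hb
    linear_combination -hb

theorem tri_cases (hp : 0 < cr (p 0) (p 1) (p 2)) (hw : w ∈ hull p) :
    w ∈ interior (hull p) ∨ (∃ i, w ∈ seg (p i) (p (i + 1))) ∨ ∃ i, w = p i := by
  by_cases hint : w ∈ interior (hull p)
  · exact Or.inl hint
  right
  rw [mem_interior_tri hp] at hint
  push Not at hint
  obtain ⟨i, hi⟩ := hint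
  have hw' := (mem_tri hp).1 hw
  have h0 : cr (p i) (p (i + 1)) w = 0 := le_antisymm hi (hw' i)
  have e1 : i + 1 + 1 = i + 2 := by fin_cases i <;> rfl
  have e2 : i + 2 + 1 = i := by fin_cases i <;> rfl
  have e3 : i + 1 + 2 = i := by fin_cases i <;> rfl
  have h1 := hw' (i + 1)
  have h2 := hw' (i + 2)
  rw [e1] at h1
  rw [e2] at h2
  rcases h1.eq_or_lt with h1 | h1
  · right
    exact ⟨i + 1, tri_corner hp (i + 1) (by rw [e1]; exact h1.symm) (by rw [e3]; exact h0)⟩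
  rcases h2.eq_or_lt with h2 | h2
  · right
    exact ⟨i, tri_corner hp i h0 h2.symm⟩
  · left
    exact ⟨i, (mem_side_tri hp i).2 ⟨h0, h1, h2⟩⟩

theorem tri_nonempty_interior (hp : 0 < cr (p 0) (p 1) (p 2)) : (interior (hull p)).Nonempty := by
  refine ⟨(1 / 3 : ℝ) • p 0 + (2 / 3 : ℝ) • ((1 / 2 : ℝ) • p 1 + (1 / 2 : ℝ) • p 2), ?_⟩
  rw [mem_interior_tri hp]
  intro i
  rw [cr_combo _ _ _ _ (by norm_num), cr_combo _ _ _ _ (by norm_num)]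
  have := tri_pos hp i
  fin_cases i <;> simp_all [cr_left, cr_right]

theorem isCompact_hull {n : ℕ} (p : Fin n → ℂ) : IsCompact (hull p) :=
  (finite_range p).isCompact_convexHull ℝ

theorem closure_interior_tri (hp : 0 < cr (p 0) (p 1) (p 2)) :
    closure (interior (hull p)) = hull p := by
  rw [(convex_convexHull ℝ _).closure_interior_eq_closure_of_nonempty_interior
    (tri_nonempty_interior hp), (isCompact_hull p).isClosed.closure_eq]

/-- The corners are extreme points. -/
theorem tri_segment_corner (hp : 0 < cr (p 0) (p 1) (p 2)) {x y : ℂ}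
    (hx : x ∈ hull p) (hy : y ∈ hull p) {i : Fin 3}
    (h : p i ∈ segment ℝ x y) : x = p i ∨ y = p i := by
  rw [segment_eq_image_lineMap] at h
  obtain ⟨t, ht, h⟩ := h
  rcases ht.1.eq_or_lt with rfl | ht0
  · left; simpa using h
  rcases ht.2.eq_or_lt with rfl | ht1
  · right; simpa using h
  left
  have e2 : i + 2 + 1 = i := by fin_cases i <;> rfl
  have a1 := (mem_tri hp).1 hx i
  have a2 := (mem_tri hp).1 hy i
  have a3 := (mem_tri hp).1 hx (i + 2)
  have a4 := (mem_tri hp).1 hy (i + 2)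
  rw [e2] at a3 a4
  have b1 : cr (p i) (p (i + 1)) (p i) = 0 := cr_left _ _
  have b2 : cr (p (i + 2)) (p i) (p i) = 0 := cr_right _ _
  rw [← h, cr_lineMap] at b1 b2
  refine tri_corner hp i ?_ ?_
  · rw [h] at b1; nlinarith
  · rw [h] at b2; nlinarith

end Triangle

section Quad

variable {p : Fin 4 → ℂ}

/-- The corners of `p` are the corners of a strictly convex quadrilateral in anti-clockwise order. -/
def QuadPos (p : Fin 4 → ℂ) : Prop :=
  0 < cr (p 0) (p 1) (p 2) ∧ 0 < cr (p 0) (p 1) (p 3) ∧ 0 < cr (p 0) (p 2) (p 3) ∧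
    0 < cr (p 1) (p 2) (p 3)

theorem range_three (a b c : ℂ) : range ![a, b, c] = {a, b, c} := by
  ext x
  simp only [mem_range, Fin.exists_fin_succ, mem_insert_iff, mem_singleton_iff]
  simp [eq_comm]

theorem hull_sub_quad {i j k : Fin 4} : hull ![p i, p j, p k] ⊆ hull p := by
  refine convexHull_mono ?_
  rw [range_three]
  rintro x (rfl | rfl | rfl) <;> exact ⟨_, rfl⟩

theorem quad_cr_nonneg (hp : QuadPos p) (hw : w ∈ hull p) (i : Fin 4) :
    0 ≤ cr (p i) (p (i + 1)) w := by
  refine convexHull_min ?_ (convex_cr_nonneg (p i) (p (i + 1))) hw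
  rintro _ ⟨j, rfl⟩
  obtain ⟨h1, h2, h3, h4⟩ := hp
  have e1 : cr (p 1) (p 2) (p 0) = cr (p 0) (p 1) (p 2) := cr_rotate _ _ _
  have e2 : cr (p 2) (p 3) (p 0) = cr (p 0) (p 2) (p 3) := cr_rotate _ _ _
  have e3 : cr (p 2) (p 3) (p 1) = cr (p 1) (p 2) (p 3) := cr_rotate _ _ _
  have e4 : cr (p 3) (p 0) (p 1) = cr (p 0) (p 1) (p 3) := by rw [← cr_rotate]
  have e5 : cr (p 3) (p 0) (p 2) = cr (p 0) (p 2) (p 3) := by rw [← cr_rotate]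
  fin_cases i <;> fin_cases j <;> simp [cr_left, cr_right, *, h1.le, h2.le, h3.le, h4.le]

theorem mem_quad (hp : QuadPos p) : w ∈ hull p ↔ ∀ i, 0 ≤ cr (p i) (p (i + 1)) w := by
  refine ⟨quad_cr_nonneg hp, fun h => ?_⟩
  have h0 : 0 ≤ cr (p 0) (p 1) w := h 0
  have h1 : 0 ≤ cr (p 1) (p 2) w := h 1
  have h2 : 0 ≤ cr (p 2) (p 3) w := h 2
  have h3 : 0 ≤ cr (p 3) (p 0) w := h 3
  rcases le_total 0 (cr (p 0) (p 2) w) with hd | hd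
  · refine hull_sub_quad (i := 0) (j := 2) (k := 3) ((mem_tri (by exact hp.2.2.1)).2 ?_)
    intro i
    fin_cases i
    exacts [hd, h2, h3]
  · refine hull_sub_quad (i := 0) (j := 1) (k := 2) ((mem_tri (by exact hp.1)).2 ?_)
    intro i
    fin_cases i
    · exact h0
    · exact h1
    · show 0 ≤ cr (p 2) (p 0) w
      rw [cr_swap]; linarith

theorem quad_side_ne (hp : QuadPos p) (i : Fin 4) : p i ≠ p (i + 1) := by
  obtain ⟨h1, h2, h3, h4⟩ := hp
  fin_cases i
  · exact ne_of_cr_pos h1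
  · exact ne_of_cr_pos h4
  · show p 2 ≠ p 3
    rw [← cr_rotate] at h3
    exact ne_of_cr_pos h3
  · show p 3 ≠ p 0
    rw [← cr_rotate, ← cr_rotate] at h2
    exact ne_of_cr_pos h2

theorem mem_interior_quad (hp : QuadPos p) :
    w ∈ interior (hull p) ↔ ∀ i, 0 < cr (p i) (p (i + 1)) w := by
  constructor
  · intro hw i
    exact cr_pos_of_mem_interior (quad_side_ne hp i) (fun x hx => (mem_quad hp).1 hx i) hw
  · intro h
    have ho : IsOpen {w | ∀ i, 0 < cr (p i) (p (i + 1)) w} := by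
      simp only [ofPred_forall]
      exact isOpen_iInter_of_finite fun i => isOpen_lt continuous_const (continuous_cr _ _)
    exact mem_interior.2 ⟨_, fun x hx => (mem_quad hp).2 fun i => (hx i).le, ho, h⟩

theorem QuadPos.convex {p : Fin 4 → ℂ} (hp : QuadPos p) (i j k : Fin 4) (hij : i < j) (hjk : j < k) :
    0 < cr (p i) (p j) (p k) := by
  obtain ⟨h1, h2, h3, h4⟩ := hp
  fin_cases i <;> fin_cases j <;> try (exact absurd hij (by decide))
  all_goals fin_cases k <;> first | exact absurd hjk (by decide) | assumption

theorem QuadPos.rotate (hp : QuadPos p) : QuadPos fun i => p (i + 1) := by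
  obtain ⟨h1, h2, h3, h4⟩ := hp
  refine ⟨h4, ?_, ?_, ?_⟩
  · show 0 < cr (p 1) (p 2) (p 0)
    rwa [cr_rotate]
  · show 0 < cr (p 1) (p 3) (p 0)
    rwa [cr_rotate]
  · show 0 < cr (p 2) (p 3) (p 0)
    rwa [cr_rotate]

theorem range_rotate {n : ℕ} [NeZero n] (p : Fin n → ℂ) (j : Fin n) :
    range (fun i => p (i + j)) = range p :=
  (Equiv.addRight j).surjective.range_comp p

end Quad

/-- The half-translation `w ↦ ε * w + c` as a real affine map. -/
noncomputable def halfTr (ε c : ℂ) : ℂ →ᵃ[ℝ] ℂ :=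
  ((LinearMap.mulLeft ℝ ε).toAffineMap) + AffineMap.const ℝ ℂ c

@[simp] theorem halfTr_apply (ε c w : ℂ) : halfTr ε c w = ε * w + c := by
  simp [halfTr]

theorem halfTr_image_eq_preimage (hε : ε = 1 ∨ ε = -1) (c : ℂ) (s : Set ℂ) :
    halfTr ε c '' s = (fun w => ε * (w - c)) ⁻¹' s := by
  have h1 := sq_eq_one_of_sign hε
  ext w
  constructor
  · rintro ⟨x, hx, rfl⟩
    show ε * (halfTr ε c x - c) ∈ s
    rwa [halfTr_apply, add_sub_cancel_right, ← mul_assoc, h1, one_mul]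
  · intro hw
    refine ⟨_, hw, ?_⟩
    rw [halfTr_apply, ← mul_assoc, h1, one_mul, sub_add_cancel]

theorem hull_halfTr {n : ℕ} (p : Fin n → ℂ) (hε : ε = 1 ∨ ε = -1) (c : ℂ) :
    hull (fun i => ε * p i + c) = (fun w => ε * (w - c)) ⁻¹' hull p := by
  rw [← halfTr_image_eq_preimage hε, AffineMap.image_convexHull, ← range_comp]
  congr 2

theorem openSegment_halfTr (a b : ℂ) (hε : ε = 1 ∨ ε = -1) (c : ℂ) :
    seg (ε * a + c) (ε * b + c) = (fun w => ε * (w - c)) ⁻¹' seg a b := by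
  rw [← halfTr_image_eq_preimage hε, image_openSegment]; simp

theorem image_comp_halfTr (hε : ε = 1 ∨ ε = -1) (c : ℂ) (f : ℂ → S) (s : Set ℂ) :
    (fun w => f (ε * (w - c))) '' ((fun w => ε * (w - c)) ⁻¹' s) = f '' s := by
  rw [← halfTr_image_eq_preimage hε, image_image]
  have h1 := sq_eq_one_of_sign hε
  congr 1; ext x
  rw [halfTr_apply, add_sub_cancel_right, ← mul_assoc, h1, one_mul]

theorem interior_preimage_halfTr (hε : ε = 1 ∨ ε = -1) (c : ℂ) (s : Set ℂ) :
    interior ((fun w => ε * (w - c)) ⁻¹' s) = (fun w => ε * (w - c)) ⁻¹' interior s := by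
  have := ((Homeomorph.subRight c).trans (Homeomorph.mulLeft₀ ε (ne_zero_of_sign hε))).preimage_interior s
  exact this.symm

theorem cr_halfTr (hε : ε = 1 ∨ ε = -1) (c a b w : ℂ) :
    cr (ε * a + c) (ε * b + c) (ε * w + c) = cr a b w := by
  rcases hε with rfl | rfl <;> simp [cr_eq] <;> ring

theorem IsPolygon.halfTr {n : ℕ} {p : Fin n → ℂ} (h : X.IsPolygon p f)
    (hε : ε = 1 ∨ ε = -1) (c : ℂ) :
    X.IsPolygon (fun i => ε * p i + c) (fun w => f (ε * (w - c))) where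
  convex i j k hij hjk := by
    have := h.convex i j k hij hjk
    exact lt_of_lt_of_eq this (cr_halfTr hε c (p i) (p j) (p k)).symm
  continuousOn := by
    rw [hull_halfTr p hε c]
    exact h.continuousOn.comp (by fun_prop) fun w hw => hw
  injOn := by
    rw [hull_halfTr p hε c, interior_preimage_halfTr hε]
    intro x hx y hy hxy
    have := h.injOn hx hy hxy
    exact sub_left_injective (mul_left_cancel₀ (ne_zero_of_sign hε) this)
  flat := by
    rw [hull_halfTr p hε c, interior_preimage_halfTr hε]
    intro w hw
    have h1 : X.IsFlatAt id f (ε * (w - c)) :=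
      ⟨(h.continuousOn.mono interior_subset).continuousAt (isOpen_interior.mem_nhds hw),
        h.flat _ hw⟩
    exact (h1.comp (k := fun w => ε * (w - c)) (g' := id) (by fun_prop) hε (c := -ε * c)
      (Eventually.of_forall fun s => by simp only [id]; ring)).2
  corner i := by
    have h1 := sq_eq_one_of_sign hε
    show f (ε * (ε * p i + c - c)) ∈ X.Z
    rw [add_sub_cancel_right, ← mul_assoc, h1, one_mul]
    exact h.corner i

theorem IsTriangle.halfTr (h : X.IsTriangle E p f) (hε : ε = 1 ∨ ε = -1) (c : ℂ) :
    X.IsTriangle E (fun i => ε * p i + c) (fun w => f (ε * (w - c))) := by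
  refine ⟨h.1.halfTr hε c, fun i => ?_, ?_⟩
  · rw [openSegment_halfTr _ _ hε, image_comp_halfTr hε]
    exact h.2.1 i
  · rw [hull_halfTr p hε c, interior_preimage_halfTr hε, image_comp_halfTr hε]
    exact h.2.2

theorem IsPolygon.isFlatAt {n : ℕ} {p : Fin n → ℂ} (h : X.IsPolygon p f)
    (hw : w ∈ interior (hull p)) : X.IsFlatAt id f w :=
  ⟨(h.continuousOn.mono interior_subset).continuousAt (isOpen_interior.mem_nhds hw), h.flat w hw⟩

variable (X) in
/-- The developing map lays out the triangle `p`, `f` without its corners. -/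
abbrev LaysOut (b : ℂ) (g : ℂ → S) (p : Fin 3 → ℂ) (f : ℂ → S) : Prop :=
  ∀ w ∈ hull p, (∀ i, w ≠ p i) → w ∈ X.dom b g ∧ X.dev b g w = f w

namespace IsTriangle

theorem pos (h : X.IsTriangle E p f) : 0 < cr (p 0) (p 1) (p 2) :=
  h.1.convex 0 1 2 (by decide) (by decide)

theorem rotate (h : X.IsTriangle E p f) (j : Fin 3) : X.IsTriangle E (fun i => p (i + j)) f := by
  refine ⟨⟨?_, ?_, ?_, ?_, fun i => h.1.corner _⟩, fun i => ?_, ?_⟩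
  · intro i k l hik hkl
    have h3 := tri_pos h.pos j
    obtain ⟨rfl, rfl, rfl⟩ : i = 0 ∧ k = 1 ∧ l = 2 := by omega
    show 0 < cr (p (0 + j)) (p (1 + j)) (p (2 + j))
    rwa [zero_add, add_comm 1 j, add_comm 2 j]
  · rw [range_rotate]; exact h.1.continuousOn
  · rw [range_rotate]; exact h.1.injOn
  · rw [range_rotate]; exact h.1.flat
  · have := h.2.1 (i + j)
    rwa [add_right_comm] at this
  · rw [range_rotate]; exact h.2.2

theorem notMem_Z (hE : ∀ e ∈ E, e ⊆ X.Zᶜ) (h : X.IsTriangle E p f)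
    (hw : w ∈ hull p) (hc : ∀ i, w ≠ p i) : f w ∉ X.Z := by
  rcases tri_cases h.pos hw with h1 | ⟨i, h1⟩ | ⟨i, h1⟩
  · exact (h.1.isFlatAt h1).notMem
  · exact hE _ (h.2.1 i) ⟨w, h1, rfl⟩
  · exact absurd h1 (hc i)

theorem segment_subset (h : X.IsTriangle E p f) {x y : ℂ} (hx : x ∈ hull p)
    (hy : y ∈ hull p) (hxc : ∀ i, x ≠ p i) (hyc : ∀ i, y ≠ p i)
    (hw : w ∈ segment ℝ x y) : w ∈ hull p ∧ ∀ i, w ≠ p i := by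
  refine ⟨(convex_convexHull ℝ _).segment_subset hx hy hw, ?_⟩
  rintro i rfl
  rcases tri_segment_corner h.pos hx hy hw with h1 | h1
  · exact hxc i h1
  · exact hyc i h1

/-- A triangle extends to a flat map on a neighbourhood of the triangle without its corners. -/
theorem exists_extension [CompactSpace S] [T2Space S] (hE : ∀ e ∈ E, e ⊆ X.Zᶜ)
    (h : X.IsTriangle E p f) : ∃ (O : Set ℂ) (F : ℂ → S), IsOpen O ∧ (∀ x ∈ O, X.IsFlatAt id F x) ∧
      ∀ w ∈ hull p, (∀ i, w ≠ p i) → w ∈ O ∧ F w = f w := by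
  obtain ⟨b, hb⟩ := tri_nonempty_interior h.pos
  have hcv := convex_convexHull ℝ (range p)
  have hint : ∀ w ∈ interior (hull p), w ∈ X.dom b f ∧ X.dev b f w = f w :=
    fun w hw => dev_eq isOpen_interior hcv.interior hb (fun x hx => h.1.isFlatAt hx)
      EventuallyEq.rfl hw
  refine ⟨X.dom b f, X.dev b f, isOpen_dom, fun x hx => flat_dev hx, fun w hw hwc => ?_⟩
  have hho : halfOpen b w ⊆ interior (hull p) := by
    rintro _ ⟨t, ht, rfl⟩
    rcases ht.1.eq_or_lt with rfl | ht0
    · simpa using hb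
    · refine hcv.openSegment_interior_self_subset_interior hb hw ?_
      rw [openSegment_eq_image_lineMap]
      exact ⟨t, ⟨ht0, ht.2⟩, rfl⟩
  have hne : (𝓝[halfOpen b w] w).NeBot :=
    mem_closure_iff_nhdsWithin_neBot.1 (mem_closure_halfOpen b w)
  have hlim : Tendsto (X.dev b f) (𝓝[halfOpen b w] w) (𝓝 (f w)) := by
    have h1 : Tendsto f (𝓝[halfOpen b w] w) (𝓝 (f w)) :=
      (h.1.continuousOn w hw).mono_left (nhdsWithin_mono _ (hho.trans interior_subset))
    refine h1.congr' ?_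
    filter_upwards [self_mem_nhdsWithin] with x hx
    exact (hint x (hho hx)).2.symm
  have hd : w ∈ X.dom b f := by
    by_contra hcon
    obtain ⟨z, hz, hlim'⟩ := tendsto_of_visible hcon (convex_halfOpen b w) Subset.rfl
      (fun x hx => (hint x (hho hx)).1)
    exact h.notMem_Z hE hw hwc (tendsto_nhds_unique hlim hlim' ▸ hz)
  exact ⟨hd, tendsto_nhds_unique ((flat_dev hd).1.tendsto.mono_left nhdsWithin_le_nhds) hlim⟩

/-- A triangle is laid out by the developing map from any of its points other than the corners. -/
theorem dev_eq_of_extension [CompactSpace S] [T2Space S] {O : Set ℂ} (hO : IsOpen O)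
    (hF : ∀ x ∈ O, X.IsFlatAt id F x) (h : X.IsTriangle E p f)
    (hOF : ∀ w ∈ hull p, (∀ i, w ≠ p i) → w ∈ O ∧ F w = f w)
    (hb : b ∈ hull p) (hbc : ∀ i, b ≠ p i) (hg : F =ᶠ[𝓝 b] g) :
    X.LaysOut b g p f := by
  intro w hw hwc
  rw [← (hOF w hw hwc).2]
  refine dev_of_segment hO hF (fun x hx => ?_) hg
  obtain ⟨h1, h2⟩ := h.segment_subset hb hw hbc hwc hx
  exact (hOF x h1 h2).1

theorem corner_notMem_dom [T2Space S] (h : X.IsTriangle E p f)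
    (hb : b ∈ hull p) (hbc : ∀ i, b ≠ p i)
    (hd : X.LaysOut b g p f)
    (i : Fin 3) : halfOpen b (p i) ⊆ X.dom b g ∧ p i ∉ X.dom b g := by
  have hpi : p i ∈ hull p := subset_convexHull ℝ _ ⟨i, rfl⟩
  have hho : ∀ x ∈ halfOpen b (p i), x ∈ hull p ∧ ∀ j, x ≠ p j := by
    intro x hx
    have hxs := halfOpen_subset_segment _ _ hx
    refine ⟨(convex_convexHull ℝ _).segment_subset hb hpi hxs, ?_⟩
    rintro j rfl
    rcases tri_segment_corner h.pos hb hpi hxs with h1 | h1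
    · exact hbc j h1
    · rw [← h1] at hx
      obtain ⟨t, ht, hte⟩ := hx
      have h3 : lineMap b (p i) t = lineMap b (p i) (1 : ℝ) := by
        rw [hte]; simp
      have := lineMap_injective ℝ (hbc i) h3
      linarith [ht.2]
  have hne : (𝓝[halfOpen b (p i)] (p i)).NeBot :=
    mem_closure_iff_nhdsWithin_neBot.1 (mem_closure_halfOpen b (p i))
  refine ⟨fun x hx => (hd x (hho x hx).1 (hho x hx).2).1, fun hcon => ?_⟩
  have h1 : Tendsto f (𝓝[halfOpen b (p i)] (p i)) (𝓝 (f (p i))) :=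
    (h.1.continuousOn _ hpi).mono_left (nhdsWithin_mono _ fun x hx => (hho x hx).1)
  have h2 := ((flat_dev hcon).1.tendsto.mono_left
    (nhdsWithin_le_nhds (s := halfOpen b (p i))))
  have h3 := tendsto_nhds_unique (h1.congr' (by
    filter_upwards [self_mem_nhdsWithin] with x hx
    exact (hd x (hho x hx).1 (hho x hx).2).2.symm)) h2
  exact (flat_dev hcon).notMem (h3 ▸ h.1.corner i)

theorem eq_rotation (hp : 0 < cr (p 0) (p 1) (p 2)) (hp' : 0 < cr (p' 0) (p' 1) (p' 2))
    (h : hull p = hull p') : ∃ j, ∀ i, p' i = p (i + j) := by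
  have key : ∀ i, ∃ j, p' i = p j := by
    intro i
    have hmem : p' i ∈ hull p := h ▸ subset_convexHull ℝ _ ⟨i, rfl⟩
    rcases tri_cases hp hmem with h1 | ⟨j, h1⟩ | ⟨j, h1⟩
    · rw [h, mem_interior_tri hp'] at h1
      simpa using h1 i
    · exfalso
      have hm : ∀ k, p k ∈ hull p' := fun k => h ▸ subset_convexHull ℝ _ ⟨k, rfl⟩
      have hne := ne_of_cr_pos (tri_pos hp j)
      rcases tri_segment_corner hp' (hm j) (hm (j + 1)) (openSegment_subset_segment ℝ _ _ h1)
        with h2 | h2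
      · rw [← h2, left_mem_openSegment_iff] at h1; exact hne h1
      · rw [← h2, right_mem_openSegment_iff] at h1; exact hne h1
    · exact ⟨j, h1⟩
  choose σ hσ using key
  have h0 := hσ 0
  have h1 := hσ 1
  have h2 := hσ 2
  rw [h0, h1, h2] at hp'
  generalize σ 0 = a at *
  generalize σ 1 = b at *
  generalize σ 2 = c at *
  have hres : ∃ j : Fin 3, a = 0 + j ∧ b = 1 + j ∧ c = 2 + j := by
    clear h0 h1 h2
    simp only [cr_eq] at hp hp'
    fin_cases a <;> fin_cases b <;> fin_cases c <;>
      simp only [Fin.zero_eta, Fin.mk_one, Fin.reduceFinMk] at hp' <;>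
      first
        | exact ⟨0, rfl, rfl, rfl⟩
        | exact ⟨1, rfl, rfl, rfl⟩
        | exact ⟨2, rfl, rfl, rfl⟩
        | (exfalso; linarith)
  obtain ⟨j, rfl, rfl, rfl⟩ := hres
  refine ⟨j, fun i => ?_⟩
  fin_cases i
  exacts [h0, h1, h2]

/-- Two triangles of `E` that agree near a common interior point are equal. -/
theorem eq_of_germ [T2Space S] (h : X.IsTriangle E p f)
    (h' : X.IsTriangle E p' f') (hw : w ∈ interior (hull p))
    (hw' : w ∈ interior (hull p')) (hg : f =ᶠ[𝓝 w] f') :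
    (∃ j, ∀ i, p' i = p (i + j)) ∧ EqOn f f' (hull p) := by
  have key : ∀ (p p' : Fin 3 → ℂ) (f f' : ℂ → S), X.IsTriangle E p f → X.IsTriangle E p' f' →
      w ∈ interior (hull p) → w ∈ interior (hull p') →
      f =ᶠ[𝓝 w] f' → interior (hull p') ⊆ interior (hull p) := by
    intro p p' f f' h h' hw hw' hg
    set A := interior (hull p) with hA
    set A' := interior (hull p') with hA'
    have hAc : Convex ℝ A := (convex_convexHull ℝ _).interior
    have hAc' : Convex ℝ A' := (convex_convexHull ℝ _).interior
    have heq := eqOn_flat (hAc.inter hAc').isPreconnected (fun x hx => h.1.isFlatAt hx.1)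
      (fun x hx => h'.1.isFlatAt hx.2) ⟨hw, hw'⟩ hg
    refine hAc'.isPreconnected.subset_of_closure_inter_subset isOpen_interior ⟨w, hw', hw⟩ ?_
    rintro x ⟨hx, hx'⟩
    have hxT : x ∈ hull p := by
      rw [← closure_interior_tri h.pos]; exact hx
    have hsub : seg w x ⊆ A ∩ A' := fun y hy =>
      ⟨(convex_convexHull ℝ _).openSegment_interior_self_subset_interior hw hxT hy,
        hAc'.segment_subset hw' hx' (openSegment_subset_segment ℝ _ _ hy)⟩
    have hxcl : x ∈ closure (seg w x) := by
      rw [closure_openSegment]; exact right_mem_segment ℝ w x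
    have hne : (𝓝[seg w x] x).NeBot := mem_closure_iff_nhdsWithin_neBot.1 hxcl
    have l1 : Tendsto f (𝓝[seg w x] x) (𝓝 (f x)) :=
      (h.1.continuousOn x hxT).mono_left (nhdsWithin_mono _ fun y hy => interior_subset (hsub hy).1)
    have l2 : Tendsto f' (𝓝[seg w x] x) (𝓝 (f' x)) :=
      (h'.1.isFlatAt hx').1.tendsto.mono_left nhdsWithin_le_nhds
    have hfx : f x = f' x := tendsto_nhds_unique (l1.congr' (by
      filter_upwards [self_mem_nhdsWithin] with y hy
      exact (heq y (hsub hy)).eq_of_nhds)) l2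
    rcases tri_cases h.pos hxT with h1 | ⟨i, h1⟩ | ⟨i, rfl⟩
    · exact h1
    · exact absurd ⟨⟨x, hx', hfx.symm⟩, ⟨_, h.2.1 i, ⟨x, h1, rfl⟩⟩⟩
        (disjoint_left.1 h'.2.2 |> fun hd => fun hh : f x ∈ f' '' A' ∧ f x ∈ ⋃₀ E => hd hh.1 hh.2)
    · exact absurd (hfx ▸ h.1.corner i) (h'.1.isFlatAt hx').notMem
  have e1 := key p p' f f' h h' hw hw' hg
  have e2 := key p' p f' f h' h hw' hw hg.symm
  have e3 : interior (hull p) = interior (hull p') := Subset.antisymm e2 e1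
  have e4 : hull p = hull p' := by
    rw [← closure_interior_tri h.pos, e3, closure_interior_tri h'.pos]
  refine ⟨eq_rotation h.pos h'.pos e4, ?_⟩
  have heq := eqOn_flat (convex_convexHull ℝ _).interior.isPreconnected
    (fun x hx => h.1.isFlatAt hx) (fun x hx => h'.1.isFlatAt (e3 ▸ hx)) hw hg
  have hc : ContinuousOn f' (hull p) := e4 ▸ h'.1.continuousOn
  intro x hx
  have hxcl : x ∈ closure (interior (hull p)) := by
    rwa [closure_interior_tri h.pos]
  have hne := mem_closure_iff_nhdsWithin_neBot.1 hxcl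
  refine tendsto_nhds_unique (((h.1.continuousOn x hx).mono_left
    (nhdsWithin_mono _ interior_subset)).congr' ?_)
    ((hc x hx).mono_left (nhdsWithin_mono _ interior_subset))
  filter_upwards [self_mem_nhdsWithin] with y hy
  exact (heq y hy).eq_of_nhds

/-- Two triangles of `E` whose interiors meet differ by a half-translation. -/
theorem eq_of_meet [T2Space S] (h : X.IsTriangle E p f)
    (h' : X.IsTriangle E p' f') {w w' : ℂ} (hw : w ∈ interior (hull p))
    (hw' : w' ∈ interior (hull p')) (hg : f w = f' w') :
    ∃ ε c : ℂ, (ε = 1 ∨ ε = -1) ∧ w' = ε * w + c ∧ (∃ j, ∀ i, p' i = ε * p (i + j) + c) ∧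
      ∀ x ∈ hull p, f' (ε * x + c) = f x := by
  obtain ⟨ε, hε, he⟩ := (h.1.isFlatAt hw).germ_eq (h'.1.isFlatAt hw') continuousAt_id hg.symm
  have hsq := sq_eq_one_of_sign hε
  have e1 : ε * (w' - (w' - ε * w)) = w := by linear_combination w * hsq
  obtain ⟨⟨j, hj⟩, hfe⟩ := (h.halfTr hε (w' - ε * w)).eq_of_germ h' (w := w')
    (by rw [hull_halfTr p hε, interior_preimage_halfTr hε, mem_preimage, e1]; exact hw) hw' (by
      filter_upwards [he] with x hx
      rw [hx]; congr 1; simp only [id]; linear_combination w * hsq)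
  refine ⟨ε, w' - ε * w, hε, by ring, ⟨j, hj⟩, fun x hx => ?_⟩
  have e2 : ε * (ε * x + (w' - ε * w) - (w' - ε * w)) = x := by linear_combination x * hsq
  rw [← hfe (by rw [hull_halfTr p hε, mem_preimage, e2]; exact hx)]
  exact congrArg f e2

end IsTriangle

theorem cr_eq_zero_iff {a b x : ℂ} (hab : a ≠ b) : cr a b x = 0 ↔ ∃ r : ℝ, x = a + r * (b - a) := by
  constructor
  · intro h
    have h5 : 0 < (b.re - a.re) ^ 2 + (b.im - a.im) ^ 2 := by
      by_contra hcon
      apply hab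
      apply Complex.ext <;> nlinarith [sq_nonneg (b.re - a.re), sq_nonneg (b.im - a.im)]
    rw [cr_eq] at h
    refine ⟨((x.re - a.re) * (b.re - a.re) + (x.im - a.im) * (b.im - a.im)) /
      ((b.re - a.re) ^ 2 + (b.im - a.im) ^ 2), ?_⟩
    apply Complex.ext
    · simp only [add_re, re_ofReal_mul, sub_re]
      field_simp
      linear_combination -(b.im - a.im) * h
    · simp only [add_im, im_ofReal_mul, sub_im]
      field_simp
      linear_combination (b.re - a.re) * h
  · rintro ⟨r, rfl⟩
    simp [cr_eq]; ring

theorem eventually_mem_interior_tri (hp : 0 < cr (p 0) (p 1) (p 2)) (hb : b ∈ seg (p 0) (p 1)) :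
    ∀ᶠ x in 𝓝 b, 0 < cr (p 0) (p 1) x → x ∈ interior (hull p) := by
  obtain ⟨-, h1, h2⟩ := (mem_side_tri hp 0).1 hb
  filter_upwards [(continuous_cr _ _).continuousAt.eventually (lt_mem_nhds h1),
    (continuous_cr _ _).continuousAt.eventually (lt_mem_nhds h2)] with x hx1 hx2 hx0
  rw [mem_interior_tri hp]
  intro i
  fin_cases i
  exacts [hx0, hx1, hx2]

/-- A point of the line through `a₀` and `a₁` is approached from the left of the line. -/
theorem frequently_cr_pos (h : a₀ ≠ a₁) (hb : cr a₀ a₁ b = 0) : ∃ᶠ x in 𝓝 b, 0 < cr a₀ a₁ x := by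
  have hc : Continuous fun t : ℝ => b + t * (Complex.I * (a₁ - a₀)) := by fun_prop
  have h1 := hc.tendsto 0
  simp only [ofReal_zero, zero_mul, add_zero] at h1
  refine (h1.mono_left (nhdsWithin_le_nhds (s := Ioi (0 : ℝ)))).frequently
    (Eventually.frequently ?_)
  filter_upwards [self_mem_nhdsWithin] with t ht
  have h4 : cr a₀ a₁ (b + t * (Complex.I * (a₁ - a₀))) =
      cr a₀ a₁ b + t * ((a₁.re - a₀.re) ^ 2 + (a₁.im - a₀.im) ^ 2) := by
    simp [cr_eq]; ring
  rw [h4, hb, zero_add]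
  refine mul_pos ht ?_
  by_contra hcon
  apply h
  apply Complex.ext <;> nlinarith [sq_nonneg (a₁.re - a₀.re), sq_nonneg (a₁.im - a₀.im)]

variable [CompactSpace S] [T2Space S]

theorem IsSaddle.neg (h : X.IsSaddle e v) : X.IsSaddle e (-v) := by
  obtain ⟨γ, hγ, -, rfl⟩ := h.exists_arc
  exact hγ.neg.isSaddle

variable (X) in
/-- The developing map from the point `b` lays out `e` as the open segment from `a₀` to `a₁`. -/
structure IsFrame (b : ℂ) (g : ℂ → S) (e : Set S) (a₀ a₁ : ℂ) : Prop where
  base : b ∈ X.dom b g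
  mem : b ∈ seg a₀ a₁
  sub : seg a₀ a₁ ⊆ X.dom b g
  image : X.dev b g '' seg a₀ a₁ = e
  left : a₀ ∉ X.dom b g
  right : a₁ ∉ X.dom b g
  near : ∀ᶠ x in 𝓝 b, X.dev b g x ∈ e ↔ cr a₀ a₁ x = 0

namespace IsFrame

theorem ne (h : X.IsFrame b g e a₀ a₁) : a₀ ≠ a₁ := by
  rintro rfl
  have := h.mem
  rw [openSegment_same] at this
  exact h.left (this ▸ h.base)

theorem swap (h : X.IsFrame b g e a₀ a₁) : X.IsFrame b g e a₁ a₀ where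
  base := h.base
  mem := openSegment_symm ℝ a₀ a₁ ▸ h.mem
  sub := openSegment_symm ℝ a₀ a₁ ▸ h.sub
  image := openSegment_symm ℝ a₀ a₁ ▸ h.image
  left := h.right
  right := h.left
  near := by
    filter_upwards [h.near] with x hx
    rw [hx, cr_swap, neg_eq_zero]

theorem base_mem (h : X.IsFrame b g e a₀ a₁) : X.dev b g b ∈ e :=
  h.image ▸ ⟨b, h.mem, rfl⟩

theorem cr_base (h : X.IsFrame b g e a₀ a₁) : cr a₀ a₁ b = 0 := by
  obtain ⟨t, ht, rfl⟩ := openSegment_lineMap h.mem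
  rw [cr_lineMap]; simp

/-- The layout of `e` is determined by the developing map. -/
theorem ends_eq (h : X.IsFrame b g e a₀ a₁) {a₀' a₁' : ℂ} (hm : b ∈ seg a₀' a₁')
    (hs : seg a₀' a₁' ⊆ X.dom b g) (hi : X.dev b g '' seg a₀' a₁' ⊆ e)
    (hl : a₀' ∉ X.dom b g) (hr : a₁' ∉ X.dom b g) :
    (a₀' = a₀ ∧ a₁' = a₁) ∨ (a₀' = a₁ ∧ a₁' = a₀) := by
  have hne' : a₀' ≠ a₁' := by
    rintro rfl
    rw [openSegment_same] at hm
    exact hl (hm ▸ h.base)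
  obtain ⟨s, hs01, hsb⟩ := openSegment_lineMap hm
  have hc : Continuous fun r : ℝ => lineMap a₀' a₁' r := by fun_prop
  have h1 := hc.tendsto s
  rw [← hsb] at h1
  obtain ⟨r, ⟨hrn, hr01⟩, hrs⟩ := (((h1.eventually h.near).and (isOpen_Ioo.mem_nhds hs01)).filter_mono
    nhdsWithin_le_nhds |>.and (self_mem_nhdsWithin (s := ({s}ᶜ : Set ℝ)))).exists
  have h2 := hrn.1 (hi ⟨_, (openSegment_eq_image_lineMap ℝ a₀' a₁').symm ▸ ⟨r, hr01, rfl⟩, rfl⟩)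
  have h3 := h.cr_base
  rw [hsb, cr_lineMap] at h3
  rw [cr_lineMap] at h2
  have h4 : (r - s) * (cr a₀ a₁ a₁' - cr a₀ a₁ a₀') = 0 := by linear_combination h2 - h3
  have h5 : cr a₀ a₁ a₁' = cr a₀ a₁ a₀' :=
    sub_eq_zero.1 ((mul_eq_zero.1 h4).resolve_left (sub_ne_zero.2 hrs))
  have h6 : cr a₀ a₁ a₀' = 0 := by rw [h5] at h3; linear_combination h3
  obtain ⟨r₀, hr₀⟩ := (cr_eq_zero_iff h.ne).1 h6
  obtain ⟨r₁, hr₁⟩ := (cr_eq_zero_iff h.ne).1 (h5.trans h6)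
  have hL : ∀ r : ℝ, a₀ + r * (a₁ - a₀) = lineMap a₀ a₁ r := fun r => by
    simp [lineMap_apply]; ring
  rw [hL] at hr₀ hr₁
  have hr01' : r₀ ≠ r₁ := fun h => hne' (by rw [hr₀, hr₁, h])
  obtain ⟨t, ht, hbt⟩ := openSegment_lineMap h.mem
  have himg : seg a₀' a₁' = lineMap a₀ a₁ '' seg r₀ r₁ := by
    rw [image_openSegment, hr₀, hr₁]
  have htm : t ∈ seg r₀ r₁ := by
    rw [himg, hbt] at hm
    obtain ⟨t', ht', hte⟩ := hm
    rwa [← lineMap_injective ℝ h.ne hte]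
  rw [openSegment_eq_Ioo' hr01'] at htm himg
  obtain ⟨e1, e2⟩ := Ioo_eq_of_ends (D := {r : ℝ | lineMap a₀ a₁ r ∈ X.dom b g}) ht htm
    (fun r hr => h.sub ((openSegment_eq_image_lineMap ℝ a₀ a₁).symm ▸ ⟨r, hr, rfl⟩))
    (fun r hr => hs (himg.symm ▸ ⟨r, hr, rfl⟩))
    (by simpa using h.left) (by simpa using h.right)
    (by rcases min_choice r₀ r₁ with hmin | hmin <;> rw [hmin]
        · simpa [← hr₀] using hl
        · simpa [← hr₁] using hr)
    (by rcases max_choice r₀ r₁ with hmax | hmax <;> rw [hmax]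
        · simpa [← hr₀] using hl
        · simpa [← hr₁] using hr)
  rcases lt_or_gt_of_ne hr01' with hlt | hlt
  · rw [min_eq_left hlt.le] at e1
    rw [max_eq_right hlt.le] at e2
    left; rw [hr₀, hr₁, ← e1, ← e2]; simp
  · rw [min_eq_right hlt.le] at e1
    rw [max_eq_left hlt.le] at e2
    right; rw [hr₀, hr₁, ← e1, ← e2]; simp

end IsFrame

theorem IsSaddle.exists_frame (h : X.IsSaddle e v)
    (hb : b ∈ X.dom b g) (hg : g b ∈ e) :
    ∃ a₀ a₁, X.IsFrame b g e a₀ a₁ ∧ a₁ - a₀ = v := by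
  obtain ⟨γ, hγ, -, he⟩ := h.exists_arc
  obtain ⟨t₀, ht₀, hgt⟩ := he ▸ hg
  have hv := hγ.ne_zero
  have key : ∀ γ : ℝ → S, X.IsArc γ v → e = γ '' Ioo 0 1 → ∀ t₀ ∈ Ioo (0 : ℝ) 1, γ t₀ = g b →
      (∀ t ∈ Ioo (0 : ℝ) 1, b + 1 * ((t : ℂ) - t₀) * v ∈ X.dom b g ∧
      γ t = X.dev b g (b + 1 * ((t : ℂ) - t₀) * v)) →
      b + 1 * ((0 : ℂ) - t₀) * v ∉ X.dom b g → b + 1 * ((1 : ℂ) - t₀) * v ∉ X.dom b g →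
      ∃ a₀ a₁, X.IsFrame b g e a₀ a₁ ∧ a₁ - a₀ = v := by
    intro γ hγ he t₀ ht₀ hgt ha ha0 ha1
    have hL : ∀ t : ℝ, lineMap (b + 1 * ((0 : ℂ) - t₀) * v) (b + 1 * ((1 : ℂ) - t₀) * v) t
        = b + 1 * ((t : ℂ) - t₀) * v := fun t => by
      simp [lineMap_apply]; ring
    refine ⟨b + 1 * ((0 : ℂ) - t₀) * v, b + 1 * ((1 : ℂ) - t₀) * v, ⟨hb, ?_, ?_, ?_, ha0, ha1, ?_⟩,
      by ring⟩
    · rw [openSegment_eq_image_lineMap]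
      exact ⟨t₀, ht₀, by rw [hL]; ring⟩
    · rw [openSegment_eq_image_lineMap]
      rintro _ ⟨t, ht, rfl⟩
      rw [hL]; exact (ha t ht).1
    · rw [openSegment_eq_image_lineMap, image_image, he]
      exact image_congr fun t ht => by rw [hL, (ha t ht).2]
    · filter_upwards [h.eventually_mem_iff hb hg] with x hx
      rw [hx, cr_eq_zero_iff (fun h => hv (by linear_combination h.symm))]
      constructor
      · rintro ⟨r, rfl⟩
        exact ⟨t₀ + r, by push_cast; ring⟩
      · rintro ⟨r, rfl⟩
        exact ⟨r - t₀, by push_cast; ring⟩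
  obtain ⟨ε, rfl | rfl, ha, ha0, ha1⟩ := hγ.exists_dev ht₀ hb hgt.symm
  · exact key γ hγ he t₀ ht₀ hgt ha ha0 ha1
  · refine key _ hγ.reverse ?_ (1 - t₀) ⟨by linarith [ht₀.2], by linarith [ht₀.1]⟩ (by simpa using hgt)
      (fun t ht => ?_) ?_ ?_
    · rw [he]
      ext x
      constructor
      · rintro ⟨t, ht, rfl⟩
        exact ⟨1 - t, ⟨by linarith [ht.2], by linarith [ht.1]⟩, by simp⟩
      · rintro ⟨t, ht, rfl⟩
        exact ⟨1 - t, ⟨by linarith [ht.2], by linarith [ht.1]⟩, rfl⟩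
    · have e1 : b + 1 * ((t : ℂ) - ((1 - t₀ : ℝ) : ℂ)) * v =
          b + -1 * (((1 - t : ℝ) : ℂ) - t₀) * v := by push_cast; ring
      rw [e1]
      exact ha (1 - t) ⟨by linarith [ht.2], by linarith [ht.1]⟩
    · convert ha1 using 2; push_cast; ring
    · convert ha0 using 2; push_cast; ring

namespace IsTriangle

theorem side_mem (h : X.IsTriangle E p f) {i : Fin 3} (hw : w ∈ seg (p i) (p (i + 1))) :
    w ∈ hull p ∧ ∀ j, w ≠ p j := by
  have hm : ∀ k, p k ∈ hull p := fun k => subset_convexHull ℝ _ ⟨k, rfl⟩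
  refine ⟨(convex_convexHull ℝ _).openSegment_subset (hm i) (hm (i + 1)) hw, ?_⟩
  rintro j rfl
  have hne := ne_of_cr_pos (tri_pos h.pos i)
  rcases tri_segment_corner h.pos (hm i) (hm (i + 1)) (openSegment_subset_segment ℝ _ _ hw)
    with h2 | h2
  · rw [← h2, left_mem_openSegment_iff] at hw; exact hne hw
  · rw [← h2, right_mem_openSegment_iff] at hw; exact hne hw

theorem interior_ne (h : X.IsTriangle E p f) (hw : w ∈ interior (hull p)) : ∀ j, w ≠ p j := by
  rintro j rfl
  rw [mem_interior_tri h.pos] at hw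
  simpa using hw j

/-- The developing map based on a side of a triangle lays out the triangle. -/
theorem exists_frame (hE : ∀ e ∈ E, ∃ v, X.IsSaddle e v)
    (h : X.IsTriangle E p f) (i : Fin 3) (hb : b ∈ seg (p i) (p (i + 1))) :
    ∃ g : ℂ → S, X.IsFrame b g (f '' seg (p i) (p (i + 1))) (p i) (p (i + 1)) ∧ X.LaysOut b g p f ∧
      X.IsSaddle (f '' seg (p i) (p (i + 1))) (p (i + 1) - p i) := by
  have hE' : ∀ e ∈ E, e ⊆ X.Zᶜ := fun e he => (hE e he).choose_spec.subset_compl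
  obtain ⟨O, F, hO, hF, hOF⟩ := h.exists_extension hE'
  obtain ⟨hbT, hbc⟩ := h.side_mem hb
  have hdev := h.dev_eq_of_extension hO hF hOF hbT hbc (EventuallyEq.refl _ F)
  have hcor := h.corner_notMem_dom hbT hbc hdev
  obtain ⟨v, hv⟩ := hE _ (h.2.1 i)
  obtain ⟨a₀, a₁, hfr, hav⟩ := hv.exists_frame (b := b) (g := F) (hdev b hbT hbc).1
    ⟨b, hb, ((hOF b hbT hbc).2).symm⟩
  have hside : ∀ x ∈ seg (p i) (p (i + 1)), x ∈ X.dom b F ∧ X.dev b F x = f x :=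
    fun x hx => hdev x (h.side_mem hx).1 (h.side_mem hx).2
  have hends := hfr.ends_eq hb (fun x hx => (hside x hx).1)
    (by rintro _ ⟨x, hx, rfl⟩; exact ⟨x, hx, (hside x hx).2.symm⟩) (hcor i).2 (hcor (i + 1)).2
  generalize f '' seg (p i) (p (i + 1)) = e at hfr hv ⊢
  rcases hends with ⟨h1, h2⟩ | ⟨h1, h2⟩
  · rw [← h1, ← h2] at hfr hav
    exact ⟨F, hfr, hdev, hav ▸ hv⟩
  · rw [← h1, ← h2] at hfr hav
    refine ⟨F, hfr.swap, hdev, ?_⟩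
    rw [← neg_sub, hav]
    exact hv.neg

end IsTriangle

namespace IsStraightTriangulation

variable (hE : X.IsStraightTriangulation E)
include hE

theorem subset_compl (he : e ∈ E) : e ⊆ X.Zᶜ := (hE.saddle e he).choose_spec.subset_compl

theorem eq_of_mem {e e' : Set S} (he : e ∈ E) (he' : e' ∈ E) {x : S} (hx : x ∈ e) (hx' : x ∈ e') :
    e = e' := by
  by_contra hne
  exact disjoint_left.1 (hE.disjoint he he' hne) hx hx'

/-- Near a point of an edge, the union of the edges is a straight line in the developing map. -/
theorem eventually_mem_edges (he : e ∈ E) (h : X.IsFrame b g e a₀ a₁) :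
    ∀ᶠ x in 𝓝 b, x ∈ X.dom b g ∧ (X.dev b g x ∈ ⋃₀ E ↔ cr a₀ a₁ x = 0) := by
  have hcl : IsClosed (⋃ e' ∈ E \ {e}, (X.Z ∪ e')) :=
    (hE.finite.subset sdiff_subset).isClosed_biUnion fun e' he' =>
      (hE.saddle e' he'.1).choose_spec.isClosed_union
  have hn : X.dev b g b ∉ ⋃ e' ∈ E \ {e}, (X.Z ∪ e') := by
    simp only [mem_iUnion, not_exists]
    rintro e' he' (hZ | hx)
    · exact hE.subset_compl he h.base_mem hZ
    · exact he'.2 (hE.eq_of_mem he'.1 he hx h.base_mem)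
  filter_upwards [h.near, isOpen_dom.mem_nhds h.base,
    (flat_dev h.base).1.eventually (hcl.isOpen_compl.mem_nhds hn)] with x hx hxd hxn
  refine ⟨hxd, ?_⟩
  rw [← hx]
  refine ⟨?_, fun h => ⟨e, he, h⟩⟩
  rintro ⟨e', he', hxe'⟩
  by_cases hee : e' = e
  · exact hee ▸ hxe'
  · exact absurd (mem_biUnion (show e' ∈ E \ {e} from ⟨he', hee⟩) (Or.inr hxe')) hxn

/-- On each side of an edge there is a triangle. -/
theorem exists_above (he : e ∈ E) (h : X.IsFrame b g e a₀ a₁) :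
    ∃ (c : ℂ) (f : ℂ → S), X.IsTriangle E ![a₀, a₁, c] f ∧ X.LaysOut b g ![a₀, a₁, c] f := by
  obtain ⟨δ, hδ, hball⟩ := Metric.eventually_nhds_iff_ball.1 (hE.eventually_mem_edges he h)
  set U := ball b δ ∩ {x | 0 < cr a₀ a₁ x} with hU
  have hUc : Convex ℝ U := (convex_ball b δ).inter (convex_cr_pos a₀ a₁)
  have hUn : ∀ x ∈ U, X.dev b g x ∉ X.Z ∪ ⋃₀ E := by
    rintro x ⟨hxb, hx⟩ (h1 | h1)
    · exact (flat_dev (hball x hxb).1).notMem h1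
    · exact hx.ne' ((hball x hxb).2.1 h1)
  have hbU : b ∈ closure U := mem_closure_iff_frequently.2
    ((frequently_cr_pos h.ne h.cr_base).and_eventually (ball_mem_nhds b hδ) |>.mono fun _ h => h.symm)
  obtain ⟨x₀, hx₀⟩ : U.Nonempty := closure_nonempty_iff.1 ⟨b, hbU⟩
  obtain ⟨p₀, f₀, hT₀, w₀, hw₀, hfw⟩ := hE.triangles _ (hUn x₀ hx₀)
  have hx₀d := (hball x₀ hx₀.1).1
  obtain ⟨ε, hε, hge⟩ := (hT₀.1.isFlatAt hw₀).germ_eq (flat_dev hx₀d) continuousAt_id hfw.symm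
  have hsq := sq_eq_one_of_sign hε
  have hT₁ := hT₀.halfTr hε (x₀ - ε * w₀)
  set p₁ : Fin 3 → ℂ := fun i => ε * p₀ i + (x₀ - ε * w₀) with hp₁
  set f₁ : ℂ → S := fun w => f₀ (ε * (w - (x₀ - ε * w₀))) with hf₁
  have hx₀T : x₀ ∈ interior (hull p₁) := by
    rw [hp₁, hull_halfTr p₀ hε, interior_preimage_halfTr hε, mem_preimage]
    convert hw₀ using 1
    linear_combination w₀ * hsq
  have hgerm : f₁ =ᶠ[𝓝 x₀] X.dev b g := by
    filter_upwards [hge] with x hx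
    rw [hx, hf₁]
    simp only [id]
    congr 1; linear_combination w₀ * hsq
  have hsubU : U ⊆ interior (hull p₁) := by
    refine hUc.isPreconnected.subset_of_closure_inter_subset isOpen_interior ⟨x₀, hx₀, hx₀T⟩ ?_
    rintro x ⟨hx, hxU⟩
    have hxT : x ∈ hull p₁ := by
      rw [← closure_interior_tri hT₁.pos]; exact hx
    have hsub : seg x₀ x ⊆ interior (hull p₁) ∩ U := fun y hy =>
      ⟨(convex_convexHull ℝ _).openSegment_interior_self_subset_interior hx₀T hxT hy,
        hUc.segment_subset hx₀ hxU (openSegment_subset_segment ℝ _ _ hy)⟩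
    have heq := eqOn_flat ((convex_convexHull ℝ (range p₁)).interior.inter hUc).isPreconnected
      (fun x hx => hT₁.1.isFlatAt hx.1) (fun x hx => flat_dev (hball x hx.2.1).1)
      ⟨hx₀T, hx₀⟩ hgerm
    have hxcl : x ∈ closure (seg x₀ x) := by
      rw [closure_openSegment]; exact right_mem_segment ℝ x₀ x
    have hne : (𝓝[seg x₀ x] x).NeBot := mem_closure_iff_nhdsWithin_neBot.1 hxcl
    have l1 : Tendsto f₁ (𝓝[seg x₀ x] x) (𝓝 (f₁ x)) :=
      (hT₁.1.continuousOn x hxT).mono_left (nhdsWithin_mono _ fun y hy => interior_subset (hsub hy).1)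
    have hfx : f₁ x = X.dev b g x := tendsto_nhds_unique (l1.congr' (by
      filter_upwards [self_mem_nhdsWithin] with y hy
      exact (heq y (hsub hy)).eq_of_nhds))
      ((flat_dev (hball x hxU.1).1).1.tendsto.mono_left nhdsWithin_le_nhds)
    rcases tri_cases hT₁.pos hxT with h1 | ⟨i, h1⟩ | ⟨i, h1⟩
    · exact h1
    · exact absurd (hfx ▸ Or.inr ⟨_, hT₁.2.1 i, ⟨x, h1, rfl⟩⟩) (hUn x hxU)
    · exact absurd (hfx ▸ Or.inl (h1 ▸ hT₁.1.corner i)) (hUn x hxU)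
  have heqU := eqOn_flat hUc.isPreconnected (fun x hx => hT₁.1.isFlatAt (hsubU hx))
    (fun x hx => flat_dev (hball x hx.1).1) hx₀ hgerm
  have hbT : b ∈ hull p₁ := by
    rw [← closure_interior_tri hT₁.pos]; exact closure_mono hsubU hbU
  have hne : (𝓝[U] b).NeBot := mem_closure_iff_nhdsWithin_neBot.1 hbU
  have hfb : f₁ b = X.dev b g b := by
    refine tendsto_nhds_unique (((hT₁.1.continuousOn b hbT).mono_left
      (nhdsWithin_mono _ (hsubU.trans interior_subset))).congr' ?_)
      ((flat_dev h.base).1.tendsto.mono_left nhdsWithin_le_nhds)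
    filter_upwards [self_mem_nhdsWithin] with y hy
    exact (heqU y hy).eq_of_nhds
  have hbe : f₁ b ∈ e := hfb ▸ h.base_mem
  obtain ⟨j, hj⟩ : ∃ i, b ∈ seg (p₁ i) (p₁ (i + 1)) := by
    rcases tri_cases hT₁.pos hbT with h1 | ⟨i, h1⟩ | ⟨i, h1⟩
    · exact absurd ⟨e, he, hbe⟩ (disjoint_left.1 hT₁.2.2 ⟨b, h1, rfl⟩)
    · exact ⟨i, h1⟩
    · exact absurd (h1 ▸ hT₁.1.corner i) (hE.subset_compl he hbe)
  have hej : f₁ '' seg (p₁ j) (p₁ (j + 1)) = e := hE.eq_of_mem (hT₁.2.1 j) he ⟨b, hj, rfl⟩ hbe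
  have hE' : ∀ e ∈ E, e ⊆ X.Zᶜ := fun e he => hE.subset_compl he
  obtain ⟨O, F, hO, hF, hOF⟩ := hT₁.exists_extension hE'
  obtain ⟨-, hbc⟩ := hT₁.side_mem hj
  have hFg : F =ᶠ[𝓝 b] g := by
    obtain ⟨η, hη, hηO⟩ := Metric.isOpen_iff.1 hO b (hOF b hbT hbc).1
    obtain ⟨y, hyU, hy⟩ := Metric.mem_closure_iff.1 hbU η hη
    have hyb : y ∈ ball b η := by rwa [mem_ball, dist_comm]
    have hyF : F =ᶠ[𝓝 y] f₁ := by
      filter_upwards [isOpen_interior.mem_nhds (hsubU hyU)] with u hu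
      exact (hOF u (interior_subset hu) (hT₁.interior_ne hu)).2
    have := eqOn_flat ((convex_ball b η).inter (convex_ball b δ)).isPreconnected
      (fun x hx => hF x (hηO hx.1)) (fun x hx => flat_dev (hball x hx.2).1)
      ⟨hyb, hyU.1⟩ (hyF.trans (heqU y hyU)) b
      ⟨mem_ball_self hη, mem_ball_self hδ⟩
    exact this.trans (dev_base h.base)
  have hT₂ := hT₁.rotate j
  have hdev := hT₁.dev_eq_of_extension hO hF hOF hbT hbc hFg
  have hcor := hT₁.corner_notMem_dom hbT hbc hdev
  have hside : ∀ x ∈ seg (p₁ j) (p₁ (j + 1)), x ∈ X.dom b g ∧ X.dev b g x = f₁ x :=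
    fun x hx => hdev x (hT₁.side_mem hx).1 (hT₁.side_mem hx).2
  have hends : p₁ j = a₀ ∧ p₁ (j + 1) = a₁ := by
    rcases h.ends_eq hj (fun x hx => (hside x hx).1) (by
      rintro _ ⟨x, hx, rfl⟩; rw [← hej]; exact ⟨x, hx, (hside x hx).2.symm⟩)
      (hcor j).2 (hcor (j + 1)).2 with h1 | ⟨h1, h2⟩
    · exact h1
    · exfalso
      have h3 := (mem_interior_tri hT₁.pos).1 hx₀T j
      rw [h1, h2, cr_swap] at h3
      have : 0 < cr a₀ a₁ x₀ := hx₀.2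
      linarith
  have hp : (fun i => p₁ (i + j)) = ![a₀, a₁, p₁ (2 + j)] := by
    ext i
    fin_cases i
    · show p₁ (0 + j) = a₀
      rw [zero_add]; exact hends.1
    · show p₁ (1 + j) = a₁
      rw [add_comm]; exact hends.2
    · rfl
  rw [hp] at hT₂
  refine ⟨p₁ (2 + j), f₁, hT₂, fun w hw hwc => hdev w ?_ ?_⟩
  · rw [← range_rotate p₁ j, hp]; exact hw
  · intro i
    have := hwc (i - j)
    rw [← hp] at this
    simpa only [sub_add_cancel] using this

end IsStraightTriangulation

/-- The apex of the triangle on a given side of an edge is unique. -/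
theorem IsTriangle.apex_unique {a₀ a₁ c c' : ℂ}
    (hb : b ∈ seg a₀ a₁) (h : X.IsTriangle E ![a₀, a₁, c] f)
    (h' : X.IsTriangle E ![a₀, a₁, c'] f')
    (hd : ∀ᶠ x in 𝓝 b, 0 < cr a₀ a₁ x → f x = f' x) : c' = c := by
  have hev : ∀ {c f}, X.IsTriangle E ![a₀, a₁, c] f →
      ∀ᶠ x in 𝓝 b, 0 < cr a₀ a₁ x → x ∈ interior (hull ![a₀, a₁, c]) := by
    intro c f h
    exact eventually_mem_interior_tri h.pos hb
  have hne := ne_of_cr_pos h.pos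
  have hbcr : cr a₀ a₁ b = 0 := ((mem_side_tri h.pos 0).1 hb).1
  obtain ⟨t, h4, ⟨ht1, ht2⟩, ht3⟩ := ((frequently_cr_pos hne hbcr).and_eventually
    (((hev h).and (hev h')).and hd.eventually_nhds)).exists
  obtain ⟨⟨j, hj⟩, -⟩ := h.eq_of_germ h' (ht1 h4) (ht2 h4) (by
    filter_upwards [ht3, (continuous_cr _ _).continuousAt.eventually (lt_mem_nhds h4)] with x hx hx'
    exact hx hx')
  have e0 : a₀ = ![a₀, a₁, c] (0 + j) := hj 0
  have e2 : c' = ![a₀, a₁, c] (2 + j) := hj 2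
  have hp := h.pos
  fin_cases j
  · exact e2
  · exact absurd e0 hne
  · have : a₀ = c := e0
    exfalso; simp [this] at hp

/-- A polygon is injective at its interior points, relative to the closed polygon. -/
theorem IsPolygon.eq_of_interior {n : ℕ} {p : Fin n → ℂ}
    (h : X.IsPolygon p f) {x y : ℂ} (hx : x ∈ hull p)
    (hy : y ∈ interior (hull p)) (hxy : f x = f y) : x = y := by
  have hcl : x ∈ closure (interior (hull p)) := by
    rw [(convex_convexHull ℝ _).closure_interior_eq_closure_of_nonempty_interior ⟨y, hy⟩]
    exact subset_closure hx
  have hne : (𝓝[interior (hull p)] x).NeBot := mem_closure_iff_nhdsWithin_neBot.1 hcl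
  by_contra hn
  obtain ⟨U, V, hU, hV, hxU, hyV, hUV⟩ := t2_separation hn
  have h1 : Tendsto f (𝓝[interior (hull p)] x) (𝓝 (f y)) := by
    rw [← hxy]
    exact (h.continuousOn x hx).mono_left (nhdsWithin_mono _ interior_subset)
  have h2 : f '' (V ∩ interior (hull p)) ∈ 𝓝 (f y) := by
    rw [← (h.isFlatAt hy).map_nhds]
    exact image_mem_map ((hV.inter isOpen_interior).mem_nhds ⟨hyV, hy⟩)
  obtain ⟨u, ⟨⟨v, hv, hvu⟩, hui⟩, huU⟩ := (((h1.eventually h2).and self_mem_nhdsWithin).and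
    (mem_nhdsWithin_of_mem_nhds (hU.mem_nhds hxU))).exists
  exact disjoint_left.1 hUV huU (h.injOn hv.2 hui hvu ▸ hv.1)

theorem IsTriangle.saddle
    (hE : ∀ e ∈ E, ∃ v, X.IsSaddle e v) (h : X.IsTriangle E p f) (i : Fin 3) :
    X.IsSaddle (f '' seg (p i) (p (i + 1))) (p (i + 1) - p i) := by
  obtain ⟨b, hb⟩ : (seg (p i) (p (i + 1))).Nonempty := ⟨_, midpoint_mem_openSegment _ _⟩
  exact (h.exists_frame hE i hb).choose_spec.2.2

namespace IsQuad

variable {p : Fin 4 → ℂ}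

theorem quadPos (h : X.IsQuad E p f) : QuadPos p :=
  ⟨h.1.convex 0 1 2 (by decide) (by decide), h.1.convex 0 1 3 (by decide) (by decide),
    h.1.convex 0 2 3 (by decide) (by decide), h.1.convex 1 2 3 (by decide) (by decide)⟩

theorem interior_lower (hp : QuadPos p) : w ∈ interior (hull ![p 0, p 1, p 2]) ↔
      w ∈ interior (hull p) ∧ cr (p 0) (p 2) w < 0 := by
  rw [mem_interior_tri (by exact hp.1), mem_interior_quad hp]
  constructor
  · intro h
    have h0 : 0 < cr (p 0) (p 1) w := h 0
    have h1 : 0 < cr (p 1) (p 2) w := h 1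
    have h2 : 0 < cr (p 2) (p 0) w := h 2
    rw [cr_swap] at h2
    refine ⟨?_, by linarith⟩
    obtain ⟨q1, q2, q3, q4⟩ := hp
    have h2' : 0 < cr (p 2) (p 0) w := h 2
    have e1 : cr (p 0) (p 1) (p 2) * cr (p 2) (p 3) w =
        cr (p 1) (p 2) w * cr (p 0) (p 2) (p 3) + cr (p 2) (p 0) w * cr (p 1) (p 2) (p 3) := by
      simp only [cr_eq]; ring
    have e2 : cr (p 0) (p 1) (p 2) * cr (p 3) (p 0) w =
        cr (p 2) (p 0) w * cr (p 0) (p 1) (p 3) + cr (p 0) (p 1) w * cr (p 0) (p 2) (p 3) := by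
      simp only [cr_eq]; ring
    intro i
    fin_cases i
    · exact h0
    · exact h1
    · refine pos_of_mul_pos_right (a := cr (p 0) (p 1) (p 2)) ?_ q1.le
      exact e1 ▸ by positivity
    · refine pos_of_mul_pos_right (a := cr (p 0) (p 1) (p 2)) ?_ q1.le
      exact e2 ▸ by positivity
  · rintro ⟨h, hd⟩ i
    fin_cases i
    · exact h 0
    · exact h 1
    · show 0 < cr (p 2) (p 0) w
      rw [cr_swap]; linarith

theorem interior_sdiff {a b w : ℂ} (hw : w ∈ seg a b) : cr a b w = 0 := by
  obtain ⟨t, -, rfl⟩ := openSegment_lineMap hw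
  rw [cr_lineMap]; simp

theorem diag_subset (hp : QuadPos p) : seg (p 0) (p 2) ⊆ interior (hull p) := by
  intro w hw
  obtain ⟨t, ⟨ht0, ht1⟩, rfl⟩ := openSegment_lineMap hw
  have ht1' : 0 < 1 - t := by linarith
  rw [mem_interior_quad hp]
  obtain ⟨q1, q2, q3, q4⟩ := hp
  intro i
  rw [cr_lineMap]
  fin_cases i
  · show 0 < (1 - t) * cr (p 0) (p 1) (p 0) + t * cr (p 0) (p 1) (p 2)
    rw [cr_left]; nlinarith
  · show 0 < (1 - t) * cr (p 1) (p 2) (p 0) + t * cr (p 1) (p 2) (p 2)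
    rw [cr_right, cr_rotate]; nlinarith
  · show 0 < (1 - t) * cr (p 2) (p 3) (p 0) + t * cr (p 2) (p 3) (p 2)
    rw [cr_left, cr_rotate]; nlinarith
  · show 0 < (1 - t) * cr (p 3) (p 0) (p 0) + t * cr (p 3) (p 0) (p 2)
    rw [cr_right, cr_rotate, cr_rotate]; nlinarith

theorem lower (h : X.IsQuad E p f) : X.IsTriangle E ![p 0, p 1, p 2] f := by
  have hp := h.quadPos
  have hsub : hull ![p 0, p 1, p 2] ⊆ hull p := hull_sub_quad
  refine ⟨⟨?_, h.1.continuousOn.mono hsub, h.1.injOn.mono (interior_mono hsub),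
    fun w hw => h.1.flat w (interior_mono hsub hw), ?_⟩, ?_, ?_⟩
  · intro i j k hij hjk
    obtain rfl : i = 0 := by omega
    obtain rfl : j = 1 := by omega
    obtain rfl : k = 2 := by omega
    exact hp.1
  · intro i; fin_cases i
    exacts [h.1.corner 0, h.1.corner 1, h.1.corner 2]
  · intro i; fin_cases i
    · exact h.2.1 0
    · exact h.2.1 1
    · show f '' seg (p 2) (p 0) ∈ E
      rw [openSegment_symm]; exact h.2.2.1
  · refine h.2.2.2.mono_left (image_mono fun w hw => ?_)
    rw [interior_lower hp] at hw
    exact ⟨hw.1, fun hd => hw.2.ne (interior_sdiff hd)⟩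

theorem halfTr (h : X.IsQuad E p f) (hε : ε = 1 ∨ ε = -1) (c : ℂ) :
    X.IsQuad E (fun i => ε * p i + c) (fun w => f (ε * (w - c))) := by
  refine ⟨h.1.halfTr hε c, fun i => ?_, ?_, ?_⟩
  · rw [openSegment_halfTr _ _ hε, image_comp_halfTr hε]; exact h.2.1 i
  · rw [openSegment_halfTr _ _ hε, image_comp_halfTr hε]; exact h.2.2.1
  · rw [openSegment_halfTr _ _ hε, hull_halfTr p hε, interior_preimage_halfTr hε, ← preimage_sdiff,
      image_comp_halfTr hε]
    exact h.2.2.2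

theorem _root_.HalfTranslationSurface.IsPolygon.rotate (h : X.IsPolygon p f) :
    X.IsPolygon (fun i => p (i + 1)) f := by
  have hp : QuadPos p :=
  ⟨h.convex 0 1 2 (by decide) (by decide), h.convex 0 1 3 (by decide) (by decide),
    h.convex 0 2 3 (by decide) (by decide), h.convex 1 2 3 (by decide) (by decide)⟩
  have hr := range_rotate p 1
  exact ⟨hp.rotate.convex, hr.symm ▸ h.continuousOn, hr.symm ▸ h.injOn, hr.symm ▸ h.flat,
    fun i => h.corner _⟩

theorem rotate_two (h : X.IsQuad E p f) : X.IsQuad E (fun i => p (i + 2)) f := by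
  have e : (fun i => p (i + 2)) = fun i => (fun j => p (j + 1)) (i + 1) := by
    ext i; simp only [add_assoc]; rfl
  refine ⟨e ▸ h.1.rotate.rotate, fun i => ?_, ?_, ?_⟩
  · have := h.2.1 (i + 2)
    rwa [add_right_comm] at this
  · show f '' seg (p 2) (p 0) ∈ E
    rw [openSegment_symm]; exact h.2.2.1
  · show Disjoint (f '' (_ \ seg (p 2) (p 0))) _
    rw [openSegment_symm, range_rotate p 2]; exact h.2.2.2

theorem upper (h : X.IsQuad E p f) : X.IsTriangle E ![p 2, p 3, p 0] f := h.rotate_two.lower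

/-- A triangle with the diagonal as a side is one of the two halves. -/
theorem exists_eq_half (h : X.IsQuad E p f)
    (h' : X.IsTriangle E p' f') {k : Fin 3}
    (hk : f' '' seg (p' k) (p' (k + 1)) = f '' seg (p 0) (p 2)) :
    ∃ ε c : ℂ, (ε = 1 ∨ ε = -1) ∧ ∃ m : Fin 4, (m = 0 ∨ m = 2) ∧ p' k = ε * p (2 + m) + c ∧
      p' (k + 1) = ε * p (0 + m) + c ∧ p' (k + 2) = ε * p (1 + m) + c ∧
      ∀ x ∈ hull p', f' x = f (ε * (x - c)) := by
  have hp := h.quadPos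
  obtain ⟨b, hb⟩ : (seg (p' k) (p' (k + 1))).Nonempty := ⟨_, midpoint_mem_openSegment _ _⟩
  obtain ⟨y, hy, hyb⟩ : f' b ∈ f '' seg (p 0) (p 2) := hk ▸ ⟨b, hb, rfl⟩
  have hbT := (h'.side_mem hb).1
  have h1 : Tendsto f' (𝓝[interior (hull p')] b) (𝓝 (f y)) := by
    rw [hyb]
    exact (h'.1.continuousOn b hbT).mono_left (nhdsWithin_mono _ interior_subset)
  have h2 : f '' interior (hull p) ∈ 𝓝 (f y) := by
    rw [← (h.1.isFlatAt (diag_subset hp hy)).map_nhds]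
    exact image_mem_map (isOpen_interior.mem_nhds (diag_subset hp hy))
  have hne : (𝓝[interior (hull p')] b).NeBot :=
    mem_closure_iff_nhdsWithin_neBot.1 (by rwa [closure_interior_tri h'.pos])
  obtain ⟨u, ⟨v, hv, hvu⟩, hu⟩ := ((h1.eventually h2).and self_mem_nhdsWithin).exists
  have key : ∀ {q : Fin 4 → ℂ} {m : Fin 4}, X.IsQuad E q f → (∀ i, q i = p (i + m)) →
      seg (q 0) (q 2) = seg (p 0) (p 2) →
      v ∈ interior (hull ![q 0, q 1, q 2]) →
      ∃ ε c : ℂ, (ε = 1 ∨ ε = -1) ∧ p' k = ε * p (2 + m) + c ∧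
      p' (k + 1) = ε * p (0 + m) + c ∧ p' (k + 2) = ε * p (1 + m) + c ∧
      ∀ x ∈ hull p', f' x = f (ε * (x - c)) := by
    intro q m hq hqm hd hvq
    obtain ⟨ε, c, hε, -, ⟨j, hj⟩, hf⟩ := hq.lower.eq_of_meet h' hvq hu hvu
    have hsq := sq_eq_one_of_sign hε
    have hkj : k + j = 2 := by
      by_contra hkj
      have hside : f' '' seg (p' k) (p' (k + 1)) =
          f '' seg (![q 0, q 1, q 2] (k + j)) (![q 0, q 1, q 2] (k + j + 1)) := by
        rw [hj k, hj (k + 1), openSegment_halfTr _ _ hε, ← image_comp_halfTr hε c f]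
        have e : k + 1 + j = k + j + 1 := add_right_comm _ _ _
        rw [e]
        refine image_congr fun x hx => ?_
        have := hf (ε * (x - c)) (hq.lower.side_mem hx).1
        rw [← this]; congr 1
        linear_combination (c - x) * hsq
      obtain ⟨x, hx, hxy⟩ : f' b ∈ f '' seg (![q 0, q 1, q 2] (k + j))
        (![q 0, q 1, q 2] (k + j + 1)) := hside ▸ ⟨b, hb, rfl⟩
      have hyq : y ∈ seg (q 0) (q 2) := hd ▸ hy
      have hxh := (hq.lower.side_mem hx).1
      have := hq.1.eq_of_interior (hull_sub_quad hxh) (diag_subset hq.quadPos hyq) (hxy.trans hyb.symm)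
      subst this
      obtain ⟨a1, a2, a3⟩ := (mem_side_tri hq.lower.pos (k + j)).1 hx
      have a4 : cr (q 0) (q 2) x = 0 := interior_sdiff hyq
      have a5 : cr (q 2) (q 0) x = 0 := by rw [cr_swap, a4, neg_zero]
      generalize k + j = i at *
      fin_cases i
      · exact a3.ne' a5
      · exact a2.ne' a5
      · exact hkj rfl
    refine ⟨ε, c, hε, ?_, ?_, ?_, fun x hx => ?_⟩
    · rw [hj k, hkj, ← hqm]; rfl
    · rw [hj (k + 1), add_right_comm, hkj, ← hqm]; rfl
    · rw [hj (k + 2), add_right_comm, hkj, ← hqm]; rfl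
    · have hx' : ε * (x - c) ∈ hull ![q 0, q 1, q 2] := by
        have e : range p' = range fun i => ε * ![q 0, q 1, q 2] i + c := by
          rw [← range_rotate (fun i => ε * ![q 0, q 1, q 2] i + c) j]
          congr 1; ext i; exact hj i
        rw [e, hull_halfTr _ hε] at hx
        exact hx
      rw [← hf _ hx']; congr 1
      linear_combination (c - x) * hsq
  rcases lt_trichotomy (cr (p 0) (p 2) v) 0 with hcr | hcr | hcr
  · obtain ⟨ε, c, hε, hh⟩ := key (m := 0) h (fun i => by rw [add_zero]) rfl
      ((interior_lower hp).2 ⟨hv, hcr⟩)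
    exact ⟨ε, c, hε, 0, Or.inl rfl, hh⟩
  · exfalso
    refine disjoint_left.1 h'.2.2 ⟨u, hu, rfl⟩ ⟨_, h.2.2.1, v, ?_, hvu⟩
    have hp3 : 0 < cr (p 0) (p 1) (p 2) := hp.1
    have := (mem_side_tri (p := ![p 0, p 1, p 2]) hp3 2 (w := v)).2 ⟨?_, ?_, ?_⟩
    · rw [openSegment_symm]; exact this
    · show cr (p 2) (p 0) v = 0
      rw [cr_swap, hcr, neg_zero]
    · exact (mem_interior_quad hp).1 hv 0
    · exact (mem_interior_quad hp).1 hv 1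
  · have h2 := h.rotate_two
    obtain ⟨ε, c, hε, hh⟩ := key (m := 2) h2 (fun i => rfl) (openSegment_symm _ _ _)
      ((interior_lower h2.quadPos).2 ⟨by rw [range_rotate p 2]; exact hv, by
        show cr (p 2) (p 0) v < 0
        rw [cr_swap]; linarith⟩)
    exact ⟨ε, c, hε, 2, Or.inr rfl, hh⟩

/-- The sides of a quadrilateral differ from both diagonals. -/
theorem notMem_side (h : X.IsQuad E p f) (hw : w ∈ interior (hull p)) (i : Fin 4) :
    f w ∉ f '' seg (p i) (p (i + 1)) := by
  rintro ⟨x, hx, hxw⟩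
  have hm : ∀ k, p k ∈ hull p := fun k => subset_convexHull ℝ _ ⟨k, rfl⟩
  have := h.1.eq_of_interior ((convex_convexHull ℝ _).openSegment_subset (hm _) (hm _) hx) hw hxw
  subst this
  exact ((mem_interior_quad h.quadPos).1 hw i).ne' (interior_sdiff hx)

/-- The other diagonal. -/
theorem flip (hE : X.IsStraightTriangulation E) (h : X.IsQuad E p f) {E' : Set (Set S)}
    (hE' : E' = insert (f '' seg (p 1) (p 3)) (E \ {f '' seg (p 0) (p 2)})) :
    X.IsQuad E' (fun i => p (i + 1)) f ∧
      E = insert (f '' seg (p 0) (p 2)) (E' \ {f '' seg (p 1) (p 3)}) ∧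
      f '' seg (p 1) (p 3) ∉ E := by
  have hp := h.quadPos
  have hmid : ∀ a b : ℂ, (seg a b).Nonempty := fun a b => ⟨_, midpoint_mem_openSegment a b⟩
  have hd02 := diag_subset hp
  have hd13 : seg (p 1) (p 3) ⊆ interior (hull p) := by
    have := diag_subset hp.rotate
    rwa [range_rotate p 1] at this
  have hd13E : f '' seg (p 1) (p 3) ∉ E := by
    intro hmem
    by_cases hs : seg (p 1) (p 3) ⊆ seg (p 0) (p 2)
    · have h3 : p 3 ∈ closure (seg (p 0) (p 2)) := by
        refine closure_mono hs ?_
        rw [closure_openSegment]; exact right_mem_segment ℝ _ _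
      have : cr (p 0) (p 2) (p 3) = 0 := by
        refine (closure_minimal (fun w hw => interior_sdiff hw)
          (isClosed_eq (continuous_cr (p 0) (p 2)) continuous_const)) h3
      exact hp.2.2.1.ne' this
    · obtain ⟨x, hx, hxn⟩ := not_subset.1 hs
      exact disjoint_left.1 h.2.2.2 ⟨x, ⟨hd13 hx, hxn⟩, rfl⟩ ⟨_, hmem, x, hx, rfl⟩
  have hne : f '' seg (p 1) (p 3) ≠ f '' seg (p 0) (p 2) := fun he =>
    hd13E (he ▸ h.2.2.1)
  refine ⟨⟨h.1.rotate, fun i => ?_, ?_, ?_⟩, ?_, hd13E⟩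
  · rw [hE']
    refine Or.inr ⟨?_, fun he => ?_⟩
    · have := h.2.1 (i + 1); exact this
    · obtain ⟨w, hw⟩ := hmid (p 0) (p 2)
      refine h.notMem_side (hd02 hw) (i + 1) ?_
      have he : f '' seg (p (i + 1)) (p (i + 1 + 1)) = f '' seg (p 0) (p 2) := he
      rw [he]; exact ⟨w, hw, rfl⟩
  · rw [hE']; exact Or.inl rfl
  · show Disjoint (f '' (_ \ seg (p 1) (p 3))) _
    rw [range_rotate p 1, disjoint_left]
    rintro _ ⟨w, ⟨hw, hwn⟩, rfl⟩ ⟨e, he, hwe⟩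
    rw [hE'] at he
    rcases he with rfl | ⟨he, hed⟩
    · obtain ⟨x, hx, hxw⟩ := hwe
      exact hwn (h.1.injOn (hd13 hx) hw hxw ▸ hx)
    · by_cases hwd : w ∈ seg (p 0) (p 2)
      · exact hed (hE.eq_of_mem he h.2.2.1 hwe ⟨w, hwd, rfl⟩)
      · exact disjoint_left.1 h.2.2.2 ⟨w, ⟨hw, hwd⟩, rfl⟩ ⟨e, he, hwe⟩
  · ext e
    rw [hE']
    constructor
    · intro he
      by_cases h1 : e = f '' seg (p 0) (p 2)
      · exact Or.inl h1
      · exact Or.inr ⟨Or.inr ⟨he, h1⟩, fun h2 => hd13E (h2 ▸ he)⟩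
    · rintro (rfl | ⟨rfl | he, h2⟩)
      · exact h.2.2.1
      · exact absurd rfl h2
      · exact he.1

/-- Triangles that are not adjacent to the diagonal persist under a flip. -/
theorem persists (h : X.IsQuad E p f) {E' : Set (Set S)}
    (hE' : E' = insert (f '' seg (p 1) (p 3)) (E \ {f '' seg (p 0) (p 2)}))
    (h' : X.IsTriangle E p' f')
    (hk : ∀ k, f' '' seg (p' k) (p' (k + 1)) ≠ f '' seg (p 0) (p 2)) :
    X.IsTriangle E' p' f' := by
  refine ⟨h'.1, fun k => hE' ▸ Or.inr ⟨h'.2.1 k, hk k⟩, ?_⟩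
  rw [disjoint_left]
  rintro _ ⟨w, hw, rfl⟩ ⟨e, he, hwe⟩
  have hn := disjoint_left.1 h'.2.2 ⟨w, hw, rfl⟩
  rw [hE'] at he
  rcases he with rfl | he
  swap
  · exact hn ⟨e, he.1, hwe⟩
  obtain ⟨y, hy, hyw⟩ := hwe
  have hp := h.quadPos
  have hyQ : y ∈ interior (hull p) := by
    have := diag_subset hp.rotate hy
    rwa [range_rotate p 1] at this
  have key : ∀ {q : Fin 4 → ℂ}, X.IsQuad E q f →
      seg (q 0) (q 2) = seg (p 0) (p 2) →
      y ∈ interior (hull ![q 0, q 1, q 2]) → False := by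
    intro q hq hd hyq
    obtain ⟨ε, c, hε, -, ⟨j, hj⟩, hf⟩ := h'.eq_of_meet hq.lower hw hyq hyw.symm
    apply hk (2 + j)
    rw [← hd]
    have e0 : q 0 = ε * p' (0 + j) + c := hj 0
    have e2 : q 2 = ε * p' (2 + j) + c := hj 2
    rw [openSegment_symm ℝ (q 0), e0, e2, openSegment_halfTr _ _ hε, ← image_comp_halfTr hε c f']
    have e : (2 : Fin 3) + j + 1 = 0 + j := by rw [add_right_comm]; rfl
    rw [e]
    refine image_congr fun x hx => ?_
    rw [← e] at hx
    have := hf (ε * (x - c)) (h'.side_mem hx).1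
    rw [← this]; congr 1
    linear_combination (x - c) * sq_eq_one_of_sign hε
  rcases lt_trichotomy (cr (p 0) (p 2) y) 0 with hcr | hcr | hcr
  · exact key h rfl ((interior_lower hp).2 ⟨hyQ, hcr⟩)
  · by_cases hyd : y ∈ seg (p 0) (p 2)
    · exact hn ⟨_, h.2.2.1, y, hyd, hyw⟩
    · apply hyd
      have := (mem_side_tri (p := ![p 0, p 1, p 2]) hp.1 2 (w := y)).2 ⟨?_, ?_, ?_⟩
      · rw [openSegment_symm]; exact this
      · show cr (p 2) (p 0) y = 0
        rw [cr_swap, hcr, neg_zero]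
      · exact (mem_interior_quad hp).1 hyQ 0
      · exact (mem_interior_quad hp).1 hyQ 1
  · have h2 := h.rotate_two
    exact key h2 (openSegment_symm _ _ _) ((interior_lower h2.quadPos).2
      ⟨by rw [range_rotate p 2]; exact hyQ, by
        show cr (p 2) (p 0) y < 0
        rw [cr_swap]; linarith⟩)

end IsQuad

variable (X) in
/-- The forward flip from `E` to `E'` takes place in the quadrilateral `p`, `f`. -/
def IsFlipQuad (E E' : Set (Set S)) (p : Fin 4 → ℂ) (f : ℂ → S) : Prop :=
  X.IsQuad E p f ∧ (∀ i, |(p (i + 1) - p i).re| ≤ |(p 2 - p 0).re|) ∧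
    E' = insert (f '' seg (p 1) (p 3)) (E \ {f '' seg (p 0) (p 2)})

namespace IsFlipQuad

variable {p : Fin 4 → ℂ}

theorem halfTr (h : X.IsFlipQuad E E' p f) (hε : ε = 1 ∨ ε = -1) (c : ℂ) :
    X.IsFlipQuad E E' (fun i => ε * p i + c) (fun w => f (ε * (w - c))) := by
  refine ⟨h.1.halfTr hε c, fun i => ?_, ?_⟩
  · have e : ∀ a b : ℂ, |(ε * a + c - (ε * b + c)).re| = |(a - b).re| := by
      intro a b
      rcases hε with rfl | rfl
      · congr 2; ring
      · rw [← abs_neg, ← neg_re]; congr 2; ring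
    rw [e, e]; exact h.2.1 i
  · rw [openSegment_halfTr _ _ hε, image_comp_halfTr hε, openSegment_halfTr _ _ hε,
      image_comp_halfTr hε]
    exact h.2.2

theorem rotate_two (h : X.IsFlipQuad E E' p f) : X.IsFlipQuad E E' (fun i => p (i + 2)) f := by
  refine ⟨h.1.rotate_two, fun i => ?_, ?_⟩
  · have := h.2.1 (i + 2)
    rw [add_right_comm] at this
    refine this.trans_eq ?_
    rw [← abs_neg, ← neg_re, neg_sub]; rfl
  · rw [h.2.2]
    show _ = insert (f '' seg (p 3) (p 1)) (E \ {f '' seg (p 2) (p 0)})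
    rw [openSegment_symm, openSegment_symm ℝ (p 2)]

/-- The old triangles at the flipped edge. -/
theorem exists_old (h : X.IsFlipQuad E E' p f)
    (h' : X.IsTriangle E p' f') {k : Fin 3}
    (hk : f' '' seg (p' k) (p' (k + 1)) = f '' seg (p 0) (p 2)) :
    ∃ q g, X.IsFlipQuad E E' q g ∧ q 2 = p' k ∧ q 0 = p' (k + 1) ∧ q 1 = p' (k + 2) ∧
      EqOn f' g (hull p') := by
  obtain ⟨ε, c, hε, m, hm, h2, h0, h1, hf⟩ := h.1.exists_eq_half h' hk
  rcases hm with rfl | rfl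
  · exact ⟨_, _, h.halfTr hε c, h2.symm, h0.symm, h1.symm, hf⟩
  · exact ⟨_, _, h.rotate_two.halfTr hε c, h2.symm, h0.symm, h1.symm, hf⟩

/-- The new triangles at the flipped edge. -/
theorem exists_new (hE : X.IsStraightTriangulation E)
    (h : X.IsFlipQuad E E' p f)
    (h' : X.IsTriangle E' p' f') {k : Fin 3}
    (hk : f' '' seg (p' k) (p' (k + 1)) = f '' seg (p 1) (p 3)) :
    ∃ q g, X.IsFlipQuad E E' q g ∧ q 3 = p' k ∧ q 1 = p' (k + 1) ∧ q 2 = p' (k + 2) ∧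
      EqOn f' g (hull p') := by
  obtain ⟨ε, c, hε, m, hm, h2, h0, h1, hf⟩ := (h.1.flip hE h.2.2).1.exists_eq_half h' hk
  rcases hm with rfl | rfl
  · exact ⟨_, _, h.halfTr hε c, h2.symm, h0.symm, h1.symm, hf⟩
  · exact ⟨_, _, h.rotate_two.halfTr hε c, h2.symm, h0.symm, h1.symm, hf⟩

theorem persists (h : X.IsFlipQuad E E' p f) (h' : X.IsTriangle E p' f')
    (hk : ∀ k, f' '' seg (p' k) (p' (k + 1)) ≠ f '' seg (p 0) (p 2)) :
    X.IsTriangle E' p' f' :=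
  h.1.persists h.2.2 h' hk

theorem persists_back (hE : X.IsStraightTriangulation E) (h : X.IsFlipQuad E E' p f)
    (h' : X.IsTriangle E' p' f')
    (hk : ∀ k, f' '' seg (p' k) (p' (k + 1)) ≠ f '' seg (p 1) (p 3)) :
    X.IsTriangle E p' f' := by
  obtain ⟨h1, h2, -⟩ := h.1.flip hE h.2.2
  refine h1.persists ?_ h' hk
  show E = insert (f '' seg (p 2) (p 0)) _
  rw [openSegment_symm]; exact h2

/-- In a flip of staggered triangulations the new corners lie strictly between the old ones. -/
theorem re_lt (hE : X.IsStaggered E) (h : X.IsFlipQuad E E' p f)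
    (hlt : (p 0).re < (p 2).re) :
    ((p 0).re < (p 1).re ∧ (p 1).re < (p 2).re) ∧ (p 0).re < (p 3).re ∧ (p 3).re < (p 2).re := by
  have key : ∀ {q : Fin 4 → ℂ}, X.IsFlipQuad E E' q f →
      (q 1).re ≠ (q 0).re ∧ (q 2).re ≠ (q 1).re ∧ |(q 1).re - (q 0).re| ≤ |(q 2).re - (q 0).re| ∧
      |(q 2).re - (q 1).re| ≤ |(q 2).re - (q 0).re| := by
    intro q hq
    have h0 := hE.2 _ (hq.1.lower.2.1 0) _ (hq.1.lower.saddle hE.1.saddle 0)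
    have h1 := hE.2 _ (hq.1.lower.2.1 1) _ (hq.1.lower.saddle hE.1.saddle 1)
    have a0 := hq.2.1 0
    have a1 := hq.2.1 1
    simp only [sub_re] at h0 h1 a0 a1
    exact ⟨sub_ne_zero.1 h0, sub_ne_zero.1 h1, a0, a1⟩
  obtain ⟨a1, a2, a3, a4⟩ := key h
  obtain ⟨b1, b2, b3, b4⟩ := key h.rotate_two
  simp only [show (0 : Fin 4) + 2 = 2 from rfl, show (1 : Fin 4) + 2 = 3 from rfl,
    show (2 : Fin 4) + 2 = 0 from rfl] at b1 b2 b3 b4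
  rw [abs_of_pos (sub_pos.2 hlt), abs_le] at a3 a4
  rw [abs_sub_comm (p 0).re (p 2).re, abs_of_pos (sub_pos.2 hlt), abs_le] at b3 b4
  refine ⟨⟨lt_of_le_of_ne (by linarith) a1.symm, lt_of_le_of_ne (by linarith) a2.symm⟩,
    lt_of_le_of_ne (by linarith) b2, lt_of_le_of_ne (by linarith) b1⟩

theorem re_gt (hE : X.IsStaggered E) (h : X.IsFlipQuad E E' p f)
    (hlt : (p 2).re < (p 0).re) :
    ((p 2).re < (p 1).re ∧ (p 1).re < (p 0).re) ∧ (p 2).re < (p 3).re ∧ (p 3).re < (p 0).re := by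
  obtain ⟨⟨h1, h2⟩, h3, h4⟩ := h.rotate_two.re_lt hE hlt
  exact ⟨⟨h3, h4⟩, h1, h2⟩

theorem re_ne (hE : X.IsStaggered E) (h : X.IsFlipQuad E E' p f) :
    (p 0).re ≠ (p 2).re := by
  have h0 := hE.2 _ (h.1.lower.2.1 2) _ (h.1.lower.saddle hE.1.saddle 2)
  exact sub_ne_zero.1 (by simpa using h0)

theorem re_ne' (hE : X.IsStaggered E) (hE' : X.IsStaggered E')
    (h : X.IsFlipQuad E E' p f) : (p 1).re ≠ (p 3).re := by
  have hq := (h.1.flip hE.1 h.2.2).1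
  have h0 := hE'.2 _ (hq.lower.2.1 2) _ (hq.lower.saddle hE'.1.saddle 2)
  exact sub_ne_zero.1 (by simpa using h0)

theorem saddle_old (hE : X.IsStraightTriangulation E)
    (h : X.IsFlipQuad E E' p f) : X.IsSaddle (f '' seg (p 0) (p 2)) (p 2 - p 0) := by
  have := h.rotate_two.1.lower.saddle hE.saddle 2
  exact this

theorem saddle_new (hE : X.IsStraightTriangulation E)
    (hE' : X.IsStraightTriangulation E')
    (h : X.IsFlipQuad E E' p f) : X.IsSaddle (f '' seg (p 1) (p 3)) (p 3 - p 1) := by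
  have hq := (h.1.flip hE h.2.2).1
  have := hq.rotate_two.lower.saddle hE'.saddle 2
  exact this

end IsFlipQuad

/-- Triangles with a common interior point have the same sides. -/
theorem IsTriangle.side_of_meet
    (h : X.IsTriangle E p f) (h' : X.IsTriangle E p' f') {w w' : ℂ}
    (hw : w ∈ interior (hull p)) (hw' : w' ∈ interior (hull p'))
    (hg : f w = f' w') (i : Fin 3) :
    ∃ j, f' '' seg (p' i) (p' (i + 1)) = f '' seg (p j) (p (j + 1)) := by
  obtain ⟨ε, c, hε, -, ⟨j, hj⟩, hf⟩ := h.eq_of_meet h' hw hw' hg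
  refine ⟨i + j, ?_⟩
  rw [hj, hj, openSegment_halfTr _ _ hε, ← image_comp_halfTr hε c f, add_right_comm]
  refine image_congr fun x hx => ?_
  have := hf (ε * (x - c)) (h.side_mem hx).1
  rw [← this]; congr 1
  linear_combination (c - x) * sq_eq_one_of_sign hε

/-- The triangles on the two sides of an edge cover a neighbourhood of a point of the edge. -/
theorem IsFrame.mem_nhds
    {a₀ a₁ c c' : ℂ} (h : X.IsFrame b g e a₀ a₁) (hT : X.IsTriangle E ![a₀, a₁, c] f)
    (hT' : X.IsTriangle E ![a₁, a₀, c'] f')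
    (hd : X.LaysOut b g ![a₀, a₁, c] f)
    (hd' : X.LaysOut b g ![a₁, a₀, c'] f') :
    e ∪ (f '' interior (hull ![a₀, a₁, c]) ∪
      f' '' interior (hull ![a₁, a₀, c'])) ∈ 𝓝 (X.dev b g b) := by
  rw [← (flat_dev h.base).map_nhds, mem_map]
  filter_upwards [h.near, eventually_mem_interior_tri hT.pos h.mem,
    eventually_mem_interior_tri hT'.pos h.swap.mem] with y h1 h2 h3
  rcases lt_trichotomy (cr a₀ a₁ y) 0 with h | h | h
  · have hy := h3 (by show 0 < cr a₁ a₀ y; rw [cr_swap]; linarith)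
    exact Or.inr (Or.inr ⟨y, hy, (hd' y (interior_subset hy) (hT'.interior_ne hy)).2.symm⟩)
  · exact Or.inl (h1.2 h)
  · have hy := h2 h
    exact Or.inr (Or.inl ⟨y, hy, (hd y (interior_subset hy) (hT.interior_ne hy)).2.symm⟩)

namespace IsStraightTriangulation

variable (hE : X.IsStraightTriangulation E)
include hE

/-- An edge has a triangle on each side. -/
theorem exists_sides (he : e ∈ E) {x : S} (hx : x ∈ e) :
    ∃ p f p' f', X.IsTriangle E p f ∧ X.IsTriangle E p' f' ∧
      f '' seg (p 0) (p 1) = e ∧ f' '' seg (p' 0) (p' 1) = e ∧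
      e ∪ (f '' interior (hull p) ∪ f' '' interior (hull p')) ∈ 𝓝 x := by
  obtain ⟨δ, hδ, g, hg, hgf⟩ := X.exists_germ (hE.subset_compl he hx) 0
  have hb := X.base_mem_dom hδ hgf (mem_ball_self hδ)
  obtain ⟨v, hv⟩ := hE.saddle e he
  obtain ⟨a₀, a₁, hfr, -⟩ := hv.exists_frame hb (hg ▸ hx)
  obtain ⟨c, f, hT, hd⟩ := hE.exists_above he hfr
  obtain ⟨c', f', hT', hd'⟩ := hE.exists_above he hfr.swap
  have hm : (0 : ℂ) ∈ seg a₀ a₁ := hfr.mem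
  have hm' : (0 : ℂ) ∈ seg a₁ a₀ := hfr.swap.mem
  have hx0 : X.dev 0 g 0 = x := (dev_base hb).eq_of_nhds.trans hg
  refine ⟨_, f, _, f', hT, hT', ?_, ?_, ?_⟩
  · refine hE.eq_of_mem (hT.2.1 0) he ⟨0, hm, ?_⟩ hx
    have := hT.side_mem (i := 0) hm
    rw [← (hd 0 this.1 this.2).2, hx0]
  · refine hE.eq_of_mem (hT'.2.1 0) he ⟨0, hm', ?_⟩ hx
    have := hT'.side_mem (i := 0) hm'
    rw [← (hd' 0 this.1 this.2).2, hx0]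
  · exact hx0 ▸ hfr.mem_nhds hT hT' hd hd'

omit hE in
/-- A triangle with the side `e` is one of two. -/
theorem eq_of_side {x : S} {p₁ p₂ : Fin 3 → ℂ} {f₁ f₂ : ℂ → S}
    (hx : x ∈ e) (he : e ∈ E)
    (h : e ∪ (f₁ '' interior (hull p₁) ∪ f₂ '' interior (hull p₂)) ∈
        𝓝 x) (hT : X.IsTriangle E p f) {k : Fin 3}
    (hk : f '' seg (p k) (p (k + 1)) = e) :
    (∃ w ∈ interior (hull p), ∃ w' ∈ interior (hull p₁), f₁ w' = f w) ∨
    ∃ w ∈ interior (hull p), ∃ w' ∈ interior (hull p₂), f₂ w' = f w := by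
  obtain ⟨b, hb, rfl⟩ := hk.symm ▸ hx
  have hbT := (hT.side_mem hb).1
  have hne : (𝓝[interior (hull p)] b).NeBot :=
    mem_closure_iff_nhdsWithin_neBot.1 (by rwa [closure_interior_tri hT.pos])
  obtain ⟨u, hu, hui⟩ := ((((hT.1.continuousOn b hbT).mono_left
    (nhdsWithin_mono _ interior_subset)).eventually h).and self_mem_nhdsWithin).exists
  rcases hu with hu | ⟨w, hw, hwu⟩ | ⟨w, hw, hwu⟩
  · exact absurd ⟨e, he, hu⟩ (disjoint_left.1 hT.2.2 ⟨u, hui, rfl⟩)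
  · exact Or.inl ⟨u, hui, w, hw, hwu⟩
  · exact Or.inr ⟨u, hui, w, hw, hwu⟩

/-- A triangulation has finitely many triangles, up to relabelling. -/
theorem exists_finite_triangles :
    ∃ T : Set ((Fin 3 → ℂ) × (ℂ → S)), T.Finite ∧ (∀ t ∈ T, X.IsTriangle E t.1 t.2) ∧
      ∀ p f, X.IsTriangle E p f → ∃ t ∈ T, ∃ ε c : ℂ, (ε = 1 ∨ ε = -1) ∧
        (∃ j, ∀ i, p i = ε * t.1 (i + j) + c) ∧
        ∀ x ∈ hull t.1, f (ε * x + c) = t.2 x := by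
  have hch : ∀ e : E, ∃ x ∈ e.1, ∃ t t' : (Fin 3 → ℂ) × (ℂ → S), X.IsTriangle E t.1 t.2 ∧
      X.IsTriangle E t'.1 t'.2 ∧ e.1 ∪ (t.2 '' interior (hull t.1) ∪
        t'.2 '' interior (hull t'.1)) ∈ 𝓝 x := by
    rintro ⟨e, he⟩
    obtain ⟨v, hv⟩ := hE.saddle e he
    obtain ⟨x, hx⟩ := hv.nonempty
    obtain ⟨p, f, p', f', h1, h2, -, -, h3⟩ := hE.exists_sides he hx
    exact ⟨x, hx, (p, f), (p', f'), h1, h2, h3⟩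
  choose x hx t t' h1 h2 h3 using hch
  have := hE.finite.to_subtype
  refine ⟨range t ∪ range t', (finite_range t).union (finite_range t'), ?_, fun p f hT => ?_⟩
  · rintro _ (⟨e, rfl⟩ | ⟨e, rfl⟩)
    exacts [h1 e, h2 e]
  · set e : E := ⟨_, hT.2.1 0⟩ with he
    rcases eq_of_side (hx e) e.2 (h3 e) hT (k := 0) rfl with ⟨w, hw, w', hw', hww⟩ |
      ⟨w, hw, w', hw', hww⟩
    · obtain ⟨ε, c, hε, -, hj, hf⟩ := (h1 e).eq_of_meet hT hw' hw hww
      exact ⟨t e, Or.inl ⟨e, rfl⟩, ε, c, hε, hj, hf⟩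
    · obtain ⟨ε, c, hε, -, hj, hf⟩ := (h2 e).eq_of_meet hT hw' hw hww
      exact ⟨t' e, Or.inr ⟨e, rfl⟩, ε, c, hε, hj, hf⟩

/-- A set of edges that contains with an edge also the other sides of the two adjacent triangles is
everything. -/
theorem eq_of_adjacent [ConnectedSpace S] {P : Set (Set S)}
    (hPE : P ⊆ E) (hP : P.Nonempty)
    (h : ∀ p f, X.IsTriangle E p f → ∀ i j, f '' seg (p i) (p (i + 1)) ∈ P →
      f '' seg (p j) (p (j + 1)) ∈ P) : P = E := by
  set U : Set (Set S) → Set S := fun P => ⋃₀ P ∪ {x | ∃ p f, X.IsTriangle E p f ∧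
    (∀ i, f '' seg (p i) (p (i + 1)) ∈ P) ∧ x ∈ f '' interior (hull p)}
    with hU
  have hUo : ∀ P ⊆ E, (∀ p f, X.IsTriangle E p f → ∀ i j, f '' seg (p i) (p (i + 1)) ∈ P →
      f '' seg (p j) (p (j + 1)) ∈ P) → IsOpen (U P) := by
    intro P hPE h
    rw [isOpen_iff_mem_nhds]
    rintro x (⟨e, he, hxe⟩ | ⟨p, f, hT, hs, w, hw, rfl⟩)
    · obtain ⟨p, f, p', f', h1, h2, h3, h4, h5⟩ := hE.exists_sides (hPE he) hxe
      filter_upwards [h5] with y hy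
      rcases hy with hy | hy | hy
      · exact Or.inl ⟨e, he, hy⟩
      · exact Or.inr ⟨p, f, h1, fun i => h p f h1 0 i (by simpa [h3] using he), hy⟩
      · exact Or.inr ⟨p', f', h2, fun i => h p' f' h2 0 i (by simpa [h4] using he), hy⟩
    · rw [← (hT.1.isFlatAt hw).map_nhds, mem_map]
      filter_upwards [isOpen_interior.mem_nhds hw] with y hy
      exact Or.inr ⟨p, f, hT, hs, y, hy, rfl⟩
  have hUn : ∀ P ⊆ E, P.Nonempty → (X.Zᶜ ∩ U P).Nonempty := by
    rintro P hPE ⟨e, he⟩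
    obtain ⟨v, hv⟩ := hE.saddle e (hPE he)
    obtain ⟨x, hx⟩ := hv.nonempty
    exact ⟨x, hE.subset_compl (hPE he) hx, Or.inl ⟨e, he, hx⟩⟩
  have h' : ∀ p f, X.IsTriangle E p f → ∀ i j, f '' seg (p i) (p (i + 1)) ∈ E \ P →
      f '' seg (p j) (p (j + 1)) ∈ E \ P := fun p f hT i j hi =>
    ⟨hT.2.1 j, fun hj => hi.2 (h p f hT j i hj)⟩
  by_contra hne
  have hne' : (E \ P).Nonempty := by
    rw [sdiff_nonempty]
    exact fun hEP => hne (hPE.antisymm hEP)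
  obtain ⟨x, -, hx1, hx2⟩ := X.isPreconnected_compl_Z (U P) (U (E \ P)) (hUo P hPE h)
    (hUo _ sdiff_subset h') (by
      intro x hx
      by_cases hxe : x ∈ ⋃₀ E
      · obtain ⟨e, he, hxe⟩ := hxe
        by_cases heP : e ∈ P
        · exact Or.inl (Or.inl ⟨e, heP, hxe⟩)
        · exact Or.inr (Or.inl ⟨e, ⟨he, heP⟩, hxe⟩)
      · obtain ⟨p, f, hT, hxT⟩ := hE.triangles x (by rintro (h | h); exacts [hx h, hxe h])
        by_cases h0 : f '' seg (p 0) (p (0 + 1)) ∈ P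
        · exact Or.inl (Or.inr ⟨p, f, hT, fun i => h p f hT 0 i h0, hxT⟩)
        · exact Or.inr (Or.inr ⟨p, f, hT, fun i => h' p f hT 0 i ⟨hT.2.1 0, h0⟩, hxT⟩))
    (hUn P hPE hP) (hUn _ sdiff_subset hne')
  rcases hx1 with ⟨e, he, hxe⟩ | ⟨p, f, hT, hs, w, hw, hwx⟩ <;>
    rcases hx2 with ⟨e', he', hxe'⟩ | ⟨p', f', hT', hs', w', hw', hwx'⟩
  · exact he'.2 (hE.eq_of_mem (hPE he) he'.1 hxe hxe' ▸ he)
  · exact disjoint_left.1 hT'.2.2 ⟨w', hw', hwx'⟩ ⟨e, hPE he, hxe⟩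
  · exact disjoint_left.1 hT.2.2 ⟨w, hw, hwx⟩ ⟨e', he'.1, hxe'⟩
  · obtain ⟨j, hj⟩ := hT.side_of_meet hT' hw hw' (hwx.trans hwx'.symm) 0
    exact (hs' 0).2 (hj ▸ hs j)

end IsStraightTriangulation

/-- The half of a quadrilateral adjacent to the diagonal is determined, as a subset of the surface. -/
theorem IsQuad.image_interior_eq {p : Fin 4 → ℂ}
    (h : X.IsQuad E p f) (h' : X.IsTriangle E p' f')
    {k : Fin 3} (hk : f' '' seg (p' k) (p' (k + 1)) = f '' seg (p 0) (p 2)) :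
    f' '' interior (hull p') = f '' interior (hull ![p 0, p 1, p 2]) ∨
    f' '' interior (hull p') = f '' interior (hull ![p 2, p 3, p 0]) := by
  obtain ⟨ε, c, hε, m, hm, h2, h0, h1, hf⟩ := h.exists_eq_half h' hk
  have hr : range p' = range fun i => ε * ![p (0 + m), p (1 + m), p (2 + m)] i + c := by
    rw [← range_rotate p' (k + 1)]
    congr 1
    ext i
    have e1 : 1 + (k + 1) = k + 2 := by fin_cases k <;> rfl
    have e2 : 2 + (k + 1) = k := by fin_cases k <;> rfl
    fin_cases i
    · show p' (0 + (k + 1)) = _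
      rw [zero_add, h0]; rfl
    · show p' (1 + (k + 1)) = _
      rw [e1, h1]; rfl
    · show p' (2 + (k + 1)) = _
      rw [e2, h2]; rfl
  have : f' '' interior (hull p') =
      f '' interior (hull ![p (0 + m), p (1 + m), p (2 + m)]) := by
    rw [← image_comp_halfTr hε c f, ← interior_preimage_halfTr hε, ← hull_halfTr _ hε, ← hr]
    exact image_congr fun x hx => hf x (interior_subset hx)
  rcases hm with rfl | rfl
  · exact Or.inl this
  · exact Or.inr this

variable (X) in
/-- The open triangles of a triangulation, as subsets of the surface. -/
def regions (E : Set (Set S)) : Set (Set S) :=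
  {r | ∃ p f, X.IsTriangle E p f ∧ f '' interior (hull p) = r}

variable (X) in
/-- Twice the area of a triangle of `E`, given as a subset of the surface. -/
noncomputable def regionArea (E : Set (Set S)) (r : Set S) : ℝ :=
  sSup {a | ∃ p f, X.IsTriangle E p f ∧ f '' interior (hull p) = r ∧
    a = cr (p 0) (p 1) (p 2)}

variable (X) in
/-- Twice the area of the surface. -/
noncomputable def totalArea (E : Set (Set S)) : ℝ := ∑ᶠ r ∈ X.regions E, X.regionArea E r

theorem regionArea_eq (h : X.IsTriangle E p f) :
    X.regionArea E (f '' interior (hull p)) = cr (p 0) (p 1) (p 2) := by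
  have : {a | ∃ p' f', X.IsTriangle E p' f' ∧ f' '' interior (hull p') =
      f '' interior (hull p) ∧ a = cr (p' 0) (p' 1) (p' 2)} =
      {cr (p 0) (p 1) (p 2)} := by
    refine Subset.antisymm ?_ (singleton_subset_iff.2 ⟨p, f, h, rfl, rfl⟩)
    rintro _ ⟨p', f', h', he, rfl⟩
    obtain ⟨w, hw⟩ := tri_nonempty_interior h.pos
    obtain ⟨w', hw', hww⟩ : f w ∈ f' '' interior (hull p') := he ▸ ⟨w, hw, rfl⟩
    obtain ⟨ε, c, hε, -, ⟨j, hj⟩, -⟩ := h.eq_of_meet h' hw hw' hww.symm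
    show cr _ _ _ = _
    rw [hj, hj, hj, cr_halfTr hε]
    fin_cases j
    · rfl
    · exact cr_rotate _ _ _
    · show cr (p 2) (p 0) (p 1) = _
      rw [← cr_rotate]
  rw [regionArea, this, csSup_singleton]

theorem IsStraightTriangulation.finite_regions
    (hE : X.IsStraightTriangulation E) : (X.regions E).Finite := by
  obtain ⟨T, hT, -, h⟩ := hE.exists_finite_triangles
  refine (hT.image fun t => t.2 '' interior (hull t.1)).subset ?_
  rintro _ ⟨p, f, hp, rfl⟩
  obtain ⟨t, ht, ε, c, hε, ⟨j, hj⟩, hf⟩ := h p f hp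
  refine ⟨t, ht, ?_⟩
  have hr : range p = range fun i => ε * t.1 i + c := by
    rw [← range_rotate (fun i => ε * t.1 i + c) j]
    congr 1; ext i; exact hj i
  show t.2 '' _ = _
  rw [← image_comp_halfTr hε c t.2, ← interior_preimage_halfTr hε, ← hull_halfTr _ hε, ← hr]
  refine image_congr fun x hx => ?_
  have hx' : ε * (x - c) ∈ hull t.1 := by
    have := interior_subset hx
    rw [hr, hull_halfTr _ hε] at this
    exact this
  rw [← hf _ hx']
  congr 1
  linear_combination (x - c) * sq_eq_one_of_sign hε

theorem IsTriangle.area_le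
    (hE : X.IsStraightTriangulation E) (h : X.IsTriangle E p f) :
    cr (p 0) (p 1) (p 2) ≤ X.totalArea E := by
  rw [totalArea, finsum_mem_eq_finite_toFinset_sum _ hE.finite_regions, ← regionArea_eq h]
  refine Finset.single_le_sum (f := X.regionArea E) (fun r hr => ?_) ?_
  · rw [Finite.mem_toFinset] at hr
    obtain ⟨p, f, hp, rfl⟩ := hr
    rw [regionArea_eq hp]; exact hp.pos.le
  · rw [Finite.mem_toFinset]; exact ⟨p, f, h, rfl⟩

theorem IsQuad.lower_notMem {p : Fin 4 → ℂ}
    (h : X.IsQuad E p f) (hd : f '' seg (p 1) (p 3) ∈ E') :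
    f '' interior (hull ![p 0, p 1, p 2]) ∉ X.regions E' := by
  rintro ⟨p', f', h', he⟩
  have hp := h.quadPos
  have h1 : p 1 ∈ closure (seg (p 1) (p 3)) := by
    rw [closure_openSegment]; exact left_mem_segment ℝ _ _
  obtain ⟨x, hx, hxs⟩ := mem_closure_iff.1 h1 {x | cr (p 0) (p 2) x < 0}
    (isOpen_lt (continuous_cr _ _) continuous_const) (by
      show cr (p 0) (p 2) (p 1) < 0
      rw [← cr_rotate, cr_swap, cr_rotate]; linarith [hp.1])
  have hxQ : x ∈ interior (hull p) := by
    have := diag_subset hp.rotate hxs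
    rwa [range_rotate p 1] at this
  have := (interior_lower hp).2 ⟨hxQ, hx⟩
  exact disjoint_left.1 h'.2.2 (he ▸ ⟨x, this, rfl⟩) ⟨_, hd, x, hxs, rfl⟩

theorem IsQuad.totalArea_eq
    (hE : X.IsStraightTriangulation E) {p : Fin 4 → ℂ} (h : X.IsQuad E p f)
    (hE' : E' = insert (f '' seg (p 1) (p 3)) (E \ {f '' seg (p 0) (p 2)})) :
    X.totalArea E = ∑ᶠ r ∈ X.regions E ∩ X.regions E', X.regionArea E r +
      (cr (p 0) (p 1) (p 2) + cr (p 2) (p 3) (p 0)) := by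
  set r₁ := f '' interior (hull ![p 0, p 1, p 2]) with hr₁
  set r₂ := f '' interior (hull ![p 2, p 3, p 0]) with hr₂
  have hd : f '' seg (p 1) (p 3) ∈ E' := hE' ▸ Or.inl rfl
  have n1 : r₁ ∉ X.regions E' := h.lower_notMem hd
  have n2 : r₂ ∉ X.regions E' := h.rotate_two.lower_notMem (by
    show f '' seg (p 3) (p 1) ∈ E'
    rwa [openSegment_symm])
  have hne : r₁ ≠ r₂ := by
    intro he
    obtain ⟨w, hw⟩ := tri_nonempty_interior h.lower.pos
    obtain ⟨w', hw', hww⟩ : f w ∈ r₂ := he ▸ ⟨w, hw, rfl⟩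
    have a1 := (interior_lower h.quadPos).1 hw
    have a2 := (interior_lower h.rotate_two.quadPos).1 hw'
    rw [range_rotate p 2] at a2
    have := h.1.injOn a2.1 a1.1 hww
    subst this
    have a3 : cr (p 2) (p 0) w' < 0 := a2.2
    rw [cr_swap] at a3
    linarith [a1.2]
  have hun : X.regions E = (X.regions E ∩ X.regions E') ∪ {r₁, r₂} := by
    refine Subset.antisymm ?_ (union_subset inter_subset_left ?_)
    · rintro _ ⟨p', f', h', rfl⟩
      by_cases hk : ∃ k, f' '' seg (p' k) (p' (k + 1)) = f '' seg (p 0) (p 2)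
      · obtain ⟨k, hk⟩ := hk
        exact Or.inr (h.image_interior_eq h' hk)
      · exact Or.inl ⟨⟨p', f', h', rfl⟩, p', f', h.persists hE' h' fun k hh => hk ⟨k, hh⟩, rfl⟩
    · rintro _ (rfl | rfl)
      exacts [⟨_, f, h.lower, rfl⟩, ⟨_, f, h.upper, rfl⟩]
  have hfin := hE.finite_regions
  rw [totalArea]
  conv_lhs => rw [hun]
  rw [finsum_mem_union ?_ (hfin.subset inter_subset_left) (toFinite _), finsum_mem_pair hne,
    regionArea_eq h.lower, regionArea_eq h.upper]
  · rfl
  · rw [disjoint_left]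
    rintro r hr (rfl | rfl)
    exacts [n1 hr.2, n2 hr.2]

theorem IsFlipQuad.totalArea_eq
    (hE : X.IsStraightTriangulation E) (hE' : X.IsStraightTriangulation E') {p : Fin 4 → ℂ}
    (h : X.IsFlipQuad E E' p f) : X.totalArea E' = X.totalArea E := by
  obtain ⟨h1, h2, -⟩ := h.1.flip hE h.2.2
  rw [h.1.totalArea_eq hE h.2.2, h1.totalArea_eq (E' := E) hE' (by
    show E = insert (f '' seg (p 2) (p 0)) _
    rw [openSegment_symm]; exact h2), inter_comm]
  congr 1
  · refine finsum_mem_congr rfl ?_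
    rintro _ ⟨⟨p', f', hT, rfl⟩, hr⟩
    have hT' : X.IsTriangle E' p' f' := by
      refine h.persists hT fun k hk => ?_
      have hd : f '' seg (p 1) (p 3) ∈ E' := h.2.2 ▸ Or.inl rfl
      rcases h.1.image_interior_eq hT hk with he | he
      · exact h.1.lower_notMem hd (he ▸ hr)
      · refine h.1.rotate_two.lower_notMem (E' := E') ?_ (he ▸ hr)
        show f '' seg (p 3) (p 1) ∈ E'
        rwa [openSegment_symm]
    rw [regionArea_eq hT, regionArea_eq hT']
  · show cr (p 1) (p 2) (p 3) + cr (p 3) (p 0) (p 1) = _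
    simp only [cr_eq]; ring

/-- Apexes over a fixed base cannot move forever towards the line of the base. -/
theorem eventually_const_apex {a₀ a₁ o : ℂ}
    (hb : b ∈ X.dom b g) (hm : b ∈ seg a₀ a₁) (hre : a₀.re ≠ a₁.re)
    (ho : o ∉ X.dom b g) (hob : halfOpen b o ⊆ X.dom b g) (hoc : cr a₀ a₁ o = 0) {l A : ℝ}
    (hl : l ≠ 0) {c : ℕ → ℂ}
    (hint : ∀ n, interior (hull ![a₀, a₁, c n]) ⊆ X.dom b g)
    (hc : ∀ n, c n ∉ X.dom b g) (hcb : ∀ n, halfOpen b (c n) ⊆ X.dom b g)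
    (hpos : ∀ n, 0 < cr a₀ a₁ (c n)) (hA : ∀ n, cr a₀ a₁ (c n) ≤ A)
    (hstep : ∀ n, c (n + 1) = c n ∨ (0 < l * ((c n).re - o.re) ∧
      l * ((c (n + 1)).re - o.re) < l * ((c n).re - o.re) ∧ (0 < l * ((c (n + 1)).re - o.re) →
      cr a₀ a₁ (c n) * (l * ((c (n + 1)).re - o.re)) ≤
        cr a₀ a₁ (c (n + 1)) * (l * ((c n).re - o.re))))) :
    ∃ M, ∀ n ≥ M, c n = c M := by
  by_contra! hcon
  set r : ℕ → ℝ := fun n => l * ((c n).re - o.re) with hr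
  have hchange : ∀ M, ∃ n ≥ M, c (n + 1) ≠ c n := by
    intro M
    by_contra! hM
    obtain ⟨n, hn, hne⟩ := hcon M
    refine hne ?_
    induction n, hn using Nat.le_induction with
    | base => rfl
    | succ n hn ih =>
      rw [hM n hn]
      by_contra hne'
      exact hne' (ih hne')
  have hrpos : ∀ n, 0 < r n := by
    intro n
    obtain ⟨m, hm, hne⟩ := hchange n
    by_contra hn
    have : ∀ m ≥ n, c m = c n := by
      intro m hm
      induction m, hm using Nat.le_induction with
      | base => rfl
      | succ m hm ih =>
        rcases hstep m with h | ⟨h, -⟩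
        · rw [h, ih]
        · rw [ih] at h; exact absurd h hn
    rcases hstep m with h | ⟨h, -⟩
    · exact hne h
    · rw [this m hm] at h; exact hn h
  have hanti : Antitone r := antitone_nat_of_succ_le fun n => by
    rcases hstep n with h | ⟨-, h, -⟩
    · exact le_of_eq (by simp only [hr, h])
    · exact h.le
  have hratio : ∀ n, cr a₀ a₁ (c 0) * r n ≤ cr a₀ a₁ (c n) * r 0 := by
    intro n
    induction n with
    | zero => exact le_rfl
    | succ n ih =>
      rcases hstep n with h | ⟨-, -, h⟩
      · simp only [hr, h]; exact ih
      · have h1 := h (hrpos (n + 1))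
        have h2 : (cr a₀ a₁ (c 0) * r (n + 1)) * r n ≤ (cr a₀ a₁ (c (n + 1)) * r 0) * r n := by
          have h3 := mul_le_mul_of_nonneg_right ih (hrpos (n + 1)).le
          have h4 := mul_le_mul_of_nonneg_right h1 (hrpos 0).le
          simp only [hr] at *
          linarith
        exact le_of_mul_le_mul_right h2 (hrpos n)
  have hre' : a₁.re - a₀.re ≠ 0 := sub_ne_zero.2 hre.symm
  set F : ℝ × ℝ → ℂ := fun x => ((o.re + x.1 / l : ℝ) : ℂ) +
    ((a₀.im + (x.2 + (a₁.im - a₀.im) * (o.re + x.1 / l - a₀.re)) / (a₁.re - a₀.re) : ℝ) : ℂ) *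
      Complex.I with hF
  have hFc : Continuous F := by
    have : Continuous fun x : ℝ × ℝ => o.re + x.1 / l := by fun_prop
    fun_prop
  have hcF : ∀ n, c n ∈ F '' (Icc 0 (r 0) ×ˢ Icc 0 A) := by
    intro n
    refine ⟨(r n, cr a₀ a₁ (c n)), ⟨⟨(hrpos n).le, hanti (Nat.zero_le n)⟩, (hpos n).le, hA n⟩, ?_⟩
    have e1 : o.re + r n / l = (c n).re := by simp only [hr]; field_simp; ring
    simp only [hF, e1]
    apply Complex.ext
    · simp only [add_re, Complex.ofReal_re, re_ofReal_mul, Complex.I_re, mul_zero, add_zero]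
    · simp only [add_im, Complex.ofReal_im, im_ofReal_mul, Complex.I_im, mul_one, zero_add, cr_eq]
      field_simp; ring
  obtain ⟨x, -, φ, hφ, hx⟩ := ((isCompact_Icc.prod isCompact_Icc).image hFc).tendsto_subseq hcF
  have hxd : x ∉ X.dom b g := fun h =>
    ((hx.eventually (isOpen_dom.mem_nhds h)).exists).elim fun n hn => hc _ hn
  have hxr : Tendsto (fun n => r (φ n)) atTop (𝓝 (l * (x.re - o.re))) :=
    ((by fun_prop : Continuous fun w : ℂ => l * (w.re - o.re)).tendsto x).comp hx
  have hxc := ((continuous_cr a₀ a₁).tendsto x).comp hx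
  have hx0 : 0 ≤ cr a₀ a₁ x := ge_of_tendsto' hxc fun n => (hpos _).le
  rcases hx0.eq_or_lt with hx0 | hx0
  · have h1 : cr a₀ a₁ (c 0) * (l * (x.re - o.re)) ≤ cr a₀ a₁ x * r 0 :=
      le_of_tendsto_of_tendsto' (hxr.const_mul _) (hxc.mul_const _) fun n => hratio _
    have h2 : 0 ≤ l * (x.re - o.re) := ge_of_tendsto' hxr fun n => (hrpos _).le
    rw [← hx0, zero_mul] at h1
    have h3 : l * (x.re - o.re) = 0 := by nlinarith [hpos 0]
    have h4 : x.re = o.re := sub_eq_zero.1 ((mul_eq_zero.1 h3).resolve_left hl)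
    have h5 : x = o := by
      refine Complex.ext h4 ?_
      rw [cr_eq, h4] at hx0
      rw [cr_eq] at hoc
      exact mul_left_cancel₀ hre' (by linarith)
    rw [h5] at hx
    obtain ⟨n, hn⟩ := (hx.eventually (eventually_mem_segment_of_visible hb ho hob)).exists
    have h6 := hn (hc _)
    rw [segment_eq_image_lineMap] at h6
    obtain ⟨t, -, ht⟩ := h6
    have h7 := hoc
    have hbc : cr a₀ a₁ b = 0 := by
      obtain ⟨t, ht, rfl⟩ := openSegment_lineMap hm
      rw [cr_lineMap]; simp
    rw [← ht, cr_lineMap, hbc, mul_zero, zero_add] at h7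
    rcases mul_eq_zero.1 h7 with h8 | h8
    · rw [h8, lineMap_apply_zero] at ht
      exact ho (ht ▸ hb)
    · exact (hpos _).ne' h8
  · have hxv : halfOpen b x ⊆ X.dom b g := by
      rintro _ ⟨t, ⟨ht0, ht1⟩, rfl⟩
      rcases ht0.eq_or_lt with rfl | ht0
      · simpa using hb
      set y : ℂ := lineMap b x t with hy
      have hyx : y ∈ interior (hull ![a₀, a₁, x]) := by
        rw [mem_interior_tri (by exact hx0)]
        obtain ⟨h1, h2, h3⟩ := (mem_side_tri (p := ![a₀, a₁, x]) hx0 0).1 hm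
        have h1 : cr a₀ a₁ b = 0 := h1
        have h2 : 0 < cr a₁ x b := h2
        have h3 : 0 < cr x a₀ b := h3
        intro i
        rw [hy, cr_lineMap]
        fin_cases i
        · show 0 < (1 - t) * cr a₀ a₁ b + t * cr a₀ a₁ x
          rw [h1]; simpa using mul_pos ht0 hx0
        · show 0 < (1 - t) * cr a₁ x b + t * cr a₁ x x
          rw [cr_right]; nlinarith
        · show 0 < (1 - t) * cr x a₀ b + t * cr x a₀ x
          rw [cr_left]; nlinarith
      rw [mem_interior_tri (by exact hx0)] at hyx
      have k0 : 0 < cr a₀ a₁ y := hyx 0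
      have k1 : 0 < cr a₁ x y := hyx 1
      have k2 : 0 < cr x a₀ y := hyx 2
      have c1 : Continuous fun w : ℂ => cr a₁ w y := by simp only [cr_eq]; fun_prop
      have c2 : Continuous fun w : ℂ => cr w a₀ y := by simp only [cr_eq]; fun_prop
      obtain ⟨n, hn1, hn2⟩ := ((((c1.tendsto x).comp hx).eventually (lt_mem_nhds k1)).and
        (((c2.tendsto x).comp hx).eventually (lt_mem_nhds k2))).exists
      refine hint (φ n) ?_
      rw [mem_interior_tri (by exact hpos (φ n))]
      intro i
      fin_cases i
      exacts [k0, hn1, hn2]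
    obtain ⟨m, hm⟩ := eventually_atTop.1 (hx.eventually (eventually_eq_of_visible hxd hxv))
    have hm' : ∀ k ≥ m, c (φ k) = x := fun k hk => hm k hk (hc _) (hcb _)
    obtain ⟨n, hn, hne⟩ := hchange (φ m)
    have h1 : r (n + 1) < r n := ((hstep n).resolve_left hne).2.1
    have h2 : r (φ (n + 1)) ≤ r (n + 1) := hanti (hφ.id_le _)
    have h3 : r n ≤ r (φ m) := hanti hn
    have hmn : m ≤ n + 1 := (hφ.id_le m).trans (hn.trans n.le_succ)
    have h4 : r (φ (n + 1)) = r (φ m) := by simp only [hr, hm' _ hmn, hm' m le_rfl]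
    linarith

/-- A triangle over a fixed edge changes under a flip as follows. -/
theorem IsFlipQuad.apex_step {p : Fin 4 → ℂ}
    (hE : X.IsStraightTriangulation E)
    (h : X.IsFlipQuad E E' p F) {b a₀ a₁ c c' : ℂ}
    (heE : e ∈ E) (heE' : e ∈ E') (hb : b ∈ seg a₀ a₁) (hfb : f b ∈ e)
    (hT : X.IsTriangle E ![a₀, a₁, c] f) (hT' : X.IsTriangle E' ![a₀, a₁, c'] f')
    (hd : ∀ᶠ x in 𝓝 b, 0 < cr a₀ a₁ x → f x = f' x) :
    c' = c ∨ ∃ q g, X.IsFlipQuad E E' q g ∧ q 3 = c' ∧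
      ((q 0 = c ∧ q 1 = a₀ ∧ q 2 = a₁) ∨ (q 0 = a₀ ∧ q 1 = a₁ ∧ q 2 = c)) := by
  by_cases hk : ∃ k, f '' seg (![a₀, a₁, c] k) (![a₀, a₁, c] (k + 1)) =
      F '' seg (p 0) (p 2)
  · right
    obtain ⟨k, hk⟩ := hk
    obtain ⟨q, g, hq, h2, h0, h1, hfg⟩ := h.exists_old hT hk
    have hfg' : ∀ᶠ x in 𝓝 b, 0 < cr a₀ a₁ x → g x = f' x := by
      filter_upwards [hd, eventually_mem_interior_tri hT.pos hb] with x h1 h2 h3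
      rw [← h1 h3]; exact (hfg (interior_subset (h2 h3))).symm
    have hnew := (hq.1.flip hE hq.2.2).1
    fin_cases k
    · exfalso
      have he : F '' seg (p 0) (p 2) = e := by
        rw [← hk]
        exact hE.eq_of_mem (hT.2.1 0) heE ⟨b, hb, rfl⟩ hfb
      rw [h.2.2, ← he] at heE'
      rcases heE' with h3 | h3
      · exact (h.1.flip hE h.2.2).2.2 (h3 ▸ h.1.2.2.1)
      · exact h3.2 rfl
    · have h2' : q 2 = a₁ := h2
      have h0' : q 0 = c := h0
      have h1' : q 1 = a₀ := h1
      refine ⟨q, g, hq, ?_, Or.inl ⟨h0', h1', h2'⟩⟩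
      have hN : X.IsTriangle E' ![q 1, q 2, q 3] g := hnew.lower
      rw [h1', h2'] at hN
      exact IsTriangle.apex_unique hb hT' hN (hfg'.mono fun x hx h => (hx h).symm)
    · have h2' : q 2 = c := h2
      have h0' : q 0 = a₀ := h0
      have h1' : q 1 = a₁ := h1
      refine ⟨q, g, hq, ?_, Or.inr ⟨h0', h1', h2'⟩⟩
      have hN : X.IsTriangle E' ![q 3, q 0, q 1] g := hnew.upper
      have hN' := hN.rotate 1
      have e : (fun i => ![q 3, q 0, q 1] (i + 1)) = ![a₀, a₁, q 3] := by
        rw [← h0', ← h1']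
        ext i; fin_cases i <;> rfl
      rw [e] at hN'
      exact IsTriangle.apex_unique hb hT' hN' (hfg'.mono fun x hx h => (hx h).symm)
  · left
    push Not at hk
    exact IsTriangle.apex_unique hb (h.persists hT hk) hT' hd

namespace IsStaggeredFlipSequence

variable (hτ : X.IsStaggeredFlipSequence τ)
include hτ

theorem exists_flipQuad (n : ℕ) : ∃ p f, X.IsFlipQuad (τ n) (τ (n + 1)) p f := hτ.2 n

theorem totalArea_eq (n : ℕ) :
    X.totalArea (τ n) = X.totalArea (τ 0) := by
  induction n with
  | zero => rfl
  | succ n ih =>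
    obtain ⟨p, f, h⟩ := hτ.exists_flipQuad n
    rw [h.totalArea_eq (hτ.1 n).1 (hτ.1 (n + 1)).1, ih]

/-- The triangle on a given side of a permanent edge is eventually constant. -/
theorem exists_permanent_triangle {N : ℕ}
    (he : ∀ m ≥ N, e ∈ τ m) (h : X.IsFrame b g e a₀ a₁) :
    ∃ M ≥ N, ∃ (c : ℂ) (f : ℂ → S), (∀ m ≥ M, X.IsTriangle (τ m) ![a₀, a₁, c] f) ∧
      X.LaysOut b g ![a₀, a₁, c] f := by
  have hb := h.mem
  have hch : ∀ n, ∃ (c : ℂ) (f : ℂ → S), X.IsTriangle (τ (N + n)) ![a₀, a₁, c] f ∧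
      X.LaysOut b g ![a₀, a₁, c] f := fun n =>
    (hτ.1 (N + n)).1.exists_above (he _ (Nat.le_add_right _ _)) h
  choose c f hT hd using hch
  have hbT : ∀ n, b ∈ hull ![a₀, a₁, c n] ∧ ∀ j, b ≠ ![a₀, a₁, c n] j := fun n =>
    (hT n).side_mem (i := 0) hb
  have hfb : ∀ n, f n b ∈ e := fun n => by
    rw [← (hd n b (hbT n).1 (hbT n).2).2]; exact h.base_mem
  have hcor := fun n => (hT n).corner_notMem_dom (hbT n).1 (hbT n).2 (hd n)
  have hre : ∀ n, a₁.re ≠ a₀.re ∧ (c n).re ≠ a₁.re ∧ a₀.re ≠ (c n).re := by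
    intro n
    have hs := fun i => (hτ.1 (N + n)).2 _ ((hT n).2.1 i) _ ((hT n).saddle (hτ.1 (N + n)).1.saddle i)
    have h0 : (a₁ - a₀).re ≠ 0 := hs 0
    have h1 : (c n - a₁).re ≠ 0 := hs 1
    have h2 : (a₀ - c n).re ≠ 0 := hs 2
    rw [sub_re, sub_ne_zero] at h0 h1 h2
    exact ⟨h0, h1, h2⟩
  have hstep : ∀ n, c (n + 1) = c n ∨ ∃ q g, X.IsFlipQuad (τ (N + n)) (τ (N + n + 1)) q g ∧
      q 3 = c (n + 1) ∧
      ((q 0 = c n ∧ q 1 = a₀ ∧ q 2 = a₁) ∨ (q 0 = a₀ ∧ q 1 = a₁ ∧ q 2 = c n)) := by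
    intro n
    obtain ⟨p, F, hp⟩ := hτ.exists_flipQuad (N + n)
    refine hp.apex_step (hτ.1 _).1 (he _ (Nat.le_add_right _ _)) (he _ (by omega)) hb
      (hfb n) (hT n) (hT (n + 1)) ?_
    filter_upwards [eventually_mem_interior_tri (hT n).pos hb,
      eventually_mem_interior_tri (hT (n + 1)).pos hb] with x h1 h2 h3
    rw [← (hd n x (interior_subset (h1 h3)) ((hT n).interior_ne (h1 h3))).2,
      ← (hd (n + 1) x (interior_subset (h2 h3)) ((hT (n + 1)).interior_ne (h2 h3))).2]
  have hconst : ∃ M, ∀ n ≥ M, c n = c M := by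
    obtain ⟨s, hs, hlt⟩ : ∃ s : ℝ, (s = 1 ∨ s = -1) ∧ s * a₀.re < s * a₁.re := by
      rcases lt_or_gt_of_ne (hre 0).1 with h | h
      · exact ⟨-1, Or.inr rfl, by linarith⟩
      · exact ⟨1, Or.inl rfl, by linarith⟩
    have hlt4 : ∀ {n q g}, X.IsFlipQuad (τ (N + n)) (τ (N + n + 1)) q g →
        (s * (q 0).re < s * (q 2).re → (s * (q 0).re < s * (q 1).re ∧ s * (q 1).re < s * (q 2).re) ∧
          s * (q 0).re < s * (q 3).re ∧ s * (q 3).re < s * (q 2).re) ∧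
        (s * (q 2).re < s * (q 0).re → (s * (q 2).re < s * (q 1).re ∧ s * (q 1).re < s * (q 0).re) ∧
          s * (q 2).re < s * (q 3).re ∧ s * (q 3).re < s * (q 0).re) := by
      intro n q g hq
      have h1 := hq.re_lt (hτ.1 _)
      have h2 := hq.re_gt (hτ.1 _)
      rcases hs with rfl | rfl
      · simpa only [one_mul] using ⟨h1, h2⟩
      · simp only [neg_one_mul, neg_lt_neg_iff]
        exact ⟨fun h => ⟨(h2 h).1.symm, (h2 h).2.symm⟩, fun h => ⟨(h1 h).1.symm, (h1 h).2.symm⟩⟩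
    have hs0 : s ≠ 0 := by rcases hs with rfl | rfl <;> norm_num
    have hs2 : s * s = 1 := by rcases hs with rfl | rfl <;> norm_num
    have hint : ∀ n, interior (hull ![a₀, a₁, c n]) ⊆ X.dom b g := fun n x hx =>
      (hd n x (interior_subset hx) ((hT n).interior_ne hx)).1
    have harea : ∀ n, cr a₀ a₁ (c n) ≤ X.totalArea (τ 0) := fun n =>
      hτ.totalArea_eq (N + n) ▸ (hT n).area_le (hτ.1 (N + n)).1
    have hmain := fun (o : ℂ) (ho : o ∉ X.dom b g) (hob : halfOpen b o ⊆ X.dom b g)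
      (hoc : cr a₀ a₁ o = 0) (l : ℝ) (hl : l ≠ 0) =>
      eventually_const_apex (A := X.totalArea (τ 0)) h.base hb (hre 0).1.symm ho hob hoc hl hint
        (fun n => (hcor n 2).2) (fun n => (hcor n 2).1) (fun n => (hT n).pos) harea
    rcases lt_or_ge (s * (c 0).re) (s * a₁.re) with h0 | h0
    · have hinv : ∀ n, s * (c n).re < s * a₁.re := by
        intro n
        induction n with
        | zero => exact h0
        | succ n ih =>
          rcases hstep n with h1 | ⟨q, g, hq, h3, ⟨h0, h1, h2⟩ | ⟨h0, h1, h2⟩⟩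
          · rwa [h1]
          · obtain ⟨a1, a2⟩ := hlt4 hq
            rw [h0, h1, h2, h3] at a1 a2
            exact (a1 ih).2.2
          · obtain ⟨a1, a2⟩ := hlt4 hq
            rw [h0, h1, h2, h3] at a1 a2
            rcases lt_trichotomy (s * a₀.re) (s * (c n).re) with h4 | h4 | h4
            · linarith [(a1 h4).1.2]
            · exact absurd (mul_left_cancel₀ hs0 h4) (hre n).2.2
            · linarith [(a2 h4).1.2]
      refine hmain a₀ h.left (hcor 0 0).1 (cr_left _ _) (-s) (neg_ne_zero.2 hs0) fun n => ?_
      rcases hstep n with h1 | ⟨q, g, hq, h3, ⟨h0, h1, h2⟩ | ⟨h0, h1, h2⟩⟩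
      · exact Or.inl h1
      · right
        obtain ⟨a1, -⟩ := hlt4 hq
        rw [h0, h1, h2, h3] at a1
        obtain ⟨⟨b1, b2⟩, b3, b4⟩ := a1 (hinv n)
        have hcr : 0 < cr (c n) a₀ (c (n + 1)) := by
          have := hq.1.quadPos.2.1
          rwa [h0, h1, h3] at this
        refine ⟨by linarith, by linarith, fun h5 => ?_⟩
        have key : cr a₀ a₁ (c (n + 1)) * (-s * ((c n).re - a₀.re)) -
            cr a₀ a₁ (c n) * (-s * ((c (n + 1)).re - a₀.re)) =
            (s * a₁.re - s * a₀.re) * cr (c n) a₀ (c (n + 1)) := by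
          simp only [cr_eq]; ring
        have := mul_pos (sub_pos.2 hlt) hcr
        linarith
      · exfalso
        obtain ⟨a1, a2⟩ := hlt4 hq
        rw [h0, h1, h2, h3] at a1 a2
        rcases lt_trichotomy (s * a₀.re) (s * (c n).re) with h4 | h4 | h4
        · linarith [(a1 h4).1.2, hinv n]
        · exact absurd (mul_left_cancel₀ hs0 h4) (hre n).2.2
        · linarith [(a2 h4).1.2]
    · have hinv : ∀ n, s * a₀.re < s * (c n).re := by
        intro n
        induction n with
        | zero => exact hlt.trans_le h0
        | succ n ih =>
          rcases hstep n with h1 | ⟨q, g, hq, h3, ⟨h0, h1, h2⟩ | ⟨h0, h1, h2⟩⟩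
          · rwa [h1]
          · obtain ⟨a1, a2⟩ := hlt4 hq
            rw [h0, h1, h2, h3] at a1 a2
            rcases lt_trichotomy (s * (c n).re) (s * a₁.re) with h4 | h4 | h4
            · linarith [(a1 h4).1.1]
            · exact absurd (mul_left_cancel₀ hs0 h4) (hre n).2.1
            · linarith [(a2 h4).1.1]
          · obtain ⟨a1, a2⟩ := hlt4 hq
            rw [h0, h1, h2, h3] at a1 a2
            exact (a1 ih).2.1
      refine hmain a₁ h.right (hcor 0 1).1 (cr_right _ _) s hs0 fun n => ?_
      rcases hstep n with h1 | ⟨q, g, hq, h3, ⟨h0, h1, h2⟩ | ⟨h0, h1, h2⟩⟩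
      · exact Or.inl h1
      · exfalso
        obtain ⟨a1, a2⟩ := hlt4 hq
        rw [h0, h1, h2, h3] at a1 a2
        rcases lt_trichotomy (s * (c n).re) (s * a₁.re) with h4 | h4 | h4
        · linarith [(a1 h4).1.1, hinv n]
        · exact absurd (mul_left_cancel₀ hs0 h4) (hre n).2.1
        · linarith [(a2 h4).1.1]
      · right
        obtain ⟨a1, -⟩ := hlt4 hq
        rw [h0, h1, h2, h3] at a1
        obtain ⟨⟨b1, b2⟩, b3, b4⟩ := a1 (hinv n)
        have hcr : 0 < cr a₁ (c n) (c (n + 1)) := by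
          have := hq.1.quadPos.2.2.2
          rwa [h1, h2, h3] at this
        refine ⟨by linarith, by linarith, fun h5 => ?_⟩
        have key : cr a₀ a₁ (c (n + 1)) * (s * ((c n).re - a₁.re)) -
            cr a₀ a₁ (c n) * (s * ((c (n + 1)).re - a₁.re)) =
            (s * a₁.re - s * a₀.re) * cr a₁ (c n) (c (n + 1)) := by
          simp only [cr_eq]; ring
        have := mul_pos (sub_pos.2 hlt) hcr
        linarith
  obtain ⟨M, hM⟩ := hconst
  refine ⟨N + M, by omega, c M, f M, fun m hm => ?_, hd M⟩
  obtain ⟨n, rfl⟩ := Nat.exists_eq_add_of_le hm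
  have hTn := hT (M + n)
  have hdn := hd (M + n)
  rw [hM (M + n) (by omega)] at hTn hdn
  have hff : ∀ w ∈ hull ![a₀, a₁, c M], (∀ i, w ≠ ![a₀, a₁, c M] i) →
      f (M + n) w = f M w := fun w hw hwc => by
    rw [← (hdn w hw hwc).2, ← (hd M w hw hwc).2]
  rw [← add_assoc] at hTn
  refine ⟨(hT M).1, fun i => ?_, ?_⟩
  · have := hTn.2.1 i
    rwa [image_congr fun w hw => hff w (hTn.side_mem hw).1 (hTn.side_mem hw).2] at this
  · have := hTn.2.2
    rwa [image_congr fun w hw => hff w (interior_subset hw) (hTn.interior_ne hw)] at this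

end IsStaggeredFlipSequence

namespace IsStaggeredFlipSequence

variable (hτ : X.IsStaggeredFlipSequence τ)
include hτ

theorem ncard_eq (n : ℕ) : (τ n).ncard = (τ 0).ncard := by
  induction n with
  | zero => rfl
  | succ n ih =>
    obtain ⟨p, f, h⟩ := hτ.exists_flipQuad n
    have hfin := (hτ.1 n).1.finite
    rw [← ih, h.2.2, ncard_insert_of_notMem (fun hd => (h.1.flip (hτ.1 n).1 h.2.2).2.2 hd.1)
      (hfin.subset sdiff_subset), ncard_sdiff_singleton_add_one h.1.2.2.1 hfin]

/-- Every edge is eventually flipped. -/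
theorem exists_notMem [ConnectedSpace S] {n : ℕ} (e : Set S) :
    ∃ m ≥ n, e ∉ τ m := by
  by_contra! hcon
  set P : ℕ → Set (Set S) := fun N => {e | ∀ m ≥ N, e ∈ τ m} with hP
  have hPsub : ∀ N m, N ≤ m → P N ⊆ τ m := fun N m hm e he => he m hm
  have hPmono : ∀ N N', N ≤ N' → P N ⊆ P N' := fun N N' hN e he m hm => he m (hN.trans hm)
  have hPfin : ∀ N, (P N).Finite := fun N => (hτ.1 N).1.finite.subset (hPsub N N le_rfl)
  have hPcard : ∀ N, (P N).ncard ≤ (τ 0).ncard := fun N =>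
    hτ.ncard_eq N ▸ ncard_le_ncard (hPsub N N le_rfl) (hτ.1 N).1.finite
  obtain ⟨N, hN⟩ : ∃ N, ∀ N', (P N').ncard ≤ (P N).ncard := by
    obtain ⟨_, ⟨N, rfl⟩, hN⟩ := exists_max_image (range fun N => (P N).ncard) id
      ((finite_Iic (τ 0).ncard).subset (by rintro _ ⟨N, rfl⟩; exact hPcard N)) (range_nonempty _)
    exact ⟨N, fun N' => hN _ ⟨N', rfl⟩⟩
  have hPeq : ∀ N' ≥ N, P N' = P N := fun N' h =>
    (eq_of_subset_of_ncard_le (hPmono N N' h) (hN N') (hPfin N')).symm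
  have hne : (P N).Nonempty := by
    have : e ∈ P (max n N) := fun m hm => hcon m ((le_max_left _ _).trans hm)
    rw [hPeq _ (le_max_right _ _)] at this
    exact ⟨e, this⟩
  have hside : ∀ e ∈ P N, ∃ M ≥ N, ∃ x ∈ e, ∃ p f p' f', (∀ m ≥ M, X.IsTriangle (τ m) p f) ∧
      (∀ m ≥ M, X.IsTriangle (τ m) p' f') ∧
      e ∪ (f '' interior (hull p) ∪ f' '' interior (hull p')) ∈
        𝓝 x := by
    intro e he
    have heN := he N le_rfl
    obtain ⟨v, hv⟩ := (hτ.1 N).1.saddle e heN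
    obtain ⟨x, hx⟩ := hv.nonempty
    obtain ⟨δ, hδ, g, hg, hgf⟩ := X.exists_germ ((hτ.1 N).1.subset_compl heN hx) 0
    have hb := X.base_mem_dom hδ hgf (mem_ball_self hδ)
    obtain ⟨a₀, a₁, hfr, -⟩ := hv.exists_frame hb (hg ▸ hx)
    obtain ⟨M, hM, c, f, hT, hd⟩ := hτ.exists_permanent_triangle he hfr
    obtain ⟨M', hM', c', f', hT', hd'⟩ := hτ.exists_permanent_triangle he hfr.swap
    refine ⟨max M M', hM.trans (le_max_left _ _), _, hfr.base_mem, _, f, _, f',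
      fun m hm => hT m ((le_max_left _ _).trans hm), fun m hm => hT' m ((le_max_right _ _).trans hm),
      hfr.mem_nhds (hT _ (le_max_left _ _)) (hT' _ (le_max_right _ _)) hd hd'⟩
  choose! M hMN hM using hside
  obtain ⟨K, hK⟩ : ∃ K, ∀ e ∈ P N, M e ≤ K :=
    ((hPfin N).image M).bddAbove.imp fun K hK e he => hK ⟨e, he, rfl⟩
  have hNK : N ≤ K := hne.elim fun e he => (hMN e he).trans (hK e he)
  have hall : P N = τ K := by
    refine (hτ.1 K).1.eq_of_adjacent (hPsub N K hNK) hne fun p f hT i j hi => ?_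
    obtain ⟨x, hx, p₁, f₁, p₂, f₂, h1, h2, h3⟩ := hM _ hi
    rw [← hPeq K hNK]
    rcases IsStraightTriangulation.eq_of_side hx (hPsub N K hNK hi) h3 hT rfl with
      ⟨w, hw, w', hw', hww⟩ | ⟨w, hw, w', hw', hww⟩
    · obtain ⟨k, hk⟩ := (h1 K (hK _ hi)).side_of_meet hT hw' hw hww j
      exact fun m hm => hk ▸ (h1 m ((hK _ hi).trans hm)).2.1 k
    · obtain ⟨k, hk⟩ := (h2 K (hK _ hi)).side_of_meet hT hw' hw hww j
      exact fun m hm => hk ▸ (h2 m ((hK _ hi).trans hm)).2.1 k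
  obtain ⟨p, f, h⟩ := hτ.exists_flipQuad K
  have h1 : f '' seg (p 0) (p 2) ∈ τ (K + 1) := hPsub N (K + 1) (by omega) (hall ▸ h.1.2.2.1)
  rw [h.2.2] at h1
  rcases h1 with h1 | h1
  · exact (h.1.flip (hτ.1 K).1 h.2.2).2.2 (h1 ▸ h.1.2.2.1)
  · exact h1.2 rfl

end IsStaggeredFlipSequence

namespace IsStraightTriangulation

variable (hE : X.IsStraightTriangulation E)
include hE

theorem exists_mem_hull {x : S} (hx : x ∉ X.Z) :
    ∃ p f, X.IsTriangle E p f ∧ x ∈ f '' hull p := by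
  by_cases hxe : x ∈ ⋃₀ E
  · obtain ⟨e, he, hxe⟩ := hxe
    obtain ⟨p, f, -, -, hT, -, h, -⟩ := hE.exists_sides he hxe
    refine ⟨p, f, hT, ?_⟩
    rw [← h] at hxe
    obtain ⟨w, hw, rfl⟩ := hxe
    exact ⟨w, (hT.side_mem (i := 0) hw).1, rfl⟩
  · obtain ⟨p, f, hT, hxT⟩ := hE.triangles x (by rintro (h | h); exacts [hx h, hxe h])
    exact ⟨p, f, hT, image_mono interior_subset hxT⟩

/-- A sequence converging to a marked point has a subsequence in a corner of a triangle. -/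
theorem exists_corner {z : S} {k : ℕ} {φ : OpenPartialHomeomorph S ℂ}
    (hφ : X.IsCone z k φ) {y : ℕ → S} (hy : Tendsto y atTop (𝓝 z)) (hyZ : ∀ n, y n ∉ X.Z) :
    ∃ (p : Fin 3 → ℂ) (f : ℂ → S) (i : Fin 3), X.IsTriangle E p f ∧ f (p i) = z ∧
      ∃ᶠ n in atTop, ∃ x ∈ hull p, (∀ j, x ≠ p j) ∧ f x = y n ∧
        ∃ η > 0, x ∈ ball (p i) η ∧ ∀ x' ∈ hull p, (∀ j, x' ≠ p j) →
          x' ∈ ball (p i) η → φ (f x') ^ k = (x' - p i) ^ 2 := by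
  obtain ⟨T, hTf, hT, hall⟩ := hE.exists_finite_triangles
  have hcov : ∀ n, ∃ t ∈ T, y n ∈ t.2 '' hull t.1 := by
    intro n
    obtain ⟨p, f, hp, w, hw, hwy⟩ := hE.exists_mem_hull (hyZ n)
    obtain ⟨t, ht, ε, c, hε, ⟨j, hj⟩, hf⟩ := hall p f hp
    refine ⟨t, ht, ε * (w - c), ?_, ?_⟩
    · have hr : range p = range fun i => ε * t.1 i + c := by
        rw [← range_rotate (fun i => ε * t.1 i + c) j]
        congr 1; ext i; exact hj i
      rw [hr, hull_halfTr _ hε] at hw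
      exact hw
    · have hr : range p = range fun i => ε * t.1 i + c := by
        rw [← range_rotate (fun i => ε * t.1 i + c) j]
        congr 1; ext i; exact hj i
      rw [hr, hull_halfTr _ hε] at hw
      rw [← hf _ hw, ← hwy]; congr 1
      linear_combination (w - c) * sq_eq_one_of_sign hε
  obtain ⟨t, ht, hfr⟩ : ∃ t ∈ T, ∃ᶠ n in atTop, y n ∈ t.2 '' hull t.1 := by
    by_contra! hcon
    have : ∀ᶠ n in (atTop : Filter ℕ), ∀ t ∈ T, y n ∉ t.2 '' hull t.1 :=
      (eventually_all_finite hTf).2 fun t ht => by simpa using hcon t ht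
    obtain ⟨n, hn⟩ := this.exists
    obtain ⟨t, ht, h⟩ := hcov n
    exact hn t ht h
  have hp := hT t ht
  obtain ⟨ψ, hψ, hyψ⟩ := extraction_of_frequently_atTop hfr
  choose x hx hxy using hyψ
  obtain ⟨w, hw, χ, hχ, hlim⟩ := (isCompact_hull t.1).tendsto_subseq hx
  have hfw : t.2 w = z := by
    have h1 : Tendsto (fun n => t.2 (x (χ n))) atTop (𝓝 (t.2 w)) :=
      (hp.1.continuousOn w hw).tendsto.comp (tendsto_nhdsWithin_iff.2 ⟨hlim,
        Eventually.of_forall fun n => hx _⟩)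
    refine tendsto_nhds_unique h1 ?_
    simp only [hxy]
    exact hy.comp (hψ.tendsto_atTop.comp hχ.tendsto_atTop)
  obtain ⟨i, rfl⟩ : ∃ i, w = t.1 i := by
    by_contra! hcon
    exact hp.notMem_Z (fun e he => hE.subset_compl he) hw hcon (hfw ▸ hφ.mem_Z)
  obtain ⟨O, F, hO, hF, hOF⟩ := hp.exists_extension fun e he => hE.subset_compl he
  set A : Set ℂ := {x | x ∈ hull t.1 ∧ ∀ j, x ≠ t.1 j} with hA
  have hAc : Convex ℝ A := convex_iff_segment_subset.2 fun x hx y hy w hw =>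
    hp.segment_subset hx.1 hy.1 hx.2 hy.2 hw
  have hAx : ∀ n, x n ∈ A := fun n => ⟨hx n, fun j hj => hyZ (ψ n) (by
    rw [← hxy, hj]; exact hp.1.corner j)⟩
  obtain ⟨η, hη, hsq⟩ := hφ.square_near_end frequently_id_ne continuous_id (A := A) (w := t.1 i)
    (f := F) (fun η _ => (hAc.inter (convex_ball _ _)).isPreconnected)
    (mem_closure_of_tendsto hlim (Eventually.of_forall fun n => hAx _)) (fun a ha => hF a (hOF a ha.1 ha.2).1) (by
      rw [← hfw]
      refine (((hp.1.continuousOn _ hw).mono_left (nhdsWithin_mono _ fun a ha => ha.1))).congr' ?_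
      filter_upwards [self_mem_nhdsWithin] with a ha
      exact (hOF a ha.1 ha.2).2.symm)
  refine ⟨t.1, t.2, i, hp, hfw, ?_⟩
  have hev : ∃ᶠ n in atTop, x (χ n) ∈ ball (t.1 i) η :=
    (hlim.eventually (ball_mem_nhds _ hη)).frequently
  refine ((hψ.tendsto_atTop.comp hχ.tendsto_atTop).frequently (p := fun n => _) (hev.mono fun n hn => ?_))
  refine ⟨x (χ n), (hAx _).1, (hAx _).2, hxy _, η, hη, hn, fun x' hx' hxc hxη => ?_⟩
  have := (hsq x' ⟨⟨hx', hxc⟩, hxη⟩).self_of_nhds.2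
  rwa [(hOF x' hx' hxc).2] at this

end IsStraightTriangulation

/-- A vertical arc follows the vertical lines of a flat polygon. -/
theorem IsArc.exists_time (h : X.IsArc γ v)
    (hv : v.re = 0) {n : ℕ} {p : Fin n → ℂ} (hp : X.IsPolygon p f) {y y' : ℂ}
    (hy : y ∈ interior (hull p)) (hy' : y' ∈ interior (hull p))
    {t : ℝ} (ht : t ∈ Ioo (0 : ℝ) 1) (hty : γ t = f y) (hre : y'.re = y.re) :
    ∃ t' ∈ Ioo (0 : ℝ) 1, γ t' = f y' := by
  have hc := (convex_convexHull ℝ (range p)).interior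
  have hdev : ∀ w ∈ interior (hull p), w ∈ X.dom y f ∧ X.dev y f w = f w :=
    fun w hw => dev_eq isOpen_interior hc hy (fun x hx => hp.isFlatAt hx) (EventuallyEq.refl _ _) hw
  obtain ⟨ε, hε, hd, h0, h1⟩ := h.exists_dev ht (hdev y hy).1 hty.symm
  have hvi : v.im ≠ 0 := fun hi => h.ne_zero (Complex.ext hv hi)
  obtain ⟨e, he, hee⟩ : ∃ e : ℝ, (e : ℂ) = ε ∧ e * e = 1 := by
    rcases hε with rfl | rfl
    · exact ⟨1, by simp, by norm_num⟩
    · exact ⟨-1, by simp, by norm_num⟩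
  have hline : ∀ s : ℝ, y + ε * ((s : ℂ) - t) * v = ⟨y.re, y.im + e * (s - t) * v.im⟩ := by
    intro s
    rw [← he]
    apply Complex.ext <;> simp [hv]
  obtain ⟨s, hs⟩ : ∃ s : ℝ, y' = y + ε * ((s : ℂ) - t) * v := by
    refine ⟨t + e * ((y'.im - y.im) / v.im), ?_⟩
    rw [hline]
    refine Complex.ext hre ?_
    show y'.im = _
    field_simp
    linear_combination -(y'.im - y.im) * hee
  have hout : ∀ r : ℝ, y + ε * ((r : ℂ) - t) * v ∉ X.dom y f → r ∉ segment ℝ t s := by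
    intro r hr hrs
    apply hr
    refine (hdev _ (hc.segment_subset hy hy' ?_)).1
    rw [segment_eq_image_lineMap] at hrs ⊢
    obtain ⟨a, ha, rfl⟩ := hrs
    refine ⟨a, ha, ?_⟩
    rw [hs, lineMap_line]
    congr 3
    simp [lineMap_apply]
  have h0' := hout 0 (by simpa using h0)
  have h1' := hout 1 (by simpa using h1)
  rw [segment_eq_uIcc] at h0' h1'
  have hs01 : s ∈ Ioo (0 : ℝ) 1 := by
    constructor
    · by_contra hn
      exact h0' (mem_uIcc.2 (Or.inr ⟨not_lt.1 hn, ht.1.le⟩))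
    · by_contra hn
      exact h1' (mem_uIcc.2 (Or.inl ⟨ht.2.le, not_lt.1 hn⟩))
  refine ⟨s, hs01, ?_⟩
  rw [(hd s hs01).2, ← hs, (hdev y' hy').2]

/-- A vertical arc starts in a corner of a triangle. -/
theorem IsStaggered.exists_start
    (hE : X.IsStaggered E) (h : X.IsArc γ v) (hv : v.re = 0) :
    ∃ (p : Fin 3 → ℂ) (f : ℂ → S) (i : Fin 3), X.IsTriangle E p f ∧ ∃ δ > 0, δ < 1 ∧
      ∀ t ∈ Ioo (0 : ℝ) δ, p i + t * v ∈ interior (hull p) ∧ γ t = f (p i + t * v) := by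
  obtain ⟨k, φ, hφ⟩ := X.exists_isCone h.left
  have hnd := frequently_mul_ne h.ne_zero
  have htend : Tendsto γ (𝓝[Ioo 0 1] 0) (𝓝 (γ 0)) :=
    (h.continuousOn 0 (by simp)).mono_left (nhdsWithin_mono _ Ioo_subset_Icc_self)
  obtain ⟨η, hη, hsq⟩ := hφ.square_near_end hnd (continuous_mul_right_ofReal v) (A := Ioo (0 : ℝ) 1)
    (w := 0) (fun η _ => (((convex_Ioo 0 1).inter (convex_ball _ _)).isPreconnected))
    (by rw [closure_Ioo zero_ne_one]; simp) h.flat htend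
  have hsq' : ∀ t ∈ Ioo (0 : ℝ) 1, t < η → φ (γ t) ^ k = (t * v) ^ 2 := by
    intro t ht htη
    have := (hsq t ⟨ht, by rw [mem_ball, dist_zero_right, Real.norm_of_nonneg ht.1.le]
                           exact htη⟩).self_of_nhds.2
    simpa using this
  have hlim01 : ∀ n : ℕ, (1 : ℝ) / ((n : ℝ) + 2) ∈ Ioo (0 : ℝ) 1 := by
    intro n
    have : (0 : ℝ) < (n : ℝ) + 2 := by positivity
    refine ⟨by positivity, ?_⟩
    rw [div_lt_one this]
    linarith [n.cast_nonneg (α := ℝ)]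
  have hlim : Tendsto (fun n : ℕ => (1 : ℝ) / ((n : ℝ) + 2)) atTop (𝓝[Ioo 0 1] 0) :=
    tendsto_nhdsWithin_iff.2 ⟨tendsto_const_nhds.div_atTop (tendsto_natCast_atTop_atTop.atTop_add
      tendsto_const_nhds), Eventually.of_forall hlim01⟩
  obtain ⟨p, f, i, hp, hpi, hfr⟩ := hE.1.exists_corner hφ (htend.comp hlim)
    (fun n => (h.flat _ (hlim01 n)).notMem)
  have hsmall : ∀ᶠ n : ℕ in atTop, (1 : ℝ) / ((n : ℝ) + 2) < η :=
    (hlim.mono_right nhdsWithin_le_nhds).eventually (gt_mem_nhds hη)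
  obtain ⟨n, ⟨x, hx, hxc, hxy, η', hη', hxη, hsqT⟩, hn⟩ := (hfr.and_eventually hsmall).exists
  set t₁ : ℝ := 1 / ((n : ℝ) + 2) with ht₁
  have ht01 : t₁ ∈ Ioo (0 : ℝ) 1 := hlim01 n
  have hxy : f x = γ t₁ := hxy
  have hxv : (x - p i) ^ 2 = (t₁ * v) ^ 2 := by
    rw [← hsqT x hx hxc hxη, hxy, hsq' t₁ ht01 hn]
  obtain ⟨ε, hε, hxε⟩ : ∃ ε : ℂ, (ε = 1 ∨ ε = -1) ∧ ε * x = ε * p i + t₁ * v := by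
    rcases sq_eq_sq_iff_eq_or_eq_neg.1 hxv with h | h
    · exact ⟨1, Or.inl rfl, by linear_combination h⟩
    · exact ⟨-1, Or.inr rfl, by linear_combination -h⟩
  have hsqε := sq_eq_one_of_sign hε
  have hT := hp.halfTr hε 0
  simp only [add_zero, sub_zero] at hT
  set q : Fin 3 → ℂ := fun i => ε * p i with hq
  set F : ℂ → S := fun w => f (ε * w) with hF
  have hull_iff : ∀ w, w ∈ hull q ↔ ε * w ∈ hull p := by
    intro w
    have := hull_halfTr p hε 0
    simp only [add_zero, sub_zero] at this
    rw [hq, this]; rfl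
  have hx₁ : q i + t₁ * v = ε * x := hxε.symm
  have hx₁h : q i + t₁ * v ∈ hull q := by
    rw [hull_iff, hx₁, ← mul_assoc, hsqε, one_mul]; exact hx
  have hF₁ : F (q i + t₁ * v) = γ t₁ := by
    rw [hx₁]; simp only [hF]; rw [← mul_assoc, hsqε, one_mul]; exact hxy
  have hsqF : ∀ t ∈ Ioo (0 : ℝ) 1, t ≤ t₁ → q i + t * v ∈ hull q →
      (∀ j, q i + t * v ≠ q j) → φ (F (q i + t * v)) ^ k = (t * v) ^ 2 := by
    intro t ht htt hm hc
    have e1 : ε * (q i + t * v) = p i + t * (ε * v) := by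
      simp only [hq]; linear_combination p i * hsqε
    have h1 := hsqT (ε * (q i + t * v)) ((hull_iff _).1 hm) (fun j hj => hc j (by
        simp only [hq] at hj ⊢
        rw [← hj]; linear_combination -(ε * p i + t * v) * hsqε)) (by
      rw [e1, mem_ball, dist_eq_norm, add_sub_cancel_left, norm_mul, norm_mul,
        norm_of_sign hε, one_mul]
      have h2 : x - p i = t₁ * (ε * v) := by
        linear_combination ε * hxε + (p i - x) * hsqε
      rw [mem_ball, dist_eq_norm, h2, norm_mul, norm_mul, norm_of_sign hε, one_mul] at hxη
      refine lt_of_le_of_lt (mul_le_mul_of_nonneg_right ?_ (norm_nonneg _)) hxη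
      rw [norm_real, norm_real, Real.norm_of_nonneg ht.1.le, Real.norm_of_nonneg ht01.1.le]
      exact htt)
    simp only [hF]
    rw [h1, e1]
    linear_combination (t * v) ^ 2 * hsqε
  have hint : ∀ t ∈ Ioo (0 : ℝ) t₁, q i + t * v ∈ interior (hull q) := by
    intro t ht
    have hs := fun j => hE.2 _ (hT.2.1 j) _ (hT.saddle hE.1.saddle j)
    have hvi : v.im ≠ 0 := fun hi => h.ne_zero (Complex.ext hv hi)
    have c1 : ∀ t : ℝ, cr (q i) (q (i + 1)) (q i + t * v) = t * ((q (i + 1) - q i).re * v.im) := by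
      intro t; simp [cr_eq, hv]; ring
    have e2 : i + 2 + 1 = i := by fin_cases i <;> rfl
    have c2 : ∀ t : ℝ, cr (q (i + 2)) (q (i + 2 + 1)) (q i + t * v) =
        t * ((q (i + 2 + 1) - q (i + 2)).re * v.im) := by
      intro t; rw [e2]; simp [cr_eq, hv]; ring
    have m := (mem_tri hT.pos).1 hx₁h
    have m1 := m i
    have m2 := m (i + 2)
    have m3 := m (i + 1)
    rw [c1] at m1
    rw [c2] at m2
    have p1 : 0 < (q (i + 1) - q i).re * v.im :=
      lt_of_le_of_ne (nonneg_of_mul_nonneg_right m1 ht01.1) (mul_ne_zero (hs i) hvi).symm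
    have p2 : 0 < (q (i + 2 + 1) - q (i + 2)).re * v.im :=
      lt_of_le_of_ne (nonneg_of_mul_nonneg_right m2 ht01.1) (mul_ne_zero (hs (i + 2)) hvi).symm
    have p3 : 0 < cr (q (i + 1)) (q (i + 2)) (q i) := by
      have := tri_pos hT.pos i
      rwa [← cr_rotate] at this
    have e3 : i + 1 + 1 = i + 2 := by fin_cases i <;> rfl
    rw [e3] at m3
    have e4 : q i + t * v = lineMap (q i) (q i + t₁ * v) (t / t₁) := by
      have : (t₁ : ℂ) ≠ 0 := by exact_mod_cast ht01.1.ne'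
      simp [lineMap_apply]; field_simp; ring
    have c3 : 0 < cr (q (i + 1)) (q (i + 2)) (q i + t * v) := by
      rw [e4, cr_lineMap]
      have a1 : t / t₁ < 1 := (div_lt_one ht01.1).2 ht.2
      have a2 : 0 < t / t₁ := div_pos ht.1 ht01.1
      have a3 : 0 < 1 - t / t₁ := by linarith
      have a4 := mul_pos a3 p3
      have a5 := mul_nonneg a2.le m3
      linarith
    rw [mem_interior_tri hT.pos]
    have : ∀ j, j = i ∨ j = i + 1 ∨ j = i + 2 := by
      intro j; fin_cases i <;> fin_cases j <;> simp
    intro j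
    rcases this j with rfl | rfl | rfl
    · rw [c1]; exact mul_pos ht.1 p1
    · rw [e3]; exact c3
    · rw [c2]; exact mul_pos ht.1 p2
  have hx₁c : ∀ j, q i + t₁ * v ≠ q j := fun j hj => by
    apply (h.flat t₁ ht01).notMem
    rw [← hF₁, hj]; exact hT.1.corner j
  obtain ⟨O, G, hO, hG, hOG⟩ := hT.exists_extension fun e he => hE.1.subset_compl he
  have hG₁ : X.IsFlatAt id G (q i + t₁ * v) := hG _ (hOG _ hx₁h hx₁c).1
  have hGγ : γ t₁ = G (q i + t₁ * v) := by rw [(hOG _ hx₁h hx₁c).2, hF₁]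
  obtain ⟨ε', hε', hgerm⟩ := hG₁.germ_eq (h.flat t₁ ht01) (continuous_mul_right_ofReal v).continuousAt
    hGγ
  have hε'1 : ε' = 1 := by
    rcases hε' with h' | h'
    · exact h'
    exfalso
    rw [h'] at hgerm
    have hev : ∀ᶠ t in 𝓝 t₁, t < 1 ∧ t < η ∧ t < 2 * t₁ ∧ 0 < t := by
      filter_upwards [gt_mem_nhds ht01.2, gt_mem_nhds hn, lt_mem_nhds ht01.1,
        gt_mem_nhds (show t₁ < 2 * t₁ by linarith [ht01.1])] with t h1 h2 h3 h4
      exact ⟨h1, h2, h4, h3⟩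
    obtain ⟨t, ⟨ht, ht1, htη, ht2, ht0⟩, htt⟩ := ((hgerm.and hev).filter_mono
      nhdsWithin_le_nhds |>.and (self_mem_nhdsWithin (s := Ioi t₁))).exists
    have htt : t₁ < t := htt
    have e1 : q i + t₁ * v + -1 * ((t : ℂ) * v - t₁ * v) = q i + ((2 * t₁ - t : ℝ) : ℂ) * v := by
      push_cast; ring
    rw [e1] at ht
    have hm := hint (2 * t₁ - t) ⟨by linarith, by linarith⟩
    have hmc := hT.interior_ne hm
    rw [(hOG _ (interior_subset hm) hmc).2] at ht
    have s1 := hsq' t ⟨ht0, ht1⟩ htη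
    have s2 := hsqF (2 * t₁ - t) ⟨by linarith, by linarith [ht01.2]⟩ (by linarith)
      (interior_subset hm) hmc
    rw [ht, s2, mul_pow, mul_pow] at s1
    have s3 := mul_right_cancel₀ (pow_ne_zero 2 h.ne_zero) s1
    have s4 : (2 * t₁ - t) ^ 2 = t ^ 2 := by exact_mod_cast s3
    nlinarith [ht01.1]
  rw [hε'1] at hgerm
  refine ⟨q, F, i, hT, t₁, ht01.1, ht01.2, fun t ht => ⟨hint t ht, ?_⟩⟩
  have hlineflat : ∀ s ∈ Ioc (0 : ℝ) t₁, q i + s * v ∈ O := by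
    intro s hs
    rcases hs.2.eq_or_lt with rfl | hlt
    · exact (hOG _ hx₁h hx₁c).1
    · have hm := hint s ⟨hs.1, hlt⟩
      exact (hOG _ (interior_subset hm) (hT.interior_ne hm)).1
  have heq := eqOn_of_isFlatAt (g := fun s : ℝ => (s : ℂ) * v) (γ₁ := γ)
    (γ₂ := fun s : ℝ => G (q i + s * v)) (J := Ioc (0 : ℝ) t₁) (convex_Ioc _ _).isPreconnected hnd
    (fun s hs => h.flat s ⟨hs.1, hs.2.trans_lt ht01.2⟩)
    (fun s hs => (hG _ (hlineflat s hs)).comp (k := fun s : ℝ => q i + s * v) (by fun_prop)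
      (ε := 1) (c := q i) (Or.inl rfl) (Eventually.of_forall fun s => by simp; ring))
    (show t₁ ∈ Ioc (0 : ℝ) t₁ from ⟨ht01.1, le_rfl⟩) (by
      filter_upwards [hgerm] with s hs
      rw [hs]; congr 1; ring) t ⟨ht.1, ht.2.le⟩
  have hm := hint t ht
  rw [heq.self_of_nhds]
  exact (hOG _ (interior_subset hm) (hT.interior_ne hm)).2

theorem isClosed_union_edges (hfin : E.Finite)
    (hs : ∀ e ∈ E, ∃ v, X.IsSaddle e v) : IsClosed (X.Z ∪ ⋃₀ E) := by
  have : X.Z ∪ ⋃₀ E = X.Z ∪ ⋃ e ∈ E, (X.Z ∪ e) := by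
    ext x
    simp only [mem_union, mem_sUnion, mem_iUnion, exists_prop]
    constructor
    · rintro (h | ⟨e, he, h⟩)
      exacts [Or.inl h, Or.inr ⟨e, he, Or.inr h⟩]
    · rintro (h | ⟨e, he, h | h⟩)
      exacts [Or.inl h, Or.inl h, Or.inr ⟨e, he, h⟩]
  rw [this]
  exact X.finite_Z.isClosed.union (hfin.isClosed_biUnion fun e he =>
    (hs e he).choose_spec.isClosed_union)

/-- The times at which a path crosses the edges. -/
def crossings (γ : ℝ → S) (E : Set (Set S)) : Set ℝ := {t | t ∈ Ioo (0 : ℝ) 1 ∧ γ t ∈ ⋃₀ E}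

/-- A vertical arc crosses the edges of a staggered triangulation finitely often. -/
theorem IsStaggered.finite_crossings
    (hE : X.IsStaggered E) (h : X.IsArc γ v) (hv : v.re = 0) :
    (crossings γ E).Finite := by
  by_contra hinf
  have hsub : crossings γ E ⊆ Icc 0 1 := fun t ht => Ioo_subset_Icc_self ht.1
  obtain ⟨x, hx, hacc⟩ := Set.Infinite.exists_accPt_of_subset_isCompact hinf isCompact_Icc hsub
  rw [accPt_iff_frequently] at hacc
  refine hacc ?_
  rcases hx.1.eq_or_lt with rfl | hx0
  · obtain ⟨p, f, i, hT, δ, hδ, -, hs⟩ := hE.exists_start h hv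
    filter_upwards [gt_mem_nhds hδ] with t ht
    rintro ⟨-, ht01, hte⟩
    obtain ⟨h1, h2⟩ := hs t ⟨ht01.1, ht⟩
    exact disjoint_left.1 hT.2.2 ⟨_, h1, h2.symm⟩ hte
  rcases hx.2.eq_or_lt with rfl | hx1
  · obtain ⟨p, f, i, hT, δ, hδ, -, hs⟩ := hE.exists_start h.reverse hv
    filter_upwards [lt_mem_nhds (show 1 - δ < 1 by linarith)] with t ht
    rintro ⟨-, ht01, hte⟩
    obtain ⟨h1, h2⟩ := hs (1 - t) ⟨by linarith [ht01.2], by linarith⟩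
    simp only [sub_sub_cancel] at h2
    exact disjoint_left.1 hT.2.2 ⟨_, h1, h2.symm⟩ hte
  have hflat := h.flat x ⟨hx0, hx1⟩
  by_cases hxe : γ x ∈ ⋃₀ E
  · obtain ⟨e, he, hxe⟩ := hxe
    obtain ⟨δ, hδ, g, hg, hgf⟩ := X.exists_germ hflat.notMem 0
    have hb := X.base_mem_dom hδ hgf (mem_ball_self hδ)
    obtain ⟨w, hw⟩ := hE.1.saddle e he
    obtain ⟨a₀, a₁, hfr, hav⟩ := hw.exists_frame hb (hg ▸ hxe)
    obtain ⟨ε, hε, hd, -⟩ := h.exists_dev ⟨hx0, hx1⟩ hb hg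
    have hc : Tendsto (fun t : ℝ => (0 : ℂ) + ε * ((t : ℂ) - x) * v) (𝓝 x) (𝓝 0) := by
      have : Continuous fun t : ℝ => (0 : ℂ) + ε * ((t : ℂ) - x) * v := by fun_prop
      have := this.tendsto x
      simpa using this
    filter_upwards [hc.eventually (hE.1.eventually_mem_edges he hfr)] with t ht
    rintro ⟨htx, ht01, hte⟩
    rw [(hd t ht01).2] at hte
    have h1 := ht.2.1 hte
    have hvi : v.im ≠ 0 := fun hi => h.ne_zero (Complex.ext hv hi)
    have hw0 : (a₁ - a₀).re ≠ 0 := hav ▸ hE.2 e he w hw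
    have h2 := hfr.cr_base
    rw [sub_re] at hw0
    have : (a₁.re - a₀.re) * ((t - x) * v.im) = 0 := by
      rcases hε with rfl | rfl
      · simp [cr_eq, hv] at h1 h2
        linear_combination h1 - h2
      · simp [cr_eq, hv] at h1 h2
        linear_combination h2 - h1
    rcases mul_eq_zero.1 this with h3 | h3
    · exact hw0 h3
    · rcases mul_eq_zero.1 h3 with h3 | h3
      · exact htx (sub_eq_zero.1 h3)
      · exact hvi h3
  · have : γ x ∉ X.Z ∪ ⋃₀ E := by
      rintro (h | h)
      exacts [hflat.notMem h, hxe h]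
    filter_upwards [hflat.1.eventually ((isClosed_union_edges hE.1.finite hE.1.saddle).isOpen_compl.mem_nhds this)]
      with t ht
    rintro ⟨-, -, hte⟩
    exact ht (Or.inr hte)

namespace IsFlipQuad

variable {p : Fin 4 → ℂ}

/-- Below or above a point of the new diagonal lies a point of the old diagonal. -/
theorem exists_re_eq (hE : X.IsStaggered E)
    (h : X.IsFlipQuad E E' p f) {x : ℝ} (hx : x ∈ segment ℝ (p 1).re (p 3).re) :
    ∃ y ∈ seg (p 0) (p 2), y.re = x := by
  have hb : x ∈ seg (p 0).re (p 2).re := by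
    rw [segment_eq_uIcc, mem_uIcc] at hx
    rcases lt_or_gt_of_ne (h.re_ne hE) with h1 | h1
    · obtain ⟨⟨a1, a2⟩, a3, a4⟩ := h.re_lt hE h1
      rw [openSegment_eq_Ioo h1]
      rcases hx with hx | hx <;> exact ⟨by linarith, by linarith⟩
    · obtain ⟨⟨a1, a2⟩, a3, a4⟩ := h.re_gt hE h1
      rw [openSegment_symm, openSegment_eq_Ioo h1]
      rcases hx with hx | hx <;> exact ⟨by linarith, by linarith⟩
  obtain ⟨a, b, ha, hb, hab, rfl⟩ := hb
  exact ⟨a • p 0 + b • p 2, ⟨a, b, ha, hb, hab, rfl⟩, by simp⟩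

/-- Vertical crossings of the new diagonal come from crossings of the old one. -/
theorem exists_crossing (hE : X.IsStaggered E)
    (h : X.IsFlipQuad E E' p f) (hγ : X.IsArc γ v) (hv : v.re = 0) {t : ℝ}
    (ht : t ∈ Ioo (0 : ℝ) 1) {y : ℂ} (hy : y ∈ seg (p 1) (p 3)) (hty : γ t = f y) :
    ∃ t' ∈ Ioo (0 : ℝ) 1, ∃ y' ∈ seg (p 0) (p 2), γ t' = f y' ∧ y'.re = y.re := by
  have hp := h.1.quadPos
  have hyQ : y ∈ interior (hull p) := by
    have := IsQuad.diag_subset hp.rotate hy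
    rwa [range_rotate p 1] at this
  have hyr : y.re ∈ segment ℝ (p 1).re (p 3).re := by
    obtain ⟨a, b, ha, hb, hab, rfl⟩ := hy
    exact ⟨a, b, ha.le, hb.le, hab, by simp⟩
  obtain ⟨y', hy', hre⟩ := h.exists_re_eq hE hyr
  obtain ⟨t', ht', hty'⟩ := hγ.exists_time hv h.1.1 hyQ (IsQuad.diag_subset hp hy') ht hty hre
  exact ⟨t', ht', y', hy', hty', hre⟩

open Classical in
/-- A flip does not increase the number of crossings with a vertical arc. -/
theorem ncard_crossings (hE : X.IsStaggered E)
    (hE' : X.IsStaggered E') (h : X.IsFlipQuad E E' p f) (hγ : X.IsArc γ v)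
    (hv : v.re = 0) : (crossings γ E').ncard ≤ (crossings γ E).ncard ∧
      ((∃ t ∈ Ioo (0 : ℝ) 1, ∃ y ∈ seg (p 0) (p 2), γ t = f y ∧ y.re = (p 1).re) →
        (crossings γ E').ncard < (crossings γ E).ncard) := by
  have hp := h.1.quadPos
  have hflip := (h.1.flip hE.1 h.2.2)
  have hex : ∀ t : ℝ, ∃ t' : ℝ, t ∈ crossings γ E' → t' ∈ crossings γ E ∧
      ((γ t ∉ f '' seg (p 1) (p 3) ∧ t' = t) ∨ ∃ y ∈ seg (p 1) (p 3), γ t = f y ∧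
        ∃ y' ∈ seg (p 0) (p 2), γ t' = f y' ∧ y'.re = y.re) := by
    intro t
    by_cases ht : t ∈ crossings γ E'
    swap
    · exact ⟨0, fun h => absurd h ht⟩
    by_cases htd : γ t ∈ f '' seg (p 1) (p 3)
    · obtain ⟨y, hy, hyt⟩ := htd
      obtain ⟨t', ht', y', hy', h1, h2⟩ := h.exists_crossing hE hγ hv ht.1 hy hyt.symm
      exact ⟨t', fun _ => ⟨⟨ht', _, h.1.2.2.1, y', hy', h1.symm⟩, Or.inr ⟨y, hy, hyt.symm, y', hy', h1, h2⟩⟩⟩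
    · refine ⟨t, fun _ => ⟨⟨ht.1, ?_⟩, Or.inl ⟨htd, rfl⟩⟩⟩
      obtain ⟨-, e, he, hte⟩ := ht
      rw [h.2.2] at he
      rcases he with rfl | he
      · exact absurd hte htd
      · exact ⟨e, he.1, hte⟩
  choose φ hφ using hex
  have hold : ∀ t ∈ crossings γ E', γ t ∉ f '' seg (p 1) (p 3) →
      γ t ∉ f '' seg (p 0) (p 2) := by
    rintro t ⟨-, e, he, hte⟩ htd htd'
    rw [h.2.2] at he
    rcases he with rfl | he
    · exact htd hte
    · exact he.2 (hE.1.eq_of_mem he.1 h.1.2.2.1 hte htd')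
  have hQ : ∀ y ∈ seg (p 0) (p 2), y ∈ interior (hull p) := fun y hy => IsQuad.diag_subset hp hy
  have hline : ∀ y₁ ∈ seg (p 1) (p 3), ∀ y₂ ∈ seg (p 1) (p 3), y₁.re = y₂.re →
      y₁ = y₂ := by
    intro y₁ hy₁ y₂ hy₂ he
    obtain ⟨s, -, rfl⟩ := openSegment_lineMap hy₁
    obtain ⟨r, -, rfl⟩ := openSegment_lineMap hy₂
    have hne := sub_ne_zero.2 (h.re_ne' hE hE').symm
    congr 1
    simp only [lineMap_apply, real_smul, vsub_eq_sub, vadd_eq_add, add_re,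
      re_ofReal_mul, sub_re] at he
    exact mul_right_cancel₀ hne (by linarith)
  have hinj : InjOn φ (crossings γ E') := by
    intro t₁ ht₁ t₂ ht₂ he
    obtain ⟨-, ⟨h1, h1'⟩ | ⟨y₁, hy₁, h1, y₁', hy₁', h1', hr₁⟩⟩ := hφ t₁ ht₁ <;>
      obtain ⟨-, ⟨h2, h2'⟩ | ⟨y₂, hy₂, h2, y₂', hy₂', h2', hr₂⟩⟩ := hφ t₂ ht₂
    · rw [← h1', ← h2', he]
    · exact absurd ⟨y₂', hy₂', by rw [← h2', ← he, h1']⟩ (hold t₁ ht₁ h1)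
    · exact absurd ⟨y₁', hy₁', by rw [← h1', he, h2']⟩ (hold t₂ ht₂ h2)
    · have e1 := h.1.1.injOn (hQ _ hy₁') (hQ _ hy₂') (by rw [← h1', he, h2'])
      have e2 := hline y₁ hy₁ y₂ hy₂ (by rw [← hr₁, e1, hr₂])
      exact hγ.injOn ht₁.1 ht₂.1 (by rw [h1, h2, e2])
  have hfin := hE.finite_crossings hγ hv
  refine ⟨ncard_le_ncard_of_injOn φ (fun t ht => (hφ t ht).1) hinj hfin, ?_⟩
  rintro ⟨t, ht, y, hy, hty, hyr⟩
  have htE : t ∈ crossings γ E := ⟨ht, _, h.1.2.2.1, y, hy, hty.symm⟩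
  refine (ncard_le_ncard_of_injOn φ (t := crossings γ E \ {t}) (fun t' ht' => ⟨(hφ t' ht').1, ?_⟩) hinj
    (hfin.subset sdiff_subset)).trans_lt (ncard_sdiff_singleton_lt_of_mem htE hfin)
  intro hφt
  have hφt : φ t' = t := hφt
  obtain ⟨-, ⟨h1, h1'⟩ | ⟨y₁, hy₁, h1, y₁', hy₁', h1', hr₁⟩⟩ := hφ t' ht'
  · refine hold t' ht' h1 ⟨y, hy, ?_⟩
    rw [← hty, ← hφt, h1']
  · have e1 := h.1.1.injOn (hQ _ hy₁') (hQ _ hy) (by rw [← h1', hφt, hty])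
    rw [e1, hyr] at hr₁
    obtain ⟨s, hs, rfl⟩ := openSegment_lineMap hy₁
    have hne := sub_ne_zero.2 (h.re_ne' hE hE').symm
    simp only [lineMap_apply, real_smul, vsub_eq_sub, vadd_eq_add, add_re,
      re_ofReal_mul, sub_re] at hr₁
    exact mul_ne_zero hs.1.ne' hne (by linarith)

end IsFlipQuad

/-- A surface with an infinite flip sequence of staggered triangulations is vertically Keane. -/
theorem IsStaggeredFlipSequence.verticallyKeane [ConnectedSpace S]
    (hτ : X.IsStaggeredFlipSequence τ) : X.VerticallyKeane := by
  intro e v he hv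
  obtain ⟨γ, hγ, -, -⟩ := he.exists_arc
  have hanti : Antitone fun n => (crossings γ (τ n)).ncard := antitone_nat_of_succ_le fun n => by
    obtain ⟨p, f, h⟩ := hτ.exists_flipQuad n
    exact (h.ncard_crossings (hτ.1 n) (hτ.1 (n + 1)) hγ hv).1
  have key : ∀ n, ∃ m, (crossings γ (τ m)).ncard < (crossings γ (τ n)).ncard := by
    intro n
    obtain ⟨p, f, i, hT, δ, hδ, hδ1, hs⟩ := (hτ.1 n).exists_start hγ hv
    set t₀ := δ / 2 with ht₀
    obtain ⟨hy, hty⟩ := hs t₀ ⟨by linarith, by linarith⟩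
    have ht01 : t₀ ∈ Ioo (0 : ℝ) 1 := ⟨by linarith, by linarith⟩
    set y := p i + t₀ * v with hydef
    have hyr : y.re = (p i).re := by simp [hydef, hv]
    have e2 : i + 2 + 1 = i := by fin_cases i <;> rfl
    have c1 := (mem_interior_tri hT.pos).1 hy i
    have c2 := (mem_interior_tri hT.pos).1 hy (i + 2)
    rw [e2] at c2
    rw [cr_eq, hyr] at c1 c2
    have c1' : 0 < ((p (i + 1)).re - (p i).re) * (y.im - (p i).im) := by linarith
    have c2' : 0 < ((p i).re - (p (i + 2)).re) * (y.im - (p i).im) := by linarith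
    set e := f '' seg (p (i + 1)) (p (i + 1 + 1)) with he
    have hmid : ∀ {m : ℕ} {P F}, X.IsFlipQuad (τ m) (τ (m + 1)) P F → X.IsTriangle (τ m) p f →
        ∀ k, f '' seg (p k) (p (k + 1)) = F '' seg (P 0) (P 2) →
        k = i + 1 ∧ ∃ q g, X.IsFlipQuad (τ m) (τ (m + 1)) q g ∧ q 2 = p (i + 1) ∧ q 0 = p (i + 2) ∧
          q 1 = p i ∧ EqOn f g (hull p) := by
      intro m P F hP hTm k hk
      obtain ⟨q, g, hq, h2, h0, h1, hfg⟩ := hP.exists_old hTm hk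
      have hki : k = i + 1 := by
        have hk3 : k = i ∨ k = i + 1 ∨ k = i + 2 := by
          clear * -
          fin_cases i <;> fin_cases k <;> simp
        have hq3 : ((q 0).re < (q 1).re ∧ (q 1).re < (q 2).re) ∨
            ((q 2).re < (q 1).re ∧ (q 1).re < (q 0).re) := by
          rcases lt_or_gt_of_ne (hq.re_ne (hτ.1 m)) with h | h
          · exact Or.inl (hq.re_lt (hτ.1 m) h).1
          · exact Or.inr (hq.re_gt (hτ.1 m) h).1
        rw [h2, h0, h1] at hq3
        rcases hk3 with rfl | rfl | rfl
        · exfalso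
          rcases pos_and_pos_or_neg_and_neg_of_mul_pos c1' with ⟨a1, a2⟩ | ⟨a1, a2⟩ <;>
          rcases pos_and_pos_or_neg_and_neg_of_mul_pos c2' with ⟨a3, a4⟩ | ⟨a3, a4⟩ <;>
          rcases hq3 with ⟨a5, a6⟩ | ⟨a5, a6⟩ <;> linarith
        · rfl
        · exfalso
          have e3 : i + 2 + 2 = i + 1 := by clear * -; fin_cases i <;> rfl
          rw [e2, e3] at hq3
          rcases pos_and_pos_or_neg_and_neg_of_mul_pos c1' with ⟨a1, a2⟩ | ⟨a1, a2⟩ <;>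
          rcases pos_and_pos_or_neg_and_neg_of_mul_pos c2' with ⟨a3, a4⟩ | ⟨a3, a4⟩ <;>
          rcases hq3 with ⟨a5, a6⟩ | ⟨a5, a6⟩ <;> linarith
      subst hki
      have e3 : i + 1 + 1 = i + 2 := by clear * -; fin_cases i <;> rfl
      have e4 : i + 1 + 2 = i := by clear * -; fin_cases i <;> rfl
      rw [e3] at h0
      rw [e4] at h1
      exact ⟨rfl, q, g, hq, h2, h0, h1, hfg⟩
    obtain ⟨m₀, hm₀, hem₀⟩ := hτ.exists_notMem (n := n) e
    have hex : ∃ j, e ∉ τ (n + j) := ⟨m₀ - n, by rwa [Nat.add_sub_cancel' hm₀]⟩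
    classical
    have hmem : ∀ j < Nat.find hex, e ∈ τ (n + j) := fun j hj => not_not.1 (Nat.find_min hex hj)
    have hpos : Nat.find hex ≠ 0 := by
      intro h0
      have := Nat.find_spec hex
      rw [h0] at this
      exact this (hT.2.1 (i + 1))
    obtain ⟨J, hJ⟩ := Nat.exists_eq_succ_of_ne_zero hpos
    have hTj : ∀ j ≤ J, X.IsTriangle (τ (n + j)) p f := by
      intro j hj
      induction j with
      | zero => exact hT
      | succ j ih =>
        have ih := ih (by omega)
        obtain ⟨P, F, hP⟩ := hτ.exists_flipQuad (n + j)
        refine hP.persists ih fun k hk => ?_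
        obtain ⟨rfl, -⟩ := hmid hP ih k hk
        have h1 := hmem (j + 1) (by omega)
        rw [← add_assoc, hP.2.2, he, hk] at h1
        rcases h1 with h1 | h1
        · exact (hP.1.flip (hτ.1 _).1 hP.2.2).2.2 (h1 ▸ hP.1.2.2.1)
        · exact h1.2 rfl
    have hTJ := hTj J le_rfl
    obtain ⟨P, F, hP⟩ := hτ.exists_flipQuad (n + J)
    have heJ : e = F '' seg (P 0) (P 2) := by
      by_contra hne
      have h1 : e ∉ τ (n + J + 1) := by
        have := Nat.find_spec hex
        rwa [hJ] at this
      exact h1 (hP.2.2 ▸ Or.inr ⟨hTJ.2.1 (i + 1), hne⟩)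
    obtain ⟨-, q, g, hq, h2, h0, h1, hfg⟩ := hmid hP hTJ (i + 1) heJ
    refine ⟨n + J + 1, lt_of_lt_of_le ?_ (hanti (show n ≤ n + J by omega))⟩
    refine (hq.ncard_crossings (hτ.1 _) (hτ.1 _) hγ hv).2 ?_
    obtain ⟨y', hy', hre⟩ := hq.exists_re_eq (hτ.1 _) (left_mem_segment ℝ (q 1).re (q 3).re)
    have hyQ : y ∈ interior (hull q) := by
      have hr : range p ⊆ range q := by
        rintro _ ⟨j, rfl⟩
        have : j = i ∨ j = i + 1 ∨ j = i + 2 := by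
          clear * -
          fin_cases i <;> fin_cases j <;> simp
        rcases this with rfl | rfl | rfl
        exacts [⟨1, h1⟩, ⟨2, h2⟩, ⟨0, h0⟩]
      exact interior_mono (convexHull_mono hr) hy
    obtain ⟨t', ht', hty'⟩ := hγ.exists_time hv hq.1.1 hyQ (IsQuad.diag_subset hq.1.quadPos hy') ht01
      (hty.trans (hfg (interior_subset hy))) (by rw [hre, hyr, h1])
    exact ⟨t', ht', y', hy', hty', hre⟩
  obtain ⟨_, ⟨n, rfl⟩, hn⟩ := WellFounded.has_min (wellFounded_lt (α := ℕ))
    (range fun n => (crossings γ (τ n)).ncard) (range_nonempty _)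
  obtain ⟨m, hm⟩ := key n
  exact hn _ ⟨m, rfl⟩ hm

/-- A segment whose ends tend to marked points is a saddle connection. -/
theorem isSaddle_and_injOn_of_tendsto (hne : a₀ ≠ a₁)
    (hF : ∀ x ∈ seg a₀ a₁, X.IsFlatAt id F x) {z₀ z₁ : S} (hz₀ : z₀ ∈ X.Z)
    (hz₁ : z₁ ∈ X.Z) (h₀ : Tendsto F (𝓝[seg a₀ a₁] a₀) (𝓝 z₀))
    (h₁ : Tendsto F (𝓝[seg a₀ a₁] a₁) (𝓝 z₁)) :
    X.IsSaddle (F '' seg a₀ a₁) (a₁ - a₀) ∧ InjOn F (seg a₀ a₁) := by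
  set L : ℝ → ℂ := fun t => a₀ + t * (a₁ - a₀) with hL
  have hLc : Continuous L := by fun_prop
  have hLi : L '' Ioo 0 1 = seg a₀ a₁ := by
    rw [openSegment_eq_image_lineMap]
    refine image_congr fun t _ => ?_
    simp [hL, lineMap_apply]; ring
  have hLm : ∀ t ∈ Ioo (0 : ℝ) 1, L t ∈ seg a₀ a₁ := fun t ht => hLi ▸ ⟨t, ht, rfl⟩
  have hfl : ∀ t ∈ Ioo (0 : ℝ) 1, X.IsFlatAt (fun s : ℝ => (s : ℂ) * (a₁ - a₀)) (fun s => F (L s)) t :=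
    fun t ht => (hF _ (hLm t ht)).comp hLc.continuousAt (ε := 1) (c := a₀) (Or.inl rfl)
      (Eventually.of_forall fun s => by simp [hL]; ring)
  have ht₀ : Tendsto (fun s => F (L s)) (𝓝[>] 0) (𝓝 z₀) := by
    refine h₀.comp (tendsto_nhdsWithin_iff.2 ⟨?_, ?_⟩)
    · have := hLc.tendsto 0
      simp only [hL, ofReal_zero, zero_mul, add_zero] at this
      exact this.mono_left nhdsWithin_le_nhds
    · filter_upwards [Ioo_mem_nhdsGT (zero_lt_one' ℝ)] with t ht using hLm t ht
  have ht₁ : Tendsto (fun s => F (L s)) (𝓝[<] 1) (𝓝 z₁) := by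
    refine h₁.comp (tendsto_nhdsWithin_iff.2 ⟨?_, ?_⟩)
    · have := hLc.tendsto 1
      simp only [hL, Complex.ofReal_one, one_mul, add_sub_cancel] at this
      exact this.mono_left nhdsWithin_le_nhds
    · filter_upwards [Ioo_mem_nhdsLT (zero_lt_one' ℝ)] with t ht using hLm t ht
  have hcont : ContinuousOn (fun s => F (L s)) (Ioo 0 1) := fun t ht =>
    (hfl t ht).1.continuousWithinAt
  set γ := extendFrom (Ioo (0 : ℝ) 1) fun s => F (L s) with hγ
  have hγe : ∀ t ∈ Ioo (0 : ℝ) 1, γ t = F (L t) := fun t ht =>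
    extendFrom_extends hcont t ht
  have harc : X.IsArc γ (a₁ - a₀) := by
    refine ⟨sub_ne_zero.2 hne.symm, continuousOn_Icc_extendFrom_Ioo hcont ht₀ ht₁, ?_, ?_,
      fun t ht => ?_⟩
    · rw [hγ, eq_lim_at_left_extendFrom_Ioo zero_lt_one ht₀]; exact hz₀
    · rw [hγ, eq_lim_at_right_extendFrom_Ioo zero_lt_one ht₁]; exact hz₁
    · refine (hfl t ht).congr ?_
      filter_upwards [isOpen_Ioo.mem_nhds ht] with s hs using hγe s hs
  have := harc.isSaddle
  rw [image_congr hγe, ← image_image, hLi] at this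
  refine ⟨this, hLi ▸ ?_⟩
  rintro _ ⟨t, ht, rfl⟩ _ ⟨s, hs, rfl⟩ hts
  rw [harc.injOn ht hs (by rw [hγe t ht, hγe s hs, hts])]

theorem isSaddle_of_tendsto (hne : a₀ ≠ a₁)
    (hF : ∀ x ∈ seg a₀ a₁, X.IsFlatAt id F x) {z₀ z₁ : S} (hz₀ : z₀ ∈ X.Z)
    (hz₁ : z₁ ∈ X.Z) (h₀ : Tendsto F (𝓝[seg a₀ a₁] a₀) (𝓝 z₀))
    (h₁ : Tendsto F (𝓝[seg a₀ a₁] a₁) (𝓝 z₁)) :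
    X.IsSaddle (F '' seg a₀ a₁) (a₁ - a₀) :=
  (isSaddle_and_injOn_of_tendsto hne hF hz₀ hz₁ h₀ h₁).1

/-- On a vertically Keane surface no vertical segment ends on both sides. -/
theorem VerticallyKeane.mem_dom (hX : X.VerticallyKeane)
    (hg : 0 ∈ X.dom 0 g) (hv : v.re = 0) : v ∈ X.dom 0 g ∨ -v ∈ X.dom 0 g := by
  by_contra! hcon
  obtain ⟨t, ht0, -, ht, hs⟩ := exists_first_exit hg hcon.1
  obtain ⟨t', ht0', -, ht', hs'⟩ := exists_first_exit hg hcon.2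
  have hv0 : v ≠ 0 := by
    rintro rfl; exact hcon.1 hg
  have hL : ∀ (r : ℝ) (u : ℂ), lineMap (0 : ℂ) u r = r * u := by
    intro r u; simp [lineMap_apply]
  simp only [hL] at ht hs ht' hs'
  have hsub : seg ((t' : ℂ) * -v) (t * v) ⊆ X.dom 0 g := by
    intro x hx
    obtain ⟨a, ⟨ha0, ha1⟩, rfl⟩ := openSegment_lineMap hx
    have e : lineMap ((t' : ℂ) * -v) ((t : ℂ) * v) a = ((a * t - (1 - a) * t' : ℝ) : ℂ) * v := by
      simp [lineMap_apply]; ring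
    rw [e]
    have h1 : 0 < 1 - a := by linarith
    rcases le_total 0 (a * t - (1 - a) * t') with h | h
    · exact hs _ h (by nlinarith)
    · have := hs' (-(a * t - (1 - a) * t')) (by linarith) (by nlinarith)
      convert this using 1
      push_cast; ring
  have h0m : (0 : ℂ) ∈ seg ((t' : ℂ) * -v) (t * v) := by
    rw [openSegment_eq_image_lineMap]
    refine ⟨t' / (t' + t), ⟨by positivity, (div_lt_one (by positivity)).2 (by linarith)⟩, ?_⟩
    have : (t' : ℂ) + t ≠ 0 := by exact_mod_cast (add_pos ht0' ht0).ne'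
    simp [lineMap_apply]; field_simp; ring
  have hne : (t' : ℂ) * -v ≠ t * v := by
    intro h
    have : ((t' : ℂ) + t) * v = 0 := by linear_combination -h
    rcases mul_eq_zero.1 this with h | h
    · have : t' + t = 0 := by exact_mod_cast h
      linarith
    · exact hv0 h
  have hc := convex_openSegment (𝕜 := ℝ) ((t' : ℂ) * -v) (t * v)
  have hhalf : ∀ u, u ∈ closure (seg ((t' : ℂ) * -v) (t * v)) → u ∉ X.dom 0 g →
      halfOpen 0 u ⊆ seg ((t' : ℂ) * -v) (t * v) := by
    rintro u hu hud _ ⟨r, ⟨hr0, hr1⟩, rfl⟩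
    rw [closure_openSegment] at hu
    have hu0 : u = t' * -v ∨ u = t * v := by
      by_contra! hn
      exact hud (hsub (mem_openSegment_of_ne_left_right hn.1.symm hn.2.symm hu))
    obtain ⟨a, ⟨ha0, ha1⟩, hae⟩ := openSegment_lineMap h0m
    rw [openSegment_eq_image_lineMap]
    have hae' : (1 - a) * t' = a * t := by
      have e : ((a * t - (1 - a) * t' : ℝ) : ℂ) * v = 0 := by
        rw [hae]; simp [lineMap_apply]; ring
      have := (mul_eq_zero.1 e).resolve_right hv0
      have : a * t - (1 - a) * t' = 0 := by exact_mod_cast this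
      linarith
    have hae'' : ((1 - a) * t' : ℂ) = a * t := by exact_mod_cast hae'
    rcases hu0 with rfl | rfl
    · refine ⟨(1 - r) * a, ⟨mul_pos (by linarith) ha0, by nlinarith⟩, ?_⟩
      simp [lineMap_apply]
      linear_combination -((1 - r) * v : ℂ) * hae''
    · refine ⟨(1 - r) * a + r, ⟨by nlinarith, by nlinarith⟩, ?_⟩
      simp [lineMap_apply]
      linear_combination -((1 - r) * v : ℂ) * hae''
  obtain ⟨z₀, hz₀, hz₀'⟩ := tendsto_of_visible ht' hc (hhalf _ (by
    rw [closure_openSegment]; exact left_mem_segment ℝ _ _) ht') hsub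
  obtain ⟨z₁, hz₁, hz₁'⟩ := tendsto_of_visible ht hc (hhalf _ (by
    rw [closure_openSegment]; exact right_mem_segment ℝ _ _) ht) hsub
  refine hX _ _ (isSaddle_of_tendsto hne (fun x hx => flat_dev (hsub hx)) hz₀ hz₁ hz₀' hz₁') ?_
  simp [hv]

/-- Saddle connections of bounded height on a vertically Keane surface have widths bounded below. -/
theorem VerticallyKeane.exists_width (hX : X.VerticallyKeane) (H : ℝ) :
    ∃ ε > 0, ∀ e v, X.IsSaddle e v → |v.im| ≤ H → ε ≤ |v.re| := by
  by_contra! hcon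
  have hch : ∀ n : ℕ, ∃ (γ : ℝ → S) (v : ℂ), X.IsArc γ v ∧ |v.im| ≤ H ∧ |v.re| < 1 / ((n : ℝ) + 1) := by
    intro n
    obtain ⟨e, v, he, h1, h2⟩ := hcon (1 / ((n : ℝ) + 1)) (by positivity)
    obtain ⟨γ, hγ, -⟩ := he.exists_arc
    exact ⟨γ, v, hγ, h1, h2⟩
  choose γ v hγ hvH hvn using hch
  set U : Ultrafilter ℕ := hyperfilter ℕ with hU
  have hUtop : (U : Filter ℕ) ≤ atTop := by
    rw [hU, ← Nat.cofinite_eq_atTop]; exact hyperfilter_le_cofinite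
  have hlim1 : Tendsto (fun n : ℕ => 1 / ((n : ℝ) + 1)) U (𝓝 0) :=
    tendsto_one_div_add_atTop_nhds_zero_nat.mono_left hUtop
  have hvb : ∀ n, ‖v n‖ ≤ 1 + H := by
    intro n
    refine (Complex.norm_le_abs_re_add_abs_im _).trans (add_le_add ((hvn n).le.trans ?_) (hvH n))
    rw [div_le_one (by positivity)]
    have : (0 : ℝ) ≤ n := n.cast_nonneg
    linarith
  obtain ⟨w, -, hw⟩ := (isCompact_closedBall (0 : ℂ) (1 + H)).ultrafilter_le_nhds (U.map v)
    (le_principal_iff.2 (show ∀ᶠ n in (U : Filter ℕ), v n ∈ closedBall 0 (1 + H) from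
      Eventually.of_forall fun n => by simpa using hvb n))
  have hvw : Tendsto v U (𝓝 w) := hw
  have hwre : w.re = 0 := by
    have h1 : Tendsto (fun n => |(v n).re|) U (𝓝 |w.re|) :=
      ((by fun_prop : Continuous fun u : ℂ => |u.re|).tendsto w).comp hvw
    have h2 := le_of_tendsto_of_tendsto' h1 hlim1 fun n => (hvn n).le
    exact abs_eq_zero.1 (le_antisymm h2 (abs_nonneg _))
  obtain ⟨z, hz, hzU⟩ : ∃ z ∈ X.Z, ∀ᶠ n in U, γ n 0 = z := by
    have h1 : (⋃ z ∈ X.Z, {n | γ n 0 = z}) ∈ U := by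
      refine Filter.mem_of_superset univ_mem fun n _ => ?_
      exact mem_biUnion (hγ n).left rfl
    obtain ⟨z, hz, h⟩ := (Ultrafilter.finite_biUnion_mem_iff X.finite_Z).1 h1
    exact ⟨z, hz, h⟩
  obtain ⟨k, φ, hφ⟩ := X.exists_isCone hz
  obtain ⟨ρ, hρ0, hρ⟩ := hφ.exists_radius
  have hk0 : k ≠ 0 := by have := hφ.one_le; omega
  have hstart : ∀ n, γ n 0 = z → ∀ t₁ ≤ (1 : ℝ), (∀ t ∈ Ioo (0 : ℝ) t₁, ‖(t : ℂ) * v n‖ ^ 2 < ρ ^ k) →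
      ∀ t ∈ Ioo (0 : ℝ) t₁, ∀ᶠ s in 𝓝 t, γ n s ∈ φ.source ∧ φ (γ n s) ^ k = ((s : ℂ) * v n - 0) ^ 2 := by
    intro n hn t₁ ht₁ hsm t ht
    have hnd := frequently_mul_ne (hγ n).ne_zero
    have h01 : (0 : ℝ) < t₁ := ht.1.trans ht.2
    have hsub : Ioo (0 : ℝ) t₁ ⊆ Ioo 0 1 := Ioo_subset_Ioo_right ht₁
    have htend : Tendsto (γ n) (𝓝[Ioo 0 t₁] 0) (𝓝 z) := by
      rw [← hn]
      exact ((hγ n).continuousOn 0 (by simp)).mono_left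
        (nhdsWithin_mono _ (hsub.trans Ioo_subset_Icc_self))
    obtain ⟨η, hη, hsq⟩ := hφ.square_near_end hnd (continuous_mul_right_ofReal (v n))
      (A := Ioo (0 : ℝ) t₁) (w := 0)
      (fun η _ => (((convex_Ioo 0 t₁).inter (convex_ball _ _)).isPreconnected))
      (by rw [closure_Ioo h01.ne]; exact ⟨le_rfl, h01.le⟩) (fun t ht => (hγ n).flat t (hsub ht)) htend
    have hmin : 0 < min η t₁ := lt_min hη h01
    have ha₀ : min η t₁ / 2 ∈ Ioo (0 : ℝ) t₁ := ⟨by linarith, by linarith [min_le_right η t₁]⟩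
    refine hφ.square_of_norm_lt hρ0 hρ hnd (continuous_mul_right_ofReal (v n)) (convex_Ioo 0 t₁).isPreconnected
      (fun t ht => (hγ n).flat t (hsub ht)) ha₀ ?_ (fun t ht => by simpa using hsm t ht) t ht
    have := hsq _ ⟨ha₀, by
      rw [mem_ball, dist_zero_right, Real.norm_of_nonneg ha₀.1.le]
      linarith [min_le_left η t₁]⟩
    simpa using this
  have hvρ : ∀ n, γ n 0 = z → ρ ^ k ≤ ‖v n‖ ^ 2 := by
    intro n hn
    by_contra! hlt
    have hsm : ∀ t ∈ Ioo (0 : ℝ) 1, ‖(t : ℂ) * v n‖ ^ 2 < ρ ^ k := by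
      intro t ht
      refine lt_of_le_of_lt ?_ hlt
      rw [norm_mul, norm_real, Real.norm_of_nonneg ht.1.le]
      exact pow_le_pow_left₀ (by have := ht.1.le; positivity)
        (mul_le_of_le_one_left (norm_nonneg _) ht.2.le) 2
    have h1 := hφ.square_of_tendsto hρ0 hρ (continuous_mul_right_ofReal (v n)) (w := 1)
      (hstart n hn 1 le_rfl hsm) (fun t ht => by simpa using hsm t ht) (by
        rw [closure_Ioo zero_ne_one]; simp) (((hγ n).continuousOn 1 (by simp)).mono_left
        (nhdsWithin_mono _ Ioo_subset_Icc_self))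
    have h2 := hφ.eq_of_mem h1.1 (hγ n).right
    have h3 := h1.2
    rw [h2, hφ.map_zero, zero_pow hk0] at h3
    simp only [Complex.ofReal_one, one_mul, sub_zero] at h3
    exact (hγ n).ne_zero (pow_eq_zero_iff two_ne_zero |>.1 h3.symm)
  have hwρ : ρ ^ k ≤ ‖w‖ ^ 2 :=
    ge_of_tendsto (((by fun_prop : Continuous fun u : ℂ => ‖u‖ ^ 2).tendsto w).comp hvw)
      (hzU.mono fun n hn => hvρ n hn)
  have hw0 : w ≠ 0 := by
    rintro rfl
    have : 0 < ρ ^ k := pow_pos hρ0 k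
    simp at hwρ; linarith
  obtain ⟨t₁, ⟨ht₁1, ht₁ρ⟩, ht₁0⟩ : ∃ t₁ : ℝ, (t₁ < 1 ∧ (t₁ * (1 + H)) ^ 2 < ρ ^ k) ∧ 0 < t₁ := by
    have hc : Continuous fun t : ℝ => (t * (1 + H)) ^ 2 := by fun_prop
    have h1 := hc.tendsto 0
    simp only [zero_mul, ne_eq, OfNat.ofNat_ne_zero, not_false_eq_true, zero_pow] at h1
    have h2 := h1.eventually (gt_mem_nhds (pow_pos hρ0 k))
    exact (((gt_mem_nhds zero_lt_one).and h2).filter_mono nhdsWithin_le_nhds |>.and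
      (self_mem_nhdsWithin (s := Ioi (0 : ℝ)))).exists
  set t₀ := t₁ / 2 with ht₀
  have ht01 : t₀ ∈ Ioo (0 : ℝ) 1 := ⟨by linarith, by linarith⟩
  have hH : 0 ≤ 1 + H := (norm_nonneg _).trans (hvb 0)
  have hsmall : ∀ n, ∀ t ∈ Ioo (0 : ℝ) t₁, ‖(t : ℂ) * v n‖ ^ 2 < ρ ^ k := by
    intro n t ht
    refine lt_of_le_of_lt ?_ ht₁ρ
    rw [norm_mul, norm_real, Real.norm_of_nonneg ht.1.le]
    exact pow_le_pow_left₀ (by have := ht.1.le; positivity)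
      (mul_le_mul ht.2.le (hvb n) (norm_nonneg _) ht₁0.le) 2
  have hx₀ : ∀ n, γ n 0 = z → γ n t₀ ∈ φ.source ∧ φ (γ n t₀) ^ k = ((t₀ : ℂ) * v n) ^ 2 := by
    intro n hn
    have := (hstart n hn t₁ ht₁1.le (hsmall n) t₀ ⟨by linarith, by linarith⟩).self_of_nhds
    simpa using this
  obtain ⟨x, -, hx⟩ := isCompact_univ.ultrafilter_le_nhds (U.map fun n => γ n t₀) (by simp)
  have hx : Tendsto (fun n => γ n t₀) U (𝓝 x) := hx
  have hxs : x ∈ φ.source := by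
    refine IsCone.mem_source_of_mem_closure hρ (s := {y | y ∈ φ.source ∧ ‖φ y‖ ≤ ρ}) (fun y hy => hy) (mem_closure_of_tendsto hx ?_)
    filter_upwards [hzU] with n hn
    obtain ⟨h1, h2⟩ := hx₀ n hn
    refine ⟨h1, IsCone.norm_le_of_square (b := 0) hρ0 (h2.trans (by rw [sub_zero])) ?_⟩
    rw [sub_zero]; exact hsmall n t₀ ⟨by linarith, by linarith⟩
  have hxφ : φ x ^ k = ((t₀ : ℂ) * w) ^ 2 := by
    have h1 : Tendsto (fun n => φ (γ n t₀) ^ k) U (𝓝 (φ x ^ k)) :=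
      ((φ.continuousAt hxs).tendsto.comp hx).pow k
    have h2 : Tendsto (fun n => ((t₀ : ℂ) * v n) ^ 2) U (𝓝 (((t₀ : ℂ) * w) ^ 2)) :=
      (hvw.const_mul _).pow 2
    refine tendsto_nhds_unique (h1.congr' ?_) h2
    filter_upwards [hzU] with n hn using (hx₀ n hn).2
  have hxZ : x ∉ X.Z := by
    intro h
    have h2 := hφ.eq_of_mem hxs h
    rw [h2, hφ.map_zero, zero_pow hk0] at hxφ
    have h3 := pow_eq_zero_iff two_ne_zero |>.1 hxφ.symm
    rcases mul_eq_zero.1 h3 with h4 | h4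
    · exact ht01.1.ne' (by exact_mod_cast h4)
    · exact hw0 h4
  obtain ⟨δ, hδ, g, hg, hgf⟩ := X.exists_germ hxZ 0
  have hb := X.base_mem_dom hδ hgf (mem_ball_self hδ)
  have key : ∀ σ : ℂ, (σ = 1 ∨ σ = -1) → σ * w ∉ X.dom 0 g := by
    rintro σ hσ ⟨V, F, hV, hVc, h0V, hwV, hVF, hFg⟩
    have hFx : F 0 = x := hFg.self_of_nhds.trans hg
    obtain ⟨r, hr, hrV⟩ := Metric.isOpen_iff.1 hV _ hwV
    have h1 : F '' (V ∩ ball 0 (r / 2)) ∈ 𝓝 x := by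
      rw [← hFx, ← (hVF 0 h0V).map_nhds]
      exact image_mem_map ((hV.inter isOpen_ball).mem_nhds
        ⟨h0V, mem_ball_self (by linarith)⟩)
    obtain ⟨n, ⟨b, ⟨hbV, hbr⟩, hbx⟩, hvn⟩ := ((hx.eventually h1).and
      (hvw.eventually (ball_mem_nhds w (show 0 < r / 2 by linarith)))).exists
    have hbx : F b = γ n t₀ := hbx
    have hbv : b + σ * v n ∈ V := by
      apply hrV
      rw [mem_ball, dist_eq_norm]
      have e : b + σ * v n - σ * w = b + σ * (v n - w) := by ring
      rw [e]
      refine (norm_add_le _ _).trans_lt ?_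
      rw [norm_mul, norm_of_sign hσ, one_mul]
      rw [mem_ball, dist_eq_norm] at hbr
      rw [dist_eq_norm] at hvn
      rw [sub_zero] at hbr
      linarith
    have hdV : ∀ u ∈ V, u ∈ X.dom b F := fun u hu =>
      (dev_eq hV hVc hbV hVF (EventuallyEq.refl _ F) hu).1
    have hseg : ∀ r : ℝ, 0 ≤ r → r ≤ 1 → b + r * (σ * v n) ∈ V := by
      intro r hr0 hr1
      refine hVc.segment_subset hbV hbv ?_
      rw [segment_eq_image_lineMap]
      exact ⟨r, ⟨hr0, hr1⟩, by simp [lineMap_apply]; ring⟩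
    obtain ⟨ε, hε, -, hd0, hd1⟩ := (hγ n).exists_dev ht01 (hdV b hbV) hbx
    by_cases hεσ : ε = σ
    · apply hd1
      convert hdV _ (hseg (1 - t₀) (by linarith [ht01.2]) (by linarith [ht01.1])) using 1
      rw [hεσ]; push_cast; ring
    · have : ε = -σ := by
        rcases hε with rfl | rfl <;> rcases hσ with rfl | rfl <;> simp_all
      apply hd0
      convert hdV _ (hseg t₀ ht01.1.le ht01.2.le) using 1
      rw [this]; ring
  rcases hX.mem_dom hb hwre with h | h
  · exact key 1 (Or.inl rfl) (by rwa [one_mul])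
  · exact key (-1) (Or.inr rfl) (by rwa [neg_one_mul])

/-- A sequence of slopes growing at most linearly does not allow the widths to stay positive. -/
theorem false_of_slopes {G : ℝ × ℝ → Prop} {w ε K : ℝ} (hε : 0 < ε)
    (h0 : ∃ x, G x) (hG : ∀ x, G x → w ≤ x.1 ∧ 0 ≤ x.2 ∧ ∃ y, G y ∧ y.2 ≤ x.2 + K ∧
      ∃ a > 0, y.1 ≤ x.1 - a ∧ (ε ≤ a ∨ 1 ≤ x.2 * a)) : False := by
  obtain ⟨x₀, hx₀⟩ := h0
  choose! hw hm f hf hfK a ha hfa hfε using hG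
  set x : ℕ → ℝ × ℝ := fun k => f^[k] x₀ with hx
  have hxs : ∀ k, x (k + 1) = f (x k) := fun k => Function.iterate_succ_apply' f k x₀
  have hxG : ∀ k, G (x k) := by
    intro k
    induction k with
    | zero => exact hx₀
    | succ k ih => rw [hxs]; exact hf _ ih
  set C : ℝ := max x₀.2 K + 1 with hC
  have hC1 : 0 < C := by
    have := (hm _ hx₀).trans (le_max_left x₀.2 K); linarith
  have hmC : ∀ k : ℕ, (x k).2 ≤ ((k : ℝ) + 1) * C := by
    intro k
    induction k with
    | zero => simp only [Nat.cast_zero, zero_add, one_mul]; exact (le_max_left x₀.2 K).trans (by linarith)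
    | succ k ih =>
      rw [hxs]
      have h1 := hfK _ (hxG k)
      have h2 : K ≤ C := (le_max_right x₀.2 K).trans (by linarith)
      push_cast; linarith
  set c : ℝ := min ε (1 / C) with hc
  have hc0 : 0 < c := lt_min hε (by positivity)
  have hac : ∀ k : ℕ, c * (1 / ((k : ℝ) + 1)) ≤ a (x k) := by
    intro k
    have hk : (0 : ℝ) < (k : ℝ) + 1 := by positivity
    rcases hfε _ (hxG k) with h | h
    · refine le_trans ?_ ((min_le_left ε (1 / C)).trans h)
      refine mul_le_of_le_one_right hc0.le ?_
      rw [div_le_one hk]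
      have : (0 : ℝ) ≤ k := k.cast_nonneg
      linarith
    · have h1 : 1 ≤ ((k : ℝ) + 1) * C * a (x k) :=
        h.trans (mul_le_mul_of_nonneg_right (hmC k) (ha _ (hxG k)).le)
      refine le_trans (mul_le_mul_of_nonneg_right (min_le_right ε (1 / C)) (by positivity)) ?_
      rw [div_mul_div_comm, one_mul, div_le_iff₀ (by positivity)]
      linarith
  have hsum : ∀ n, (x n).1 + ∑ k ∈ Finset.range n, c * (1 / ((k : ℝ) + 1)) ≤ (x 0).1 := by
    intro n
    induction n with
    | zero => simp
    | succ n ih =>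
      rw [Finset.sum_range_succ, hxs]
      have := hfa _ (hxG n)
      linarith [hac n]
  have hdiv := (Real.tendsto_sum_range_one_div_nat_succ_atTop.const_mul_atTop hc0).eventually_gt_atTop
    ((x 0).1 - w)
  obtain ⟨n, hn⟩ := hdiv.exists
  rw [Finset.mul_sum] at hn
  linarith [hsum n, hw _ (hxG n)]

/-- The flip of a wide edge: estimates for the slopes and widths. -/
theorem IsFlipQuad.slope_step
    (hE : X.IsStaggered E) (hE' : X.IsStaggered E') {p : Fin 4 → ℂ}
    (h : X.IsFlipQuad E E' p f) (hlt : (p 0).re < (p 2).re) {w H ε A : ℝ} (hw : 0 < w)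
    (hε : ∀ e ∈ E, ∀ v, X.IsSaddle e v → |v.im| ≤ H → ε ≤ |v.re|)
    (hA : ∀ q g, X.IsTriangle E q g → cr (q 0) (q 1) (q 2) ≤ A) (hH : A / w + 1 ≤ H)
    (hw0 : w ≤ (p 2).re - (p 0).re) (hw1 : w ≤ |(p 3).re - (p 1).re|) :
    |(p 3).im - (p 1).im| / |(p 3).re - (p 1).re| ≤
        |(p 2).im - (p 0).im| / ((p 2).re - (p 0).re) + 2 * A / w ^ 2 ∧
      ∃ a > 0, |(p 3).re - (p 1).re| ≤ (p 2).re - (p 0).re - a ∧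
        (ε ≤ a ∨ 1 ≤ |(p 2).im - (p 0).im| / ((p 2).re - (p 0).re) * a) := by
  obtain ⟨⟨h1, h2⟩, h3, h4⟩ := h.re_lt hE hlt
  set U := (p 2).re - (p 0).re with hU
  have hU0 : 0 < U := sub_pos.2 hlt
  set V := |(p 3).re - (p 1).re| with hV
  have hV0 : 0 < V := hw.trans_le hw1
  have hq := h.1.quadPos
  have a1 : cr (p 0) (p 1) (p 2) ≤ A := hA _ _ h.1.lower
  have a2 : cr (p 2) (p 3) (p 0) ≤ A := hA _ _ h.1.upper
  rw [cr_rotate] at a2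
  have a0 : 0 < A := hq.1.trans_le a1
  have b1 := hq.1
  have b2 := hq.2.2.1
  constructor
  · have key : |U * ((p 3).im - (p 1).im)| ≤ |(p 2).im - (p 0).im| * V + 2 * A := by
      have e : U * ((p 3).im - (p 1).im) = ((p 2).im - (p 0).im) * ((p 3).re - (p 1).re) +
          (cr (p 0) (p 1) (p 2) + cr (p 0) (p 2) (p 3)) := by
        simp only [cr_eq, hU]; ring
      rw [e, hV, ← abs_mul]
      refine (abs_add_le _ _).trans (add_le_add le_rfl ?_)
      rw [abs_of_pos (by linarith)]; linarith
    rw [abs_mul, abs_of_pos hU0] at key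
    have e : |(p 3).im - (p 1).im| / V ≤ |(p 2).im - (p 0).im| / U + 2 * A / (U * V) := by
      rw [div_add_div _ _ hU0.ne' (by positivity), div_le_div_iff₀ hV0 (by positivity)]
      have := mul_le_mul_of_nonneg_right key (mul_pos hV0 hV0).le
      have := mul_le_mul_of_nonneg_right this hU0.le
      nlinarith
    refine e.trans (add_le_add le_rfl ?_)
    refine div_le_div_of_nonneg_left (by linarith) (by positivity) ?_
    rw [pow_two]; exact mul_le_mul hw0 hw1 hw.le hU0.le
  · -- `s` is the side on the left
    have side : ∀ s : ℂ, (p 0).re < s.re → X.IsSaddle (f '' seg (p 0) s) (s - p 0) →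
        f '' seg (p 0) s ∈ E → |cr (p 0) (p 2) s| ≤ A →
        ε ≤ s.re - (p 0).re ∨ 1 ≤ |(p 2).im - (p 0).im| / U * (s.re - (p 0).re) := by
      intro s hs hsd hsE hcr
      by_cases him : |(s - p 0).im| ≤ H
      · left
        have := hε _ hsE _ hsd him
        rwa [sub_re, abs_of_pos (sub_pos.2 hs)] at this
      · right
        push Not at him
        rw [sub_im] at him
        have e : U * (s.im - (p 0).im) = ((p 2).im - (p 0).im) * (s.re - (p 0).re) +
            cr (p 0) (p 2) s := by
          simp only [cr_eq, hU]; ring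
        have e1 : U * |s.im - (p 0).im| ≤ |(p 2).im - (p 0).im| * (s.re - (p 0).re) + A := by
          rw [← abs_of_pos hU0, ← abs_mul, e]
          refine (abs_add_le _ _).trans (add_le_add ?_ hcr)
          rw [abs_mul, abs_of_pos (sub_pos.2 hs)]
        rw [div_mul_eq_mul_div, le_div_iff₀ hU0]
        have e2 : U * (A / w + 1) ≤ U * |s.im - (p 0).im| :=
          mul_le_mul_of_nonneg_left (hH.trans him.le) hU0.le
        have e3 : A ≤ U * (A / w) := by
          rw [mul_div_assoc', le_div_iff₀ hw]
          nlinarith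
        nlinarith
    have hs1 : X.IsSaddle (f '' seg (p 0) (p 1)) (p 1 - p 0) := h.1.lower.saddle hE.1.saddle 0
    have hs3 : X.IsSaddle (f '' seg (p 0) (p 3)) (p 3 - p 0) := by
      have := (h.1.upper.saddle hE.1.saddle 1).neg
      rw [neg_sub] at this
      rw [openSegment_symm]; exact this
    rcases lt_or_gt_of_ne (h.re_ne' hE hE') with hlt' | hlt'
    · refine ⟨(p 1).re - (p 0).re, sub_pos.2 h1, ?_, side (p 1) h1 hs1 (h.1.2.1 0) ?_⟩
      · rw [hV, abs_of_pos (sub_pos.2 hlt')]; linarith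
      · rw [← cr_rotate, cr_swap, cr_rotate, abs_neg, abs_of_pos b1]; exact a1
    · refine ⟨(p 3).re - (p 0).re, sub_pos.2 h3, ?_, side (p 3) h3 hs3 ?_ ?_⟩
      · rw [hV, abs_of_neg (sub_neg.2 hlt')]; linarith
      · rw [openSegment_symm]; exact h.1.2.1 3
      · rw [abs_of_pos b2]; exact a2

namespace IsStaggeredFlipSequence

variable (hτ : X.IsStaggeredFlipSequence τ)
include hτ

/-- An edge is flipped at some later time. -/
theorem exists_flip [ConnectedSpace S] {n : ℕ}
    (he : e ∈ τ n) : ∃ m ≥ n, ∃ p f, X.IsFlipQuad (τ m) (τ (m + 1)) p f ∧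
      f '' seg (p 0) (p 2) = e ∧ (p 0).re < (p 2).re := by
  classical
  obtain ⟨m₀, hm₀, hem₀⟩ := hτ.exists_notMem (n := n) e
  have hex : ∃ j, e ∉ τ (n + j) := ⟨m₀ - n, by rwa [Nat.add_sub_cancel' hm₀]⟩
  have hpos : Nat.find hex ≠ 0 := by
    intro h0
    have := Nat.find_spec hex
    rw [h0] at this
    exact this he
  obtain ⟨J, hJ⟩ := Nat.exists_eq_succ_of_ne_zero hpos
  have hmem : e ∈ τ (n + J) := not_not.1 (Nat.find_min hex (by omega))
  obtain ⟨P, F, hP⟩ := hτ.exists_flipQuad (n + J)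
  have heJ : F '' seg (P 0) (P 2) = e := by
    by_contra hne
    have h1 : e ∉ τ (n + J + 1) := by
      have := Nat.find_spec hex
      rwa [hJ] at this
    exact h1 (hP.2.2 ▸ Or.inr ⟨hmem, Ne.symm hne⟩)
  rcases lt_or_gt_of_ne (hP.re_ne (hτ.1 _)) with hlt | hlt
  · exact ⟨n + J, Nat.le_add_right _ _, P, F, hP, heJ, hlt⟩
  · refine ⟨n + J, Nat.le_add_right _ _, _, F, hP.rotate_two, ?_, hlt⟩
    rw [openSegment_symm]; exact heJ

/-- The edges of width at least `w` disappear. -/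
theorem exists_width_lt [ConnectedSpace S] {w : ℝ} (hw : 0 < w) :
    ∃ N, ∀ n ≥ N, ∀ e ∈ τ n, ∀ v, X.IsSaddle e v → |v.re| < w := by
  set W : ℕ → Set (Set S) := fun n => {e | e ∈ τ n ∧ ∃ v, X.IsSaddle e v ∧ w ≤ |v.re|} with hW
  have hsad : ∀ {e : Set S} {v v' : ℂ}, X.IsSaddle e v → X.IsSaddle e v' → |v'.re| = |v.re| := by
    intro e v v' h h'
    rcases h.holonomy_eq h' with rfl | rfl
    · rfl
    · rw [neg_re, abs_neg]
  have hnarrow : ∀ {n p f}, X.IsFlipQuad (τ n) (τ (n + 1)) p f →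
      f '' seg (p 1) (p 3) ∈ W (n + 1) → f '' seg (p 0) (p 2) ∈ W n := by
    rintro n p f h ⟨-, v, hv, hvw⟩
    refine ⟨h.1.2.2.1, _, h.saddle_old (hτ.1 n).1, ?_⟩
    rw [hsad (h.saddle_new (hτ.1 n).1 (hτ.1 (n + 1)).1) hv] at hvw
    refine hvw.trans ?_
    rw [sub_re, sub_re]
    rcases lt_or_gt_of_ne (h.re_ne (hτ.1 n)) with hlt | hlt
    · obtain ⟨⟨h1, h2⟩, h3, h4⟩ := h.re_lt (hτ.1 n) hlt
      rw [abs_of_pos (sub_pos.2 hlt), abs_le]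
      constructor <;> linarith
    · obtain ⟨⟨h1, h2⟩, h3, h4⟩ := h.re_gt (hτ.1 n) hlt
      rw [abs_of_neg (sub_neg.2 hlt), abs_le]
      constructor <;> linarith
  have hWfin : ∀ n, (W n).Finite := fun n => (hτ.1 n).1.finite.subset fun e he => he.1
  have hsub : ∀ {n p f}, X.IsFlipQuad (τ n) (τ (n + 1)) p f →
      W (n + 1) ⊆ insert (f '' seg (p 1) (p 3))
        (W n \ {f '' seg (p 0) (p 2)}) := by
    rintro n p f h e ⟨he, hev⟩
    rw [h.2.2] at he
    rcases he with rfl | he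
    · exact Or.inl rfl
    · exact Or.inr ⟨⟨he.1, hev⟩, he.2⟩
  have hcard : ∀ n, (W (n + 1)).ncard ≤ (W n).ncard ∧ ∀ {p f}, X.IsFlipQuad (τ n) (τ (n + 1)) p f →
      f '' seg (p 0) (p 2) ∈ W n → (W n).ncard ≤ (W (n + 1)).ncard →
      f '' seg (p 1) (p 3) ∈ W (n + 1) := by
    intro n
    have hlt : ∀ {p f}, X.IsFlipQuad (τ n) (τ (n + 1)) p f →
        f '' seg (p 1) (p 3) ∉ W (n + 1) →
        W (n + 1) ⊆ W n \ {f '' seg (p 0) (p 2)} := by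
      intro p f h hd e he
      rcases hsub h he with rfl | h1
      · exact absurd he hd
      · exact h1
    constructor
    · obtain ⟨p, f, h⟩ := hτ.exists_flipQuad n
      by_cases hd : f '' seg (p 1) (p 3) ∈ W (n + 1)
      · refine (ncard_le_ncard (hsub h) (((hWfin n).subset sdiff_subset).insert _)).trans ?_
        refine (ncard_insert_le _ _).trans ?_
        rw [ncard_sdiff_singleton_add_one (hnarrow h hd) (hWfin n)]
      · exact ncard_le_ncard ((hlt h hd).trans sdiff_subset) (hWfin n)
    · intro p f h hd' hle
      by_contra hd
      have h1 := ncard_le_ncard (hlt h hd) ((hWfin n).subset sdiff_subset)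
      have h2 := ncard_sdiff_singleton_lt_of_mem hd' (hWfin n)
      omega
  by_contra! hcon
  have hne : ∀ n, (W n).Nonempty := by
    intro n
    obtain ⟨m, hm, e, he, v, hv, hvw⟩ := hcon n
    have hback : ∀ m, (W (m + 1)).Nonempty → (W m).Nonempty := by
      rintro m ⟨e, he⟩
      obtain ⟨p, f, h⟩ := hτ.exists_flipQuad m
      rcases hsub h he with rfl | h1
      · exact ⟨_, hnarrow h he⟩
      · exact ⟨e, h1.1⟩
    obtain ⟨j, rfl⟩ := Nat.exists_eq_add_of_le hm
    have : ∀ j, (W (n + j)).Nonempty → (W n).Nonempty := by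
      intro j
      induction j with
      | zero => exact id
      | succ j ih => exact fun h => ih (hback _ h)
    exact this j ⟨e, he, v, hv, hvw⟩
  obtain ⟨N, hN⟩ : ∃ N, ∀ n ≥ N, (W n).ncard ≤ (W (n + 1)).ncard := by
    obtain ⟨N, hN⟩ := Nat.sInf_mem (range_nonempty fun n => (W n).ncard)
    refine ⟨N, fun n hn => ?_⟩
    have h1 : (W n).ncard ≤ (W N).ncard := antitone_nat_of_succ_le (f := fun n => (W n).ncard) (fun n => (hcard n).1) hn
    exact (h1.trans_eq hN).trans (Nat.sInf_le ⟨n + 1, rfl⟩)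
  obtain ⟨ε, hε, hεs⟩ := hτ.verticallyKeane.exists_width (totalArea X (τ 0) / w + 1)
  refine false_of_slopes (w := w) (K := 2 * totalArea X (τ 0) / w ^ 2) (G := fun x => ∃ n ≥ N, ∃ p f,
    X.IsFlipQuad (τ n) (τ (n + 1)) p f ∧ (p 0).re < (p 2).re ∧
      f '' seg (p 0) (p 2) ∈ W n ∧ x = ((p 2).re - (p 0).re,
        |(p 2).im - (p 0).im| / ((p 2).re - (p 0).re))) hε ?_ ?_
  · obtain ⟨e, he, v, hv, hvw⟩ := hne N
    obtain ⟨m, hm, p, f, h, rfl, hlt⟩ := hτ.exists_flip he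
    exact ⟨_, m, hm, p, f, h, hlt, ⟨h.1.2.2.1, v, hv, hvw⟩, rfl⟩
  · rintro _ ⟨n, hn, p, f, h, hlt, hd, rfl⟩
    have hs0 := h.saddle_old (hτ.1 n).1
    have hs1 := h.saddle_new (hτ.1 n).1 (hτ.1 (n + 1)).1
    have hd' := (hcard n).2 h hd (hN n hn)
    obtain ⟨-, v, hv, hvw⟩ := hd
    rw [hsad hs0 hv, sub_re, abs_of_pos (sub_pos.2 hlt)] at hvw
    obtain ⟨hd1, v', hv', hvw'⟩ := id hd'
    rw [hsad hs1 hv', sub_re] at hvw'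
    refine ⟨hvw, div_nonneg (abs_nonneg _) (sub_pos.2 hlt).le, ?_⟩
    obtain ⟨m, hm, p', f', h', he, hlt'⟩ := hτ.exists_flip hd1
    have hs2 := h'.saddle_old (hτ.1 m).1
    rw [he] at hs2
    have e1 : (p' 2).re - (p' 0).re = |(p 3).re - (p 1).re| := by
      have := hsad hs1 hs2
      rwa [sub_re, sub_re, abs_of_pos (sub_pos.2 hlt')] at this
    have e2 : |(p' 2).im - (p' 0).im| = |(p 3).im - (p 1).im| := by
      rcases hs1.holonomy_eq hs2 with h | h
      · rw [← sub_im, h, sub_im]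
      · rw [← sub_im, h, neg_im, abs_neg, sub_im]
    obtain ⟨k1, a, ha, k2, k3⟩ := h.slope_step (hτ.1 n) (hτ.1 (n + 1)) hlt hw
      (fun e _ v hv => hεs e v hv) (fun q g hq => hτ.totalArea_eq n ▸ IsTriangle.area_le (hτ.1 n).1 hq)
      le_rfl hvw hvw'
    refine ⟨_, ⟨m, by omega, p', f', h', hlt', ?_, rfl⟩, ?_, a, ha, ?_, k3⟩
    · rw [he]
      exact ⟨he ▸ h'.1.2.2.1, v', hv', hd'.2.elim fun v h => (hsad hv' h.1) ▸ h.2⟩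
    · simp only [e1, e2]; exact k1
    · simp only [e1]; exact k2

end IsStaggeredFlipSequence

/-- The sides of `p` have slopes of sign `σ`, and the area of `p` is small relative to its height. -/
def IsMono (σ c : ℝ) (p : Fin 3 → ℂ) : Prop :=
  (∀ i, 0 < σ * ((p (i + 1) - p i).re * (p (i + 1) - p i).im)) ∧
    ∃ i, cr (p 0) (p 1) (p 2) ≤ c * |(p (i + 1) - p i).im|

theorem IsMono.rotate {σ c : ℝ} (h : IsMono σ c p) (j : Fin 3) :
    IsMono σ c (fun i => p (i + j)) := by
  have e : ∀ i, i + 1 + j = i + j + 1 := fun i => add_right_comm _ _ _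
  refine ⟨fun i => by simpa only [e] using h.1 (i + j), ?_⟩
  obtain ⟨i, hi⟩ := h.2
  refine ⟨i - j, ?_⟩
  have e1 : cr (p (0 + j)) (p (1 + j)) (p (2 + j)) = cr (p 0) (p 1) (p 2) := by
    clear * -
    fin_cases j
    · rfl
    · exact cr_rotate _ _ _
    · exact (cr_rotate _ _ _).symm
  simp only [e, sub_add_cancel]
  rwa [e1]

theorem IsMono.halfTr {σ c : ℝ} (h : IsMono σ c p) (hε : ε = 1 ∨ ε = -1)
    (d : ℂ) : IsMono σ c (fun i => ε * p i + d) := by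
  have e : ∀ i, ((ε * p (i + 1) + d) - (ε * p i + d)) = ε * (p (i + 1) - p i) := fun i => by ring
  refine ⟨fun i => ?_, ?_⟩
  · simp only [e]
    rcases hε with rfl | rfl
    · simpa only [one_mul] using h.1 i
    · simpa only [neg_one_mul, neg_re, neg_im, neg_mul_neg] using h.1 i
  · obtain ⟨i, hi⟩ := h.2
    refine ⟨i, ?_⟩
    simp only [e, cr_halfTr hε]
    rcases hε with rfl | rfl
    · rwa [one_mul]
    · rwa [neg_one_mul, neg_im, abs_neg]

/-- A monochromatic triangle created by a forward flip comes from a monochromatic triangle. -/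
theorem IsMono.parent {σ c : ℝ} {q : Fin 4 → ℂ} (hq : QuadPos q) (hσ : σ = 1 ∨ σ = -1)
    (h01 : (q 0).re < (q 1).re) (h03 : (q 0).re < (q 3).re) (h12 : (q 1).re < (q 2).re)
    (h32 : (q 3).re < (q 2).re) (h : IsMono σ c ![q 1, q 2, q 3]) :
    IsMono σ c ![q 0, q 1, q 2] ∨ IsMono σ c ![q 2, q 3, q 0] := by
  obtain ⟨k1, k2, k3, k4⟩ := hq
  obtain ⟨h1, i, hi⟩ := h
  have s0 : 0 < σ * (((q 2).re - (q 1).re) * ((q 2).im - (q 1).im)) := h1 0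
  have s1 : 0 < σ * (((q 3).re - (q 2).re) * ((q 3).im - (q 2).im)) := h1 1
  have s2 : 0 < σ * (((q 1).re - (q 3).re) * ((q 1).im - (q 3).im)) := h1 2
  have t0 : 0 < σ * ((q 2).im - (q 1).im) := by
    rw [mul_left_comm] at s0; exact (pos_iff_pos_of_mul_pos s0).1 (sub_pos.2 h12)
  have t1 : 0 < σ * ((q 2).im - (q 3).im) := by
    rw [mul_left_comm] at s1; nlinarith [(neg_iff_neg_of_mul_pos s1).1 (sub_neg.2 h32)]
  rw [mul_left_comm] at s2
  have hi' : (cr (q 1) (q 2) (q 3) ≤ c * |(q 2).im - (q 1).im| ∨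
      cr (q 1) (q 2) (q 3) ≤ c * |(q 3).im - (q 2).im|) ∨
      cr (q 1) (q 2) (q 3) ≤ c * |(q 1).im - (q 3).im| := by
    clear * - hi
    fin_cases i
    · exact Or.inl (Or.inl hi)
    · exact Or.inl (Or.inr hi)
    · exact Or.inr hi
  have a0 : |(q 2).im - (q 1).im| = σ * ((q 2).im - (q 1).im) := by
    rw [← abs_of_pos t0, abs_mul]; rcases hσ with rfl | rfl <;> simp
  have a1 : |(q 3).im - (q 2).im| = σ * ((q 2).im - (q 3).im) := by
    rw [← abs_of_pos t1, abs_mul, abs_sub_comm]; rcases hσ with rfl | rfl <;> simp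
  rw [a0, a1] at hi'
  have hc : 0 < c := by
    by_contra hc
    push Not at hc
    rcases hi' with (h | h) | h
    · nlinarith
    · nlinarith
    · nlinarith [abs_nonneg ((q 1).im - (q 3).im)]
  have h31 : (q 3).re ≠ (q 1).re := fun h => by rw [h] at s2; simp at s2
  rcases lt_or_gt_of_ne h31 with hlt | hlt
  · left
    have t2 : 0 < σ * ((q 1).im - (q 3).im) := (pos_iff_pos_of_mul_pos s2).1 (sub_pos.2 hlt)
    have a2 : |(q 1).im - (q 3).im| = σ * ((q 1).im - (q 3).im) := by
      rw [← abs_of_pos t2, abs_mul]; rcases hσ with rfl | rfl <;> simp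
    rw [a2] at hi'
    have hcr : cr (q 1) (q 2) (q 3) ≤ c * (σ * ((q 2).im - (q 3).im)) := by
      rcases hi' with (h | h) | h <;> nlinarith
    have t4 : 0 < σ * ((q 1).im - (q 0).im) := by
      rw [cr_eq] at k1 k2
      rcases hσ with rfl | rfl
      · refine (pos_iff_pos_of_mul_pos ?_).1 (sub_pos.2 hlt)
        linear_combination k2 + mul_pos t2 (sub_pos.2 h01)
      · refine (pos_iff_pos_of_mul_pos ?_).1 (sub_pos.2 h12)
        linear_combination k1 + mul_pos t0 (sub_pos.2 h01)
    have t5 : 0 < σ * ((q 2).im - (q 0).im) := by linarith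
    refine ⟨fun i => ?_, 2, ?_⟩
    · fin_cases i
      · change 0 < σ * (((q 1).re - (q 0).re) * ((q 1).im - (q 0).im))
        rw [mul_left_comm]; exact mul_pos (sub_pos.2 h01) t4
      · exact h1 0
      · change 0 < σ * (((q 0).re - (q 2).re) * ((q 0).im - (q 2).im))
        nlinarith [mul_pos (sub_pos.2 (h01.trans h12)) t5]
    · change cr (q 0) (q 1) (q 2) ≤ c * |(q 0).im - (q 2).im|
      have a5 : |(q 0).im - (q 2).im| = σ * ((q 2).im - (q 0).im) := by
        rw [← abs_of_pos t5, abs_mul, abs_sub_comm]; rcases hσ with rfl | rfl <;> simp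
      rw [a5]
      have id1 : cr (q 1) (q 2) (q 3) * (σ * ((q 2).im - (q 0).im)) -
          cr (q 0) (q 1) (q 2) * (σ * ((q 2).im - (q 3).im)) =
          σ * ((q 2).im - (q 1).im) * cr (q 0) (q 2) (q 3) := by
        simp only [cr_eq]; ring
      have := mul_pos t0 k3
      refine le_of_mul_le_mul_right ?_ t1
      linear_combination mul_le_mul_of_nonneg_right hcr t5.le + this - id1
  · right
    have t2 : 0 < σ * ((q 3).im - (q 1).im) := by
      nlinarith [(neg_iff_neg_of_mul_pos s2).1 (sub_neg.2 hlt)]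
    have a2 : |(q 1).im - (q 3).im| = σ * ((q 3).im - (q 1).im) := by
      rw [← abs_of_pos t2, abs_mul, abs_sub_comm]; rcases hσ with rfl | rfl <;> simp
    rw [a2] at hi'
    have hcr : cr (q 1) (q 2) (q 3) ≤ c * (σ * ((q 2).im - (q 1).im)) := by
      rcases hi' with (h | h) | h <;> nlinarith
    have t4 : 0 < σ * ((q 3).im - (q 0).im) := by
      rw [cr_eq] at k2 k3
      rcases hσ with rfl | rfl
      · refine (pos_iff_pos_of_mul_pos ?_).1 (sub_pos.2 h32)
        linear_combination k3 + mul_pos t1 (sub_pos.2 h03)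
      · refine (pos_iff_pos_of_mul_pos ?_).1 (sub_pos.2 hlt)
        linear_combination k2 + mul_pos t2 (sub_pos.2 h03)
    have t5 : 0 < σ * ((q 2).im - (q 0).im) := by linarith
    refine ⟨fun i => ?_, 2, ?_⟩
    · fin_cases i
      · exact h1 1
      · change 0 < σ * (((q 0).re - (q 3).re) * ((q 0).im - (q 3).im))
        nlinarith [mul_pos (sub_pos.2 h03) t4]
      · change 0 < σ * (((q 2).re - (q 0).re) * ((q 2).im - (q 0).im))
        rw [mul_left_comm]; exact mul_pos (sub_pos.2 (h01.trans h12)) t5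
    · change cr (q 2) (q 3) (q 0) ≤ c * |(q 2).im - (q 0).im|
      have a5 : |(q 2).im - (q 0).im| = σ * ((q 2).im - (q 0).im) := by
        rw [← abs_of_pos t5, abs_mul]; rcases hσ with rfl | rfl <;> simp
      rw [a5, cr_rotate]
      have id1 : cr (q 1) (q 2) (q 3) * (σ * ((q 2).im - (q 0).im)) -
          cr (q 0) (q 2) (q 3) * (σ * ((q 2).im - (q 1).im)) =
          σ * ((q 2).im - (q 3).im) * cr (q 0) (q 1) (q 2) := by
        simp only [cr_eq]; ring
      have := mul_pos t1 k1
      refine le_of_mul_le_mul_right ?_ t0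
      linear_combination mul_le_mul_of_nonneg_right hcr t5.le + this - id1

namespace IsStaggeredFlipSequence

variable (hτ : X.IsStaggeredFlipSequence τ)
include hτ

theorem tendsto_maxWidth [ConnectedSpace S] :
    Tendsto (fun n => X.maxWidth (τ n)) atTop (𝓝 0) := by
  rw [Metric.tendsto_atTop]
  intro w hw
  obtain ⟨N, hN⟩ := hτ.exists_width_lt (half_pos hw)
  refine ⟨N, fun n hn => ?_⟩
  have h0 : 0 ≤ X.maxWidth (τ n) := Real.sSup_nonneg (by rintro _ ⟨e, -, v, -, rfl⟩; positivity)
  have h1 : X.maxWidth (τ n) ≤ w / 2 :=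
    Real.sSup_le (by rintro _ ⟨e, he, v, hv, rfl⟩; exact (hN n hn e he v hv).le) (half_pos hw).le
  rw [Real.dist_eq, sub_zero, abs_of_nonneg h0]
  linarith

/-- The edges of height at most `H` disappear. -/
theorem exists_lt_height [ConnectedSpace S] (H : ℝ) :
    ∃ N, ∀ n ≥ N, ∀ e ∈ τ n, ∀ v, X.IsSaddle e v → H < |v.im| := by
  obtain ⟨ε, hε, h⟩ := hτ.verticallyKeane.exists_width H
  obtain ⟨N, hN⟩ := hτ.exists_width_lt hε
  refine ⟨N, fun n hn e he v hv => ?_⟩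
  by_contra hcon
  exact (hN n hn e he v hv).not_ge (h e v hv (not_lt.1 hcon))

theorem tendsto_minHeight [ConnectedSpace S] :
    Tendsto (fun n => X.minHeight (τ n)) atTop atTop := by
  refine tendsto_atTop.2 fun H => ?_
  obtain ⟨N, hN⟩ := hτ.exists_lt_height H
  filter_upwards [eventually_ge_atTop N] with n hn
  obtain ⟨p, f, h⟩ := hτ.exists_flipQuad n
  exact le_csInf ⟨_, _, h.1.2.2.1, _, h.saddle_old (hτ.1 n).1, rfl⟩
    (by rintro _ ⟨e, he, v, hv, rfl⟩; exact (hN n hn e he v hv).le)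

theorem mono_parent {σ c : ℝ} (hσ : σ = 1 ∨ σ = -1) {n : ℕ}
    (h : X.IsTriangle (τ (n + 1)) p f) (hp : IsMono σ c p) :
    ∃ p f, X.IsTriangle (τ n) p f ∧ IsMono σ c p := by
  obtain ⟨P, F, hP⟩ := hτ.exists_flipQuad n
  by_cases hk : ∃ k, f '' seg (p k) (p (k + 1)) = F '' seg (P 1) (P 3)
  · obtain ⟨k, hk⟩ := hk
    obtain ⟨q, g, hq, q3, q1, q2, -⟩ := hP.exists_new (hτ.1 n).1 h hk
    have hm : IsMono σ c ![q 1, q 2, q 3] := by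
      convert hp.rotate (k + 1) using 1
      rw [q1, q2, q3]
      clear * -
      ext i
      fin_cases k <;> fin_cases i <;> rfl
    have main : ∀ {q : Fin 4 → ℂ} {g : ℂ → S}, X.IsFlipQuad (τ n) (τ (n + 1)) q g →
        IsMono σ c ![q 1, q 2, q 3] → (q 0).re < (q 2).re →
        ∃ p f, X.IsTriangle (τ n) p f ∧ IsMono σ c p := by
      intro q g hq hm hlt
      obtain ⟨⟨h1, h2⟩, h3, h4⟩ := hq.re_lt (hτ.1 n) hlt
      rcases hm.parent hq.1.quadPos hσ h1 h3 h2 h4 with h | h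
      · exact ⟨_, g, hq.1.lower, h⟩
      · exact ⟨_, g, hq.1.upper, h⟩
    rcases lt_or_gt_of_ne (hq.re_ne (hτ.1 n)) with hlt | hlt
    · exact main hq hm hlt
    · refine main (hq.halfTr (Or.inr rfl) 0) ?_ (by simpa using hlt)
      convert hm.halfTr (ε := -1) (Or.inr rfl) 0 using 1
      ext i
      fin_cases i <;> rfl
  · push Not at hk
    exact ⟨p, f, hP.persists_back (hτ.1 n).1 h hk, hp⟩

/-- The triangles with three sides of slope of sign `σ` disappear. -/
theorem exists_not_mono [ConnectedSpace S] {σ : ℝ}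
    (hσ : σ = 1 ∨ σ = -1) : ∃ N, ∀ n ≥ N, ∀ p f, X.IsTriangle (τ n) p f →
      ¬ ∀ i, 0 < σ * ((p (i + 1) - p i).re * (p (i + 1) - p i).im) := by
  obtain ⟨T, hT, hTt, hTe⟩ := (hτ.1 0).1.exists_finite_triangles
  obtain ⟨c, hc, hc0⟩ : ∃ c : ℝ, (∀ t ∈ T, ∀ i : Fin 3,
      c * |(t.1 (i + 1) - t.1 i).im| < cr (t.1 0) (t.1 1) (t.1 2)) ∧ 0 < c := by
    have : ∀ᶠ c : ℝ in 𝓝[>] 0, ∀ t ∈ T, ∀ i : Fin 3,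
        c * |(t.1 (i + 1) - t.1 i).im| < cr (t.1 0) (t.1 1) (t.1 2) := by
      refine hT.eventually_all.2 fun t ht => eventually_all.2 fun i => ?_
      refine nhdsWithin_le_nhds ?_
      have hcont : Continuous fun c : ℝ => c * |(t.1 (i + 1) - t.1 i).im| := by fun_prop
      refine hcont.continuousAt.eventually_lt_const ?_
      simpa using (hTt t ht).pos
    exact (this.and self_mem_nhdsWithin).exists
  have hno : ∀ n p f, X.IsTriangle (τ n) p f → ¬ IsMono σ c p := by
    intro n
    induction n with
    | zero =>
      intro p f h hm
      obtain ⟨t, ht, ε, d, hε, ⟨j, hj⟩, -⟩ := hTe p f h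
      have e : t.1 = fun i => ε * p (i + -j) + -(ε * d) := by
        ext i
        rw [hj, neg_add_cancel_right]
        linear_combination (-t.1 i) * sq_eq_one_of_sign hε
      have h2 := (hm.rotate (-j)).halfTr hε (-(ε * d))
      rw [← e] at h2
      obtain ⟨i, hi⟩ := h2.2
      exact (hc t ht i).not_ge hi
    | succ n ih =>
      intro p f h hm
      obtain ⟨p', f', h', hm'⟩ := hτ.mono_parent hσ h hm
      exact ih p' f' h' hm'
  obtain ⟨N, hN⟩ := hτ.exists_width_lt (half_pos hc0)
  refine ⟨N, fun n hn p f h hall => hno n p f h ⟨hall, ?_⟩⟩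
  have hw : ∀ i, |(p (i + 1) - p i).re| ≤ c / 2 := fun i =>
    (hN n hn _ (h.2.1 i) _ (h.saddle (hτ.1 n).1.saddle i)).le
  by_contra! hcon
  have e : cr (p 0) (p 1) (p 2) = (p 1 - p 0).re * (p 2 - p 1).im - (p 1 - p 0).im * (p 2 - p 1).re := by
    simp only [cr_eq, sub_re, sub_im]; ring
  have b1 : (p 1 - p 0).re * (p 2 - p 1).im ≤ c / 2 * |(p 2 - p 1).im| := by
    refine (le_abs_self _).trans ?_
    rw [abs_mul]; exact mul_le_mul_of_nonneg_right (hw 0) (abs_nonneg _)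
  have b2 : -((p 1 - p 0).im * (p 2 - p 1).re) ≤ |(p 1 - p 0).im| * (c / 2) := by
    refine (neg_le_abs _).trans ?_
    rw [abs_mul]; exact mul_le_mul_of_nonneg_left (hw 1) (abs_nonneg _)
  have c0 : c * |(p 1 - p 0).im| < cr (p 0) (p 1) (p 2) := hcon 0
  have c1 : c * |(p 2 - p 1).im| < cr (p 0) (p 1) (p 2) := hcon 1
  linarith

end IsStaggeredFlipSequence

/-- Some triangle has a corner from which a vertical ray enters it. -/
theorem IsStraightTriangulation.exists_vertical
    (hE : X.IsStraightTriangulation E) {z : S} (hz : z ∈ X.Z) :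
    ∃ p f i, X.IsTriangle E p f ∧ f (p i) = z ∧
      ∃ x ∈ hull p, (x - p i).re = 0 ∧ (x - p i).im ≠ 0 := by
  obtain ⟨k, φ, hφ⟩ := exists_isCone hz
  obtain ⟨ρ, hρ0, hρ⟩ := hφ.exists_radius
  obtain ⟨ζ, hζ⟩ := IsAlgClosed.exists_pow_nat_eq (-1 : ℂ) hφ.one_le
  have hζn : ‖ζ‖ = 1 := by
    have : ‖ζ‖ ^ k = 1 := by rw [← norm_pow, hζ, norm_neg, norm_one]
    exact (pow_eq_one_iff_of_nonneg (norm_nonneg _) (by have := hφ.one_le; omega)).1 this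
  set s : ℕ → ℝ := fun n => ρ * (1 / ((n : ℝ) + 1)) with hs
  have hs0 : ∀ n, 0 < s n := fun n => by positivity
  have hsρ : ∀ n, s n ≤ ρ := fun n => mul_le_of_le_one_right hρ0.le (by
    rw [div_le_one (by positivity)]; linarith [n.cast_nonneg (α := ℝ)])
  have hst : Tendsto s atTop (𝓝 0) := by
    have := (tendsto_one_div_add_atTop_nhds_zero_nat (𝕜 := ℝ)).const_mul ρ
    rwa [mul_zero] at this
  have hmem : ∀ n, ζ * (s n : ℂ) ∈ φ.target := fun n => hρ (by
    rw [mem_closedBall_zero_iff, norm_mul, hζn, one_mul, norm_real, Real.norm_eq_abs,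
      abs_of_pos (hs0 n)]
    exact hsρ n)
  have hy : Tendsto (fun n => φ.symm (ζ * (s n : ℂ))) atTop (𝓝 z) := by
    have h0 : φ.symm 0 = z := by rw [← hφ.map_zero, φ.left_inv hφ.mem_source]
    have h1 : ContinuousAt φ.symm 0 :=
      φ.continuousAt_symm (hφ.map_zero ▸ φ.map_source hφ.mem_source)
    rw [ContinuousAt, h0] at h1
    refine h1.comp ?_
    have := ((Complex.continuous_ofReal.tendsto 0).comp hst).const_mul ζ
    simpa using this
  have hyZ : ∀ n, φ.symm (ζ * (s n : ℂ)) ∉ X.Z := by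
    intro n hn
    have h1 := hφ.eq_of_mem (φ.map_target (hmem n)) hn
    have h2 := φ.right_inv (hmem n)
    rw [h1, hφ.map_zero] at h2
    have : ‖ζ * (s n : ℂ)‖ = s n := by
      rw [norm_mul, hζn, one_mul, norm_real, Real.norm_eq_abs, abs_of_pos (hs0 n)]
    rw [← h2, norm_zero] at this
    exact (hs0 n).ne this
  obtain ⟨p, f, i, hT, hfz, hfr⟩ := hE.exists_corner hφ hy hyZ
  obtain ⟨n, x, hx, hxc, hfx, η, -, hxη, hsq⟩ := hfr.exists
  refine ⟨p, f, i, hT, hfz, x, hx, ?_⟩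
  have e := hsq x hx hxc hxη
  rw [hfx, φ.right_inv (hmem n), mul_pow, hζ] at e
  have hpos : 0 < s n ^ k := pow_pos (hs0 n) k
  rw [← Complex.ofReal_pow] at e
  have e1 := congrArg Complex.re e
  have e2 := congrArg Complex.im e
  rw [pow_two] at e1 e2
  simp only [neg_one_mul, neg_re, neg_im, Complex.ofReal_re, Complex.ofReal_im,
    Complex.mul_re, Complex.mul_im] at e1 e2
  have hre : (x - p i).re = 0 := by
    by_contra hre
    have : (x - p i).im = 0 := by
      rcases mul_eq_zero.1 (show (x - p i).re * (x - p i).im = 0 by linarith) with h | h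
      · exact absurd h hre
      · exact h
    rw [this] at e1
    nlinarith [mul_self_nonneg (x - p i).re]
  refine ⟨hre, fun h => ?_⟩
  rw [hre, h] at e1
  linarith

open Classical in
/-- Red for positive slope, blue for negative slope. -/
noncomputable def slopeColour (X : HalfTranslationSurface S) (e : Set S) : EdgeColour :=
  if ∃ v, X.IsSaddle e v ∧ 0 < v.re * v.im then .red else .blue

/-- The sign of the slope of the edges of a given colour. -/
def EdgeColour.sign : EdgeColour → ℝ
  | .red => 1
  | .blue => -1

theorem sign_slopeColour (h : X.IsSaddle e v)
    (hre : v.re ≠ 0) (him : v.im ≠ 0) : 0 < EdgeColour.sign (X.slopeColour e) * (v.re * v.im) := by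
  unfold slopeColour
  split_ifs with hr
  · obtain ⟨v', hv', hpos⟩ := hr
    rw [EdgeColour.sign, one_mul]
    rcases hv'.holonomy_eq h with rfl | rfl
    · exact hpos
    · simpa using hpos
  · push Not at hr
    rw [EdgeColour.sign, neg_one_mul, neg_pos]
    exact lt_of_le_of_ne (hr v h) (mul_ne_zero hre him)

theorem IsTriangle.mem_closure_side
    (h : X.IsTriangle E p f) {i j : Fin 3} (hj : p j ∈ closure (seg (p i) (p (i + 1)))) :
    f (p j) ∈ closure (f '' seg (p i) (p (i + 1))) :=
  ((h.1.continuousOn _ (subset_convexHull _ _ (mem_range_self j))).mono fun _ hw =>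
    (h.side_mem hw).1).mem_closure_image hj

theorem IsStaggeredFlipSequence.eventually_isVeering [ConnectedSpace S]
    (hτ : X.IsStaggeredFlipSequence τ) :
    ∀ᶠ n in atTop, X.IsVeering (τ n) := by
  obtain ⟨N₀, hN₀⟩ := hτ.exists_lt_height 0
  obtain ⟨N₁, hN₁⟩ := hτ.exists_not_mono (Or.inl rfl)
  obtain ⟨N₂, hN₂⟩ := hτ.exists_not_mono (Or.inr rfl)
  filter_upwards [eventually_ge_atTop N₀, eventually_ge_atTop N₁, eventually_ge_atTop N₂]
    with n h0 h1 h2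
  have hE := (hτ.1 n).1
  have hcol : ∀ e ∈ τ n, ∀ v, X.IsSaddle e v →
      0 < EdgeColour.sign (X.slopeColour e) * (v.re * v.im) := fun e he v hv =>
    sign_slopeColour hv ((hτ.1 n).2 e he v hv) (abs_pos.1 (hN₀ n h0 e he v hv))
  have hmono : ∀ c p f, X.IsTriangle (τ n) p f →
      ¬ ∀ i, 0 < EdgeColour.sign c * ((p (i + 1) - p i).re * (p (i + 1) - p i).im) := by
    rintro (_ | _)
    · exact hN₁ n h1
    · exact hN₂ n h2
  refine ⟨hE, X.slopeColour, fun e he v hv => ⟨fun h => ?_, fun h => ?_⟩, ?_, ?_⟩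
  · have := hcol e he v hv
    rw [h, EdgeColour.sign, one_mul] at this
    rcases mul_pos_iff.1 this with h | h
    · exact div_pos h.2 h.1
    · exact div_pos_of_neg_of_neg h.2 h.1
  · have := hcol e he v hv
    rw [h, EdgeColour.sign, neg_one_mul, neg_pos] at this
    rcases mul_neg_iff.1 this with h | h
    · exact div_neg_of_neg_of_pos h.2 h.1
    · exact div_neg_of_pos_of_neg h.2 h.1
  · rintro p f hT ⟨c, hc⟩
    exact hmono c p f hT fun i => hc i ▸ hcol _ (hT.2.1 i) _ (hT.saddle hE.saddle i)
  · rintro z hz ⟨c, hc⟩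
    obtain ⟨p, f, i, hT, rfl, x, hx, hre, him⟩ := hE.exists_vertical hz
    have key : ∀ {p : Fin 3 → ℂ}, X.IsTriangle (τ n) p f → x ∈ hull p →
        (x - p 0).re = 0 → (x - p 0).im ≠ 0 →
        (∀ e ∈ τ n, f (p 0) ∈ closure e → X.slopeColour e = c) → False := by
      clear! p
      intro p hT hx hre him hc
      have s := fun i => hcol _ (hT.2.1 i) _ (hT.saddle hE.saddle i)
      have s0 := s 0
      have s2 := s 2
      rw [hc _ (hT.2.1 0) (hT.mem_closure_side (by
        rw [closure_openSegment]; exact left_mem_segment _ _ _))] at s0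
      rw [hc _ (hT.2.1 2) (hT.mem_closure_side (by
        rw [closure_openSegment]; exact right_mem_segment _ _ _))] at s2
      have m0 : 0 ≤ cr (p 0) (p 1) x := (mem_tri hT.pos).1 hx 0
      have m2 : 0 ≤ cr (p 2) (p 0) x := (mem_tri hT.pos).1 hx 2
      have e0 : cr (p 0) (p 1) x = (p 1 - p 0).re * (x - p 0).im := by
        rw [cr_eq, ← sub_re, ← sub_im, ← sub_re, hre]
        ring
      have e2 : cr (p 2) (p 0) x = (p 0 - p 2).re * (x - p 0).im := by
        rw [← cr_rotate, cr_eq]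
        simp only [← sub_re, ← sub_im, hre]
        simp only [sub_re, sub_im]
        ring
      rw [e0] at m0
      rw [e2] at m2
      change 0 < _ * ((p 1 - p 0).re * (p 1 - p 0).im) at s0
      change 0 < _ * ((p 0 - p 2).re * (p 0 - p 2).im) at s2
      refine hmono c p f hT fun i => ?_
      have s1 : 0 < EdgeColour.sign c * ((p 2 - p 1).re * (p 2 - p 1).im) := by
        have r1 : p 2 - p 1 = -((p 1 - p 0) + (p 0 - p 2)) := by ring
        rw [r1]
        generalize p 1 - p 0 = u at *
        generalize p 0 - p 2 = v at *
        generalize (x - p 0).im = t at *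
        simp only [neg_re, neg_im, neg_mul_neg, add_re, add_im]
        have hu : u.re ≠ 0 := fun h => by simp [h] at s0
        have hv : v.re ≠ 0 := fun h => by simp [h] at s2
        rw [mul_left_comm] at s0 s2 ⊢
        rcases lt_or_gt_of_ne him with ht | ht
        · have a1 : u.re < 0 := lt_of_le_of_ne (by nlinarith) hu
          have a2 : v.re < 0 := lt_of_le_of_ne (by nlinarith) hv
          have b1 := (neg_iff_neg_of_mul_pos s0).1 a1
          have b2 := (neg_iff_neg_of_mul_pos s2).1 a2
          rw [mul_add]
          exact mul_pos_of_neg_of_neg (add_neg a1 a2) (add_neg b1 b2)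
        · have a1 : 0 < u.re := lt_of_le_of_ne (by nlinarith) hu.symm
          have a2 : 0 < v.re := lt_of_le_of_ne (by nlinarith) hv.symm
          have b1 := (pos_iff_pos_of_mul_pos s0).1 a1
          have b2 := (pos_iff_pos_of_mul_pos s2).1 a2
          rw [mul_add]
          exact mul_pos (add_pos a1 a2) (add_pos b1 b2)
      fin_cases i
      · exact s0
      · exact s1
      · exact s2
    have h0 : ∀ g : Fin 3 → ℂ, g (0 + i) = g i := fun g => by rw [zero_add]
    refine key (hT.rotate i) (by rwa [range_rotate]) ?_ ?_ ?_
    · simpa only [zero_add] using hre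
    · simpa only [zero_add] using him
    · simpa only [zero_add] using hc

namespace IsQuad

variable {p : Fin 4 → ℂ}

theorem mem_diag (hp : QuadPos p) (hw : w ∈ interior (hull p))
    (h0 : cr (p 0) (p 2) w = 0) : w ∈ seg (p 0) (p 2) := by
  have h := (mem_interior_quad hp).1 hw
  exact (mem_side_tri (p := ![p 0, p 2, p 3]) hp.2.2.1 0).2 ⟨h0, h 2, h 3⟩

theorem interior_upper (hp : QuadPos p) : w ∈ interior (hull ![p 2, p 3, p 0]) ↔
      w ∈ interior (hull p) ∧ 0 < cr (p 0) (p 2) w := by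
  have := interior_lower (p := fun i => p (i + 2)) (by
    have := hp.rotate.rotate
    simp only [add_assoc] at this
    exact this) (w := w)
  rw [range_rotate] at this
  refine this.trans (and_congr_right fun _ => ?_)
  change cr (p 2) (p 0) w < 0 ↔ _
  rw [cr_swap, neg_lt_zero]

theorem mem_cases (hp : QuadPos p) (hw : w ∈ interior (hull p)) :
    w ∈ interior (hull ![p 0, p 1, p 2]) ∨ w ∈ seg (p 0) (p 2) ∨
      w ∈ interior (hull ![p 2, p 3, p 0]) := by
  rw [interior_lower hp, interior_upper hp]
  rcases lt_trichotomy (cr (p 0) (p 2) w) 0 with h | h | h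
  · exact Or.inl ⟨hw, h⟩
  · exact Or.inr (Or.inl (mem_diag hp hw h))
  · exact Or.inr (Or.inr ⟨hw, h⟩)

theorem isStraightTriangulation_flip (hE : X.IsStraightTriangulation E)
    (h : X.IsQuad E p f) {E' : Set (Set S)}
    (hE' : E' = insert (f '' seg (p 1) (p 3)) (E \ {f '' seg (p 0) (p 2)})) :
    X.IsStraightTriangulation E' := by
  obtain ⟨hQ, -, -⟩ := h.flip hE hE'
  have hp := h.quadPos
  have hsub0 := diag_subset hp
  have hsub1 : seg (p 1) (p 3) ⊆ interior (hull p) := by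
    have := diag_subset hp.rotate
    rwa [range_rotate] at this
  have hne : p 1 ≠ p 3 := fun he => by
    have := hp.2.1
    rw [he, cr_right] at this
    exact this.false
  have htend : ∀ i, Tendsto f (𝓝[seg (p 1) (p 3)] (p i)) (𝓝 (f (p i))) := fun i =>
    (h.1.continuousOn _ (subset_convexHull _ _ (mem_range_self i))).mono
      (hsub1.trans interior_subset)
  refine ⟨hE' ▸ (hE.finite.subset sdiff_subset).insert _, ?_, ?_, ?_⟩
  · intro e he
    rw [hE'] at he
    rcases he with rfl | he
    · exact ⟨_, isSaddle_of_tendsto hne (fun x hx => h.1.isFlatAt (hsub1 hx)) (h.1.corner 1)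
        (h.1.corner 3) (htend 1) (htend 3)⟩
    · exact hE.saddle e he.1
  · rw [hE']
    refine (hE.disjoint.subset sdiff_subset).insert fun e he _ => ?_
    have : Disjoint (f '' seg (p 1) (p 3)) e := by
      rw [disjoint_left]
      rintro _ ⟨w, hw, rfl⟩ hwe
      by_cases hd : w ∈ seg (p 0) (p 2)
      · exact he.2 (hE.eq_of_mem he.1 h.2.2.1 hwe ⟨w, hd, rfl⟩)
      · exact disjoint_left.1 h.2.2.2 ⟨w, ⟨hsub1 hw, hd⟩, rfl⟩ ⟨e, he.1, hwe⟩
    exact this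
  · intro x hx
    by_cases hxQ : x ∈ f '' interior (hull p)
    · obtain ⟨w, hw, rfl⟩ := hxQ
      have hw' : w ∈ interior (hull (fun i => p (i + 1))) := by rwa [range_rotate]
      rcases mem_cases hp.rotate hw' with h1 | h1 | h1
      · exact ⟨_, f, hQ.lower, w, h1, rfl⟩
      · exact absurd (Or.inr ⟨f '' seg (p 1) (p 3), by rw [hE']; exact Or.inl rfl, w, h1, rfl⟩) hx
      · exact ⟨_, f, hQ.upper, w, h1, rfl⟩
    · have hxE : x ∉ X.Z ∪ ⋃₀ E := by
        rintro (hz | ⟨e, he, hxe⟩)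
        · exact hx (Or.inl hz)
        · by_cases hed : e = f '' seg (p 0) (p 2)
          · exact hxQ (image_mono hsub0 (hed ▸ hxe))
          · exact hx (Or.inr ⟨e, hE' ▸ Or.inr ⟨he, hed⟩, hxe⟩)
      obtain ⟨p', f', hT, hxT⟩ := hE.triangles x hxE
      refine ⟨p', f', h.persists hE' hT fun k hk => hxQ ?_, hxT⟩
      rcases h.image_interior_eq hT hk with he | he
      · rw [he] at hxT
        exact image_mono (fun w hw => ((interior_lower hp).1 hw).1) hxT
      · rw [he] at hxT
        exact image_mono (fun w hw => ((interior_upper hp).1 hw).1) hxT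

end IsQuad

/-- Two triangles on the two sides of an edge wider than their other sides form a strictly convex
quadrilateral. -/
theorem quadPos_of_wide {a₀ a₁ c c' : ℂ} (h : 0 < cr a₀ a₁ c) (h' : 0 < cr a₁ a₀ c')
    (hc : a₀.re < c.re ∧ c.re < a₁.re) (hc' : a₀.re < c'.re ∧ c'.re < a₁.re) :
    QuadPos ![a₀, c', a₁, c] := by
  have hW : 0 < a₁.re - a₀.re := by linarith
  refine ⟨?_, ?_, h, ?_⟩
  · show 0 < cr a₀ c' a₁
    rwa [← cr_rotate, ← cr_rotate]
  · show 0 < cr a₀ c' c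
    refine (pos_iff_pos_of_mul_pos (a := a₁.re - a₀.re) ?_).1 hW
    have e : (a₁.re - a₀.re) * cr a₀ c' c =
        (c'.re - a₀.re) * cr a₀ a₁ c + (c.re - a₀.re) * cr a₁ a₀ c' := by
      simp only [cr_eq]; ring
    rw [e]
    exact add_pos (mul_pos (sub_pos.2 hc'.1) h) (mul_pos (sub_pos.2 hc.1) h')
  · show 0 < cr c' a₁ c
    refine (pos_iff_pos_of_mul_pos (a := a₁.re - a₀.re) ?_).1 hW
    have e : (a₁.re - a₀.re) * cr c' a₁ c =
        (a₁.re - c'.re) * cr a₀ a₁ c + (a₁.re - c.re) * cr a₁ a₀ c' := by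
      simp only [cr_eq]; ring
    rw [e]
    exact add_pos (mul_pos (sub_pos.2 hc'.2) h) (mul_pos (sub_pos.2 hc.2) h')

theorem IsStraightTriangulation.nonempty
    (hE : X.IsStraightTriangulation E) : E.Nonempty := by
  by_contra hE0
  rw [not_nonempty_iff_eq_empty] at hE0
  obtain ⟨x, hx⟩ := X.exists_notMem_Z
  obtain ⟨p, f, h, -⟩ := hE.triangles x (by rw [hE0]; simpa using hx)
  exact (hE0 ▸ h.2.1 0 : _ ∈ (∅ : Set (Set S)))

/-- The quadrilateral formed by the two triangles at an edge wider than the other four sides. -/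
theorem IsFrame.exists_quad {a₀ a₁ c c' : ℂ} (he : e ∈ E)
    (h : X.IsFrame b g e a₀ a₁) (hT : X.IsTriangle E ![a₀, a₁, c] f)
    (hT' : X.IsTriangle E ![a₁, a₀, c'] f')
    (hd : X.LaysOut b g ![a₀, a₁, c] f)
    (hd' : X.LaysOut b g ![a₁, a₀, c'] f')
    (hc : a₀.re < c.re ∧ c.re < a₁.re) (hc' : a₀.re < c'.re ∧ c'.re < a₁.re) :
    ∃ F, X.IsQuad E ![a₀, c', a₁, c] F := by
  classical
  have hq := quadPos_of_wide hT.pos hT'.pos hc hc'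
  set p : Fin 4 → ℂ := ![a₀, c', a₁, c] with hp
  set A := hull ![a₀, a₁, c] with hA
  set B := hull ![a₁, a₀, c'] with hB
  set I := seg a₀ a₁ with hI
  have hAp : A ⊆ hull p := hull_sub_quad (p := p) (i := 0) (j := 2) (k := 3)
  have hBp : B ⊆ hull p := hull_sub_quad (p := p) (i := 2) (j := 0) (k := 1)
  have hIA : I ⊆ A := fun w hw => (hT.side_mem (i := 0) hw).1
  have hIB : I ⊆ B := fun w hw => (hT'.side_mem (i := 0) (openSegment_symm ℝ a₀ a₁ ▸ hw)).1
  have hfI : ∀ w ∈ I, X.dev b g w = f w := fun w hw =>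
    (hd w (hT.side_mem (i := 0) hw).1 (hT.side_mem (i := 0) hw).2).2
  have hfI' : ∀ w ∈ I, X.dev b g w = f' w := fun w hw => by
    rw [hI, openSegment_symm] at hw
    exact (hd' w (hT'.side_mem (i := 0) hw).1 (hT'.side_mem (i := 0) hw).2).2
  have hclA : closure I ⊆ A := closure_minimal hIA (isCompact_hull _).isClosed
  have hclB : closure I ⊆ B := closure_minimal hIB (isCompact_hull _).isClosed
  have hseg : EqOn f f' (closure I) := by
    refine EqOn.of_subset_closure (s := I) (fun w hw => ?_) (hT.1.continuousOn.mono hclA)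
      (hT'.1.continuousOn.mono hclB) subset_closure subset_rfl
    rw [← hfI w hw, hfI' w hw]
  have hcl0 : ∀ w ∈ A, cr a₀ a₁ w = 0 → w ∈ closure I := by
    intro w hw h0
    have hi := (mem_tri hT.pos).1 hw
    have i1 : 0 ≤ cr a₁ c w := hi 1
    have i2 : 0 ≤ cr c a₀ w := hi 2
    have hD : 0 < cr a₀ a₁ c := hT.pos
    have hs := cr_add_add a₀ a₁ c w
    have hw' := bary a₀ a₁ c w
    rw [h0, Complex.ofReal_zero, zero_mul, add_zero] at hw'
    rw [hI, closure_openSegment]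
    refine ⟨_, _, div_nonneg i1 hD.le, div_nonneg i2 hD.le, by field_simp; linarith, ?_⟩
    have hD' : (cr a₀ a₁ c : ℂ) ≠ 0 := mod_cast hD.ne'
    simp only [real_smul, Complex.ofReal_div]
    field_simp
    linear_combination -hw'
  have hAs : ∀ w ∈ A, 0 ≤ cr a₀ a₁ w := fun w hw => (mem_tri hT.pos).1 hw 0
  have hBs : ∀ w ∈ B, cr a₀ a₁ w ≤ 0 := fun w hw => by
    have : 0 ≤ cr a₁ a₀ w := (mem_tri hT'.pos).1 hw 0
    rw [cr_swap] at this; linarith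
  have hcov : ∀ w ∈ hull p, w ∈ A ∨ w ∈ B := by
    intro w hw
    have hw' := (mem_quad hq).1 hw
    rcases le_total 0 (cr a₀ a₁ w) with h0 | h0
    · refine Or.inl ((mem_tri hT.pos).2 fun i => ?_)
      fin_cases i
      exacts [h0, hw' 2, hw' 3]
    · refine Or.inr ((mem_tri hT'.pos).2 fun i => ?_)
      have h1 : 0 ≤ cr a₁ a₀ w := by rw [cr_swap]; linarith
      fin_cases i
      exacts [h1, hw' 0, hw' 1]
  set F : ℂ → S := fun w => if 0 ≤ cr a₀ a₁ w then f w else f' w with hF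
  have hFA : EqOn F f A := fun w hw => if_pos (hAs w hw)
  have hFB : EqOn F f' B := by
    intro w hw
    by_cases h0 : 0 ≤ cr a₀ a₁ w
    · have h1 := le_antisymm (hBs w hw) h0
      have h2 : w ∈ A := (hcov w (hBp hw)).elim id fun _ => by
        refine (mem_tri hT.pos).2 fun i => ?_
        have hw' := (mem_quad hq).1 (hBp hw)
        fin_cases i
        exacts [h0, hw' 2, hw' 3]
      rw [hFA h2]; exact hseg (hcl0 w h2 h1)
    · exact if_neg h0
  have hFI : ∀ w ∈ I, F w = X.dev b g w := fun w hw => by rw [hFA (hIA hw), hfI w hw]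
  have hAint : ∀ w ∈ interior (hull p), 0 < cr a₀ a₁ w → w ∈ interior A := by
    intro w hw h0
    have hw' := (mem_interior_quad hq).1 hw
    refine (mem_interior_tri hT.pos).2 fun i => ?_
    fin_cases i
    exacts [h0, hw' 2, hw' 3]
  have hBint : ∀ w ∈ interior (hull p), cr a₀ a₁ w < 0 → w ∈ interior B := by
    intro w hw h0
    have hw' := (mem_interior_quad hq).1 hw
    refine (mem_interior_tri hT'.pos).2 fun i => ?_
    have h1 : 0 < cr a₁ a₀ w := by rw [cr_swap]; linarith
    fin_cases i
    exacts [h1, hw' 0, hw' 1]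
  have hIint : ∀ w ∈ interior (hull p), cr a₀ a₁ w = 0 → w ∈ I := fun w hw h0 =>
    IsQuad.mem_diag hq hw h0
  have hFd : ∀ w ∈ interior (hull p), w ∈ X.dom b g ∧ F w = X.dev b g w := by
    intro w hw
    rcases lt_trichotomy (cr a₀ a₁ w) 0 with h0 | h0 | h0
    · have h1 := hBint w hw h0
      obtain ⟨h2, h3⟩ := hd' w (interior_subset h1) (hT'.interior_ne h1)
      exact ⟨h2, by rw [h3, hFB (interior_subset h1)]⟩
    · have h1 := hIint w hw h0
      exact ⟨h.sub h1, hFI w h1⟩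
    · have h1 := hAint w hw h0
      obtain ⟨h2, h3⟩ := hd w (interior_subset h1) (hT.interior_ne h1)
      exact ⟨h2, by rw [h3, hFA (interior_subset h1)]⟩
  have hcA : ContinuousOn F A := hT.1.continuousOn.congr hFA
  have hcB : ContinuousOn F B := hT'.1.continuousOn.congr hFB
  have htend : ∀ w ∈ closure I, Tendsto F (𝓝[I] w) (𝓝 (F w)) := fun w hw =>
    (hcA w (hclA hw)).mono hIA
  have ha₀ : a₀ ∈ closure I := by rw [hI, closure_openSegment]; exact left_mem_segment _ _ _
  have ha₁ : a₁ ∈ closure I := by rw [hI, closure_openSegment]; exact right_mem_segment _ _ _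
  have hZ₀ : F a₀ ∈ X.Z := by rw [hFA (hclA ha₀)]; exact hT.1.corner 0
  have hZ₁ : F a₁ ∈ X.Z := by rw [hFA (hclA ha₁)]; exact hT.1.corner 1
  have hIp : I ⊆ interior (hull p) := IsQuad.diag_subset hq
  have hflat : ∀ w ∈ interior (hull p), X.IsFlatAt id F w := fun w hw =>
    (flat_dev (hFd w hw).1).congr (by
      filter_upwards [isOpen_interior.mem_nhds hw] with x hx using (hFd x hx).2)
  have hinjI : InjOn F I := (isSaddle_and_injOn_of_tendsto h.ne (fun w hw => hflat w (hIp hw)) hZ₀ hZ₁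
    (htend _ ha₀) (htend _ ha₁)).2
  have hIe : ∀ w ∈ I, F w ∈ e := fun w hw => by rw [hFI w hw, ← h.image]; exact ⟨w, hw, rfl⟩
  have hnA : ∀ w ∈ interior A, F w ∉ ⋃₀ E := fun w hw => by
    rw [hFA (interior_subset hw)]; exact disjoint_left.1 hT.2.2 ⟨w, hw, rfl⟩
  have hnB : ∀ w ∈ interior B, F w ∉ ⋃₀ E := fun w hw => by
    rw [hFB (interior_subset hw)]; exact disjoint_left.1 hT'.2.2 ⟨w, hw, rfl⟩
  have hAB : ∀ w ∈ interior A, ∀ w' ∈ interior B, F w ≠ F w' := by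
    intro w hw w' hw' hww
    rw [hFA (interior_subset hw), hFB (interior_subset hw')] at hww
    obtain ⟨ε, d, hε, -, ⟨j, hj⟩, hfd⟩ := hT.eq_of_meet hT' hw hw' hww
    have h0 : a₁ = ε * ![a₀, a₁, c] (0 + j) + d := hj 0
    have h1 : a₀ = ε * ![a₀, a₁, c] (1 + j) + d := hj 1
    have hre : ∀ u v : ℂ, a₁ = ε * u + d → a₀ = ε * v + d →
        |a₁.re - a₀.re| = |u.re - v.re| := by
      intro u v hu hv
      have : a₁ - a₀ = ε * (u - v) := by rw [hu, hv]; ring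
      rw [← sub_re, this, ← sub_re]
      rcases hε with rfl | rfl
      · rw [one_mul]
      · rw [neg_one_mul, neg_re, abs_neg]
    fin_cases j
    · have h0' : a₁ = ε * a₀ + d := h0
      have h1' : a₀ = ε * a₁ + d := h1
      have hε1 : ε = -1 := hε.resolve_left fun hε1 => by
        rw [hε1] at h0' h1'
        exact h.ne (by linear_combination (h1' - h0') / 2)
      rw [hε1] at h0' hfd
      have mI : ∀ t : ℝ, t ∈ Ioo (0 : ℝ) 1 → (1 - t : ℂ) * a₀ + t * a₁ ∈ I := fun t ht =>
        ⟨1 - t, t, sub_pos.2 ht.2, ht.1, by ring, by simp⟩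
      have m1 := mI (1 / 3) (by norm_num)
      have m2 := mI (2 / 3) (by norm_num)
      have e1 := hfd _ (hIA m1)
      have e2 : -1 * ((1 - ((1 / 3 : ℝ) : ℂ)) * a₀ + ((1 / 3 : ℝ) : ℂ) * a₁) + d =
          (1 - ((2 / 3 : ℝ) : ℂ)) * a₀ + ((2 / 3 : ℝ) : ℂ) * a₁ := by
        push_cast; linear_combination -h0'
      rw [e2, ← hFB (hIB m2), ← hFA (hIA m1)] at e1
      have e3 := hinjI m2 m1 e1
      push_cast at e3
      exact h.ne (by linear_combination -3 * e3)
    · have := hre a₁ c h0 h1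
      rw [abs_of_pos (by linarith), abs_of_pos (by linarith)] at this
      linarith
    · have := hre c a₀ h0 h1
      rw [abs_of_pos (by linarith), abs_of_pos (by linarith)] at this
      linarith
  refine ⟨F, ⟨?_, ?_, ?_, fun w hw => (hflat w hw).2, ?_⟩, ?_, ?_, ?_⟩
  · exact QuadPos.convex hq
  · refine (hcA.union_of_isClosed hcB (isCompact_hull _).isClosed (isCompact_hull _).isClosed).mono ?_
    exact fun w hw => hcov w hw
  · intro w hw w' hw' hww
    rcases lt_trichotomy (cr a₀ a₁ w) 0 with h0 | h0 | h0 <;>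
      rcases lt_trichotomy (cr a₀ a₁ w') 0 with h1 | h1 | h1
    · have := hBint w hw h0
      have h2 := hBint w' hw' h1
      rw [hFB (interior_subset this), hFB (interior_subset h2)] at hww
      exact hT'.1.injOn this h2 hww
    · exact absurd ⟨e, he, hww ▸ hIe w' (hIint w' hw' h1)⟩ (hnB w (hBint w hw h0))
    · exact absurd hww.symm (hAB _ (hAint w' hw' h1) _ (hBint w hw h0))
    · exact absurd ⟨e, he, hww ▸ hIe w (hIint w hw h0)⟩ (hnB w' (hBint w' hw' h1))
    · exact hinjI (hIint w hw h0) (hIint w' hw' h1) hww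
    · exact absurd ⟨e, he, hww ▸ hIe w (hIint w hw h0)⟩ (hnA w' (hAint w' hw' h1))
    · exact absurd hww (hAB _ (hAint w hw h0) _ (hBint w' hw' h1))
    · exact absurd ⟨e, he, hww ▸ hIe w' (hIint w' hw' h1)⟩ (hnA w (hAint w hw h0))
    · have := hAint w hw h0
      have h2 := hAint w' hw' h1
      rw [hFA (interior_subset this), hFA (interior_subset h2)] at hww
      exact hT.1.injOn this h2 hww
  · have m : ∀ i, F (![a₀, a₁, c] i) ∈ X.Z := fun i => by
      rw [hFA (subset_convexHull _ _ (mem_range_self i))]; exact hT.1.corner i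
    have m' : F c' ∈ X.Z := by
      have : F c' = f' c' := hFB (subset_convexHull _ _ (mem_range_self (f := ![a₁, a₀, c']) 2))
      rw [this]; exact hT'.1.corner 2
    intro i
    fin_cases i
    exacts [m 0, m', m 1, m 2]
  · have m : ∀ i : Fin 3, F '' seg (![a₀, a₁, c] i) (![a₀, a₁, c] (i + 1)) ∈ E := fun i => by
      rw [(hFA.mono fun w hw => (hT.side_mem hw).1).image_eq]; exact hT.2.1 i
    have m' : ∀ i : Fin 3, F '' seg (![a₁, a₀, c'] i) (![a₁, a₀, c'] (i + 1)) ∈ E :=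
      fun i => by rw [(hFB.mono fun w hw => (hT'.side_mem hw).1).image_eq]; exact hT'.2.1 i
    intro i
    fin_cases i
    exacts [m' 1, m' 2, m 1, m 2]
  · have : F '' I = e := by rw [image_congr hFI]; exact h.image
    exact this.symm ▸ he
  · rw [disjoint_left]
    rintro _ ⟨w, ⟨hw, hwd⟩, rfl⟩
    rcases lt_trichotomy (cr a₀ a₁ w) 0 with h0 | h0 | h0
    · exact hnB w (hBint w hw h0)
    · exact absurd (hIint w hw h0) hwd
    · exact hnA w (hAint w hw h0)

/-- On a vertically Keane surface, a staggered triangulation can be flipped at its widest edge. -/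
theorem IsStaggered.exists_flip (hX : X.VerticallyKeane)
    (hE : X.IsStaggered E) : ∃ E', X.IsStaggered E' ∧ X.IsForwardFlip E E' := by
  choose! v hv using hE.1.saddle
  obtain ⟨e, he, hmax⟩ := E.exists_max_image (fun e => |(v e).re|) hE.1.finite hE.1.nonempty
  obtain ⟨x, hx⟩ := (hv e he).nonempty
  obtain ⟨δ, hδ, g, rfl, hg⟩ := exists_germ ((hv e he).subset_compl hx) 0
  obtain ⟨a₀, a₁, h, hlt, hW⟩ : ∃ a₀ a₁, X.IsFrame 0 g e a₀ a₁ ∧ a₀.re < a₁.re ∧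
      a₁.re - a₀.re = |(v e).re| := by
    obtain ⟨a₀, a₁, h, hav⟩ := (hv e he).exists_frame
      (base_mem_dom hδ hg (mem_ball_self hδ)) hx
    have hre : a₁.re - a₀.re = (v e).re := by rw [← hav, sub_re]
    rcases lt_or_gt_of_ne (hE.2 e he _ (hv e he)) with h0 | h0
    · exact ⟨a₁, a₀, h.swap, by linarith, by rw [abs_of_neg h0]; linarith⟩
    · exact ⟨a₀, a₁, h, by linarith, by rw [abs_of_pos h0]; linarith⟩
  obtain ⟨c, f, hT, hd⟩ := hE.1.exists_above he h
  obtain ⟨c', f', hT', hd'⟩ := hE.1.exists_above he h.swap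
  have side : ∀ {p f}, X.IsTriangle E p f → ∀ i, (p (i + 1)).re - (p i).re ≠ 0 ∧
      |(p (i + 1)).re - (p i).re| ≤ a₁.re - a₀.re := by
    intro p f hp i
    have hs := hp.saddle hE.1.saddle i
    rw [← sub_re, hW]
    refine ⟨hE.2 _ (hp.2.1 i) _ hs, le_trans (le_of_eq ?_) (hmax _ (hp.2.1 i))⟩
    rcases (hv _ (hp.2.1 i)).holonomy_eq hs with h | h
    · rw [h]
    · rw [h, neg_re, abs_neg]
  have btw : ∀ {c f}, X.IsTriangle E ![a₀, a₁, c] f ∨ X.IsTriangle E ![a₁, a₀, c] f →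
      a₀.re < c.re ∧ c.re < a₁.re := by
    intro c f hc
    have : (c.re - a₁.re ≠ 0 ∧ |c.re - a₁.re| ≤ a₁.re - a₀.re) ∧
        (c.re - a₀.re ≠ 0 ∧ |c.re - a₀.re| ≤ a₁.re - a₀.re) := by
      rcases hc with hc | hc
      · refine ⟨side hc 1, ?_⟩
        have : a₀.re - c.re ≠ 0 ∧ |a₀.re - c.re| ≤ a₁.re - a₀.re := side hc 2
        rwa [abs_sub_comm, sub_ne_zero, ne_comm, ← sub_ne_zero] at this
      · refine ⟨?_, side hc 1⟩
        have : a₁.re - c.re ≠ 0 ∧ |a₁.re - c.re| ≤ a₁.re - a₀.re := side hc 2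
        rwa [abs_sub_comm, sub_ne_zero, ne_comm, ← sub_ne_zero] at this
    obtain ⟨⟨h1, h2⟩, h3, h4⟩ := this
    rw [abs_le] at h2 h4
    exact ⟨lt_of_le_of_ne (by linarith) (sub_ne_zero.1 h3).symm,
      lt_of_le_of_ne (by linarith) (sub_ne_zero.1 h1)⟩
  obtain ⟨F, hQ⟩ := h.exists_quad he hT hT' hd hd' (btw (Or.inl hT)) (btw (Or.inr hT'))
  refine ⟨_, ⟨hQ.isStraightTriangulation_flip hE.1 rfl, fun e _ v hv => hX e v hv⟩, _, F, hQ, ?_, rfl⟩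
  have b := btw (Or.inl hT)
  have b' := btw (Or.inr hT')
  have hW' : |(a₁ - a₀).re| = a₁.re - a₀.re := by rw [sub_re, abs_of_pos (sub_pos.2 hlt)]
  intro i
  refine le_trans ?_ hW'.ge
  fin_cases i
  · change |(c' - a₀).re| ≤ _
    rw [sub_re, abs_le]; constructor <;> linarith
  · change |(a₁ - c').re| ≤ _
    rw [sub_re, abs_le]; constructor <;> linarith
  · change |(c - a₁).re| ≤ _
    rw [sub_re, abs_le]; constructor <;> linarith
  · change |(a₀ - c).re| ≤ _
    rw [sub_re, abs_le]; constructor <;> linarith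

/-- A staggered triangulation of a vertically Keane surface starts an infinite flip sequence. -/
theorem IsStaggered.exists_flipSequence (hX : X.VerticallyKeane)
    (hE : X.IsStaggered E) : ∃ τ, X.IsStaggeredFlipSequence τ := by
  choose! F hF hFF using fun (E : Set (Set S)) (hE : X.IsStaggered E) => hE.exists_flip hX
  have h : ∀ n : ℕ, X.IsStaggered (F^[n] E) := by
    intro n
    induction n with
    | zero => exact hE
    | succ n ih => rw [Function.iterate_succ_apply']; exact hF _ ih
  exact ⟨fun n => F^[n] E, h, fun n => by
    simp only [Function.iterate_succ_apply']; exact hFF _ (h n)⟩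

theorem dom_congr {g g' : ℂ → S} (h : g =ᶠ[𝓝 b] g')
    (hw : w ∈ X.dom b g) : w ∈ X.dom b g' ∧ X.dev b g' w = X.dev b g w := by
  obtain ⟨U, f, hU, hc, hb, hwU, hf, hg⟩ := hw
  have h1 := dev_eq hU hc hb hf (hg.trans h) hwU
  exact ⟨h1.1, h1.2.trans (dev_eq hU hc hb hf hg hwU).2.symm⟩

theorem dom_halfTr (hε : ε = 1 ∨ ε = -1) (d : ℂ)
    (hw : w ∈ X.dom b g) : ε * w + d ∈ X.dom (ε * b + d) (fun u => g (ε * (u - d))) ∧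
      X.dev (ε * b + d) (fun u => g (ε * (u - d))) (ε * w + d) = X.dev b g w := by
  obtain ⟨U, f, hU, hc, hb, hwU, hf, hg⟩ := hw
  have hcont : Continuous fun u : ℂ => ε * (u - d) := by fun_prop
  have e : ∀ u : ℂ, ε * (ε * u + d - d) = u := fun u => by
    rw [add_sub_cancel_right, ← mul_assoc, sq_eq_one_of_sign hε, one_mul]
  have := dev_eq (X := X) (U := (fun u => ε * (u - d)) ⁻¹' U) (f := fun u => f (ε * (u - d)))
    (b := ε * b + d) (g := fun u => g (ε * (u - d))) (w := ε * w + d)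
    (hU.preimage hcont) (by rw [← halfTr_image_eq_preimage hε]; exact hc.affine_image _)
    (by rwa [mem_preimage, e])
    (fun u hu => (hf _ hu).comp (k := fun u => ε * (u - d)) hcont.continuousAt hε (c := -(ε * d))
      (Eventually.of_forall fun y => by simp only [id]; ring))
    (by have := hcont.tendsto (ε * b + d); rw [e] at this; exact this.eventually hg)
    (by rwa [mem_preimage, e])
  rw [e] at this
  exact ⟨this.1, this.2.trans (dev_eq hU hc hb hf hg hwU).2.symm⟩

variable (X) in
/-- The disc of centre `c` and radius `r` develops from the germ of `g` at its point `b`. -/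
def IsDisc (b : ℂ) (g : ℂ → S) (c : ℂ) (r : ℝ) : Prop := b ∈ ball c r ∧ ball c r ⊆ X.dom b g

theorem segment_diff_subset_ball {c x y : ℂ} (hx : x ∈ ball c r)
    (hy : y ∈ closedBall c r) {u : ℂ} (hu : u ∈ segment ℝ x y) (huy : u ≠ y) :
    u ∈ ball c r := by
  rcases eq_or_ne u x with rfl | hux
  · exact hx
  have hr : r ≠ 0 := (Metric.pos_of_mem_ball hx).ne'
  rw [← interior_closedBall c hr] at hx ⊢
  exact (convex_closedBall c r).openSegment_interior_self_subset_interior hx hy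
    (mem_openSegment_of_ne_left_right hux.symm huy.symm hu)

namespace IsDisc

theorem mem_dom_of_germ (h : X.IsDisc b g c r) (hx : x ∈ ball c r)
    {g' : ℂ → S} (hg : X.dev b g =ᶠ[𝓝 x] g') {y : ℂ} (hy : y ∈ closedBall c r)
    (hyd : y ∈ X.dom b g) : y ∈ X.dom x g' ∧ X.dev x g' y = X.dev b g y := by
  obtain ⟨U, f, hU, hc, hb, hyU, hf, hfg⟩ := hyd
  obtain ⟨F, hF, hFU, hFB⟩ := exists_glue hU isOpen_ball hf (fun x hx => flat_dev (h.2 hx))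
    (hc.inter (convex_ball c r)).isPreconnected ⟨hb, h.1⟩ (hfg.trans (dev_base (h.2 h.1)).symm)
  have := dev_of_segment (hU.union isOpen_ball) hF (b := x) (w := y) (g := g') (fun u hu => by
    by_cases huy : u = y
    · exact Or.inl (huy ▸ hyU)
    · exact Or.inr (segment_diff_subset_ball hx hy hu huy)) (by
      filter_upwards [isOpen_ball.mem_nhds hx, hg] with u hu hug
      rw [hFB hu, hug])
  exact ⟨this.1, by rw [this.2, hFU hyU, (dev_eq hU hc hb hf hfg hyU).2]⟩

theorem rebase (h : X.IsDisc b g c r) (hx : x ∈ ball c r) :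
    X.IsDisc x (X.dev b g) c r ∧ ∀ y ∈ closedBall c r, (y ∈ X.dom x (X.dev b g) ↔ y ∈ X.dom b g) ∧
      (y ∈ X.dom b g → X.dev x (X.dev b g) y = X.dev b g y) := by
  have h1 := fun y hy hyd => h.mem_dom_of_germ hx (EventuallyEq.refl _ (X.dev b g)) (y := y) hy hyd
  have h2 : X.IsDisc x (X.dev b g) c r :=
    ⟨hx, fun y hy => (h1 y (ball_subset_closedBall hy) (h.2 hy)).1⟩
  refine ⟨h2, fun y hy => ⟨⟨fun hyd => (h2.mem_dom_of_germ h.1 ?_ hy hyd).1, fun hyd =>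
    (h1 y hy hyd).1⟩, fun hyd => (h1 y hy hyd).2⟩⟩
  filter_upwards [isOpen_ball.mem_nhds h.1, dev_base (h.2 h.1)] with u hu hug
  rw [(h1 u (ball_subset_closedBall hu) (h.2 hu)).2, hug]

/-- Two discs that meet, in a common coordinate. -/
theorem transport (h : X.IsDisc b g c r) {b' : ℂ} {g' : ℂ → S} {c' : ℂ} {r' : ℝ}
    (h' : X.IsDisc b' g' c' r') {x x' : ℂ} (hx : x ∈ ball c r) (hx' : x' ∈ ball c' r')
    (heq : X.dev b' g' x' = X.dev b g x) :
    ∃ ε d : ℂ, (ε = 1 ∨ ε = -1) ∧ x = ε * x' + d ∧ X.IsDisc x (X.dev b g) (ε * c' + d) r' ∧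
      ∀ y ∈ closedBall c' r', (ε * y + d ∈ X.dom x (X.dev b g) ↔ y ∈ X.dom b' g') ∧
        (y ∈ X.dom b' g' → X.dev x (X.dev b g) (ε * y + d) = X.dev b' g' y) := by
  obtain ⟨ε, hε, hgerm⟩ := (flat_dev (h.2 hx)).germ_eq (flat_dev (h'.2 hx')) continuousAt_id heq
  have hεε := sq_eq_one_of_sign hε
  obtain ⟨h1, h2⟩ := h'.rebase hx'
  set d := x - ε * x' with hd
  have hxd : x = ε * x' + d := by rw [hd]; ring
  have hcont : Continuous fun u : ℂ => ε * (u - d) := by fun_prop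
  have e0 : ε * (x - d) = x' := by rw [hd, sub_sub_cancel, ← mul_assoc, hεε, one_mul]
  have hg : (fun u => X.dev b' g' (ε * (u - d))) =ᶠ[𝓝 x] X.dev b g := by
    have := hcont.tendsto x
    rw [e0] at this
    filter_upwards [this.eventually hgerm] with u hu
    rw [hu]
    congr 1
    simp only [id]
    linear_combination (u - d) * hεε + hxd
  have key : ∀ y, y ∈ X.dom x' (X.dev b' g') → ε * y + d ∈ X.dom x (X.dev b g) ∧
      X.dev x (X.dev b g) (ε * y + d) = X.dev x' (X.dev b' g') y := by
    intro y hy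
    have k1 := dom_halfTr hε d hy
    rw [← hxd] at k1
    have k2 := dom_congr hg k1.1
    exact ⟨k2.1, k2.2.trans k1.2⟩
  have key' : ∀ y, ε * y + d ∈ X.dom x (X.dev b g) → y ∈ X.dom x' (X.dev b' g') := by
    intro y hy
    have k1 := (dom_halfTr hε (-(ε * d)) hy).1
    have e1 : ∀ u : ℂ, ε * (ε * u + d) + -(ε * d) = u := fun u => by linear_combination u * hεε
    have e2 : ε * x + -(ε * d) = x' := by rw [← e0]; ring
    rw [e1, e2] at k1
    refine (dom_congr ?_ k1).1
    filter_upwards [hgerm] with u hu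
    rw [hu]
    congr 1
    simp only [id]
    linear_combination d * hεε - hxd
  refine ⟨ε, d, hε, hxd, ⟨?_, fun y hy => ?_⟩, fun y hy => ⟨⟨fun hyd => ?_, fun hyd => ?_⟩, fun hyd => ?_⟩⟩
  · rw [hxd, mem_ball, dist_eq_norm, add_sub_add_right_eq_sub, ← mul_sub, norm_mul,
      norm_of_sign hε, one_mul, ← dist_eq_norm]
    exact hx'
  · have e1 : ε * (ε * (y - d)) + d = y := by linear_combination (y - d) * hεε
    rw [← e1]
    refine (key _ (h1.2 ?_)).1
    rw [← e1, mem_ball, dist_eq_norm, add_sub_add_right_eq_sub, ← mul_sub, norm_mul,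
      norm_of_sign hε, one_mul, ← dist_eq_norm] at hy
    exact hy
  · exact (h2 y hy).1.1 (key' y hyd)
  · exact (key y ((h2 y hy).1.2 hyd)).1
  · exact (key y ((h2 y hy).1.2 hyd)).2.trans ((h2 y hy).2 hyd)

end IsDisc

/-- The radius of a disc that develops is bounded. -/
theorem exists_radius_bound [ConnectedSpace S]
    (X : HalfTranslationSurface S) :
    ∃ R : ℝ, ∀ b g c r, ball c r ⊆ X.dom b g → r ≤ R := by
  set A : Set S := {y | ∃ c g, g c = y ∧ c ∈ X.dom c g ∧ X.dom c g = univ} with hA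
  have hlim : ∀ y ∉ X.Z, (∀ n : ℕ, ∃ᶠ y' in 𝓝 y, ∃ c g, g c = y' ∧ c ∈ X.dom c g ∧
      ball c n ⊆ X.dom c g) → y ∈ A := by
    intro y hy hfr
    obtain ⟨δ, hδ, g, rfl, hg⟩ := exists_germ hy 0
    have hdisc : X.IsDisc 0 g 0 δ := ⟨mem_ball_self hδ, base_mem_dom hδ hg⟩
    refine ⟨0, g, rfl, hdisc.2 hdisc.1, eq_univ_of_forall fun w => ?_⟩
    have hnear : X.dev 0 g '' ball 0 (min δ 1) ∈ 𝓝 (g 0) := by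
      rw [← (dev_base (hdisc.2 hdisc.1)).eq_of_nhds, ← (flat_dev (hdisc.2 hdisc.1)).map_nhds]
      exact image_mem_map (ball_mem_nhds _ (lt_min hδ one_pos))
    obtain ⟨n, hn⟩ := exists_nat_gt (‖w‖ + 1)
    obtain ⟨y', ⟨c, g', rfl, hc, hball⟩, u, hu, huy⟩ := ((hfr n).and_eventually hnear).exists
    have hn0 : (0 : ℝ) < n := (by positivity : (0 : ℝ) ≤ ‖w‖ + 1).trans_lt hn
    have huδ : u ∈ ball (0 : ℂ) δ := ball_subset_ball (min_le_left _ _) hu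
    have hu1 : ‖u‖ < 1 := mem_ball_zero_iff.1 (ball_subset_ball (min_le_right _ _) hu)
    have hdisc' : X.IsDisc c g' c n := ⟨mem_ball_self hn0, hball⟩
    obtain ⟨ε, d, hε, hud, hD, -⟩ := hdisc.transport hdisc' huδ hdisc'.1
      (by rw [huy, (dev_base hc).eq_of_nhds])
    rw [← hud] at hD
    have h0 : (0 : ℂ) ∈ ball u n := by
      rw [mem_ball_iff_norm, zero_sub, norm_neg]; linarith [norm_nonneg w]
    have hw : w ∈ ball u n := by
      rw [mem_ball_iff_norm]; linarith [norm_sub_le w u]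
    refine (hD.mem_dom_of_germ h0 ?_ (ball_subset_closedBall hw) (hD.2 hw)).1
    filter_upwards [ball_mem_nhds 0 hδ, dev_base (hdisc.2 hdisc.1)] with x hx hxg
    rw [((hdisc.rebase huδ).2 x (ball_subset_closedBall hx)).2 (hdisc.2 hx), hxg]
  by_contra! hcon
  have hbig : ∀ n : ℕ, ∃ y c g, g c = y ∧ c ∈ X.dom c g ∧ ball c n ⊆ X.dom c g := by
    intro n
    obtain ⟨b, g, c, r, hball, hr⟩ := hcon n
    have hc : c ∈ ball c r := mem_ball_self (n.cast_nonneg.trans_lt hr)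
    have key : ball c r ⊆ X.dom c (X.dev b g) := fun w hw =>
      (dev_eq isOpen_ball (convex_ball c r) hc (fun x hx => flat_dev (hball hx))
        (EventuallyEq.refl _ _) hw).1
    exact ⟨_, c, X.dev b g, rfl, key hc, (ball_subset_ball hr.le).trans key⟩
  choose y c g hy hc hball using hbig
  obtain ⟨y₀, -, hy₀⟩ := isCompact_univ.ultrafilter_le_nhds ((hyperfilter ℕ).map y) (by simp)
  have ht : Tendsto y (hyperfilter ℕ) (𝓝 y₀) := hy₀
  have hge : ∀ n : ℕ, ∀ᶠ m in (hyperfilter ℕ : Filter ℕ), n ≤ m := fun n =>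
    Nat.hyperfilter_le_atTop (eventually_ge_atTop n)
  have hy₀Z : y₀ ∉ X.Z := fun hz => by
    obtain ⟨n, hn1, hn⟩ := ((hge 1).and (ht.eventually
      (eventually_exists_notMem_dom hz one_pos))).exists
    obtain ⟨w, hw, hwd⟩ := hn (c n) (g n) (hy n) (hc n)
    exact hwd (hball n (ball_subset_ball (by exact_mod_cast hn1) hw))
  have hy₀A : y₀ ∈ A := hlim y₀ hy₀Z fun n => ht.frequently (((hge n).mono fun m hm =>
    ⟨c m, g m, hy m, hc m, (ball_subset_ball (by exact_mod_cast hm)).trans (hball m)⟩).frequently)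
  have hAopen : IsOpen A := by
    rw [isOpen_iff_mem_nhds]
    rintro _ ⟨c, g, rfl, hc, huniv⟩
    rw [← (dev_base hc).eq_of_nhds, ← (flat_dev hc).map_nhds]
    refine mem_map.2 (Eventually.of_forall fun u => ?_)
    have : ∀ w, w ∈ X.dom u (X.dev c g) := fun w => (dev_eq isOpen_univ convex_univ (mem_univ u)
      (fun x _ => flat_dev (huniv ▸ mem_univ x)) (EventuallyEq.refl _ _) (mem_univ w)).1
    exact ⟨u, X.dev c g, rfl, this u, eq_univ_of_forall this⟩
  have hall : X.Zᶜ ⊆ A := isPreconnected_compl_Z.subset_of_closure_inter_subset hAopen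
    ⟨y₀, hy₀Z, hy₀A⟩ fun y hy => hlim y hy.2 fun n => (mem_closure_iff_frequently.1 hy.1).mono
      fun y' ⟨c, g, h1, h2, h3⟩ => ⟨c, g, h1, h2, h3 ▸ subset_univ _⟩
  obtain ⟨z, hz⟩ := X.nonempty_Z
  have := X.neBot_punctured z
  have hnZ : ∀ᶠ x in 𝓝[≠] z, x ∉ X.Z := by
    filter_upwards [mem_nhdsWithin_of_mem_nhds ((X.finite_Z.subset (sdiff_subset (t := {z}))).isClosed.isOpen_compl.mem_nhds
      (fun h => h.2 rfl : z ∉ X.Z \ {z})), self_mem_nhdsWithin] with x hx hxz hxZ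
    exact hx ⟨hxZ, hxz⟩
  obtain ⟨x, hxZ, hx⟩ := (hnZ.and (nhdsWithin_le_nhds
    (eventually_exists_notMem_dom hz one_pos))).exists
  obtain ⟨c, g, hgc, hc, huniv⟩ := hall hxZ
  obtain ⟨w, -, hw⟩ := hx c g hgc hc
  exact hw (huniv ▸ mem_univ w)

theorem exists_tendsto_hyperfilter {α : Type*} [TopologicalSpace α] {K : Set α} (hK : IsCompact K)
    {f : ℕ → α} (hf : ∀ᶠ n in (hyperfilter ℕ : Filter ℕ), f n ∈ K) :
    ∃ a ∈ K, Tendsto f (hyperfilter ℕ) (𝓝 a) :=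
  hK.ultrafilter_le_nhds' ((hyperfilter ℕ).map f) hf

theorem norm_sub_sq_eq (x c : ℂ) : ‖x - c‖ ^ 2 = (x.re - c.re) ^ 2 + (x.im - c.im) ^ 2 := by
  rw [Complex.sq_norm, Complex.normSq_apply, sub_re, sub_im]; ring

theorem mem_ball_iff_sq {x c : ℂ} (hr : 0 < r) : x ∈ ball c r ↔ ‖x - c‖ ^ 2 - r ^ 2 < 0 := by
  rw [mem_ball_iff_norm, sub_neg, sq_lt_sq₀ (norm_nonneg _) hr.le]

theorem mem_sphere_iff_sq {x c : ℂ} (hr : 0 < r) : x ∈ sphere c r ↔ ‖x - c‖ ^ 2 - r ^ 2 = 0 := by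
  rw [mem_sphere_iff_norm, sub_eq_zero, sq_eq_sq₀ (norm_nonneg _) hr.le]

namespace IsDisc

theorem pos (h : X.IsDisc b g c r) : 0 < r := Metric.pos_of_mem_ball h.1

theorem visible (h : X.IsDisc b g c r) {y : ℂ} (hy : y ∈ closedBall c r)
    (hyd : y ∉ X.dom b g) : halfOpen b y ⊆ ball c r := by
  intro u hu
  refine segment_diff_subset_ball h.1 hy (halfOpen_subset_segment b y hu) ?_
  rintro rfl
  obtain ⟨s, hs, he⟩ := hu
  rcases AffineMap.lineMap_eq_right_iff.1 he with h1 | h1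
  · exact hyd (h1 ▸ h.2 h.1)
  · exact hs.2.ne h1

theorem transport_base (h : X.IsDisc b g c r) {b' : ℂ} {g' : ℂ → S} {c' : ℂ} {r' : ℝ}
    (h' : X.IsDisc b' g' c' r') {x x' : ℂ} (hx : x ∈ ball c r) (hx' : x' ∈ ball c' r')
    (heq : X.dev b' g' x' = X.dev b g x) :
    ∃ ε d : ℂ, (ε = 1 ∨ ε = -1) ∧ x = ε * x' + d ∧ (b ∈ ball (ε * c' + d) r' →
      X.IsDisc b g (ε * c' + d) r' ∧
      ∀ y ∈ closedBall c' r', (ε * y + d ∈ X.dom b g ↔ y ∈ X.dom b' g') ∧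
        (y ∈ X.dom b' g' → X.dev b g (ε * y + d) = X.dev b' g' y)) := by
  obtain ⟨ε, d, hε, hxd, hD, hiff⟩ := h.transport h' hx hx' heq
  refine ⟨ε, d, hε, hxd, fun hb => ?_⟩
  have hg : X.dev x (X.dev b g) =ᶠ[𝓝 b] g := by
    filter_upwards [isOpen_ball.mem_nhds h.1, dev_base (h.2 h.1)] with u hu hug
    rw [((h.rebase hx).2 u (ball_subset_closedBall hu)).2 (h.2 hu), hug]
  have k1 := fun y hy hyd => hD.mem_dom_of_germ hb hg (y := y) hy hyd
  have hD' : X.IsDisc b g (ε * c' + d) r' :=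
    ⟨hb, fun y hy => (k1 y (ball_subset_closedBall hy) (hD.2 hy)).1⟩
  have k2 := fun y hy hyd => hD'.mem_dom_of_germ hD.1 (EventuallyEq.refl _ _) (y := y) hy hyd
  have hcb : ∀ y ∈ closedBall c' r', ε * y + d ∈ closedBall (ε * c' + d) r' := by
    intro y hy
    rw [mem_closedBall_iff_norm, add_sub_add_right_eq_sub, ← mul_sub, norm_mul, norm_of_sign hε,
      one_mul]
    exact mem_closedBall_iff_norm.1 hy
  exact ⟨hD', fun y hy => ⟨⟨fun hyd => (hiff y hy).1.1 (k2 _ (hcb y hy) hyd).1, fun hyd =>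
    (k1 _ (hcb y hy) ((hiff y hy).1.2 hyd)).1⟩, fun hyd => by
      rw [(k1 _ (hcb y hy) ((hiff y hy).1.2 hyd)).2, (hiff y hy).2 hyd]⟩⟩

theorem finite (h : X.IsDisc b g c r) :
    (sphere c r \ X.dom b g).Finite := by
  by_contra hinf
  obtain ⟨y, hy, hacc⟩ := Set.Infinite.exists_accPt_of_subset_isCompact hinf (isCompact_sphere c r)
    sdiff_subset
  have hcl : IsClosed (sphere c r \ X.dom b g) :=
    Metric.isClosed_sphere.inter isOpen_dom.isClosed_compl
  have hyV : y ∈ sphere c r \ X.dom b g := by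
    rw [← hcl.closure_eq]; exact mem_closure_iff_clusterPt.2 hacc.clusterPt
  have hs : ∀ y ∈ sphere c r \ X.dom b g, halfOpen b y ⊆ X.dom b g := fun y hy =>
    (h.visible (sphere_subset_closedBall hy.1) hy.2).trans h.2
  obtain ⟨w, ⟨hwy, hw⟩, hw'⟩ := ((accPt_iff_frequently.1 hacc).and_eventually
    (eventually_eq_of_visible hyV.2 (hs y hyV))).exists
  exact hwy (hw' hw.2 (hs w hw))

/-- A disc grows along a pencil of circles until it meets a new marked point. -/
theorem exists_growth [ConnectedSpace S] (h : X.IsDisc b g c r) (n : ℂ)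
    (m : ℝ) {l : ℂ → ℝ} (hl : ∀ x, l x = n.re * x.re + n.im * x.im + m) (hlb : 0 ≤ l b)
    (hnm : n ≠ 0 ∨ n = 0 ∧ 0 < m) :
    ∃ c' r' t, X.IsDisc b g c' r' ∧ (∀ x, ‖x - c'‖ ^ 2 - r' ^ 2 = ‖x - c‖ ^ 2 - r ^ 2 - t * l x) ∧
      ∃ w ∈ sphere c' r' \ X.dom b g, 0 < l w := by
  obtain ⟨R, hR⟩ := exists_radius_bound X
  set Q : ℝ → ℂ → ℝ := fun t x => ‖x - c‖ ^ 2 - r ^ 2 - t * l x with hQ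
  set C : ℝ → ℂ := fun t => c + (t / 2 : ℝ) * n with hC
  set ρ : ℝ → ℝ := fun t => r ^ 2 + t * l c + t ^ 2 * (n.re ^ 2 + n.im ^ 2) / 4 with hρ
  have hlc : Continuous l := by
    have : l = fun x => n.re * x.re + n.im * x.im + m := funext hl
    rw [this]; fun_prop
  have hQC : ∀ t x, Q t x = ‖x - C t‖ ^ 2 - ρ t := by
    intro t x
    simp only [hQ, hρ, hC, norm_sub_sq_eq, hl, add_re, add_im, re_ofReal_mul, im_ofReal_mul]
    ring
  have hb0 : Q 0 b < 0 := by
    have := (mem_ball_iff_sq h.pos).1 h.1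
    simpa [hQ] using this
  have hQb : ∀ t ≥ 0, Q t b < 0 := fun t ht => by
    simp only [hQ] at hb0 ⊢
    nlinarith [mul_nonneg ht hlb]
  have hρ0 : ∀ t ≥ 0, 0 < ρ t := fun t ht => by
    have := hQb t ht
    rw [hQC] at this
    nlinarith [sq_nonneg ‖b - C t‖]
  have hball : ∀ t ≥ 0, {x | Q t x < 0} = ball (C t) √(ρ t) := by
    intro t ht
    ext x
    rw [mem_ball_iff_sq (Real.sqrt_pos.2 (hρ0 t ht)), Real.sq_sqrt (hρ0 t ht).le, ← hQC]
    rfl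
  set T : Set ℝ := {t | 0 ≤ t ∧ {x | Q t x < 0} ⊆ X.dom b g} with hT
  have h0T : (0 : ℝ) ∈ T := by
    refine ⟨le_rfl, fun x hx => h.2 ((mem_ball_iff_sq h.pos).2 ?_)⟩
    have : Q 0 x < 0 := hx
    simpa [hQ] using this
  have hR0 : 0 < R := h.pos.trans_le (hR _ _ _ _ h.2)
  have hTρ : ∀ t ∈ T, ρ t ≤ R ^ 2 := by
    rintro t ⟨ht, hsub⟩
    rw [hball t ht] at hsub
    exact (Real.sqrt_le_left hR0.le).1 (hR _ _ _ _ hsub)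
  have hTb : BddAbove T := by
    rcases hnm with hn | ⟨rfl, hm⟩
    · set N := n.re ^ 2 + n.im ^ 2 with hN
      have hN0 : 0 < N := by
        have := Complex.normSq_pos.2 hn
        rw [Complex.normSq_apply] at this; nlinarith
      refine ⟨max 1 (4 * (R ^ 2 + |l c|) / N), fun t ht => ?_⟩
      by_contra! hcon
      obtain ⟨h1, h2⟩ := max_lt_iff.1 hcon
      rw [div_lt_iff₀ hN0] at h2
      have h3 := hTρ t ht
      have h4 := neg_abs_le (l c)
      have h5 : R ^ 2 < t * N / 4 + l c := by linarith
      have h6 : t * R ^ 2 < t * (t * N / 4 + l c) := mul_lt_mul_of_pos_left h5 (by linarith)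
      have h7 : R ^ 2 ≤ t * R ^ 2 := le_mul_of_one_le_left (sq_nonneg _) h1.le
      have h8 : ρ t = r ^ 2 + t * (t * N / 4 + l c) := by simp only [hρ]; ring
      nlinarith [sq_nonneg r]
    · refine ⟨R ^ 2 / m, fun t ht => ?_⟩
      rw [le_div_iff₀ hm]
      have h3 := hTρ t ht
      have : l c = m := by rw [hl]; simp
      simp only [hρ, this, Complex.zero_re, Complex.zero_im] at h3
      nlinarith [sq_nonneg r]
  set t₀ := sSup T with ht₀
  have ht₀0 : 0 ≤ t₀ := le_csSup hTb h0T
  have hneg : ∀ t x, Q t x < 0 → l x ≤ 0 → 0 ≤ t → x ∈ X.dom b g := by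
    intro t x hx hlx ht
    refine h0T.2 (show Q 0 x < 0 from ?_)
    simp only [hQ] at hx ⊢
    nlinarith [mul_nonneg ht (neg_nonneg.2 hlx)]
  have ht₀T : t₀ ∈ T := by
    refine ⟨ht₀0, fun x (hx : Q t₀ x < 0) => ?_⟩
    rcases le_or_gt (l x) 0 with hlx | hlx
    · exact hneg _ x hx hlx ht₀0
    · obtain ⟨t, ht, htt⟩ := exists_lt_of_lt_csSup ⟨0, h0T⟩
        (sub_lt_self (sSup T) (div_pos (neg_pos.2 hx) hlx))
      refine ht.2 (show Q t x < 0 from ?_)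
      have : (t₀ - t) * l x < -Q t₀ x := by
        rw [← lt_div_iff₀ hlx]; linarith
      simp only [hQ] at this ⊢
      linarith
  have hdisc : X.IsDisc b g (C t₀) √(ρ t₀) := by
    rw [IsDisc, ← hball t₀ ht₀0]; exact ⟨hQb t₀ ht₀0, ht₀T.2⟩
  refine ⟨C t₀, √(ρ t₀), t₀, hdisc, fun x => ?_, ?_⟩
  · rw [Real.sq_sqrt (hρ0 _ ht₀0).le]; exact (hQC t₀ x).symm
  by_contra! hcon
  have hx : ∀ k : ℕ, ∃ x, Q (t₀ + 1 / ((k : ℝ) + 1)) x < 0 ∧ x ∉ X.dom b g := by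
    intro k
    have hk : (0 : ℝ) < 1 / ((k : ℝ) + 1) := by positivity
    by_contra! hk'
    have := le_csSup hTb (show t₀ + 1 / ((k : ℝ) + 1) ∈ T from ⟨by linarith, hk'⟩)
    linarith
  choose x hxQ hxd using hx
  have hxl : ∀ k, 0 < l (x k) := fun k => by
    by_contra hk
    exact hxd k (hneg _ _ (hxQ k) (not_lt.1 hk) (by positivity))
  obtain ⟨y, -, hy⟩ := exists_tendsto_hyperfilter (isCompact_closedBall (C (t₀ + 1)) √(ρ (t₀ + 1)))
    (f := x) (Eventually.of_forall fun k => by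
      refine ball_subset_closedBall ?_
      rw [← hball _ (by linarith)]
      change Q (t₀ + 1) (x k) < 0
      have h1 := hxQ k
      have h2 : 1 / ((k : ℝ) + 1) ≤ 1 := by
        rw [div_le_one (by positivity)]; linarith [k.cast_nonneg (α := ℝ)]
      simp only [hQ] at h1 ⊢
      nlinarith [hxl k])
  have hyd : y ∉ X.dom b g := isOpen_dom.isClosed_compl.mem_of_tendsto hy (Eventually.of_forall hxd)
  have hly : 0 ≤ l y := ge_of_tendsto ((hlc.tendsto y).comp hy) (Eventually.of_forall fun k => (hxl k).le)
  have htk : Tendsto (fun k : ℕ => t₀ + 1 / ((k : ℝ) + 1)) (hyperfilter ℕ) (𝓝 t₀) := by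
    have := (tendsto_one_div_add_atTop_nhds_zero_nat (𝕜 := ℝ)).const_add t₀
    rw [add_zero] at this
    exact this.mono_left Nat.hyperfilter_le_atTop
  have hQy : Q t₀ y ≤ 0 := by
    have : Tendsto (fun k : ℕ => Q (t₀ + 1 / ((k : ℝ) + 1)) (x k)) (hyperfilter ℕ) (𝓝 (Q t₀ y)) :=
      (((hy.sub_const c).norm.pow 2).sub_const _).sub (htk.mul ((hlc.tendsto y).comp hy))
    exact le_of_tendsto this (Eventually.of_forall fun k => (hxQ k).le)
  have hQy0 : Q t₀ y = 0 := le_antisymm hQy (not_lt.1 fun hlt => hyd (ht₀T.2 hlt))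
  have hly0 : l y = 0 := by
    refine le_antisymm (hcon y ⟨(mem_sphere_iff_sq hdisc.pos).2 ?_, hyd⟩) hly
    rw [Real.sq_sqrt (hρ0 _ ht₀0).le, ← hQC, hQy0]
  have hyc : y ∈ closedBall c r := by
    refine sphere_subset_closedBall ((mem_sphere_iff_sq h.pos).2 ?_)
    simp only [hQ, hly0, mul_zero, sub_zero] at hQy0
    exact hQy0
  obtain ⟨k, hk⟩ := (hy.eventually (eventually_mem_segment_of_visible (h.2 h.1) hyd
    ((h.visible hyc hyd).trans h.2))).exists
  obtain ⟨u, v, hu, hv, huv, he⟩ := hk (hxd k)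
  have hlin : l y = u * l b + v * l (x k) := by
    have h1 : y.re = u * b.re + v * (x k).re := by rw [← he]; simp
    have h2 : y.im = u * b.im + v * (x k).im := by rw [← he]; simp
    rw [hl, hl, hl, h1, h2]
    linear_combination (-m) * huv
  have hv0 : v = 0 := by
    by_contra hv0
    have := mul_pos (lt_of_le_of_ne hv (Ne.symm hv0)) (hxl k)
    nlinarith [mul_nonneg hu hlb]
  rw [hv0] at he huv
  rw [add_zero] at huv
  rw [huv, zero_smul, add_zero, one_smul] at he
  exact hyd (he ▸ h.2 h.1)

end IsDisc

variable (X) in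
/-- The marked points on the boundary of a disc. -/
def bd (b : ℂ) (g : ℂ → S) (c : ℂ) (r : ℝ) : Set ℂ := sphere c r \ X.dom b g

variable (X) in
/-- The chords, between marked points, of the discs without marked points. -/
def delaunayEdges : Set (Set S) :=
  {e | ∃ b g c r a₀ a₁, X.IsDisc b g c r ∧ a₀ ∈ X.bd b g c r ∧ a₁ ∈ X.bd b g c r ∧ a₀ ≠ a₁ ∧
    e = X.dev b g '' seg a₀ a₁}

theorem openSegment_subset_ball {c a₀ a₁ : ℂ} (h₀ : a₀ ∈ sphere c r)
    (h₁ : a₁ ∈ sphere c r) (hne : a₀ ≠ a₁) : seg a₀ a₁ ⊆ ball c r := by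
  have hr : r ≠ 0 := by
    rintro rfl
    rw [Metric.sphere_zero, mem_singleton_iff] at h₀ h₁
    exact hne (h₀.trans h₁.symm)
  rw [← interior_closedBall c hr]
  exact (strictConvex_closedBall ℝ c r).openSegment_subset (sphere_subset_closedBall h₀)
    (sphere_subset_closedBall h₁) hne

namespace IsDisc

theorem tendsto (h : X.IsDisc b g c r) (hw : w ∈ X.bd b g c r) :
    ∃ z ∈ X.Z, Tendsto (X.dev b g) (𝓝[ball c r] w) (𝓝 z) :=
  tendsto_of_visible hw.2 (convex_ball c r)
    (h.visible (sphere_subset_closedBall hw.1) hw.2) h.2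

theorem isSaddle (h : X.IsDisc b g c r)
    (h₀ : a₀ ∈ X.bd b g c r) (h₁ : a₁ ∈ X.bd b g c r) (hne : a₀ ≠ a₁) :
    X.IsSaddle (X.dev b g '' seg a₀ a₁) (a₁ - a₀) := by
  obtain ⟨z₀, hz₀, ht₀⟩ := h.tendsto h₀
  obtain ⟨z₁, hz₁, ht₁⟩ := h.tendsto h₁
  have hsub := openSegment_subset_ball h₀.1 h₁.1 hne
  exact isSaddle_of_tendsto hne (fun x hx => flat_dev (h.2 (hsub hx))) hz₀ hz₁
    (ht₀.mono_left (nhdsWithin_mono _ hsub)) (ht₁.mono_left (nhdsWithin_mono _ hsub))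

/-- Close to a marked point, a disc has at most one marked point on its boundary. -/
theorem eq_of_near (h : X.IsDisc b g c r) {z : S} {k : ℕ}
    {φ : OpenPartialHomeomorph S ℂ} (hφ : X.IsCone z k φ) {ρ η : ℝ} (hρ0 : 0 < ρ)
    (hρ : closedBall 0 ρ ⊆ φ.target) (hη : (2 * η) ^ 2 < ρ ^ k) (hr : r < η)
    (hc : X.dev b g c ∈ φ.source) (hn : ‖φ (X.dev b g c)‖ ^ k < η ^ 2) {w w' : ℂ}
    (hw : w ∈ X.bd b g c r) (hw' : w' ∈ X.bd b g c r) : w = w' := by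
  have hcb : c ∈ ball c r := mem_ball_self h.pos
  have hη0 : 0 < η := h.pos.trans hr
  obtain ⟨o, ho⟩ := hφ.eventually_square (flat_dev (h.2 hcb)) hc
  have hco : ‖c - o‖ < η := by
    rw [← norm_pow, ho.self_of_nhds.2, norm_pow] at hn
    exact (sq_lt_sq₀ (norm_nonneg _) hη0.le).1 hn
  have hJ : ∀ a ∈ ball c r, ‖id a - o‖ ^ 2 < ρ ^ k := by
    intro a ha
    refine lt_trans ?_ hη
    rw [sq_lt_sq₀ (norm_nonneg _) (by positivity)]
    have := norm_sub_le_norm_sub_add_norm_sub a c o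
    have := mem_ball_iff_norm.1 ha
    simp only [id]; linarith
  have hsq := hφ.square_of_norm_lt hρ0 hρ frequently_id_ne continuous_id
    (convex_ball c r).isPreconnected (fun a ha => flat_dev (h.2 ha)) hcb ho hJ
  have key : ∀ w ∈ X.bd b g c r, w = o := by
    intro w hw
    obtain ⟨z', hz', ht⟩ := h.tendsto hw
    have hcl : w ∈ closure (ball c r) := by
      rw [closure_ball c h.pos.ne']; exact sphere_subset_closedBall hw.1
    obtain ⟨h1, h2⟩ := hφ.square_of_tendsto hρ0 hρ continuous_id hsq hJ hcl ht
    rw [hφ.eq_of_mem h1 hz', hφ.map_zero, zero_pow (by have := hφ.one_le; omega)] at h2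
    exact sub_eq_zero.1 (pow_eq_zero_iff two_ne_zero |>.1 h2.symm)
  rw [key w hw, key w' hw']

end IsDisc

theorem mul_add_mem_openSegment {ε d a₀ a₁ : ℂ} :
    (fun y => ε * y + d) '' seg a₀ a₁ = seg (ε * a₀ + d) (ε * a₁ + d) :=
  image_openSegment ℝ (halfTr ε d) a₀ a₁

/-- In the coordinate `ε y + d`, a chord has the same image. -/
theorem image_chord {b b' d ε a₀ a₁ : ℂ} {g g' : ℂ → S} {c' : ℂ} {r' : ℝ}
    (h₀ : a₀ ∈ X.bd b' g' c' r') (h₁ : a₁ ∈ X.bd b' g' c' r') (hne : a₀ ≠ a₁)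
    (h' : X.IsDisc b' g' c' r') (h : ∀ y ∈ closedBall c' r', y ∈ X.dom b' g' →
      X.dev b g (ε * y + d) = X.dev b' g' y) :
    X.dev b g '' seg (ε * a₀ + d) (ε * a₁ + d) = X.dev b' g' '' seg a₀ a₁ := by
  rw [← mul_add_mem_openSegment, image_image]
  refine image_congr fun y hy => ?_
  have hy' := openSegment_subset_ball h₀.1 h₁.1 hne hy
  exact h y (ball_subset_closedBall hy') (h'.2 hy')

theorem mem_bd_transport {b b' d ε a : ℂ} {g g' : ℂ → S} {c' : ℂ} {r' : ℝ} (hε : ε = 1 ∨ ε = -1)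
    (h : ∀ y ∈ closedBall c' r', ε * y + d ∈ X.dom b g ↔ y ∈ X.dom b' g')
    (ha : a ∈ X.bd b' g' c' r') : ε * a + d ∈ X.bd b g (ε * c' + d) r' := by
  refine ⟨?_, fun hd => ha.2 ((h a (sphere_subset_closedBall ha.1)).1 hd)⟩
  rw [mem_sphere_iff_norm, add_sub_add_right_eq_sub, ← mul_sub, norm_mul, norm_of_sign hε, one_mul]
  exact mem_sphere_iff_norm.1 ha.1

/-- There are finitely many Delaunay edges. -/
theorem finite_delaunayEdges [ConnectedSpace S]
    (X : HalfTranslationSurface S) : X.delaunayEdges.Finite := by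
  by_contra hinf
  obtain ⟨R, hR⟩ := exists_radius_bound X
  set e := Set.Infinite.natEmbedding _ hinf with he
  choose b g c r a₀ a₁ hD h₀ h₁ hne hea using fun n => (e n).2
  have hcb : ∀ n, c n ∈ ball (c n) (r n) := fun n => mem_ball_self (hD n).pos
  obtain ⟨z, -, hz⟩ := exists_tendsto_hyperfilter (isCompact_univ (X := S))
    (f := fun n => X.dev (b n) (g n) (c n)) (Eventually.of_forall fun _ => mem_univ _)
  by_cases hzZ : z ∈ X.Z
  · obtain ⟨k, φ, hφ⟩ := exists_isCone hzZ
    obtain ⟨ρ, hρ0, hρ⟩ := hφ.exists_radius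
    set η : ℝ := √(ρ ^ k) / 4 with hη
    have hρk : 0 < ρ ^ k := pow_pos hρ0 k
    have hη0 : 0 < η := by positivity
    have hη2 : (2 * η) ^ 2 < ρ ^ k := by
      have : (2 * η) ^ 2 = √(ρ ^ k) ^ 2 / 4 := by rw [hη]; ring
      rw [this, Real.sq_sqrt hρk.le]; linarith
    have hs : ∀ᶠ x in 𝓝 z, x ∈ φ.source ∧ ‖φ x‖ ^ k < η ^ 2 := by
      refine Eventually.and (φ.open_source.mem_nhds hφ.mem_source) ?_
      have : ContinuousAt (fun x => ‖φ x‖ ^ k) z := (φ.continuousAt hφ.mem_source).norm.pow k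
      refine this.eventually_lt_const ?_
      show ‖φ z‖ ^ k < η ^ 2
      rw [hφ.map_zero, norm_zero, zero_pow (by have := hφ.one_le; omega)]
      positivity
    obtain ⟨n, ⟨h1, h2⟩, h3⟩ := (hz.eventually (hs.and (eventually_exists_notMem_dom hzZ hη0))).exists
    obtain ⟨hDc, -⟩ := (hD n).rebase (hcb n)
    obtain ⟨w, hw, hwd⟩ := h3 _ _ rfl (hDc.2 hDc.1)
    refine hne n ((hD n).eq_of_near hφ hρ0 hρ hη2 ?_ h1 h2 (h₀ n) (h₁ n))
    by_contra! hle
    exact hwd (hDc.2 (ball_subset_ball hle hw))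
  obtain ⟨δ, hδ, G, rfl, hG⟩ := exists_germ hzZ 0
  have hd0 : X.IsDisc 0 G 0 δ := ⟨mem_ball_self hδ, base_mem_dom hδ hG⟩
  have hnorm : ∀ n, X.dev (b n) (g n) (c n) ∈ X.dev 0 G '' ball 0 (δ / 4) →
      ∃ q : ℂ × ℂ × ℂ, ‖q.1‖ < δ / 4 ∧ δ / 2 ≤ r n ∧ X.IsDisc 0 G q.1 (r n) ∧
        q.2.1 ∈ X.bd 0 G q.1 (r n) ∧ q.2.2 ∈ X.bd 0 G q.1 (r n) ∧
        (e n : Set S) = X.dev 0 G '' seg q.2.1 q.2.2 := by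
    rintro n ⟨u, hu, huc⟩
    rw [mem_ball_zero_iff] at hu
    have huδ : u ∈ ball (0 : ℂ) δ := mem_ball_zero_iff.2 (by linarith)
    have hrδ : δ / 2 ≤ r n := by
      obtain ⟨ε, d, hε, hud, -, hiff⟩ := hd0.transport (hD n) huδ (hcb n) huc.symm
      by_contra! hlt
      have hs := (h₀ n).1
      have hcl := sphere_subset_closedBall hs
      refine (h₀ n).2 ((hiff _ hcl).1.1 ?_)
      have hmem : ε * a₀ n + d ∈ ball (0 : ℂ) δ := by
        rw [mem_ball_zero_iff]
        have e1 : ε * a₀ n + d = ε * (a₀ n - c n) + u := by rw [hud]; ring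
        rw [e1]
        refine (norm_add_le _ _).trans_lt ?_
        rw [norm_mul, norm_of_sign hε, one_mul, mem_sphere_iff_norm.1 hs]
        linarith
      exact (((hd0.rebase huδ).2 _ (ball_subset_closedBall hmem)).1).2 (hd0.2 hmem)
    obtain ⟨ε, d, hε, hud, hb⟩ := hd0.transport_base (hD n) huδ (hcb n) huc.symm
    have hbd : (∀ y ∈ closedBall (c n) (r n), ε * y + d ∈ X.dom 0 G ↔ y ∈ X.dom (b n) (g n)) →
        ∀ a ∈ X.bd (b n) (g n) (c n) (r n), ε * a + d ∈ X.bd 0 G (ε * c n + d) (r n) :=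
      fun h2 a ha => mem_bd_transport hε h2 ha
    rw [← hud] at hb hbd
    obtain ⟨h1, h2⟩ := hb (by rw [mem_ball_iff_norm, zero_sub, norm_neg]; linarith)
    have hbd' := hbd fun y hy => (h2 y hy).1
    refine ⟨(u, ε * a₀ n + d, ε * a₁ n + d), hu, hrδ, h1, hbd' _ (h₀ n), hbd' _ (h₁ n), ?_⟩
    rw [hea n, image_chord (h₀ n) (h₁ n) (hne n) (hD n) fun y hy => (h2 y hy).2]
  have h0 := hd0.2 hd0.1
  have hnear : ∀ᶠ n in (hyperfilter ℕ : Filter ℕ),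
      X.dev (b n) (g n) (c n) ∈ X.dev 0 G '' ball 0 (δ / 4) := by
    refine hz.eventually (p := fun y => y ∈ X.dev 0 G '' ball 0 (δ / 4)) ?_
    have : X.dev 0 G '' ball 0 (δ / 4) ∈ map (X.dev 0 G) (𝓝 0) :=
      image_mem_map (ball_mem_nhds _ (by linarith))
    rwa [(flat_dev h0).map_nhds, (dev_base h0).eq_of_nhds] at this
  obtain ⟨q, hq⟩ := (hnear.mono hnorm).choice
  obtain ⟨u, hu, hut⟩ := exists_tendsto_hyperfilter (isCompact_closedBall (0 : ℂ) (δ / 4))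
    (f := fun n => (q n).1) (hq.mono fun n hn => mem_closedBall_zero_iff.2 hn.1.le)
  obtain ⟨r₀, hr₀, hrt⟩ := exists_tendsto_hyperfilter (isCompact_Icc (a := δ / 2) (b := R))
    (f := r) (hq.mono fun n hn => ⟨hn.2.1, hR _ _ _ _ (hD n).2⟩)
  rw [mem_closedBall_zero_iff] at hu
  have hD₀ : X.IsDisc 0 G u r₀ := by
    refine ⟨by rw [mem_ball_iff_norm, zero_sub, norm_neg]; linarith [hr₀.1], fun x hx => ?_⟩
    have h1 := (hut.const_sub x).norm.eventually_lt hrt (mem_ball_iff_norm.1 hx)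
    obtain ⟨n, hn, hqn⟩ := (h1.and hq).exists
    exact hqn.2.2.1.2 (mem_ball_iff_norm.2 hn)
  have hpt : ∀ p : ℕ → ℂ, (∀ᶠ n in (hyperfilter ℕ : Filter ℕ), X.IsDisc 0 G (q n).1 (r n) ∧
      p n ∈ X.bd 0 G (q n).1 (r n)) → ∃ a, ∀ᶠ n in (hyperfilter ℕ : Filter ℕ), p n = a := by
    intro p hp
    obtain ⟨a, -, hat⟩ := exists_tendsto_hyperfilter (isCompact_closedBall (0 : ℂ) (δ / 4 + R)) (f := p)
      ((hp.and hq).mono fun n ⟨hn, hn'⟩ => by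
        rw [mem_closedBall_zero_iff, ← sub_add_cancel (p n) (q n).1]
        refine (norm_add_le _ _).trans ?_
        rw [mem_sphere_iff_norm.1 hn.2.1]
        linarith [hn'.1, hR _ _ _ _ (hD n).2])
    have had : a ∉ X.dom 0 G :=
      isOpen_dom.isClosed_compl.mem_of_tendsto hat (hp.mono fun n hn => hn.2.2)
    have has : a ∈ closedBall u r₀ := by
      rw [mem_closedBall_iff_norm]
      exact le_of_tendsto_of_tendsto (hat.sub hut).norm hrt
        (hp.mono fun n hn => (mem_sphere_iff_norm.1 hn.2.1).le)
    refine ⟨a, ?_⟩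
    filter_upwards [hat.eventually (eventually_eq_of_visible had ((hD₀.visible has had).trans hD₀.2)),
      hp] with n hn hpn
    exact hn hpn.2.2 ((hpn.1.visible (sphere_subset_closedBall hpn.2.1) hpn.2.2).trans hpn.1.2)
  obtain ⟨p₀, hp₀⟩ := hpt (fun n => (q n).2.1) (hq.mono fun n hn => ⟨hn.2.2.1, hn.2.2.2.1⟩)
  obtain ⟨p₁, hp₁⟩ := hpt (fun n => (q n).2.2) (hq.mono fun n hn => ⟨hn.2.2.1, hn.2.2.2.2.1⟩)
  have hconst : ∀ᶠ n in (hyperfilter ℕ : Filter ℕ), (e n : Set S) = X.dev 0 G '' seg p₀ p₁ := by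
    filter_upwards [hq, hp₀, hp₁] with n hn h1 h2
    rw [hn.2.2.2.2.2, h1, h2]
  refine Set.Finite.notMem_hyperfilter (Set.Subsingleton.finite ?_) hconst
  intro n hn m hm
  exact e.injective (Subtype.ext ((show (e n : Set S) = _ from hn).trans (show (e m : Set S) = _ from hm).symm))

/-- A parameter on a circle through `a` with centre `c`, infinite at `a`. -/
noncomputable def arc (c a u : ℂ) : ℝ :=
  ((c.re - a.re) * (u.im - a.im) - (c.im - a.im) * (u.re - a.re)) /
    ((u.re - a.re) ^ 2 + (u.im - a.im) ^ 2)

theorem arc_spec {c a u : ℂ} (ha : a ∈ sphere c r) (hu : u ∈ sphere c r) (hne : u ≠ a) :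
    u.re = a.re + ((c.re - a.re) / 2 - (c.im - a.im) * arc c a u) / (1 / 4 + arc c a u ^ 2) ∧
      u.im = a.im + ((c.im - a.im) / 2 + (c.re - a.re) * arc c a u) / (1 / 4 + arc c a u ^ 2) := by
  have hD : (u.re - a.re) ^ 2 + (u.im - a.im) ^ 2 ≠ 0 := by
    rw [← norm_sub_sq_eq]; exact pow_ne_zero 2 (norm_ne_zero_iff.2 (sub_ne_zero.2 hne))
  have h1 : ‖u - c‖ ^ 2 = ‖a - c‖ ^ 2 := by rw [mem_sphere_iff_norm.1 ha, mem_sphere_iff_norm.1 hu]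
  rw [norm_sub_sq_eq, norm_sub_sq_eq] at h1
  have hN : 1 / 4 + arc c a u ^ 2 ≠ 0 := by positivity
  set D := (u.re - a.re) ^ 2 + (u.im - a.im) ^ 2 with hDd
  have hdot : (c.re - a.re) * (u.re - a.re) + (c.im - a.im) * (u.im - a.im) = D / 2 := by
    rw [hDd]; linear_combination (-1 / 2) * h1
  have hs : arc c a u * D = (c.re - a.re) * (u.im - a.im) - (c.im - a.im) * (u.re - a.re) :=
    div_mul_cancel₀ _ hD
  generalize arc c a u = s at *
  have hND : (1 / 4 + s ^ 2) * D = (c.re - a.re) ^ 2 + (c.im - a.im) ^ 2 := by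
    have : (1 / 4 + s ^ 2) * D * D = ((c.re - a.re) ^ 2 + (c.im - a.im) ^ 2) * D := by
      have e : (1 / 4 + s ^ 2) * D * D = (D / 2) ^ 2 + (s * D) ^ 2 := by ring
      rw [e, ← hdot, hs, hDd]; ring
    exact mul_right_cancel₀ hD this
  constructor
  · rw [← sub_eq_iff_eq_add', eq_div_iff hN]
    refine mul_right_cancel₀ hD ?_
    linear_combination (u.re - a.re) * hND + (c.re - a.re) * hdot + (c.im - a.im) * hs
  · rw [← sub_eq_iff_eq_add', eq_div_iff hN]
    refine mul_right_cancel₀ hD ?_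
    linear_combination (u.im - a.im) * hND + (c.im - a.im) * hdot - (c.re - a.re) * hs

section Circle

variable {c a u v w : ℂ} (ha : a ∈ sphere c r) (hr : 0 < r)
include ha hr

theorem normSq_center_pos : 0 < ((c.re - a.re) ^ 2 + (c.im - a.im) ^ 2) / 2 := by
  rw [← norm_sub_sq_eq, norm_sub_rev, mem_sphere_iff_norm.1 ha]; positivity

theorem cr_arc (hu : u ∈ sphere c r) (hv : v ∈ sphere c r) (hua : u ≠ a) (hva : v ≠ a) :
    ∃ K > 0, cr a u v = K * (arc c a v - arc c a u) := by
  obtain ⟨h1, h2⟩ := arc_spec ha hu hua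
  obtain ⟨h3, h4⟩ := arc_spec ha hv hva
  have hK := normSq_center_pos ha hr
  generalize arc c a u = s at *
  generalize arc c a v = t at *
  have hs : 0 < 1 / 4 + s ^ 2 := by positivity
  have ht : 0 < 1 / 4 + t ^ 2 := by positivity
  refine ⟨((c.re - a.re) ^ 2 + (c.im - a.im) ^ 2) / 2 / ((1 / 4 + s ^ 2) * (1 / 4 + t ^ 2)),
    by positivity, ?_⟩
  rw [cr_eq, h1, h2, h3, h4]
  field_simp
  ring

theorem cr_arc_three (hu : u ∈ sphere c r) (hv : v ∈ sphere c r)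
    (hw : w ∈ sphere c r) (hua : u ≠ a) (hva : v ≠ a) (hwa : w ≠ a) :
    ∃ K > 0, cr u v w = K * ((arc c a v - arc c a u) * ((arc c a w - arc c a u) *
      (arc c a w - arc c a v))) := by
  obtain ⟨h1, h2⟩ := arc_spec ha hu hua
  obtain ⟨h3, h4⟩ := arc_spec ha hv hva
  obtain ⟨h5, h6⟩ := arc_spec ha hw hwa
  have hK := normSq_center_pos ha hr
  generalize arc c a u = s at *
  generalize arc c a v = t at *
  generalize arc c a w = q at *
  have hs : 0 < 1 / 4 + s ^ 2 := by positivity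
  have ht : 0 < 1 / 4 + t ^ 2 := by positivity
  have hq : 0 < 1 / 4 + q ^ 2 := by positivity
  refine ⟨((c.re - a.re) ^ 2 + (c.im - a.im) ^ 2) / 2 /
    ((1 / 4 + s ^ 2) * (1 / 4 + t ^ 2) * (1 / 4 + q ^ 2)), by positivity, ?_⟩
  rw [cr_eq, h1, h2, h3, h4, h5, h6]
  field_simp
  ring

end Circle

theorem mem_openSegment_of_ball {c a₀ a₁ x : ℂ} (h₀ : a₀ ∈ sphere c r)
    (h₁ : a₁ ∈ sphere c r) (hne : a₀ ≠ a₁) (hx : x ∈ ball c r) (h : cr a₀ a₁ x = 0) :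
    x ∈ seg a₀ a₁ := by
  have hr := Metric.pos_of_mem_ball hx
  obtain ⟨t, rfl⟩ := (cr_eq_zero_iff hne).1 h
  have e0 := (mem_sphere_iff_sq hr).1 h₀
  have e1 := (mem_sphere_iff_sq hr).1 h₁
  have ex := (mem_ball_iff_sq hr).1 hx
  rw [norm_sub_sq_eq] at e0 e1 ex
  simp only [add_re, add_im, re_ofReal_mul, im_ofReal_mul, sub_re, sub_im] at ex
  have hN : 0 < (a₁.re - a₀.re) ^ 2 + (a₁.im - a₀.im) ^ 2 := by
    rw [← norm_sub_sq_eq]; exact pow_pos (norm_pos_iff.2 (sub_ne_zero.2 hne.symm)) 2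
  have key : 0 < t * (1 - t) * ((a₁.re - a₀.re) ^ 2 + (a₁.im - a₀.im) ^ 2) := by
    linear_combination ex - (1 - t) * e0 - t * e1
  have htt : 0 < t * (1 - t) := pos_of_mul_pos_left key hN.le
  have ht0 : 0 < t := by nlinarith
  have ht1 : t < 1 := by nlinarith
  exact ⟨1 - t, t, by linarith, ht0, by ring, by
    simp only [real_smul]; push_cast; ring⟩

theorem exists_cross {c p q u v : ℂ} (hp : p ∈ sphere c r)
    (hq : q ∈ sphere c r) (hu : u ∈ sphere c r) (hv : v ∈ sphere c r)
    (h : cr p q u * cr p q v < 0) : ∃ x ∈ seg p q, x ∈ seg u v := by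
  have hne : p ≠ q := by rintro rfl; simp [cr_eq] at h
  have huv : u ≠ v := by rintro rfl; nlinarith [mul_self_nonneg (cr p q u)]
  have hd : cr p q u - cr p q v ≠ 0 := fun h0 => by
    rw [sub_eq_zero.1 h0] at h; nlinarith [mul_self_nonneg (cr p q v)]
  set t := cr p q u / (cr p q u - cr p q v) with ht
  have h01 : 0 < t ∧ t < 1 := by
    rcases mul_neg_iff.1 h with ⟨h1, h2⟩ | ⟨h1, h2⟩
    · exact ⟨div_pos h1 (by linarith), (div_lt_one (by linarith)).2 (by linarith)⟩
    · exact ⟨div_pos_of_neg_of_neg h1 (by linarith), (div_lt_one_of_neg (by linarith)).2 (by linarith)⟩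
  have hx : lineMap u v t ∈ seg u v := by
    rw [openSegment_eq_image_lineMap]; exact ⟨t, h01, rfl⟩
  refine ⟨_, mem_openSegment_of_ball hp hq hne
    (openSegment_subset_ball hu hv huv hx) ?_, hx⟩
  rw [cr_lineMap, ht]
  field_simp
  ring

theorem cr_mul_neg {p q u v x : ℂ} (hx : x ∈ seg u v) (h : cr p q x = 0)
    (hu : cr p q u ≠ 0) : cr p q u * cr p q v < 0 := by
  obtain ⟨t, ⟨h0, h1⟩, rfl⟩ := openSegment_lineMap hx
  rw [cr_lineMap] at h
  have hA := mul_self_pos.2 hu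
  have : t * (cr p q u * cr p q v) = -((1 - t) * (cr p q u * cr p q u)) := by
    linear_combination cr p q u * h
  by_contra! hcon
  nlinarith [mul_nonneg h0.le hcon, mul_pos (sub_pos.2 h1) hA]

theorem openSegment_eq_of_collinear {D : Set ℂ} {a b p q x : ℂ} (hab : a ≠ b) (hpq : p ≠ q)
    (h : cr a b p = 0) (hx : x ∈ seg a b) (hx' : x ∈ seg p q)
    (hs : seg a b ⊆ D) (hs' : seg p q ⊆ D) (ha : a ∉ D) (hb : b ∉ D) (hp : p ∉ D)
    (hq : q ∉ D) : seg a b = seg p q := by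
  obtain ⟨L, hL⟩ : ∃ L : ℝ →ᵃ[ℝ] ℂ, L = lineMap a b := ⟨_, rfl⟩
  have hLa (t : ℝ) : L t = a + t * (b - a) := by
    rw [hL, lineMap_apply]; simp [add_comm]
  have hL0 : L 0 = a := hL ▸ lineMap_apply_zero a b
  have hL1 : L 1 = b := hL ▸ lineMap_apply_one a b
  obtain ⟨s, hs1⟩ := (cr_eq_zero_iff hab).1 h
  rw [← hLa] at hs1
  have hLI : seg a b = L '' Ioo 0 1 := by
    rw [← openSegment_eq_Ioo one_pos, image_openSegment, hL0, hL1]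
  rw [hLI] at hx hs ⊢
  rw [← hL0] at ha
  rw [← hL1] at hb
  obtain ⟨y, hy, rfl⟩ := hx
  obtain ⟨u, rfl⟩ : ∃ u, q = L u := by
    obtain ⟨t, ht, hxt⟩ := openSegment_lineMap hx'
    have ht' : (t : ℂ) ≠ 0 := mod_cast ht.1.ne'
    refine ⟨s + (y - s) / t, ?_⟩
    rw [hLa, hs1, hLa, AffineMap.lineMap_apply_module] at hxt
    rw [hLa]
    simp only [real_smul] at hxt
    push_cast at hxt ⊢
    field_simp
    linear_combination -hxt
  subst hs1
  rw [← image_openSegment] at hx' hs' ⊢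
  have hinj : Function.Injective L := hL ▸ lineMap_injective ℝ hab
  have hsu : s ≠ u := fun h => hpq (by rw [h])
  rw [hinj.mem_set_image] at hx'
  rw [image_subset_iff] at hs hs'
  congr 1
  rcases lt_or_gt_of_ne hsu with h | h
  · rw [openSegment_eq_Ioo h] at hx' hs' ⊢
    obtain ⟨e1, e2⟩ := Ioo_eq_of_ends (D := L ⁻¹' D) hy hx' hs hs' ha hb hp hq
    rw [e1, e2]
  · rw [openSegment_symm, openSegment_eq_Ioo h] at hx' hs' ⊢
    obtain ⟨e1, e2⟩ := Ioo_eq_of_ends (D := L ⁻¹' D) hy hx' hs hs' ha hb hq hp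
    rw [e1, e2]

/-- The difference of the powers with respect to two circles. -/
noncomputable def powDiff (c : ℂ) (r : ℝ) (c' : ℂ) (r' : ℝ) (u : ℂ) : ℝ :=
  ‖u - c‖ ^ 2 - r ^ 2 - (‖u - c'‖ ^ 2 - r' ^ 2)

theorem powDiff_combo {c c' : ℂ} {r r' : ℝ} (x y : ℂ) {s t : ℝ} (h : s + t = 1) :
    powDiff c r c' r' (s • x + t • y) = s * powDiff c r c' r' x + t * powDiff c r c' r' y := by
  obtain rfl : s = 1 - t := by linarith
  simp only [powDiff, norm_sub_sq_eq, add_re, add_im, real_smul, re_ofReal_mul, im_ofReal_mul]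
  ring

theorem eq_of_powDiff {c c' : ℂ} {r r' : ℝ} (hr : 0 < r) (hr' : 0 < r') {p q u : ℂ}
    (h : cr p q u ≠ 0) (h0 : powDiff c r c' r' p = 0) (h1 : powDiff c r c' r' q = 0)
    (h2 : powDiff c r c' r' u = 0) : c = c' ∧ r = r' := by
  have hc : c = c' := by
    simp only [powDiff, norm_sub_sq_eq] at h0 h1 h2
    rw [cr_eq] at h
    have e1 : (c.re - c'.re) * ((q.re - p.re) * (u.im - p.im) - (q.im - p.im) * (u.re - p.re)) = 0 := by
      linear_combination ((h0 - h1) * (u.im - p.im) - (h0 - h2) * (q.im - p.im)) / 2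
    have e2 : (c.im - c'.im) * ((q.re - p.re) * (u.im - p.im) - (q.im - p.im) * (u.re - p.re)) = 0 := by
      linear_combination (-(h0 - h1) * (u.re - p.re) + (h0 - h2) * (q.re - p.re)) / 2
    exact Complex.ext (sub_eq_zero.1 ((mul_eq_zero.1 e1).resolve_right h))
      (sub_eq_zero.1 ((mul_eq_zero.1 e2).resolve_right h))
  refine ⟨hc, ?_⟩
  rw [powDiff, hc] at h0
  exact (sq_eq_sq₀ hr.le hr'.le).1 (by linarith)

theorem powDiff_mem_openSegment {c c' a₀ a₁ x : ℂ} {r r' : ℝ} (hx : x ∈ seg a₀ a₁)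
    (h₀ : powDiff c r c' r' a₀ ≤ 0) (h₁ : powDiff c r c' r' a₁ ≤ 0) :
    powDiff c r c' r' x ≤ 0 ∧ (powDiff c r c' r' x = 0 →
      powDiff c r c' r' a₀ = 0 ∧ powDiff c r c' r' a₁ = 0) := by
  obtain ⟨s, t, hs, ht, hst, rfl⟩ := hx
  rw [powDiff_combo _ _ hst]
  have e0 := mul_nonpos_of_nonneg_of_nonpos hs.le h₀
  have e1 := mul_nonpos_of_nonneg_of_nonpos ht.le h₁
  refine ⟨by linarith, fun h => ?_⟩
  exact ⟨(mul_eq_zero.1 (by linarith : s * _ = 0)).resolve_left hs.ne',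
    (mul_eq_zero.1 (by linarith : t * _ = 0)).resolve_left ht.ne'⟩

theorem powDiff_swap (c : ℂ) (r : ℝ) (c' : ℂ) (r' : ℝ) (u : ℂ) :
    powDiff c' r' c r u = -powDiff c r c' r' u := by simp only [powDiff]; ring

/-- If the difference of powers is nonpositive at the corners of a triangle and nonnegative at an
interior point, the circles agree. -/
theorem eq_of_powDiff_interior {c c' : ℂ} {r r' : ℝ} (hr : 0 < r) (hr' : 0 < r')
    (hp : 0 < cr (p 0) (p 1) (p 2)) (hx : x ∈ interior (hull p))
    (h : ∀ i, powDiff c r c' r' (p i) ≤ 0) (hx0 : 0 ≤ powDiff c r c' r' x) : c = c' ∧ r = r' := by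
  have hi := (mem_interior_tri hp).1 hx
  have i0 : 0 < cr (p 0) (p 1) x := hi 0
  have i1 : 0 < cr (p 1) (p 2) x := hi 1
  have i2 : 0 < cr (p 2) (p 0) x := hi 2
  have key : cr (p 0) (p 1) (p 2) * powDiff c r c' r' x = cr (p 1) (p 2) x * powDiff c r c' r' (p 0) +
      cr (p 2) (p 0) x * powDiff c r c' r' (p 1) + cr (p 0) (p 1) x * powDiff c r c' r' (p 2) := by
    simp only [powDiff, norm_sub_sq_eq, cr_eq]; ring
  have e := mul_nonneg hp.le hx0
  have e0 := mul_nonpos_of_nonneg_of_nonpos i1.le (h 0)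
  have e1 := mul_nonpos_of_nonneg_of_nonpos i2.le (h 1)
  have e2 := mul_nonpos_of_nonneg_of_nonpos i0.le (h 2)
  exact eq_of_powDiff hr hr' hp.ne'
    ((mul_eq_zero.1 (by linarith : cr (p 1) (p 2) x * _ = 0)).resolve_left i1.ne')
    ((mul_eq_zero.1 (by linarith : cr (p 2) (p 0) x * _ = 0)).resolve_left i2.ne')
    ((mul_eq_zero.1 (by linarith : cr (p 0) (p 1) x * _ = 0)).resolve_left i0.ne')

namespace IsDisc

theorem powDiff_nonpos {c' : ℂ} {r' : ℝ} (h : X.IsDisc b g c r) (h' : X.IsDisc b g c' r') {a : ℂ}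
    (ha : a ∈ X.bd b g c r) : powDiff c r c' r' a ≤ 0 := by
  have h1 := (mem_sphere_iff_sq h.pos).1 ha.1
  have h2 : ¬ ‖a - c'‖ ^ 2 - r' ^ 2 < 0 := fun hlt => ha.2 (h'.2 ((mem_ball_iff_sq h'.pos).2 hlt))
  rw [powDiff]; linarith

theorem bd_rebase (h : X.IsDisc b g c r) (hx : x ∈ ball c r) :
    X.bd x (X.dev b g) c r = X.bd b g c r := by
  ext y
  refine and_congr_right fun hy => not_congr ?_
  exact ((h.rebase hx).2 y (sphere_subset_closedBall hy)).1

theorem image_rebase (h : X.IsDisc b g c r) (hx : x ∈ ball c r) {s : Set ℂ}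
    (hs : s ⊆ ball c r) : X.dev x (X.dev b g) '' s = X.dev b g '' s :=
  image_congr fun y hy => ((h.rebase hx).2 y (ball_subset_closedBall (hs hy))).2 (h.2 (hs hy))

/-- A Delaunay edge through a point of a disc. -/
theorem exists_chord (h : X.IsDisc b g c r) (hx : x ∈ ball c r)
    (he : e ∈ X.delaunayEdges) (hxe : X.dev b g x ∈ e) : ∃ c' r' p q, X.IsDisc x (X.dev b g) c' r' ∧
      p ∈ X.bd x (X.dev b g) c' r' ∧ q ∈ X.bd x (X.dev b g) c' r' ∧ p ≠ q ∧ x ∈ seg p q ∧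
      e = X.dev x (X.dev b g) '' seg p q := by
  obtain ⟨b', g', c', r', a₀, a₁, h', h₀, h₁, hne, rfl⟩ := he
  obtain ⟨x', hx', hxx'⟩ := hxe
  obtain ⟨ε, d, hε, rfl, hD, hiff⟩ :=
    h.transport h' hx (openSegment_subset_ball h₀.1 h₁.1 hne hx') hxx'
  refine ⟨_, r', ε * a₀ + d, ε * a₁ + d, hD, mem_bd_transport hε (fun y hy => (hiff y hy).1) h₀,
    mem_bd_transport hε (fun y hy => (hiff y hy).1) h₁, ?_, ?_,
    (image_chord h₀ h₁ hne h' fun y hy => (hiff y hy).2).symm⟩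
  · exact fun h => hne (mul_left_cancel₀ (ne_zero_of_sign hε) (add_right_cancel h))
  · rw [← mul_add_mem_openSegment]; exact ⟨x', hx', rfl⟩

/-- A Delaunay edge meeting a chord of a disc is that chord or a chord crossing it. -/
theorem chord_cases (h : X.IsDisc b g c r)
    (h₀ : a₀ ∈ X.bd b g c r) (h₁ : a₁ ∈ X.bd b g c r) (hne : a₀ ≠ a₁)
    (hx : x ∈ seg a₀ a₁) (he : e ∈ X.delaunayEdges) (hxe : X.dev b g x ∈ e) :
    e = X.dev b g '' seg a₀ a₁ ∨ ∃ p ∈ X.bd b g c r, ∃ q ∈ X.bd b g c r, p ≠ q ∧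
      x ∈ seg p q ∧ cr a₀ a₁ p ≠ 0 ∧ e = X.dev b g '' seg p q := by
  have hxb := openSegment_subset_ball h₀.1 h₁.1 hne hx
  obtain ⟨c', r', p, q, hD, hp, hq, hpq, hxpq, hee⟩ := h.exists_chord hxb he hxe
  obtain ⟨hDx, -⟩ := h.rebase hxb
  rw [← h.bd_rebase hxb] at h₀ h₁ ⊢
  have hs := openSegment_subset_ball h₀.1 h₁.1 hne
  obtain ⟨e1, e2⟩ := powDiff_mem_openSegment hx (hDx.powDiff_nonpos hD h₀) (hDx.powDiff_nonpos hD h₁)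
  obtain ⟨e3, e4⟩ := powDiff_mem_openSegment hxpq (hD.powDiff_nonpos hDx hp)
    (hD.powDiff_nonpos hDx hq)
  rw [powDiff_swap] at e3 e4
  have hx0 : powDiff c r c' r' x = 0 := le_antisymm e1 (by linarith)
  obtain ⟨z0, z1⟩ := e2 hx0
  obtain ⟨z2, z3⟩ := e4 (by rw [hx0, neg_zero])
  rw [powDiff_swap, neg_eq_zero] at z2
  by_cases hcr : cr a₀ a₁ p = 0
  · left
    rw [hee, ← h.image_rebase hxb hs]
    exact congrArg _ (openSegment_eq_of_collinear hne hpq hcr hx hxpq (hs.trans hDx.2)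
      ((openSegment_subset_ball hp.1 hq.1 hpq).trans hD.2) h₀.2 h₁.2 hp.2 hq.2).symm
  · right
    obtain ⟨rfl, rfl⟩ := eq_of_powDiff h.pos hD.pos hcr z0 z1 z2
    exact ⟨p, hp, q, hq, hpq, hxpq, hcr, by
      rw [hee, h.image_rebase hxb (openSegment_subset_ball hp.1 hq.1 hpq)]⟩

end IsDisc

theorem mul_neg_iff_of_pos {x y : ℝ} (hx : 0 < x) : x * y < 0 ↔ y < 0 := by
  rw [← neg_pos, ← mul_neg, mul_pos_iff_of_pos_left hx, neg_pos]

namespace IsDisc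

theorem isFrame (h : X.IsDisc b g c r) {a₀ a₁ x : ℂ}
    (h₀ : a₀ ∈ X.bd b g c r) (h₁ : a₁ ∈ X.bd b g c r) (hx : x ∈ seg a₀ a₁) (hne : a₀ ≠ a₁) :
    X.IsFrame x (X.dev b g) (X.dev b g '' seg a₀ a₁) a₀ a₁ := by
  have hs := openSegment_subset_ball h₀.1 h₁.1 hne
  obtain ⟨hD, -⟩ := h.rebase (hs hx)
  have him := h.image_rebase (hs hx) hs
  refine ⟨hD.2 hD.1, hx, hs.trans hD.2, him, ?_, ?_, ?_⟩
  · exact (h.bd_rebase (hs hx) ▸ h₀).2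
  · exact (h.bd_rebase (hs hx) ▸ h₁).2
  filter_upwards [(h.isSaddle h₀ h₁ hne).eventually_mem_iff (hD.2 hD.1) (mem_image_of_mem _ hx)]
    with y hy
  obtain ⟨t, rfl⟩ := (cr_eq_zero_iff hne).1 (IsQuad.interior_sdiff hx)
  rw [hy, cr_eq_zero_iff hne]
  constructor
  · rintro ⟨s, rfl⟩
    exact ⟨t + s, by push_cast; ring⟩
  · rintro ⟨s, rfl⟩
    exact ⟨s - t, by push_cast; ring⟩

/-- Disjoint chords of a disc do not cross. -/
theorem mul_nonneg_of_disjoint (h : X.IsDisc b g c r)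
    (hE : E.PairwiseDisjoint id) {p q u v : ℂ} (hp : p ∈ X.bd b g c r) (hq : q ∈ X.bd b g c r)
    (hu : u ∈ X.bd b g c r) (hv : v ∈ X.bd b g c r) (hpq : X.dev b g '' seg p q ∈ E)
    (huv : X.dev b g '' seg u v ∈ E) : 0 ≤ cr p q u * cr p q v := by
  by_contra! hlt
  obtain ⟨x, hx, hx'⟩ := exists_cross hp.1 hq.1 hu.1 hv.1 hlt
  have hne : p ≠ q := by rintro rfl; simp [cr_eq] at hlt
  have hne' : u ≠ v := by rintro rfl; nlinarith [mul_self_nonneg (cr p q u)]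
  have he := hE.elim_set hpq huv _ (mem_image_of_mem _ hx) (mem_image_of_mem _ hx')
  have hf := h.isFrame hu hv hx' hne'
  obtain ⟨rfl, rfl⟩ | ⟨rfl, rfl⟩ := (h.isFrame hp hq hx hne).ends_eq hf.mem hf.sub
    (hf.image.trans he.symm).subset hf.left hf.right <;> simp at hlt

end IsDisc

variable (X) in
/-- A maximal collection of disjoint Delaunay edges. -/
structure IsMaximalDelaunay (E : Set (Set S)) : Prop where
  sub : E ⊆ X.delaunayEdges
  disjoint : E.PairwiseDisjoint id
  meets : ∀ s ∈ X.delaunayEdges, s ∉ E → ∃ e ∈ E, ∃ x ∈ s, x ∈ e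

theorem exists_isMaximalDelaunay [ConnectedSpace S]
    (X : HalfTranslationSurface S) : ∃ E, X.IsMaximalDelaunay E := by
  obtain ⟨E, hE⟩ := Set.Finite.exists_maximal
    ((finite_delaunayEdges X).finite_subsets.subset (inter_subset_left
      (t := {E : Set (Set S) | E.PairwiseDisjoint id}))) ⟨∅, empty_subset _, pairwiseDisjoint_empty⟩
  refine ⟨E, hE.1.1, hE.1.2, fun s hs hsE => ?_⟩
  by_contra! hcon
  refine hsE (hE.2 (y := insert s E) ⟨insert_subset hs hE.1.1, ?_⟩ (subset_insert s E)
    (mem_insert s E))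
  exact hE.1.2.insert fun e he _ => Set.disjoint_left.2 fun x hx => hcon e he x hx

namespace IsMaximalDelaunay

variable (hE : X.IsMaximalDelaunay E)
include hE

theorem mem_or_cross (h : X.IsDisc b g c r) {p q : ℂ} (hp : p ∈ X.bd b g c r) (hq : q ∈ X.bd b g c r)
    (hpq : p ≠ q) : X.dev b g '' seg p q ∈ E ∨ ∃ u ∈ X.bd b g c r, ∃ v ∈ X.bd b g c r,
      X.dev b g '' seg u v ∈ E ∧ 0 < cr p q u ∧ cr p q v < 0 := by
  refine or_iff_not_imp_left.2 fun hn => ?_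
  obtain ⟨e, he, -, ⟨x, hx, rfl⟩, hxe⟩ := hE.meets _ ⟨b, g, c, r, p, q, h, hp, hq, hpq, rfl⟩ hn
  obtain rfl | ⟨u, hu, v, hv, -, hx', hcr, rfl⟩ := h.chord_cases hp hq hpq hx (hE.sub he) hxe
  · exact absurd he hn
  · rcases mul_neg_iff.1 (cr_mul_neg hx' (IsQuad.interior_sdiff hx) hcr) with ⟨h1, h2⟩ | ⟨h1, h2⟩
    · exact ⟨u, hu, v, hv, he, h1, h2⟩
    · exact ⟨v, hv, u, hu, by rwa [openSegment_symm], h2, h1⟩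

/-- To the left of an edge there is a Delaunay triangle. -/
theorem exists_apex [ConnectedSpace S] (h : X.IsDisc b g c r) (h₀ : a₀ ∈ X.bd b g c r)
    (h₁ : a₁ ∈ X.bd b g c r) (hne : a₀ ≠ a₁) (hb : b ∈ seg a₀ a₁)
    (he : X.dev b g '' seg a₀ a₁ ∈ E) : ∃ c' r' w, X.IsDisc b g c' r' ∧
      a₀ ∈ X.bd b g c' r' ∧ a₁ ∈ X.bd b g c' r' ∧ w ∈ X.bd b g c' r' ∧ 0 < cr a₀ a₁ w ∧
      X.dev b g '' seg a₁ w ∈ E ∧ X.dev b g '' seg w a₀ ∈ E := by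
  obtain ⟨c', r', t, hD, hpow, w₀, hw₀, hw₀'⟩ := h.exists_growth ⟨-(a₁.im - a₀.im), a₁.re - a₀.re⟩
    ((a₁.im - a₀.im) * a₀.re - (a₁.re - a₀.re) * a₀.im) (l := cr a₀ a₁)
    (fun x => by rw [cr_eq]; ring) (IsQuad.interior_sdiff hb).ge (Or.inl fun h0 => hne (by
      rw [Complex.ext_iff] at h0 ⊢
      simp only [Complex.zero_re, Complex.zero_im] at h0
      exact ⟨by linarith [h0.2], by linarith [h0.1]⟩))
  have hmem : ∀ a ∈ X.bd b g c r, cr a₀ a₁ a = 0 → a ∈ X.bd b g c' r' := by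
    intro a ha ha0
    refine ⟨(mem_sphere_iff_sq hD.pos).2 ?_, ha.2⟩
    rw [hpow, (mem_sphere_iff_sq h.pos).1 ha.1, ha0]; ring
  replace h₀ := hmem a₀ h₀ (by rw [cr_eq]; ring)
  replace h₁ := hmem a₁ h₁ (by rw [cr_eq]; ring)
  set s := arc c' a₀ with hs
  have hlt : ∀ u ∈ X.bd b g c' r', ∀ v ∈ X.bd b g c' r', u ≠ a₀ → v ≠ a₀ →
      (0 < cr a₀ u v ↔ s u < s v) ∧ (cr a₀ u v < 0 ↔ s v < s u) := by
    intro u hu v hv hua hva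
    obtain ⟨K, hK, hcr⟩ := cr_arc h₀.1 hD.pos hu.1 hv.1 hua hva
    rw [hcr, mul_pos_iff_of_pos_left hK, sub_pos, mul_neg_iff_of_pos hK, sub_neg]
    exact ⟨Iff.rfl, Iff.rfl⟩
  have hnz : ∀ {u v : ℂ}, cr a₀ u v ≠ 0 → v ≠ a₀ := by
    rintro u _ hcr rfl
    exact hcr (by rw [cr_eq]; ring)
  have hnz' : ∀ {u v : ℂ}, 0 < cr a₀ u v → v ≠ a₀ := fun h => hnz h.ne'
  have hfin : {w ∈ X.bd b g c' r' | 0 < cr a₀ a₁ w}.Finite := hD.finite.subset (sep_subset _ _)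
  obtain ⟨w, ⟨hw, hwp⟩, hmax⟩ := hfin.exists_maximalFor s _ ⟨w₀, hw₀, hw₀'⟩
  have hQ : X.dev b g '' seg a₀ w ∈ E := by
    refine (hE.mem_or_cross hD h₀ hw (hnz' hwp).symm).resolve_right ?_
    rintro ⟨u, hu, v, hv, -, hpos, -⟩
    have e1 := ((hlt w hw u hu (hnz' hwp) (hnz' hpos)).1).1 hpos
    have e2 := ((hlt a₁ h₁ w hw hne.symm (hnz' hwp)).1).1 hwp
    exact e1.not_ge (hmax ⟨hu, ((hlt a₁ h₁ u hu hne.symm (hnz' hpos)).1).2 (e2.trans e1)⟩ e1.le)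
  obtain ⟨w₁, ⟨⟨hw₁, hp₁⟩, hE₁⟩, hmin⟩ := (hfin.subset (sep_subset _ fun w =>
    X.dev b g '' seg a₀ w ∈ E)).exists_minimalFor s _ ⟨w, ⟨hw, hwp⟩, hQ⟩
  have hwa := hnz' hp₁
  have e1 := ((hlt a₁ h₁ w₁ hw₁ hne.symm hwa).1).1 hp₁
  have hwa₁ : a₁ ≠ w₁ := fun h => e1.ne (by rw [h])
  refine ⟨c', r', w₁, hD, h₀, h₁, hw₁, hp₁, ?_, by rwa [openSegment_symm]⟩
  refine (hE.mem_or_cross hD h₁ hw₁ hwa₁).resolve_right ?_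
  rintro ⟨u, hu, v, hv, huv, hcu, hcv⟩
  have hva : v ≠ a₀ := by
    rintro rfl
    rw [cr_rotate] at hcv
    exact lt_asymm hcv hp₁
  have hcr3 : ∀ x ∈ X.bd b g c' r', x ≠ a₀ → ∃ K > 0, cr a₁ w₁ x = K * ((s x - s a₁) * (s x - s w₁)) := by
    intro x hx hxa
    obtain ⟨K, hK, hcr⟩ := cr_arc_three h₀.1 hD.pos h₁.1 hw₁.1 hx.1 hne.symm hwa hxa
    exact ⟨K * (s w₁ - s a₁), mul_pos hK (sub_pos.2 e1), by rw [hcr]; ring⟩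
  obtain ⟨K, hK, hKv⟩ := hcr3 v hv hva
  rw [hKv, mul_neg_iff_of_pos hK] at hcv
  have hv1 : s a₁ < s v := by by_contra! h; nlinarith
  have hv2 : s v < s w₁ := by by_contra! h; nlinarith
  by_cases hua : u = a₀
  · subst hua
    exact hv2.not_ge (hmin ⟨⟨hv, ((hlt a₁ h₁ v hv hne.symm hva).1).2 hv1⟩, huv⟩ hv2.le)
  obtain ⟨K', hK', hKu⟩ := hcr3 u hu hua
  rw [hKu, mul_pos_iff_of_pos_left hK'] at hcu
  rcases mul_pos_iff.1 hcu with ⟨-, h2⟩ | ⟨h1, -⟩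
  · have n1 := ((hlt w₁ hw₁ u hu hwa hua).1).2 (sub_pos.1 h2)
    have n2 := ((hlt w₁ hw₁ v hv hwa hva).2).2 hv2
    exact (mul_neg_of_pos_of_neg n1 n2).not_ge
      (hD.mul_nonneg_of_disjoint hE.disjoint h₀ hw₁ hu hv hE₁ huv)
  · have n1 := ((hlt a₁ h₁ u hu hne.symm hua).2).2 (sub_neg.1 h1)
    have n2 := ((hlt a₁ h₁ v hv hne.symm hva).1).2 hv1
    refine (mul_neg_of_neg_of_pos n1 n2).not_ge
      (hD.mul_nonneg_of_disjoint hE.disjoint h₀ h₁ hu hv he huv)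

end IsMaximalDelaunay

theorem convex_powDiff_nonpos (c : ℂ) (r : ℝ) (c' : ℂ) (r' : ℝ) :
    Convex ℝ {u | powDiff c r c' r' u ≤ 0} := by
  intro x hx y hy s t hs ht hst
  rw [mem_ofPred_eq] at hx hy ⊢
  rw [powDiff_combo _ _ hst]
  linarith [mul_nonpos_of_nonneg_of_nonpos hs hx, mul_nonpos_of_nonneg_of_nonpos ht hy]

/-- A triangle inscribed in a circle meets it only in the corners. -/
theorem tri_subset_ball (hp : 0 < cr (p 0) (p 1) (p 2))
    (h : ∀ i, p i ∈ sphere c r) {u : ℂ} (hu : u ∈ hull p) :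
    u ∈ ball c r ∨ ∃ i, u = p i := by
  obtain hu | ⟨i, hu⟩ | hu := tri_cases hp hu
  · left
    have h0 : r ≠ 0 := by
      rintro rfl
      simp only [Metric.sphere_zero, mem_singleton_iff] at h
      simp [h] at hp
    rw [← interior_closedBall c h0]
    refine interior_mono (convexHull_min ?_ (convex_closedBall c r)) hu
    rintro _ ⟨i, rfl⟩
    exact sphere_subset_closedBall (h i)
  · exact .inl (openSegment_subset_ball (h i) (h (i + 1))
      (ne_of_cr_pos (tri_pos hp i)) hu)
  · exact .inr hu

namespace IsDisc

/-- The developing map embeds a triangle whose corners are marked points on the boundary of a disc. -/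
theorem injOn_tri (h : X.IsDisc b g c r)
    (hpos : 0 < cr (p 0) (p 1) (p 2)) (hp : ∀ i, p i ∈ X.bd b g c r) :
    InjOn (X.dev b g) (interior (hull p)) := by
  intro x hx y hy hxy
  have hball : ∀ u ∈ interior (hull p), u ∈ ball c r := by
    intro u hu
    refine (tri_subset_ball hpos (fun i => (hp i).1) (interior_subset hu)).resolve_right ?_
    rintro ⟨i, rfl⟩
    have := (mem_interior_tri hpos).1 hu i
    rw [cr_eq] at this
    linarith
  have hxb := hball x hx
  obtain ⟨hDx, hx'⟩ := h.rebase hxb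
  obtain ⟨ε, d, hε, hxd, hD, hiff⟩ := h.transport h hxb (hball y hy) hxy.symm
  have hx0 : powDiff (ε * c + d) r c r x ≤ 0 := by
    have hm : hull p ⊆ halfTr ε d ⁻¹' {u | powDiff (ε * c + d) r c r u ≤ 0} := by
      refine convexHull_min ?_ ((convex_powDiff_nonpos _ _ _ _).affine_preimage _)
      rintro _ ⟨i, rfl⟩
      exact hD.powDiff_nonpos hDx (mem_bd_transport hε (fun y hy => (hiff y hy).1) (hp i))
    rw [hxd]
    exact hm (interior_subset hy)
  rw [powDiff_swap] at hx0
  obtain ⟨hc, -⟩ := eq_of_powDiff_interior h.pos hD.pos hpos hx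
    (fun i => hDx.powDiff_nonpos hD (h.bd_rebase hxb ▸ hp i)) (by linarith)
  rcases hε with rfl | rfl
  · rw [hxd]; linear_combination -hc
  · exfalso
    have hcb := mem_ball_self (x := c) h.pos
    obtain ⟨δ, hδ, hinj⟩ := (flat_dev (h.2 hcb)).injOn_nhds
    set η := min δ r / 2 with hη
    have hη0 : 0 < η := half_pos (lt_min hδ h.pos)
    have hlt : η < min δ r := half_lt_self (lt_min hδ h.pos)
    have hm : ∀ σ : ℂ, ‖σ‖ = 1 → ∀ ρ, min δ r ≤ ρ → c + σ * η ∈ ball c ρ := by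
      intro σ hσ ρ hρ
      rw [mem_ball_iff_norm, add_sub_cancel_left, norm_mul, hσ, one_mul, norm_real,
        Real.norm_of_nonneg hη0.le]
      exact hlt.trans_le hρ
    have e1 : (-1 : ℂ) * (c + 1 * η) + d = c + -1 * η := by linear_combination -hc
    have h1 := hm 1 (by simp) r (min_le_right _ _)
    have h2 := hm (-1) (by simp) r (min_le_right _ _)
    have e2 := (hiff _ (ball_subset_closedBall h1)).2 (h.2 h1)
    rw [e1, (hx' _ (ball_subset_closedBall h2)).2 (h.2 h2)] at e2
    have e3 := hinj (hm (-1) (by simp) δ (min_le_left _ _)) (hm 1 (by simp) δ (min_le_left _ _)) e2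
    have e4 : (η : ℂ) = 0 := by linear_combination (-1 / 2) * e3
    exact hη0.ne' (mod_cast e4)

end IsDisc

namespace IsMaximalDelaunay

variable (hE : X.IsMaximalDelaunay E)
include hE

theorem notMem_of_interior (h : X.IsDisc b g c r) (hpos : 0 < cr (p 0) (p 1) (p 2))
    (hp : ∀ i, p i ∈ X.bd b g c r) (he : ∀ i, X.dev b g '' seg (p i) (p (i + 1)) ∈ E)
    (hx : x ∈ interior (hull p)) (hxb : x ∈ ball c r) :
    X.dev b g x ∉ ⋃₀ E := by
  rintro ⟨e, heE, hxe⟩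
  obtain ⟨c', r', u, v, hD, hu, hv, huv, hxuv, hee⟩ := h.exists_chord hxb (hE.sub heE) hxe
  obtain ⟨hDx, -⟩ := h.rebase hxb
  obtain ⟨h1, -⟩ := powDiff_mem_openSegment hxuv (hD.powDiff_nonpos hDx hu) (hD.powDiff_nonpos hDx hv)
  rw [powDiff_swap] at h1
  obtain ⟨rfl, rfl⟩ := eq_of_powDiff_interior h.pos hD.pos hpos hx
    (fun i => hDx.powDiff_nonpos hD (h.bd_rebase hxb ▸ hp i)) (by linarith)
  rw [h.bd_rebase hxb] at hu hv
  rw [h.image_rebase hxb (openSegment_subset_ball hu.1 hv.1 huv)] at hee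
  have hi := (mem_interior_tri hpos).1 hx
  have hside : ∀ a ∈ X.bd b g c r, ∀ a' ∈ X.bd b g c r, e = X.dev b g '' seg a a' →
      x ∈ seg a a' → ∃ i, a = p i := by
    intro a ha a' ha' hea hxa
    have hcor : a ∈ hull p := by
      refine (mem_tri hpos).2 fun i => ?_
      by_contra! hneg
      have h2 := h.mul_nonneg_of_disjoint hE.disjoint (hp i) (hp (i + 1)) ha ha' (he i) (hea ▸ heE)
      obtain ⟨t, ht, rfl⟩ := openSegment_lineMap hxa
      have h3 := hi i
      rw [cr_lineMap] at h3
      have h4 := mul_neg_of_pos_of_neg (sub_pos.2 ht.2) hneg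
      have h5 : 0 < cr (p i) (p (i + 1)) a' := pos_of_mul_pos_right (by linarith) ht.1.le
      nlinarith
    refine (tri_subset_ball hpos (fun i => (hp i).1) hcor).resolve_left fun hab => ha.2 (h.2 hab)
  obtain ⟨i, rfl⟩ := hside u hu v hv hee hxuv
  obtain ⟨j, rfl⟩ := hside v hv _ hu (by rwa [openSegment_symm]) (by rwa [openSegment_symm])
  have hz := IsQuad.interior_sdiff hxuv
  have key : i = j ∨ j = i + 1 ∨ i = j + 1 := by clear * -; decide +revert
  rcases key with rfl | rfl | rfl
  · exact huv rfl
  · exact (hi i).ne' hz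
  · rw [cr_swap] at hz
    exact (hi j).ne' (neg_eq_zero.1 hz)

theorem isTriangle (h : X.IsDisc b g c r) (hpos : 0 < cr (p 0) (p 1) (p 2))
    (hp : ∀ i, p i ∈ X.bd b g c r) (he : ∀ i, X.dev b g '' seg (p i) (p (i + 1)) ∈ E) :
    ∃ f, X.IsTriangle E p f ∧ EqOn f (X.dev b g) (ball c r) := by
  have hsub : ∀ u ∈ hull p, u ∈ ball c r ∨ ∃ i, u = p i := fun u hu =>
    tri_subset_ball hpos (fun i => (hp i).1) hu
  have hint : ∀ u ∈ interior (hull p), u ∈ ball c r := by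
    intro u hu
    refine (hsub u (interior_subset hu)).resolve_right ?_
    rintro ⟨i, rfl⟩
    have := (mem_interior_tri hpos).1 hu i
    rw [cr_eq] at this
    linarith
  have hcont : ∀ u ∈ ball c r, Tendsto (X.dev b g) (𝓝[ball c r] u) (𝓝 (X.dev b g u)) :=
    fun u hu => (flat_dev (h.2 hu)).1.mono_left nhdsWithin_le_nhds
  have hcl : ∀ i, p i ∈ closure (ball c r) := fun i => by
    rw [closure_ball c h.pos.ne']; exact sphere_subset_closedBall (hp i).1
  have heq : EqOn (extendFrom (ball c r) (X.dev b g)) (X.dev b g) (ball c r) :=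
    fun u hu => extendFrom_eq (subset_closure hu) (hcont u hu)
  refine ⟨_, ⟨⟨?_, ?_, ?_, ?_, ?_⟩, fun i => ?_, ?_⟩, heq⟩
  · intro i j k hij hjk
    fin_cases i <;> fin_cases j <;> try (exact absurd hij (by decide))
    all_goals fin_cases k <;> first | exact absurd hjk (by decide) | exact hpos
  · refine continuousOn_extendFrom (fun u hu => ?_) fun u hu => ?_
    · obtain hu | ⟨i, rfl⟩ := hsub u hu
      exacts [subset_closure hu, hcl i]
    · obtain hu | ⟨i, rfl⟩ := hsub u hu
      · exact ⟨_, hcont u hu⟩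
      · obtain ⟨z, -, hz⟩ := h.tendsto (hp i)
        exact ⟨z, hz⟩
  · exact (h.injOn_tri hpos hp).congr fun u hu => (heq (hint u hu)).symm
  · intro w hw
    exact ((flat_dev (h.2 (hint w hw))).congr
      (heq.eventuallyEq_of_mem (isOpen_ball.mem_nhds (hint w hw)))).2
  · intro i
    obtain ⟨z, hz, ht⟩ := h.tendsto (hp i)
    rwa [extendFrom_eq (hcl i) ht]
  · rw [image_congr fun u hu => heq (openSegment_subset_ball (hp i).1 (hp (i + 1)).1
      (ne_of_cr_pos (tri_pos hpos i)) hu)]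
    exact he i
  · refine Set.disjoint_left.2 ?_
    rintro _ ⟨u, hu, rfl⟩
    rw [heq (hint u hu)]
    exact hE.notMem_of_interior h hpos hp he hu (hint u hu)

end IsMaximalDelaunay

theorem exists_delaunayEdge [ConnectedSpace S]
    (X : HalfTranslationSurface S) : X.delaunayEdges.Nonempty := by
  obtain ⟨y, hy⟩ := X.exists_notMem_Z
  obtain ⟨δ, hδ, g, -, hg⟩ := exists_germ hy 0
  have h : X.IsDisc 0 g 0 δ := ⟨mem_ball_self hδ, base_mem_dom hδ hg⟩
  obtain ⟨c, r, -, h1, -, w₀, hw₀, -⟩ := h.exists_growth 0 1 (l := fun _ => 1) (by simp) zero_le_one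
    (Or.inr ⟨rfl, one_pos⟩)
  have e1 := (mem_sphere_iff_sq h1.pos).1 hw₀.1
  have e2 := (mem_ball_iff_sq h1.pos).1 h1.1
  rw [norm_sub_sq_eq] at e1 e2
  obtain ⟨c', r', t, h2, hpow, w, hw, hlw⟩ := h1.exists_growth (c - w₀)
    (-((c - w₀).re * w₀.re + (c - w₀).im * w₀.im))
    (l := fun x => (c - w₀).re * x.re + (c - w₀).im * x.im + -((c - w₀).re * w₀.re + (c - w₀).im * w₀.im))
    (fun x => rfl) (by
      simp only [sub_re, sub_im, Complex.zero_re, Complex.zero_im] at *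
      nlinarith [sq_nonneg w₀.re, sq_nonneg w₀.im])
    (Or.inl fun h0 => by
      rw [sub_eq_zero] at h0
      rw [← h0, sub_self, sub_self] at e1
      nlinarith [h1.pos])
  have hw₀' : w₀ ∈ X.bd 0 g c' r' := by
    refine ⟨(mem_sphere_iff_sq h2.pos).2 ?_, hw₀.2⟩
    rw [hpow, (mem_sphere_iff_sq h1.pos).1 hw₀.1]; ring
  refine ⟨_, 0, g, c', r', w₀, w, h2, hw₀', hw, ?_, rfl⟩
  rintro rfl
  simp at hlw

theorem IsMaximalDelaunay.nonempty [ConnectedSpace S]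
    (hE : X.IsMaximalDelaunay E) : E.Nonempty := by
  obtain ⟨s, hs⟩ := exists_delaunayEdge X
  by_cases h : s ∈ E
  · exact ⟨s, h⟩
  · obtain ⟨e, he, -⟩ := hE.meets s hs h
    exact ⟨e, he⟩

theorem isOpen_image_of_isFlatAt {U : Set ℂ} (hU : IsOpen U)
    (hf : ∀ x ∈ U, X.IsFlatAt id f x) : IsOpen (f '' U) := by
  refine isOpen_iff_mem_nhds.2 ?_
  rintro _ ⟨x, hx, rfl⟩
  rw [← (hf x hx).map_nhds]
  exact image_mem_map (hU.mem_nhds hx)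

/-- A connected set avoiding the edges and the marked points lies in a triangle if it meets it. -/
theorem IsTriangle.subset_of_meets
    (h : X.IsTriangle E p f) {V : Set S} (hV : IsPreconnected V) (hVK : Disjoint V (X.Z ∪ ⋃₀ E))
    (hm : (V ∩ f '' interior (hull p)).Nonempty) :
    V ⊆ f '' interior (hull p) := by
  refine hV.subset_of_closure_inter_subset
    (isOpen_image_of_isFlatAt isOpen_interior fun x hx => h.1.isFlatAt hx) hm ?_
  rintro y ⟨hy, hyV⟩
  obtain ⟨u, hu, rfl⟩ := closure_minimal (image_mono interior_subset)
    ((isCompact_hull p).image_of_continuousOn h.1.continuousOn).isClosed hy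
  obtain hu | ⟨i, hu⟩ | ⟨i, rfl⟩ := tri_cases h.pos hu
  · exact mem_image_of_mem _ hu
  · exact (Set.disjoint_left.1 hVK hyV (.inr ⟨_, h.2.1 i, mem_image_of_mem _ hu⟩)).elim
  · exact (Set.disjoint_left.1 hVK hyV (.inl (h.1.corner i))).elim

namespace IsMaximalDelaunay

variable (hE : X.IsMaximalDelaunay E)
include hE

theorem saddle (he : e ∈ E) : ∃ v, X.IsSaddle e v := by
  obtain ⟨b, g, c, r, a₀, a₁, h, h₀, h₁, hne, rfl⟩ := hE.sub he
  exact ⟨_, h.isSaddle h₀ h₁ hne⟩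

theorem eventually_left [ConnectedSpace S] (h : X.IsDisc b g c r)
    (h₀ : a₀ ∈ X.bd b g c r) (h₁ : a₁ ∈ X.bd b g c r) (hne : a₀ ≠ a₁) (hb : b ∈ seg a₀ a₁)
    (he : X.dev b g '' seg a₀ a₁ ∈ E) : ∀ᶠ u in 𝓝 b, 0 < cr a₀ a₁ u →
      ∃ p f, X.IsTriangle E p f ∧ X.dev b g u ∈ f '' interior (hull p) := by
  obtain ⟨c', r', w, hD, h0, h1, hw, hpos, e1, e2⟩ := hE.exists_apex h h₀ h₁ hne hb he
  obtain ⟨f, hf, hfd⟩ := hE.isTriangle (p := ![a₀, a₁, w]) hD hpos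
    (fun i => by fin_cases i <;> assumption) (fun i => by fin_cases i <;> assumption)
  filter_upwards [eventually_mem_interior_tri (p := ![a₀, a₁, w]) hpos hb,
    isOpen_ball.mem_nhds hD.1] with u hu hub hcr
  exact ⟨_, f, hf, u, hu hcr, hfd hub⟩

theorem isStraightTriangulation [ConnectedSpace S] : X.IsStraightTriangulation E := by
  have hfin : E.Finite := (finite_delaunayEdges X).subset hE.sub
  have hK := isClosed_union_edges hfin fun e he => hE.saddle he
  set T : Set S := {x | ∃ p f, X.IsTriangle E p f ∧ x ∈ f '' interior (hull p)} with hT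
  have hTo : IsOpen T := by
    refine isOpen_iff_mem_nhds.2 ?_
    rintro x ⟨p, f, hf, hx⟩
    refine mem_of_superset ((isOpen_image_of_isFlatAt isOpen_interior
      fun x hx => hf.1.isFlatAt hx).mem_nhds hx) fun y hy => ⟨p, f, hf, hy⟩
  have hopen : IsOpen (⋃₀ E ∪ T) := by
    refine isOpen_iff_mem_nhds.2 ?_
    rintro x (⟨e, he, hx⟩ | hx)
    · obtain ⟨b, g, c, r, a₀, a₁, h, h₀, h₁, hne, rfl⟩ := hE.sub he
      obtain ⟨y, hy, rfl⟩ := hx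
      have hs := openSegment_subset_ball h₀.1 h₁.1 hne
      have hf := h.isFrame h₀ h₁ hy hne
      obtain ⟨hD, -⟩ := h.rebase (hs hy)
      rw [← h.bd_rebase (hs hy)] at h₀ h₁
      rw [← h.image_rebase (hs hy) hs] at he
      have hl := hE.eventually_left hD h₀ h₁ hne hy he
      have hr := hE.eventually_left hD h₁ h₀ hne.symm (by rwa [openSegment_symm])
        (by rwa [openSegment_symm])
      rw [← (dev_base hf.base).eq_of_nhds, ← (flat_dev hf.base).map_nhds, mem_map]
      filter_upwards [hl, hr, hf.near] with u h1 h2 h3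
      rcases lt_trichotomy (cr a₀ a₁ u) 0 with hu | hu | hu
      · exact .inr (h2 (by rw [cr_swap]; exact neg_pos.2 hu))
      · exact .inl ⟨_, he, by rw [h.image_rebase (hs hy) hs]; exact h3.2 hu⟩
      · exact .inr (h1 hu)
    · exact mem_of_superset (hTo.mem_nhds hx) subset_union_right
  refine ⟨hfin, fun e he => hE.saddle he, hE.disjoint, fun x hx => ?_⟩
  have hsub : X.Zᶜ ⊆ ⋃₀ E ∪ T := by
    refine isPreconnected_compl_Z.subset_of_closure_inter_subset hopen ?_ ?_
    · obtain ⟨e, he⟩ := hE.nonempty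
      obtain ⟨v, hv⟩ := hE.saddle he
      obtain ⟨y, hy⟩ := hv.nonempty
      exact ⟨y, hv.subset_compl hy, .inl ⟨e, he, hy⟩⟩
    · rintro y ⟨hy, hyZ⟩
      by_cases hyE : y ∈ ⋃₀ E
      · exact .inl hyE
      obtain ⟨δ, hδ, f, rfl, hf⟩ := exists_germ hyZ 0
      have hf0 := hf 0 (mem_ball_self hδ)
      obtain ⟨η, hη, hη'⟩ := Metric.eventually_nhds_iff_ball.1
        ((hf0.1.eventually (hK.isOpen_compl.mem_nhds (not_or.2 ⟨hyZ, hyE⟩))).and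
          (ball_mem_nhds 0 hδ))
      have hflat : ∀ u ∈ ball (0 : ℂ) η, X.IsFlatAt id f u := fun u hu => hf u (hη' u hu).2
      have hV := (isOpen_image_of_isFlatAt isOpen_ball hflat).mem_nhds
        (mem_image_of_mem f (mem_ball_self hη))
      have hVK : Disjoint (f '' ball 0 η) (X.Z ∪ ⋃₀ E) := by
        refine Set.disjoint_left.2 ?_
        rintro _ ⟨u, hu, rfl⟩
        exact (hη' u hu).1
      obtain ⟨z, hzV, hzE | ⟨p, F, hF, hz⟩⟩ := mem_closure_iff_nhds.1 hy _ hV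
      · exact (Set.disjoint_left.1 hVK hzV (.inr hzE)).elim
      · exact .inr ⟨p, F, hF, hF.subset_of_meets ((convex_ball 0 η).isPreconnected.image f
          fun u hu => (hflat u hu).1.continuousWithinAt) hVK ⟨z, hzV, hz⟩ (mem_of_mem_nhds hV)⟩
  exact (hsub fun h => hx (.inl h)).resolve_left fun h => hx (.inr h)

end IsMaximalDelaunay

theorem exists_isStraightTriangulation [ConnectedSpace S]
    (X : HalfTranslationSurface S) : ∃ E, X.IsStraightTriangulation E :=
  let ⟨E, hE⟩ := exists_isMaximalDelaunay X
  ⟨E, hE.isStraightTriangulation⟩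

end HalfTranslationSurface

theorem theorem2p6 {S : Type*} [TopologicalSpace S] [CompactSpace S] [ConnectedSpace S] [T2Space S]
    (X : HalfTranslationSurface S) :
    (∀ τ : ℕ → Set (Set S), X.IsStaggeredFlipSequence τ →
      Tendsto (fun n => X.maxWidth (τ n)) atTop (𝓝 0) ∧
      Tendsto (fun n => X.minHeight (τ n)) atTop atTop ∧
      (∀ᶠ n in atTop, X.IsVeering (τ n)) ∧
      X.VerticallyKeane) ∧
    (X.VerticallyKeane → ∃ τ : ℕ → Set (Set S), X.IsStaggeredFlipSequence τ) := by
  refine ⟨fun τ hτ => ⟨hτ.tendsto_maxWidth, hτ.tendsto_minHeight, hτ.eventually_isVeering,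
    hτ.verticallyKeane⟩, fun hX => ?_⟩
  obtain ⟨E, hE⟩ := HalfTranslationSurface.exists_isStraightTriangulation X
  exact HalfTranslationSurface.IsStaggered.exists_flipSequence hX ⟨hE, fun e _ v hv => hX e v hv⟩
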